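/- Let $p$ be a prime, $L$ a finite extension of $\mathbb{Q}_p$ with ring of integers $O_L$, uniformizer $\pi$, residue field $k_L$, residue degree $f$ and ramification index $e$; let $L^{nr}\subset L$ be the maximal unramified subextension of $L/\mathbb{Q}_p$. Let $k$ be a perfect field of characteristic $p$ containing $k_L$, $\sigma$ the Frobenius of $W(k)$, and $\mathcal{T}$ the set of embeddings $O_{L^{nr}}\to W(k)$. An $F$-crystal with action of $O_L$ is a free $W(k)$-module $M$ of finite rank with an injective $\sigma$-linear map $F:M\to M$ and a morphism of $\mathbb{Z}_p$-algebras $O_L\to\mathrm{End}(M,F)$. Then $M=\bigoplus_{\tau\in\mathcal{T}}M_\tau$, where $M_\tau$ is the part on which $O_{L^{nr}}$ acts through $\tau$, and $F$ restricts to $F_\tau:M_{\sigma^{-1}\tau}\to M_\tau$. Each $M_\tau$ is a free module over the discrete valuation ring $W_{O_L,\tau}(k)=W(k)\otimes_{O_{L^{nr}},\tau}O_L$, of rank $h$ independent of $\tau$, called the rank of the crystal. Let $v$ be the valuation with $v(p)=1$. The slopes of the polygon $\mathrm{Hdg}_{O_L,\tau}(M,F)$ are $a_{\tau,i}=v(\alpha_{\tau,i})$,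 ordered increasingly, where $M_\tau/F_\tau M_{\sigma^{-1}\tau}\simeq\bigoplus_{i=1}^h W_{O_L,\tau}(k)/(\alpha_{\tau,i})$, and $\mathrm{Hdg}_{O_L}(M,F)=\frac1f\sum_{\tau\in\mathcal{T}}\mathrm{Hdg}_{O_L,\tau}(M,F)$. The slopes $\lambda_1\le\dots\le\lambda_h$ of the Newton polygon $\mathrm{Newt}_{O_L}(M,F)$ are such that, over the extension of $W_{O_L,\tau}(\bar k)[1/p]$ obtained by adjoining a suitable root of $\pi$ (to which $\sigma^f$ extends trivially on that root), the matrix of the $\sigma^f$-linear map $F^f$ on $M_\tau[1/p]$ is in some basis upper triangular with diagonal entries of valuations $f\lambda_1,\dots,f\lambda_h$; they do not depend on $\tau$. Let $(M,F)$ be an $F$-crystal with action of $O_L$ of rank $h$, with slopes $a_{\tau,1}\le\dots\le a_{\tau,h}$ of $\mathrm{Hdg}_{O_L,\tau}(M,F)$ for $\tau\in\mathcal{T}$ and $\lambda_1\le\dots\le\lambda_h$ of $\mathrm{Newt}_{O_L}(M,F)$. Suppose that a point $(i,j)\in\mathbb{N}\times\frac1{ef}\mathbb{N}$ is a break point of $\mathrm{Newt}_{O_L}(M,F)$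 (that is, $0<i<h$, $\lambda_i<\lambda_{i+1}$ and $j=\lambda_1+\dots+\lambda_i$) and lies on $\mathrm{Hdg}_{O_L}(M,F)$. Then there is a unique decomposition $(M,F)=(M_1,F_1)\oplus(M_2,F_2)$ into $F$-crystals with action of $O_L$ such that 1. $M_1$ has rank $i$, $\mathrm{Newt}_{O_L}(M_1,F_1)$ has slopes $\lambda_1,\dots,\lambda_i$, and for every $\tau\in\mathcal{T}$ the polygon $\mathrm{Hdg}_{O_L,\tau}(M_1,F_1)$ has slopes $a_{\tau,1},\dots,a_{\tau,i}$; 2. $M_2$ has rank $h-i$, $\mathrm{Newt}_{O_L}(M_2,F_2)$ has slopes $\lambda_{i+1},\dots,\lambda_h$, and for every $\tau\in\mathcal{T}$ the polygon $\mathrm{Hdg}_{O_L,\tau}(M_2,F_2)$ has slopes $a_{\tau,i+1},\dots,a_{\tau,h}$. -/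

import Mathlib

open scoped TensorProduct

noncomputable section

namespace HodgeNewton

universe u v w

/-! ### The field `L`: ring of integers, residue degree, maximal unramified subextension -/

section LocalField

variable (p : ℕ) [Fact p.Prime] (L : Type v) [Field L] [Algebra ℚ_[p] L] [Algebra ℤ_[p] L]
  [IsScalarTower ℤ_[p] ℚ_[p] L]

/-- The ring of integers `O_L` of a finite extension `L` of `ℚ_p`. -/
abbrev OL : Subalgebra ℤ_[p] L := integralClosure ℤ_[p] L

/-- The residue field `k_L = O_L / (π)`, for a uniformizer `π` of `L`. -/
abbrev ResidueFieldOL (π : OL p L) : Type v := OL p L ⧸ Ideal.span {π}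

/-- The residue degree `f = [k_L : 𝔽_p]`, for a uniformizer `π` of `L`. -/
def residueDegree (π : OL p L) : ℕ := (Ideal.span {π}).inertiaDeg ℤ_[p]

variable {L} in
/-- The subextension `S / ℚ_p` is unramified: `p` is a uniformizer of its ring of integers. -/
def IsUnramifiedSub (S : IntermediateField ℚ_[p] L) : Prop :=
  Irreducible ((p : ℕ) : integralClosure ℤ_[p] S)

/-- `L^nr`, the largest unramified subextension of `L / ℚ_p` (the compositum of all of them). -/
def maxUnramified : IntermediateField ℚ_[p] L :=
  sSup {S : IntermediateField ℚ_[p] L | IsUnramifiedSub p S}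

/-- The ring of integers of `L^nr`, as a subring of `O_L`: the elements of `O_L` lying in `L^nr`. -/
def OLnr : Subalgebra ℤ_[p] (OL p L) :=
  ((maxUnramified p L).toSubalgebra.restrictScalars ℤ_[p]).comap (OL p L).val

end LocalField

/-! ### The rings `W_{O_L,τ}(k)` -/

section Ring

variable (p : ℕ) [Fact p.Prime] (k : Type u) [Field k] [CharP k p]
  (L : Type v) [Field L] [Algebra ℚ_[p] L] [Algebra ℤ_[p] L] [IsScalarTower ℤ_[p] ℚ_[p] L]

/-- The structure map `ℤ_p = W(𝔽_p) → W(k)`. -/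
def padicToWitt : ℤ_[p] →+* WittVector p k :=
  (WittVector.map (ZMod.castHom dvd_rfl k)).comp (WittVector.fromPadicInt p)

/-- The set `𝒯` of embeddings of the ring of integers of `L^nr` into `W(k)`. -/
abbrev Emb (k : Type u) [Field k] : Type (max u v) := OLnr p L →+* WittVector p k

variable {p k L}

/-- `σ⁻¹ ∘ τ`, where `σ` is the Frobenius of `W(k)`. -/
def Emb.frobInv [PerfectRing k p] (τ : Emb p L k) : Emb p L k :=
  ((WittVector.frobeniusEquiv p k).symm : WittVector p k →+* WittVector p k).comp τ

/-- The embedding `τ` followed by `W(k) → W(k')`, where `k'` is an algebraic closure of `k`. -/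
def Emb.bar {k : Type u} [Field k] (τ : Emb p L k) : Emb p L (AlgebraicClosure k) :=
  (WittVector.map (algebraMap k (AlgebraicClosure k))).comp τ

/-- The ring morphism `A ⊗ B → E`, `a ⊗ b ↦ g a * h b`, for `g` with central values. -/
def tensorLift {R A B E : Type*} [CommRing R] [CommRing A] [CommRing B] [Ring E] [Algebra R A]
    [Algebra R B] (g : A →+* E) (h : B →+* E) (hg : ∀ a e, Commute (g a) e)
    (H : ∀ r, g (algebraMap R A r) = h (algebraMap R B r)) : A ⊗[R] B →+* E :=
  letI : Algebra R E := (g.comp (algebraMap R A)).toAlgebra' fun _ e => hg _ e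
  (Algebra.TensorProduct.lift (R := R) (S := R) { g with commutes' := fun _ => rfl }
    { h with commutes' := fun r => (H r).symm } (fun a _ => hg a _) : A ⊗[R] B →ₐ[R] E).toRingHom

theorem tensorLift_tmul {R A B E : Type*} [CommRing R] [CommRing A] [CommRing B] [Ring E]
    [Algebra R A] [Algebra R B] (g : A →+* E) (h : B →+* E) (hg : ∀ a e, Commute (g a) e)
    (H : ∀ r, g (algebraMap R A r) = h (algebraMap R B r)) (a : A) (b : B) :
    tensorLift g h hg H (a ⊗ₜ[R] b) = g a * h b :=
  let _ : Algebra R E := (g.comp (algebraMap R A)).toAlgebra' fun _ e => hg _ e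
  Algebra.TensorProduct.lift_tmul (R := R) (S := R)
    ({ g with commutes' := fun _ => rfl } : A →ₐ[R] E)
    ({ h with commutes' := fun r => (H r).symm } : B →ₐ[R] E) (fun a _ => hg a _) a b

/-- The ring `W(k)`, seen as an algebra over the ring of integers of `L^nr` through `τ`. -/
def WTau {k : Type u} [Field k] (_τ : Emb p L k) : Type u := WittVector p k

section WTau

variable {k : Type u} [Field k] (τ : Emb p L k)

instance : CommRing (WTau τ) := inferInstanceAs (CommRing (WittVector p k))

/-- The identity `W(k) → W(k)`. -/
def WTau.of : WittVector p k ≃+* WTau τ := RingEquiv.refl (WittVector p k)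

instance : Algebra (OLnr p L) (WTau τ) := ((WTau.of τ).toRingHom.comp τ).toAlgebra

end WTau

/-- `W_{O_L,τ}(k) = W(k) ⊗ O_L`, the tensor product being over the ring of integers of `L^nr`,
which acts on `W(k)` through `τ`. -/
abbrev WOL {k : Type u} [Field k] (τ : Emb p L k) : Type (max u v) :=
  WTau τ ⊗[OLnr p L] OL p L

namespace WOL

variable {k : Type u} [Field k] (τ : Emb p L k)

/-- The map `W(k) → W_{O_L,τ}(k)`, `x ↦ x ⊗ 1`. -/
def ofWitt : WittVector p k →+* WOL τ :=
  (Algebra.TensorProduct.includeLeftRingHom : WTau τ →+* WOL τ).comp (WTau.of τ).toRingHom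

/-- The map `O_L → W_{O_L,τ}(k)`, `a ↦ 1 ⊗ a`. -/
def ofInt : OL p L →+* WOL τ :=
  (Algebra.TensorProduct.includeRight : OL p L →ₐ[OLnr p L] WOL τ).toRingHom

variable {τ}

/-- The universal property of the tensor product `W_{O_L,τ}(k)`. -/
def lift {S : Type*} [CommRing S] (g : WittVector p k →+* S) (h : OL p L →+* S)
    (H : ∀ a : OLnr p L, g (τ a) = h a) : WOL τ →+* S :=
  tensorLift (g.comp (WTau.of τ).symm.toRingHom) h (fun _ _ => Commute.all _ _) H

theorem ofWitt_apply_eq (a : OLnr p L) : ofWitt τ (τ a) = ofInt τ a :=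
  ((Algebra.TensorProduct.includeRight : OL p L →ₐ[OLnr p L] WOL τ).commutes a).symm

theorem ofWitt_mul_ofInt (x : WittVector p k) (a : OL p L) :
    ofWitt τ x * ofInt τ a = WTau.of τ x ⊗ₜ[OLnr p L] a := by
  change (WTau.of τ x ⊗ₜ[OLnr p L] (1 : OL p L)) * ((1 : WTau τ) ⊗ₜ[OLnr p L] a) = _
  rw [Algebra.TensorProduct.tmul_mul_tmul, mul_one, one_mul]

/-- The map `W_{O_L,τ}(k) → W_{O_L,τ}(k')` for `k'` an algebraic closure of `k`. -/
def toBar : WOL τ →+* WOL τ.bar :=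
  lift ((ofWitt τ.bar).comp (WittVector.map (algebraMap k (AlgebraicClosure k)))) (ofInt τ.bar)
    (fun a => ofWitt_apply_eq (τ := τ.bar) a)

end WOL

end Ring

/-! ### `F`-crystals with an action of `O_L` -/

section Crystal

variable (p : ℕ) [Fact p.Prime] (k : Type u) [Field k] [CharP k p]
  (L : Type v) [Field L] [Algebra ℚ_[p] L] [Algebra ℤ_[p] L] [IsScalarTower ℤ_[p] ℚ_[p] L]

/-- The structure of an `F`-crystal with an action of `O_L` on a `W(k)`-module `M`: `M` is free of
finite rank, `F` is an injective `σ`-linear endomorphism, and `O_L → End(M, F)` is a morphism of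
`ℤ_p`-algebras. -/
structure Crystal (M : Type w) [AddCommGroup M] [Module (WittVector p k) M] where
  free : Module.Free (WittVector p k) M
  finite : Module.Finite (WittVector p k) M
  /-- the Frobenius `F` -/
  F : M →ₛₗ[(WittVector.frobenius : WittVector p k →+* WittVector p k)] M
  F_injective : Function.Injective F
  /-- the action of `O_L` -/
  act : OL p L →+* Module.End (WittVector p k) M
  act_padic : ∀ (a : ℤ_[p]) (x : M), act (algebraMap ℤ_[p] (OL p L) a) x = padicToWitt p k a • x
  act_F : ∀ (a : OL p L) (x : M), F (act a x) = act a (F x)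

variable {p k L}

namespace Crystal

variable {M : Type w} [AddCommGroup M] [Module (WittVector p k) M] (C : Crystal p k L M)

/-- The submodule `M_τ` of `M` on which the integers of `L^nr` act through `τ`. -/
def comp (τ : Emb p L k) : Submodule (WittVector p k) M where
  carrier := {x | ∀ a : OLnr p L, C.act a x = τ a • x}
  add_mem' hx hy a := by rw [map_add, hx a, hy a, smul_add]
  zero_mem' a := by rw [map_zero, smul_zero]
  smul_mem' c x hx a := by rw [map_smul, hx a, smul_comm]

theorem act_mem_comp {τ : Emb p L k} (b : OL p L) {x : M} (hx : x ∈ C.comp τ) :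
    C.act b x ∈ C.comp τ := fun a => by
  rw [← Module.End.mul_apply, ← map_mul, mul_comm, map_mul, Module.End.mul_apply, hx a, map_smul]

/-- The action of `O_L` on `M_τ`. -/
def compAct (τ : Emb p L k) : OL p L →+* Module.End (WittVector p k) (C.comp τ) where
  toFun b := (C.act b).restrict fun _ hx => C.act_mem_comp b hx
  map_one' := by ext x; simp
  map_mul' a b := by ext x; simp
  map_zero' := by ext x; simp
  map_add' a b := by ext x; simp

/-- The ring morphism `W_{O_L,τ}(k) → End(M_τ)` sending `x ⊗ a` to `y ↦ x • a y`. -/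
def compRingHom (τ : Emb p L k) : WOL τ →+* Module.End (WittVector p k) (C.comp τ) :=
  tensorLift
    ((algebraMap (WittVector p k) (Module.End (WittVector p k) (C.comp τ))).comp
      (WTau.of τ).symm.toRingHom)
    (C.compAct τ) (fun x e => Algebra.commutes ((WTau.of τ).symm x) e)
    (fun a => LinearMap.ext fun x => Subtype.ext (x.2 a).symm)

/-- `M_τ` is a module over `W_{O_L,τ}(k)`. -/
instance (τ : Emb p L k) : Module (WOL τ) (C.comp τ) := Module.compHom _ (C.compRingHom τ)

theorem coe_tmul_smul (τ : Emb p L k) (c : WTau τ) (a : OL p L) (x : C.comp τ) :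
    (((c ⊗ₜ[OLnr p L] a : WOL τ) • x : C.comp τ) : M) =
      (WTau.of τ).symm c • C.act a (x : M) := by
  have h : C.compRingHom τ (c ⊗ₜ[OLnr p L] a) =
      algebraMap (WittVector p k) _ ((WTau.of τ).symm c) * C.compAct τ a :=
    tensorLift_tmul _ _ _ _ c a
  exact congrArg Subtype.val (LinearMap.congr_fun h x)

/-- The `W_{O_L,τ}(k)`-submodule `F_τ(M_{σ⁻¹τ})` of `M_τ`. -/
def imageF [PerfectRing k p] (τ : Emb p L k) : Submodule (WOL τ) (C.comp τ) where
  carrier := {y | ∃ x ∈ C.comp τ.frobInv, C.F x = y}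
  add_mem' := by
    rintro _ _ ⟨x, hx, hx'⟩ ⟨y, hy, hy'⟩
    exact ⟨x + y, add_mem hx hy, by rw [map_add, hx', hy']; rfl⟩
  zero_mem' := ⟨0, zero_mem _, by simp⟩
  smul_mem' c y hy := by
    induction c using TensorProduct.induction_on with
    | zero => exact ⟨0, zero_mem _, by
        rw [map_zero]
        exact (congrArg Subtype.val (zero_smul (WOL τ) y)).symm⟩
    | tmul c a =>
      obtain ⟨x, hx, hx'⟩ := hy
      refine ⟨(WittVector.frobeniusEquiv p k).symm ((WTau.of τ).symm c) • C.act a x,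
        Submodule.smul_mem _ _ (C.act_mem_comp a hx), ?_⟩
      rw [coe_tmul_smul, LinearMap.map_smulₛₗ, C.act_F, hx']
      congr 1
      exact (WittVector.frobeniusEquiv p k).apply_symm_apply _
    | add c d hc hd =>
      obtain ⟨x, hx, hx'⟩ := hc
      obtain ⟨z, hz, hz'⟩ := hd
      exact ⟨x + z, add_mem hx hz, by rw [map_add, hx', hz', add_smul]; rfl⟩

/-- The rank of `M_τ` over `W_{O_L,τ}(k)`. The rank of the crystal is this integer, which does not
depend on `τ`. -/
def rank (τ : Emb p L k) : ℕ := Module.finrank (WOL τ) (C.comp τ)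

/-! ### Sub-crystals -/

/-- A sub-`F`-crystal of `(M, F)`, stable under the action of `O_L`. -/
structure Sub where
  /-- the underlying `W(k)`-submodule -/
  carrier : Submodule (WittVector p k) M
  F_mem : ∀ x ∈ carrier, C.F x ∈ carrier
  act_mem : ∀ (a : OL p L), ∀ x ∈ carrier, C.act a x ∈ carrier

/-- A sub-crystal, as a crystal with the induced Frobenius and the induced action of `O_L`. -/
def Sub.crystal [PerfectRing k p] {C : Crystal p k L M} (N : C.Sub) : Crystal p k L N.carrier where
  free :=
    haveI := C.free
    haveI := C.finite
    inferInstance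
  finite :=
    haveI := C.free
    haveI := C.finite
    inferInstance
  F :=
    { toFun := fun x => ⟨C.F x, N.F_mem x x.2⟩
      map_add' := fun x y => Subtype.ext (map_add C.F (x : M) y)
      map_smul' := fun c x => Subtype.ext (LinearMap.map_smulₛₗ C.F c (x : M)) }
  F_injective x y h := Subtype.ext (C.F_injective (congrArg Subtype.val h))
  act :=
    { toFun := fun a => (C.act a).restrict (N.act_mem a)
      map_one' := by ext x; simp
      map_mul' := fun a b => by ext x; simp
      map_zero' := by ext x; simp
      map_add' := fun a b => by ext x; simp }
  act_padic a x := Subtype.ext (C.act_padic a x)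
  act_F a x := Subtype.ext (C.act_F a x)

/-! ### Hodge polygons -/

/-- `s 0 ≤ ⋯ ≤ s (h - 1)` are the slopes of the Hodge polygon of a crystal of rank `h` relative to
`τ`: there are `a₁, …, a_h` with `M_τ / F_τ(M_{σ⁻¹τ}) ≃ ⨁ W_{O_L,τ}(k) / (a_i)` and `v(a_i) = s i`.
Here `v` is the valuation of the discrete valuation ring `W_{O_L,τ}(k)` normalized by `v(p) = 1`;
as a non-negative additive valuation, it is determined by this normalization. -/
def IsHodgeSlopes [PerfectRing k p] (τ : Emb p L k) {h : ℕ} (s : Fin h → ℚ) : Prop :=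
  Monotone s ∧
  ∃ val : AddValuation (WOL τ) (WithTop ℚ), (∀ x, 0 ≤ val x) ∧ val (p : WOL τ) = 1 ∧
  ∃ a : Fin h → WOL τ, (∀ i, val (a i) = (s i : WithTop ℚ)) ∧
    Nonempty ((C.comp τ ⧸ C.imageF τ) ≃ₗ[WOL τ] ((i : Fin h) → WOL τ ⧸ Ideal.span {a i}))

end Crystal

/-! ### Newton polygons -/

/-- An extension `K` of `W_{O_L,τ}(k')[1/p]`, with `k'` an algebraic closure of `k`, obtained by
adjoining a root of the uniformizer `π` of `L`. It carries its valuation normalized by `v(p) = 1`,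
and the endomorphism `σ^f`, which is the `f`-th power of the Frobenius on `W(k')` and is trivial on
`O_L` and on the chosen root of `π`. Given `m`, all these data are determined by the listed
properties, up to isomorphism. -/
structure RootExt (τ : Emb p L k) (π : OL p L) where
  /-- the field `K` -/
  K : Type (max u v)
  [field : Field K]
  /-- the inclusion of `W_{O_L,τ}(k')` in `K` -/
  incl : WOL τ.bar →+* K
  incl_injective : Function.Injective incl
  /-- the degree `m` of the root of `π` -/
  m : ℕ
  m_pos : 0 < m
  /-- an `m`-th root of `π` -/
  root : K
  root_pow : root ^ m = incl (WOL.ofInt τ.bar π)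
  closure_eq_top : Subfield.closure (insert root (Set.range incl)) = ⊤
  /-- the endomorphism `σ^f` of `K` -/
  frob : K →+* K
  frob_witt : ∀ x : WittVector p (AlgebraicClosure k),
    frob (incl (WOL.ofWitt τ.bar x)) =
      incl (WOL.ofWitt τ.bar (WittVector.frobenius^[residueDegree p L π] x))
  frob_int : ∀ a : OL p L, frob (incl (WOL.ofInt τ.bar a)) = incl (WOL.ofInt τ.bar a)
  frob_root : frob root = root
  /-- the valuation of `K` -/
  val : AddValuation K (WithTop ℚ)
  val_nonneg : ∀ x, 0 ≤ val (incl x)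
  val_p : val (p : K) = 1

attribute [instance] RootExt.field

/-- The map `W_{O_L,τ}(k) → K`. -/
def RootExt.ofWOL {τ : Emb p L k} {π : OL p L} (E : RootExt τ π) : WOL τ →+* E.K :=
  E.incl.comp WOL.toBar

/-- `s 0 ≤ ⋯ ≤ s (h - 1)` are the slopes of the Newton polygon, relative to `τ`, of the crystal
(of rank `h`): after extension of scalars to some `K` as above, the matrix of `F^f` acting on
`M_τ[1/p]` is, in a suitable basis, upper triangular with diagonal entries of valuations `f * s i`.

Here `X` is the matrix of `F^f` in a basis `b` of `M_τ` and `P` is the matrix of the change of basis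
from `b` to the new basis; as `F^f` is `σ^f`-linear, its matrix `Y` in the new basis is
`P⁻¹ * X * σ^f(P)`. -/
def Crystal.IsNewtonSlopesAt {M : Type w} [AddCommGroup M] [Module (WittVector p k) M]
    (C : Crystal p k L M) (π : OL p L) (τ : Emb p L k) {h : ℕ} (s : Fin h → ℚ) : Prop :=
  Monotone s ∧
  ∃ (b : Module.Basis (Fin h) (WOL τ) (C.comp τ)) (X : Matrix (Fin h) (Fin h) (WOL τ)),
    (∀ j, C.F^[residueDegree p L π] (b j : M) = ((∑ i, X i j • b i : C.comp τ) : M)) ∧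
  ∃ (E : RootExt τ π) (P Y : Matrix (Fin h) (Fin h) E.K),
    IsUnit P.det ∧ X.map E.ofWOL * P.map E.frob = P * Y ∧
    (∀ i j, j < i → Y i j = 0) ∧
    ∀ i, E.val (Y i i) = (((residueDegree p L π : ℚ) * s i : ℚ) : WithTop ℚ)

/-- `s` is the sequence of slopes of the Newton polygon of the crystal. The Newton polygon relative
to `τ` does not depend on `τ`. -/
def Crystal.IsNewtonSlopes {M : Type w} [AddCommGroup M] [Module (WittVector p k) M]
    (C : Crystal p k L M) (π : OL p L) {h : ℕ} (s : Fin h → ℚ) : Prop :=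
  ∀ τ : Emb p L k, C.IsNewtonSlopesAt π τ s

/-! ### Polygons -/

/-- The value at `i` of the polygon with slopes `s 0, …, s (h - 1)`. -/
def polygon {h : ℕ} (s : Fin h → ℚ) (i : ℕ) : ℚ := ∑ j : Fin h, if (j : ℕ) < i then s j else 0

/-- `(i, y)` is a break point of the polygon with slopes `s 0 ≤ ⋯ ≤ s (h - 1)`: it lies on the
polygon, `0 < i < h`, and the slope changes at `i`. -/
def IsBreakPoint {h : ℕ} (s : Fin h → ℚ) (i : ℕ) (y : ℚ) : Prop :=
  polygon s i = y ∧ ∃ (_ : 0 < i) (hi : i < h), s ⟨i - 1, by omega⟩ < s ⟨i, hi⟩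

theorem IsBreakPoint.le {h : ℕ} {s : Fin h → ℚ} {i : ℕ} {y : ℚ} (H : IsBreakPoint s i y) : i ≤ h :=
  H.2.2.1.le

/-- The first `i` terms of a sequence of `h` slopes. -/
def firstSlopes {h : ℕ} (s : Fin h → ℚ) {i : ℕ} (hi : i ≤ h) : Fin i → ℚ :=
  fun j => s (Fin.castLE hi j)

/-- The last `h - i` terms of a sequence of `h` slopes. -/
def lastSlopes {h : ℕ} (s : Fin h → ℚ) {i : ℕ} (hi : i ≤ h) : Fin (h - i) → ℚ :=
  fun j => s ⟨i + j, by omega⟩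

/-- The value at `i` of the Hodge polygon of a crystal whose Hodge polygon relative to `τ` has
slopes `a τ`: the average of these polygons over the `f` elements `τ` of the finite set `𝒯`. -/
def hodgePolygon (π : OL p L) {h : ℕ} (a : Emb p L k → Fin h → ℚ) (i : ℕ) : ℚ :=
  (∑ᶠ τ : Emb p L k, polygon (a τ) i) / residueDegree p L π

end Crystal

end HodgeNewton

end

open HodgeNewton

noncomputable section

namespace HodgeNewton

set_option linter.unusedSectionVars false

/-! ### Rings that are complete for the powers of an element -/

/-! Measure orders in units of `v(π)` and put `α = e f λ_i < β = e f λ_{i+1}`. The gap defines two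
sub-crystals. The slow one, `slowSub`, consists of the `x` such that `F^{fm} x` is divisible by
`π^⌊βm⌋` for all `m`, up to a bounded power of `π`. The fast one, `fastSub`, consists of the `x`
such that `π^⌊αm⌋ x` lies in the image of `F^{fm}`, up to a bounded power of `π`. Their intersection
is zero, because an element of both is divisible by `π^(⌊βm⌋ - ⌊αm⌋ - const)` for every `m`
(`disjoint_fastSub_slowSub`). The theorem says that they span `M` when the Hodge and Newton polygons
meet at `i`.

The slow part always has rank `h - i`. Over the field `K` of the Newton polygon, the triangular form
of `F^f` gives `h - i` vectors with the required growth up to any finite order. The conditions up to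
that order are divisibility conditions on linear forms over `W_{O_L,τ}(k)`, so a count by Smith
normal form produces as many independent integral solutions (`exists_slow_approx`), and a
compactness argument deals with all orders at once (`exists_slow_vectors`). No descent from the
algebraic closure is needed. The rank is not larger, because the subspace of `K^h` with slopes at
most `λ_i` injects into the coordinates complementary to the slow part (`Split.card_le`).

The slow part is saturated. In bases of the `M_τ` whose last vectors span it, `F_τ` is block lower
triangular, with diagonal blocks `A_τ` and `D_τ`. The order of `det A_τ` is at least `d_τ`, the sum
of the `i` smallest elementary divisors of `F_τ`, as for any minor of size `i` (`pow_sum_dvd_det`).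
The sum over `τ` of these orders is the order of the determinant of `F^f` modulo the slow part, that
is `e f (λ_1 + ⋯ + λ_i)`. The polygons meet at `i`, so this number is also the sum of the `d_τ`, and
the orders agree for every `τ` (`associated_det_diagBlock`). Hence `det A_τ` divides all minors of
size `i` of vectors in the image of `F_τ`, and Cramer's rule shows that `F_τ` carries a graph over
the first coordinates into another such graph (`exists_lift_compF`). So `F^f` acts on the integral
graphs. This action is a contraction: `D` gains `β` and the inverse of `A` loses at most `α`. Its
fixed point (`exists_fixed_matrix`) is a complement of the slow part stable by `F^f`, made of fast
vectors. The maps `F_τ` carry the conclusion around the cycle of embeddings (`fastSub_sup_slowSub`).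

The Newton slopes of the two parts are read off the splitting over `K`. The elementary divisors of
`M` are those of the two parts together, and those of the fast part have the smallest possible sum
`d_τ`, so they are the first `i` ones (`eq_first_last`). For uniqueness, the Newton slopes of any
decomposition force its summands into the fast and the slow part; since these meet in zero, both
inclusions are equalities (`eq_of_le_of_isCompl`). -/

/-- The ring `R` is complete and separated for the topology defined by the powers of `c`. -/
structure AdicComplete {R : Type*} [CommRing R] (c : R) : Prop where
  separated : ∀ x : R, (∀ n, c ^ n ∣ x) → x = 0
  exists_limit : ∀ x : ℕ → R, (∀ n, c ^ n ∣ x (n + 1) - x n) → ∃ l, ∀ n, c ^ n ∣ l - x n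

theorem dvd_sub_of_le {R : Type*} [CommRing R] {c : R} {x : ℕ → R}
    (hx : ∀ n, c ^ n ∣ x (n + 1) - x n) {m n : ℕ} (h : m ≤ n) : c ^ m ∣ x n - x m := by
  induction n, h using Nat.le_induction with
  | base => simp
  | succ n hmn ih =>
    have := dvd_add ((pow_dvd_pow c hmn).trans (hx n)) ih
    simpa using this

/-- The explicit form is convenient for passing to finite free algebras; this bridge gives access to
the Jacobson radical and to Hensel's lemma. -/
theorem adicComplete_iff {R : Type*} [CommRing R] (c : R) :
    AdicComplete c ↔ IsAdicComplete (Ideal.span {c}) R := by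
  have key : ∀ (n : ℕ) (x y : R),
      x ≡ y [SMOD (Ideal.span {c} ^ n • ⊤ : Submodule R R)] ↔ c ^ n ∣ x - y := by
    intro n x y
    rw [SModEq.sub_mem, smul_eq_mul, Ideal.mul_top, Ideal.span_singleton_pow,
      Ideal.mem_span_singleton]
  constructor
  · intro H
    refine { haus' := fun x hx => H.separated x fun n => ?_, prec' := fun x hx => ?_ }
    · simpa using (key n x 0).1 (hx n)
    · obtain ⟨l, hl⟩ := H.exists_limit x fun n => by
        have := (key n _ _).1 (hx (Nat.le_succ n))
        rw [← neg_sub, dvd_neg]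
        exact this
      refine ⟨l, fun n => (key _ _ _).2 ?_⟩
      rw [← neg_sub, dvd_neg]
      exact hl n
  · intro H
    refine ⟨fun x hx => H.haus' x fun n => (key _ _ _).2 (by simpa using hx n), fun x hx => ?_⟩
    obtain ⟨l, hl⟩ := H.prec' x fun {m n} hmn => (key _ _ _).2 (by
      rw [← neg_sub, dvd_neg]
      exact dvd_sub_of_le hx hmn)
    refine ⟨l, fun n => ?_⟩
    rw [← neg_sub, dvd_neg]
    exact (key _ _ _).1 (hl n)

/-- Divisibility by a power of `c` is tested on the coordinates in a basis, so limits are computed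
coordinatewise. -/
theorem AdicComplete.of_finite_free {A B : Type*} [CommRing A] [CommRing B] [Algebra A B]
    [Module.Free A B] [Module.Finite A B] {c : A} (H : AdicComplete c) :
    AdicComplete (algebraMap A B c) := by
  classical
  let b := Module.Free.chooseBasis A B
  have key : ∀ (n : ℕ) (x : B), algebraMap A B c ^ n ∣ x ↔ ∀ i, c ^ n ∣ b.repr x i := by
    intro n x
    constructor
    · rintro ⟨y, rfl⟩ i
      rw [← map_pow, ← Algebra.smul_def, map_smul]
      exact ⟨_, rfl⟩
    · intro h
      choose y hy using h
      refine ⟨∑ i, y i • b i, ?_⟩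
      rw [← map_pow, ← Algebra.smul_def, Finset.smul_sum]
      conv_lhs => rw [← b.sum_repr x]
      exact Finset.sum_congr rfl fun i _ => by rw [hy, smul_smul]
  refine ⟨fun x hx => ?_, fun x hx => ?_⟩
  · refine b.repr.injective (Finsupp.ext fun i => ?_)
    rw [map_zero]
    exact H.separated _ fun n => (key n x).1 (hx n) i
  · have : ∀ i, ∃ l, ∀ n, c ^ n ∣ l - b.repr (x n) i := fun i =>
      H.exists_limit _ fun n => by simpa using (key n _).1 (hx n) i
    choose l hl using this
    refine ⟨∑ i, l i • b i, fun n => (key n _).2 fun i => ?_⟩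
    rw [map_sub, Finsupp.sub_apply]
    simpa [Finsupp.single_apply] using hl i n

/-- The powers of `c` and of `ϖ` define the same topology; the subsequence of indices `e * n` is
Cauchy at the speed required for `c`. This passes from `p` to `π`. -/
theorem AdicComplete.of_associated_pow {R : Type*} [CommRing R] {c ϖ : R} (H : AdicComplete c)
    {e : ℕ} (he : 0 < e) (h : Associated c (ϖ ^ e)) : AdicComplete ϖ := by
  have key : ∀ n, Associated (c ^ n) (ϖ ^ (e * n)) := fun n => by
    rw [pow_mul]
    exact h.pow_pow
  refine ⟨fun x hx => H.separated x fun n => (key n).dvd.trans (hx _), fun x hx => ?_⟩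
  obtain ⟨l, hl⟩ := H.exists_limit (fun n => x (e * n)) fun n =>
    (key n).dvd.trans (dvd_sub_of_le hx (by gcongr; omega))
  refine ⟨l, fun n => ?_⟩
  have h1 : ϖ ^ n ∣ l - x (e * n) :=
    ((pow_dvd_pow ϖ (Nat.le_mul_of_pos_left n he)).trans (key n).symm.dvd).trans (hl n)
  simpa using dvd_add h1 (dvd_sub_of_le hx (Nat.le_mul_of_pos_left n he))

theorem AdicComplete.isUnit_of_dvd_sub_one {R : Type*} [CommRing R] {c x : R}
    (H : AdicComplete c) (h : c ∣ x - 1) : IsUnit x := by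
  have := (adicComplete_iff c).1 H
  have h1 : x - 1 ∈ (⊥ : Ideal R).jacobson :=
    IsAdicComplete.le_jacobson_bot (Ideal.span {c}) (Ideal.mem_span_singleton.2 h)
  have := Ideal.mem_jacobson_bot.1 h1 1
  simpa using this

/-- A ring complete for the powers of a regular element that generates a maximal ideal is a
discrete valuation ring. -/
theorem isDiscreteValuationRing_of_adicComplete {R : Type*} [CommRing R] [Nontrivial R] {c : R}
    (H : AdicComplete c) (hreg : ∀ x, c * x = 0 → x = 0) (hc : ¬ IsUnit c)
    (hmax : ∀ x, ¬ c ∣ x → ∃ y, c ∣ x * y - 1) :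
    ∃ _ : IsDomain R, IsDiscreteValuationRing R ∧ Irreducible c := by
  have hunit : ∀ x, ¬ c ∣ x → IsUnit x := fun x hx => by
    obtain ⟨y, hy⟩ := hmax x hx
    exact isUnit_of_mul_isUnit_left (H.isUnit_of_dvd_sub_one hy)
  -- Separatedness gives a largest power of `c` dividing `x`; the cofactor is not divisible by `c`,
  -- hence is a unit.
  have hfac : ∀ x, x ≠ 0 → ∃ n, Associated (c ^ n) x := by
    intro x hx
    have : ∃ n, ¬ c ^ n ∣ x := by
      by_contra hcon
      push Not at hcon
      exact hx (H.separated x hcon)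
    classical
    obtain ⟨m, hm⟩ : ∃ m, Nat.find this = m + 1 := Nat.exists_eq_succ_of_ne_zero fun h0 => by
      have := Nat.find_spec this
      rw [h0] at this
      simp at this
    have h1 : c ^ m ∣ x := not_not.1 (Nat.find_min this (by omega : m < Nat.find this))
    have h2 := Nat.find_spec this
    rw [hm] at h2
    obtain ⟨y, rfl⟩ := h1
    obtain ⟨u, rfl⟩ := hunit y fun ⟨z, hz⟩ => h2 ⟨z, by rw [hz, pow_succ, mul_assoc]⟩
    exact ⟨m, u, rfl⟩
  have hregn : ∀ n x, c ^ n * x = 0 → x = 0 := by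
    intro n
    induction n with
    | zero => intro x h; simpa using h
    | succ n ih => intro x h; exact ih x (hreg _ (by rw [← mul_assoc, ← pow_succ']; exact h))
  have : NoZeroDivisors R := ⟨fun {a b} hab => by
    by_contra hcon
    push Not at hcon
    obtain ⟨n, u, rfl⟩ := hfac a hcon.1
    refine hcon.2 (hregn n b ?_)
    have : (u : R) * (c ^ n * b) = 0 := by rw [← hab]; ring
    exact (Units.mul_right_eq_zero u).1 this⟩
  have : IsDomain R := NoZeroDivisors.to_isDomain R
  have hc0 : c ≠ 0 := fun h0 => one_ne_zero (hreg 1 (by rw [h0, zero_mul]) : (1 : R) = 0)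
  have hirr : Irreducible c := by
    refine ⟨hc, fun a b hab => ?_⟩
    by_contra hcon
    push Not at hcon
    obtain ⟨a', rfl⟩ := not_not.1 (mt (hunit a) hcon.1)
    obtain ⟨b', rfl⟩ := not_not.1 (mt (hunit b) hcon.2)
    refine hc (.of_mul_eq_one (a' * b') (mul_left_cancel₀ hc0 ?_))
    rw [mul_one]
    conv_rhs => rw [hab]
    ring
  exact ⟨this, IsDiscreteValuationRing.ofHasUnitMulPowIrreducibleFactorization
    ⟨c, hirr, fun {x} hx => hfac x hx⟩, hirr⟩

open Polynomial

/-! ### The ring of integers of a finite extension of `ℚ_p` -/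

theorem natCard_quotient {A B : Type*} [CommRing A] [CommRing B] [Algebra A B] [Module.Finite A B]
    (I : Ideal A) [I.IsMaximal] (J : Ideal B) [J.LiesOver I] :
    Nat.card (B ⧸ J) = Nat.card (A ⧸ I) ^ Module.finrank (A ⧸ I) (B ⧸ J) := by
  let : Field (A ⧸ I) := Ideal.Quotient.field I
  exact Module.natCard_eq_pow_finrank (K := A ⧸ I) (V := B ⧸ J)

theorem charZero_of_padic (p : ℕ) [Fact p.Prime] (L : Type*) [Field L] [Algebra ℚ_[p] L] :
    CharZero L :=
  charZero_of_injective_algebraMap (algebraMap ℚ_[p] L).injective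

section LocalField

variable {p : ℕ} [Fact p.Prime] {L : Type*} [Field L] [Algebra ℚ_[p] L] [Algebra ℤ_[p] L]
  [IsScalarTower ℤ_[p] ℚ_[p] L] [FiniteDimensional ℚ_[p] L]

/-- Since `ℤ_p` is integrally closed, `x` is integral exactly when its minimal polynomial over `ℚ_p`
has coefficients of norm at most `1`. So `O_L` is the unit ball of a multiplicative nonarchimedean
norm, which is why it is local. -/
theorem mem_OL_iff (x : L) : x ∈ OL p L ↔ spectralNorm ℚ_[p] L x ≤ 1 := by
  have hint : IsIntegral ℚ_[p] x := Algebra.IsIntegral.isIntegral x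
  constructor
  · intro hx
    have h := minpoly.isIntegrallyClosed_eq_field_fractions' (R := ℤ_[p]) ℚ_[p] (s := x) hx
    rw [spectralNorm, spectralValue_le_one_iff (minpoly.monic hint)]
    intro n
    rw [h, coeff_map]
    exact PadicInt.norm_le_one _
  · intro hx
    rw [spectralNorm, spectralValue_le_one_iff (minpoly.monic hint)] at hx
    have hl : minpoly ℚ_[p] x ∈ lifts (algebraMap ℤ_[p] ℚ_[p]) :=
      (lifts_iff_coeff_lifts _).2 fun n => ⟨⟨_, hx n⟩, rfl⟩
    obtain ⟨q, hq, -, hqm⟩ := lifts_and_natDegree_eq_and_monic hl (minpoly.monic hint)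
    refine ⟨q, hqm, ?_⟩
    rw [IsScalarTower.algebraMap_eq ℤ_[p] ℚ_[p] L, ← eval₂_map, hq]
    exact minpoly.aeval _ _

theorem isUnit_OL_iff (x : OL p L) : IsUnit x ↔ spectralNorm ℚ_[p] L x = 1 := by
  have hmul := spectralAlgNorm_mul (K := ℚ_[p]) (L := L)
  simp only [spectralAlgNorm_def] at hmul
  constructor
  · rintro ⟨u, rfl⟩
    have h1 := (mem_OL_iff (L := L) _).1 (u : OL p L).2
    have h2 := (mem_OL_iff (L := L) _).1 ((u⁻¹ : (OL p L)ˣ) : OL p L).2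
    have h3 := hmul (u : OL p L) ((u⁻¹ : (OL p L)ˣ) : OL p L)
    have h4 : ((u : OL p L) : L) * (((u⁻¹ : (OL p L)ˣ) : OL p L) : L) = 1 := by
      rw [← Subalgebra.coe_mul, Units.mul_inv, Subalgebra.coe_one]
    rw [h4, spectralNorm_one] at h3
    refine le_antisymm h1 ?_
    rw [h3]
    exact mul_le_of_le_one_right (spectralNorm_nonneg _) h2
  · intro hx
    have hx0 : (x : L) ≠ 0 := fun h0 => by
      rw [h0, spectralNorm_zero] at hx
      exact zero_ne_one hx
    have h3 := hmul (x : L) (x : L)⁻¹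
    rw [mul_inv_cancel₀ hx0, spectralNorm_one, hx, one_mul] at h3
    refine .of_mul_eq_one ⟨(x : L)⁻¹, (mem_OL_iff _).2 h3.ge⟩ (Subtype.ext ?_)
    exact mul_inv_cancel₀ hx0

instance : IsLocalRing (OL p L) := by
  refine .of_nonunits_add fun a b ha hb => ?_
  rw [mem_nonunits_iff, isUnit_OL_iff] at *
  have ha' := lt_of_le_of_ne ((mem_OL_iff _).1 a.2) ha
  have hb' := lt_of_le_of_ne ((mem_OL_iff _).1 b.2) hb
  refine (lt_of_le_of_lt (isNonarchimedean_spectralNorm (K := ℚ_[p]) (a : L) (b : L)) ?_).ne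
  exact max_lt ha' hb'

instance : Module.Finite ℤ_[p] (OL p L) := IsIntegralClosure.finite ℤ_[p] ℚ_[p] L _

theorem natCast_p_ne_zero_OL : (p : OL p L) ≠ 0 := fun h => by
  have := charZero_of_padic p L
  have h1 := congrArg Subtype.val h
  simp only [SubringClass.coe_natCast] at h1
  exact (Fact.out : p.Prime).ne_zero (by exact_mod_cast h1)

theorem not_isUnit_natCast_p : ¬ IsUnit (p : OL p L) := by
  rw [isUnit_OL_iff]
  have h := spectralNorm_extends (K := ℚ_[p]) (L := L) (p : ℚ_[p])
  rw [map_natCast, Padic.norm_p] at h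
  rw [SubringClass.coe_natCast, h]
  have := (Fact.out : p.Prime).one_lt
  exact (inv_lt_one_of_one_lt₀ (by exact_mod_cast this)).ne

instance : IsDiscreteValuationRing (OL p L) := by
  have : IsDedekindDomain (OL p L) := integralClosure.isDedekindDomain ℤ_[p] ℚ_[p] L
  have h : ¬ IsField (OL p L) := fun hf => by
    obtain ⟨y, hy⟩ := hf.mul_inv_cancel (natCast_p_ne_zero_OL (p := p) (L := L))
    exact not_isUnit_natCast_p (.of_mul_eq_one y hy)
  exact ((IsDiscreteValuationRing.TFAE (OL p L) h).out 0 2).2 this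

theorem isUnit_OL_of_not_dvd {π : OL p L} (hπ : Irreducible π) {x : OL p L} (h : ¬ π ∣ x) :
    IsUnit x := by
  by_contra hx
  have := (IsLocalRing.mem_maximalIdeal x).2 hx
  rw [hπ.maximalIdeal_eq, Ideal.mem_span_singleton] at this
  exact h this

theorem exists_associated_p {π : OL p L} (hπ : Irreducible π) :
    ∃ e, 0 < e ∧ Associated (p : OL p L) (π ^ e) := by
  obtain ⟨e, he⟩ := IsDiscreteValuationRing.associated_pow_irreducible
    (natCast_p_ne_zero_OL (p := p) (L := L)) hπ
  refine ⟨e, Nat.pos_of_ne_zero fun h0 => ?_, he⟩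
  rw [h0, pow_zero] at he
  exact not_isUnit_natCast_p (associated_one_iff_isUnit.1 he)

theorem adicComplete_padicInt : AdicComplete (p : ℤ_[p]) := by
  rw [adicComplete_iff, ← PadicInt.maximalIdeal_eq_span_p]
  infer_instance

instance : Module.Free ℤ_[p] (OL p L) := by
  have : Module.IsTorsionFree ℤ_[p] L := .trans_faithfulSMul ℤ_[p] ℚ_[p] L
  infer_instance

theorem adicComplete_OL {π : OL p L} (hπ : Irreducible π) : AdicComplete π := by
  obtain ⟨e, he, h⟩ := exists_associated_p hπ
  have := (adicComplete_padicInt (p := p)).of_finite_free (B := OL p L)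
  rw [map_natCast] at this
  exact this.of_associated_pow he h

theorem dvd_p {π : OL p L} (hπ : Irreducible π) : π ∣ (p : OL p L) := by
  obtain ⟨e, he, h⟩ := exists_associated_p hπ
  exact (dvd_pow_self π he.ne').trans h.symm.dvd

theorem dvd_algebraMap_iff {π : OL p L} (hπ : Irreducible π) (a : ℤ_[p]) :
    π ∣ algebraMap ℤ_[p] (OL p L) a ↔ PadicInt.toZMod a = 0 := by
  rw [← RingHom.mem_ker, PadicInt.ker_toZMod]
  constructor
  · intro h
    rw [IsLocalRing.mem_maximalIdeal]
    intro ha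
    exact hπ.not_isUnit (isUnit_of_dvd_unit h (ha.map _))
  · rw [PadicInt.maximalIdeal_eq_span_p, Ideal.mem_span_singleton]
    rintro ⟨b, rfl⟩
    rw [map_mul, map_natCast]
    exact (dvd_p hπ).mul_right _

theorem card_residueField {π : OL p L} (hπ : Irreducible π) :
    Nat.card (OL p L ⧸ Ideal.span {π}) = p ^ residueDegree p L π := by
  have hmax : (Ideal.span {π}).IsMaximal := by
    rw [← hπ.maximalIdeal_eq]; infer_instance
  have hover : (Ideal.span {π}).LiesOver (IsLocalRing.maximalIdeal ℤ_[p]) := ⟨by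
    ext a
    rw [Ideal.mem_comap, Ideal.mem_span_singleton, dvd_algebraMap_iff hπ, ← RingHom.mem_ker,
      PadicInt.ker_toZMod]⟩
  have h1 : residueDegree p L π =
      Module.finrank (ℤ_[p] ⧸ IsLocalRing.maximalIdeal ℤ_[p]) (OL p L ⧸ Ideal.span {π}) :=
    Ideal.inertiaDeg_eq_of_isMaximal (IsLocalRing.maximalIdeal ℤ_[p]) (Ideal.span {π})
  have h2 : Nat.card (ℤ_[p] ⧸ IsLocalRing.maximalIdeal ℤ_[p]) = p :=
    (Nat.card_congr (PadicInt.residueField (p := p)).toEquiv).trans (Nat.card_zmod p)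
  rw [h1, natCard_quotient (IsLocalRing.maximalIdeal ℤ_[p]), h2]

theorem residueDegree_pos {π : OL p L} (hπ : Irreducible π) : 0 < residueDegree p L π := by
  have : (Ideal.span {π}).IsPrime := by
    rw [← hπ.maximalIdeal_eq]; infer_instance
  exact Ideal.inertiaDeg_pos _ _

end LocalField

open Polynomial

/-! ### Reduction modulo `p` and simple roots -/

theorem padicInt_hom_eq {p : ℕ} [Fact p.Prime] {κ : Type*} [CommRing κ] [CharP κ p]
    [Algebra (ZMod p) κ] (r : ℤ_[p] →+* κ) (a : ℤ_[p]) :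
    r a = algebraMap (ZMod p) κ (PadicInt.toZMod a) := by
  have h1 : a - ((PadicInt.toZMod a).val : ℤ_[p]) ∈ RingHom.ker (PadicInt.toZMod (p := p)) := by
    rw [RingHom.mem_ker, map_sub, map_natCast, ZMod.natCast_zmod_val, sub_self]
  rw [PadicInt.ker_toZMod, PadicInt.maximalIdeal_eq_span_p, Ideal.mem_span_singleton] at h1
  obtain ⟨b, hb⟩ := h1
  have h2 : r a = ((PadicInt.toZMod a).val : κ) := by
    rw [← sub_eq_zero, ← map_natCast r, ← map_sub, hb, map_mul, map_natCast, CharP.cast_eq_zero,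
      zero_mul]
  rw [h2]
  conv_rhs => rw [← ZMod.natCast_zmod_val (PadicInt.toZMod a), map_natCast]

theorem hom_aeval_padicInt {p : ℕ} [Fact p.Prime] {B κ : Type*} [CommRing B] [Algebra ℤ_[p] B]
    [CommRing κ] [CharP κ p] [Algebra (ZMod p) κ] (r : B →+* κ) (b : B) (q : ℤ_[p][X]) :
    r (aeval b q) = aeval (r b) (q.map PadicInt.toZMod) := by
  rw [aeval_def, hom_eval₂, aeval_def, eval₂_map]
  congr 1
  ext a
  exact padicInt_hom_eq (r.comp (algebraMap ℤ_[p] B)) a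

/-- Taylor's formula at `a` gives `(b - a) * (g'(a) + k (b - a)) = 0`; if the second factor
vanishes, `c` divides `g'(a)`. This is the uniqueness half of Hensel's lemma. -/
theorem eq_of_simple_root {R : Type*} [CommRing R] [IsDomain R] (g : R[X]) {c a b : R}
    (ha : g.eval a = 0) (hb : g.eval b = 0) (hab : c ∣ b - a)
    (hd : ¬ c ∣ g.derivative.eval a) : a = b := by
  obtain ⟨⟨k, hk⟩⟩ : Nonempty {k : R // g.eval (a + (b - a)) =
      g.eval a + g.derivative.eval a * (b - a) + k * (b - a) ^ 2} := ⟨g.binomExpansion a (b - a)⟩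
  rw [add_sub_cancel, ha, hb] at hk
  have h1 : (b - a) * (g.derivative.eval a + k * (b - a)) = 0 := by
    rw [hk]; ring
  rcases mul_eq_zero.1 h1 with h | h
  · exact (sub_eq_zero.1 h).symm
  · refine absurd ?_ hd
    rw [eq_neg_of_add_eq_zero_left h]
    exact (hab.mul_left _).neg_right

theorem AdicComplete.hensel {R : Type*} [CommRing R] {c : R} (H : AdicComplete c) {g : R[X]}
    (hg : g.Monic) (a : R) (ha : c ∣ g.eval a) (hd : IsUnit (g.derivative.eval a)) :
    ∃ b, g.eval b = 0 ∧ c ∣ b - a := by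
  have := (adicComplete_iff c).1 H
  obtain ⟨b, hb, hba⟩ := HenselianRing.is_henselian (I := Ideal.span {c}) g hg a
    (Ideal.mem_span_singleton.2 ha) (hd.map _)
  exact ⟨b, hb, Ideal.mem_span_singleton.1 hba⟩

section LocalField

variable {p : ℕ} [Fact p.Prime] {L : Type*} [Field L] [Algebra ℚ_[p] L] [Algebra ℤ_[p] L]
  [IsScalarTower ℤ_[p] ℚ_[p] L] [FiniteDimensional ℚ_[p] L]

/-- A primitive element of the residue field over `𝔽_p` is a simple root of its minimal polynomial,
because finite fields are perfect; Hensel's lemma lifts it to a root of any monic lift of that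
polynomial. -/
theorem exists_residue_generator_of_surjective {π : OL p L} (hπ : Irreducible π) {κ : Type*}
    [Field κ] [Finite κ] [CharP κ p] [Algebra (ZMod p) κ] (r : OL p L →+* κ)
    (hsurj : Function.Surjective r) (hr : ∀ x, r x = 0 ↔ π ∣ x)
    (hcard : Nat.card κ = p ^ residueDegree p L π) :
    ∃ (g : ℤ_[p][X]) (θ : OL p L), g.Monic ∧ g.natDegree = residueDegree p L π ∧
      Irreducible (g.map PadicInt.toZMod) ∧ aeval θ g = 0 ∧
      ¬ π ∣ aeval θ (derivative g) ∧ ∀ b : OL p L, ∃ q : ℤ_[p][X], π ∣ b - aeval θ q := by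
  have htoZ : Function.Surjective (PadicInt.toZMod (p := p)) := ZMod.ringHom_surjective _
  have hrank : Module.finrank (ZMod p) κ = residueDegree p L π := by
    have := Module.natCard_eq_pow_finrank (K := ZMod p) (V := κ)
    rw [hcard, Nat.card_zmod] at this
    exact (Nat.pow_right_injective (Fact.out : p.Prime).two_le this).symm
  obtain ⟨α, hα⟩ := Field.exists_primitive_element (ZMod p) κ
  have hint : IsIntegral (ZMod p) α := Algebra.IsIntegral.isIntegral α
  have hdeg : (minpoly (ZMod p) α).natDegree = residueDegree p L π := by
    rw [(Field.primitive_element_iff_minpoly_natDegree_eq (ZMod p) α).1 hα, hrank]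
  obtain ⟨g, hg, hgd, hgm⟩ := lifts_and_natDegree_eq_and_monic
    (f := PadicInt.toZMod (p := p)) (p := minpoly (ZMod p) α)
    ((mem_lifts _).2 (Polynomial.map_surjective _ htoZ _)) (minpoly.monic hint)
  have hsep : aeval α (derivative (minpoly (ZMod p) α)) ≠ 0 :=
    (Algebra.IsSeparable.isSeparable (ZMod p) α).aeval_derivative_ne_zero (minpoly.aeval _ _)
  obtain ⟨θ₀, hθ₀⟩ := hsurj α
  have hdu : ∀ θ : OL p L, r θ = α → ¬ π ∣ aeval θ (derivative g) := by
    intro θ hθ h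
    rw [← hr, hom_aeval_padicInt, hθ, ← derivative_map, hg] at h
    exact hsep h
  obtain ⟨θ, hθ, hθθ⟩ := (adicComplete_OL hπ).hensel (hgm.map (algebraMap ℤ_[p] (OL p L))) θ₀
    (by rw [eval_map_algebraMap, ← hr, hom_aeval_padicInt, hθ₀, hg, minpoly.aeval])
    (isUnit_OL_of_not_dvd hπ (by
      rw [derivative_map, eval_map_algebraMap]; exact hdu θ₀ hθ₀))
  rw [eval_map_algebraMap] at hθ
  have hrθ : r θ = α := by
    rw [← hθ₀, ← sub_eq_zero, ← map_sub, hr]; exact hθθ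
  refine ⟨g, θ, hgm, hgd.trans hdeg, hg ▸ minpoly.irreducible hint, hθ, hdu θ hrθ, fun b => ?_⟩
  have hb : r b ∈ IntermediateField.adjoin (ZMod p) {α} := by rw [hα]; trivial
  rw [← IntermediateField.mem_toSubalgebra,
    IntermediateField.adjoin_simple_toSubalgebra_of_isAlgebraic hint.isAlgebraic] at hb
  obtain ⟨q₀, hq₀⟩ := (Algebra.adjoin_singleton_eq_range_aeval (ZMod p) α).le hb
  obtain ⟨q, rfl⟩ := Polynomial.map_surjective _ htoZ q₀
  refine ⟨q, ?_⟩
  rw [← hr, map_sub, hom_aeval_padicInt, hrθ, sub_eq_zero]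
  exact hq₀.symm

/-- A root of an unramified polynomial that generates the residue field. -/
theorem exists_residue_generator {π : OL p L} (hπ : Irreducible π) :
    ∃ (g : ℤ_[p][X]) (θ : OL p L), g.Monic ∧ g.natDegree = residueDegree p L π ∧
      Irreducible (g.map PadicInt.toZMod) ∧ aeval θ g = 0 ∧
      ¬ π ∣ aeval θ (derivative g) ∧ ∀ b : OL p L, ∃ q : ℤ_[p][X], π ∣ b - aeval θ q := by
  have hmax : (Ideal.span {π}).IsMaximal := by
    rw [← hπ.maximalIdeal_eq]; infer_instance
  let : Field (OL p L ⧸ Ideal.span {π}) := Ideal.Quotient.field _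
  have hcard := card_residueField hπ
  have hfin : Finite (OL p L ⧸ Ideal.span {π}) := Nat.finite_of_card_ne_zero (by
    rw [hcard]; exact pow_ne_zero _ (Fact.out : p.Prime).ne_zero)
  let : Fintype (OL p L ⧸ Ideal.span {π}) := Fintype.ofFinite _
  have hchar : CharP (OL p L ⧸ Ideal.span {π}) p := charP_of_card_eq_prime_pow
    (f := residueDegree p L π) (by rw [← hcard, Nat.card_eq_fintype_card])
  let : Algebra (ZMod p) (OL p L ⧸ Ideal.span {π}) := ZMod.algebra _ p
  exact exists_residue_generator_of_surjective hπ (Ideal.Quotient.mk _)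
    Ideal.Quotient.mk_surjective
    (fun x => by rw [Ideal.Quotient.eq_zero_iff_mem, Ideal.mem_span_singleton]) hcard

end LocalField

open Polynomial

/-! ### The maximal unramified subextension -/

/-- The ring is finite free over `ℤ_p`, hence complete for `p`, and its quotient by `p` is a field
because `g` is irreducible modulo `p`. -/
theorem adjoinRoot_isDiscreteValuationRing {p : ℕ} [Fact p.Prime] {g : ℤ_[p][X]} (hg : g.Monic)
    (hirr : Irreducible (g.map PadicInt.toZMod)) :
    ∃ _ : IsDomain (AdjoinRoot g), IsDiscreteValuationRing (AdjoinRoot g) ∧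
      Irreducible (p : AdjoinRoot g) := by
  have htoZ : Function.Surjective (PadicInt.toZMod (p := p)) := ZMod.ringHom_surjective _
  have hfree : Module.Free ℤ_[p] (AdjoinRoot g) := .of_basis (AdjoinRoot.powerBasis' hg).basis
  have hfin : Module.Finite ℤ_[p] (AdjoinRoot g) := .of_basis (AdjoinRoot.powerBasis' hg).basis
  have hcomp := (adicComplete_padicInt (p := p)).of_finite_free (B := AdjoinRoot g)
  rw [map_natCast] at hcomp
  have hdvd : ∀ q : ℤ_[p][X], (p : AdjoinRoot g) ∣ AdjoinRoot.mk g q ↔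
      g.map PadicInt.toZMod ∣ q.map PadicInt.toZMod := by
    intro q
    constructor
    · rintro ⟨y, hy⟩
      obtain ⟨y, rfl⟩ := AdjoinRoot.mk_surjective y
      rw [← map_natCast (AdjoinRoot.mk g), ← map_mul, AdjoinRoot.mk_eq_mk] at hy
      obtain ⟨z, hz⟩ := hy
      refine ⟨z.map PadicInt.toZMod, ?_⟩
      have := congrArg (Polynomial.map (PadicInt.toZMod (p := p))) hz
      simpa using this
    · rintro ⟨z, hz⟩
      obtain ⟨z, rfl⟩ := Polynomial.map_surjective _ htoZ z
      rw [← Polynomial.map_mul, ← sub_eq_zero, ← Polynomial.map_sub] at hz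
      have : ∀ n, ∃ c : ℤ_[p], (q - g * z).coeff n = p * c := fun n => by
        have h1 := congrArg (fun r => r.coeff n) hz
        simp only [coeff_map, coeff_zero] at h1
        rw [← RingHom.mem_ker, PadicInt.ker_toZMod, PadicInt.maximalIdeal_eq_span_p,
          Ideal.mem_span_singleton] at h1
        exact h1
      have h2 : C (p : ℤ_[p]) ∣ q - g * z := (C_dvd_iff_dvd_coeff _ _).2 this
      have h3 := map_dvd (AdjoinRoot.mk g) h2
      simpa using h3
  have hnt : Nontrivial (AdjoinRoot g) := by
    refine ⟨⟨0, 1, fun h => hirr.not_isUnit ?_⟩⟩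
    have h1 := (hdvd 1).1 (by rw [map_one, ← h]; exact dvd_zero _)
    rw [Polynomial.map_one] at h1
    exact isUnit_of_dvd_one h1
  refine isDiscreteValuationRing_of_adicComplete hcomp (fun x hx => ?_) (fun hu => ?_) fun x hx => ?_
  · have : (p : ℤ_[p]) • x = 0 := by rw [Algebra.smul_def, map_natCast]; exact hx
    exact (smul_eq_zero.1 this).resolve_left (PadicInt.prime_p.ne_zero)
  · have h1 := (hdvd 1).1 (by rw [map_one]; exact hu.dvd)
    rw [Polynomial.map_one] at h1
    exact hirr.not_isUnit (isUnit_of_dvd_one h1)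
  · obtain ⟨x, rfl⟩ := AdjoinRoot.mk_surjective x
    rw [hdvd] at hx
    obtain ⟨a, b, hab⟩ := (hirr.coprime_iff_not_dvd.2 hx)
    obtain ⟨b, rfl⟩ := Polynomial.map_surjective _ htoZ b
    refine ⟨AdjoinRoot.mk g b, ?_⟩
    rw [← map_mul, ← map_one (AdjoinRoot.mk g), ← map_sub, hdvd]
    refine ⟨-a, ?_⟩
    rw [Polynomial.map_sub, Polynomial.map_mul, Polynomial.map_one, ← hab]
    ring

section LocalField

variable {p : ℕ} [Fact p.Prime] {L : Type*} [Field L] [Algebra ℚ_[p] L] [Algebra ℤ_[p] L]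
  [IsScalarTower ℤ_[p] ℚ_[p] L] [FiniteDimensional ℚ_[p] L]

/-- The map `ℤ_p[X]/(g) → O_L` attached to a root of `g`. -/
def rootHom {g : ℤ_[p][X]} {θ : OL p L} (hθ : aeval θ g = 0) : AdjoinRoot g →ₐ[ℤ_[p]] OL p L :=
  AdjoinRoot.liftAlgHom g (Algebra.ofId _ _) θ hθ

theorem rootHom_mk {g : ℤ_[p][X]} {θ : OL p L} (hθ : aeval θ g = 0) (q : ℤ_[p][X]) :
    rootHom hθ (AdjoinRoot.mk g q) = aeval θ q :=
  AdjoinRoot.lift_mk (i := (Algebra.ofId ℤ_[p] (OL p L)).toRingHom) hθ q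

/-- A nonzero element of the source divides a power of `p`, whose image is nonzero. -/
theorem rootHom_injective {g : ℤ_[p][X]} {θ : OL p L} (hθ : aeval θ g = 0) (hg : g.Monic)
    (hirr : Irreducible (g.map PadicInt.toZMod)) : Function.Injective (rootHom hθ) := by
  obtain ⟨_, _, hp⟩ := adjoinRoot_isDiscreteValuationRing hg hirr
  rw [injective_iff_map_eq_zero]
  intro x hx
  by_contra hx0
  obtain ⟨n, u, hu⟩ := IsDiscreteValuationRing.associated_pow_irreducible hx0 hp
  have h1 := congrArg (rootHom hθ) hu
  rw [map_mul, hx, zero_mul, map_pow, map_natCast] at h1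
  exact pow_ne_zero n natCast_p_ne_zero_OL h1.symm

theorem exists_pow_mul_eq_map {p : ℕ} [Fact p.Prime] (r : ℚ_[p][X]) :
    ∃ (N : ℕ) (q : ℤ_[p][X]), C ((p : ℚ_[p]) ^ N) * r = q.map (algebraMap ℤ_[p] ℚ_[p]) := by
  obtain ⟨b, hb, hr⟩ := IsLocalization.integerNormalization_spec (nonZeroDivisors ℤ_[p]) r
  obtain ⟨N, u, hu⟩ := IsDiscreteValuationRing.associated_pow_irreducible
    (nonZeroDivisors.ne_zero hb) (PadicInt.prime_p (p := p)).irreducible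
  refine ⟨N, C (u : ℤ_[p]) * IsLocalization.integerNormalization (nonZeroDivisors ℤ_[p]) r, ?_⟩
  have h1 : (p : ℚ_[p]) ^ N = algebraMap ℤ_[p] ℚ_[p] u * algebraMap ℤ_[p] ℚ_[p] b := by
    rw [← map_mul, mul_comm, hu, map_pow, map_natCast]
  rw [Polynomial.map_mul, map_C, hr, h1, C_mul, mul_assoc, ← smul_eq_C_mul (algebraMap _ _ b),
    algebraMap_smul]

/-- The integral elements of `ℚ_p(θ)` are the polynomials in `θ`. -/
theorem exists_aeval_of_mem_adjoin {g : ℤ_[p][X]} {θ : OL p L} (hθ : aeval θ g = 0) (hg : g.Monic)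
    (hirr : Irreducible (g.map PadicInt.toZMod)) (x : OL p L)
    (hx : (x : L) ∈ IntermediateField.adjoin ℚ_[p] {(θ : L)}) : ∃ q : ℤ_[p][X], x = aeval θ q := by
  obtain ⟨_, _, hp⟩ := adjoinRoot_isDiscreteValuationRing hg hirr
  rw [← IntermediateField.mem_toSubalgebra,
    IntermediateField.adjoin_simple_toSubalgebra_of_isAlgebraic (.of_finite ℚ_[p] (θ : L))] at hx
  obtain ⟨r, hr⟩ := (Algebra.adjoin_singleton_eq_range_aeval ℚ_[p] (θ : L)).le hx
  obtain ⟨N, q, hq⟩ := exists_pow_mul_eq_map r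
  have h1 : (p : OL p L) ^ N * x = aeval θ q := by
    apply Subtype.ext
    have h2 := congrArg (aeval (θ : L)) hq
    have h3 : aeval (θ : L) r = x := hr
    rw [map_mul, aeval_C, h3, aeval_map_algebraMap] at h2
    have h4 : ((aeval θ q : OL p L) : L) = aeval (θ : L) q := (aeval_algebraMap_apply L θ q).symm
    rw [h4, ← h2]
    simp
  rcases eq_or_ne x 0 with rfl | hx0
  · exact ⟨0, by simp⟩
  have hq0 : AdjoinRoot.mk g q ≠ 0 := fun h0 => by
    have := congrArg (rootHom hθ) h0
    rw [rootHom_mk, ← h1, map_zero] at this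
    exact mul_ne_zero (pow_ne_zero _ natCast_p_ne_zero_OL) hx0 this
  obtain ⟨n, u, hu⟩ := IsDiscreteValuationRing.associated_pow_irreducible hq0 hp
  have h5 := congrArg (rootHom hθ) hu
  rw [map_mul, rootHom_mk, ← h1, map_pow, map_natCast] at h5
  -- Up to a unit of `ℤ_p[X]/(g)`, the relation reads `p^N x = p^n`. If `n < N` it would make `p` a
  -- unit of `O_L`.
  rcases le_or_gt N n with hNn | hNn
  · obtain ⟨q', hq'⟩ := AdjoinRoot.mk_surjective
      ((p : AdjoinRoot g) ^ (n - N) * ((u⁻¹ : (AdjoinRoot g)ˣ) : AdjoinRoot g))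
    refine ⟨q', ?_⟩
    rw [← rootHom_mk hθ, hq', map_mul, map_pow, map_natCast]
    refine mul_left_cancel₀ (pow_ne_zero N (natCast_p_ne_zero_OL (p := p) (L := L))) ?_
    rw [← mul_assoc, ← pow_add, Nat.add_sub_cancel' hNn, ← h5, mul_assoc, ← map_mul,
      Units.mul_inv, map_one, mul_one]
  · exfalso
    have h6 : (p : OL p L) ^ n * ((p : OL p L) ^ (N - n) * x * rootHom hθ u) =
        (p : OL p L) ^ n * 1 := by
      rw [mul_one, ← mul_assoc, ← mul_assoc, ← pow_add, Nat.add_sub_cancel' hNn.le, h5]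
    have h7 := mul_left_cancel₀ (pow_ne_zero n (natCast_p_ne_zero_OL (p := p) (L := L))) h6
    refine not_isUnit_natCast_p (p := p) (L := L) (isUnit_of_dvd_one ?_)
    rw [← h7, mul_assoc]
    exact (dvd_pow_self _ (by omega)).mul_right _

theorem coe_aeval_OL (θ : OL p L) (q : ℤ_[p][X]) :
    ((aeval θ q : OL p L) : L) = aeval (θ : L) q :=
  (aeval_algebraMap_apply L θ q).symm

theorem aeval_mem_adjoin (θ : OL p L) (q : ℤ_[p][X]) :
    ((aeval θ q : OL p L) : L) ∈ IntermediateField.adjoin ℚ_[p] {(θ : L)} := by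
  rw [coe_aeval_OL, ← aeval_map_algebraMap ℚ_[p]]
  exact IntermediateField.algebra_adjoin_le_adjoin _ _ (aeval_mem_adjoin_singleton _ _)

/-- The integers of `ℚ_p(θ)` are the polynomials in `θ`, so factorizations of `p` and units can be
compared with those of `ℤ_p[X]/(g)`, where `p` is irreducible. -/
theorem isUnramifiedSub_adjoin {g : ℤ_[p][X]} {θ : OL p L} (hθ : aeval θ g = 0) (hg : g.Monic)
    (hirr : Irreducible (g.map PadicInt.toZMod)) :
    IsUnramifiedSub p (IntermediateField.adjoin ℚ_[p] {(θ : L)}) := by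
  obtain ⟨_, _, hp⟩ := adjoinRoot_isDiscreteValuationRing hg hirr
  let S := IntermediateField.adjoin ℚ_[p] {(θ : L)}
  have hlift : ∀ a : integralClosure ℤ_[p] S, ∃ α : AdjoinRoot g,
      ((rootHom hθ α : OL p L) : L) = ((a : S) : L) := by
    intro a
    have ha : ((a : S) : L) ∈ OL p L := a.2.map (S.val.restrictScalars ℤ_[p])
    obtain ⟨q, hq⟩ := exists_aeval_of_mem_adjoin hθ hg hirr ⟨_, ha⟩ (a : S).2
    exact ⟨AdjoinRoot.mk g q, by rw [rootHom_mk, ← hq]⟩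
  have hunit : ∀ (a : integralClosure ℤ_[p] S) (α : AdjoinRoot g),
      ((rootHom hθ α : OL p L) : L) = ((a : S) : L) → IsUnit α → IsUnit a := by
    rintro a _ ha ⟨u, rfl⟩
    obtain ⟨q, hq⟩ := AdjoinRoot.mk_surjective ((u⁻¹ : (AdjoinRoot g)ˣ) : AdjoinRoot g)
    have hq2 : rootHom hθ ((u⁻¹ : (AdjoinRoot g)ˣ) : AdjoinRoot g) = aeval θ q := by
      rw [← hq, rootHom_mk]
    let b' : S := ⟨_, aeval_mem_adjoin θ q⟩
    have hb' : IsIntegral ℤ_[p] b' :=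
      (isIntegral_algHom_iff (S.val.restrictScalars ℤ_[p]) Subtype.val_injective).1
        (aeval θ q : OL p L).2
    refine .of_mul_eq_one ⟨b', hb'⟩ (Subtype.ext (Subtype.ext ?_))
    change ((a : S) : L) * ((aeval θ q : OL p L) : L) = 1
    rw [← ha, ← hq2, ← Subalgebra.coe_mul, ← map_mul, Units.mul_inv, map_one, Subalgebra.coe_one]
  refine ⟨fun h => ?_, fun a b hab => ?_⟩
  · exact not_isUnit_natCast_p (p := p) (L := S) h
  · obtain ⟨α, hα⟩ := hlift a
    obtain ⟨β, hβ⟩ := hlift b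
    have h1 : (p : AdjoinRoot g) = α * β := by
      refine rootHom_injective hθ hg hirr (Subtype.ext ?_)
      have h2 := congrArg (fun x : integralClosure ℤ_[p] S => ((x : S) : L)) hab
      rw [map_natCast, map_mul, Subalgebra.coe_mul, hα, hβ]
      simpa using h2
    exact (hp.isUnit_or_isUnit h1).imp (hunit a α hα) (hunit b β hβ)

/-- Nakayama's lemma over `ℤ_p`: the hypothesis says that `ℤ_p[θ]` generates `O_L` modulo `p`. -/
theorem eq_aeval_of_unramified {θ : OL p L}
    (hgen : ∀ b : OL p L, ∃ q : ℤ_[p][X], (p : OL p L) ∣ b - aeval θ q) (b : OL p L) :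
    ∃ q : ℤ_[p][X], b = aeval θ q := by
  let N : Submodule ℤ_[p] (OL p L) := Subalgebra.toSubmodule (Algebra.adjoin ℤ_[p] {θ})
  have h1 : (⊤ : Submodule ℤ_[p] (OL p L)) ≤ N ⊔ (IsLocalRing.maximalIdeal ℤ_[p]) • ⊤ := by
    intro x _
    obtain ⟨q, y, hy⟩ := hgen x
    rw [← add_sub_cancel (aeval θ q) x, hy]
    refine Submodule.add_mem_sup (aeval_mem_adjoin_singleton _ _) ?_
    have : (p : OL p L) * y = (p : ℤ_[p]) • y := by rw [Algebra.smul_def, map_natCast]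
    rw [this]
    refine Submodule.smul_mem_smul ?_ trivial
    rw [PadicInt.maximalIdeal_eq_span_p]
    exact Ideal.mem_span_singleton_self _
  have h2 := Submodule.le_of_le_smul_of_le_jacobson_bot (Module.Finite.fg_top)
    (IsLocalRing.maximalIdeal_le_jacobson ⊥) h1
  obtain ⟨q, hq⟩ := (Algebra.adjoin_singleton_eq_range_aeval ℤ_[p] θ).le (h2 (Submodule.mem_top (x := b)))
  exact ⟨q, hq.symm⟩

/-- The residue of the generator `θS` of the integers of `S` lies in `k_L`, so `θS` is congruent
modulo `π` to some `β` of `ℤ_p[X]/(g)`. Hensel's lemma in this complete ring moves `β` to a root `γ`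
of `gS`. Simple roots are unique in their residue class, so `θS` is the image of `γ`. As `θS`
generates the integers of `S`, clearing denominators gives the inclusion of `S`. -/
theorem le_adjoin_of_isUnramifiedSub {π : OL p L} (hπ : Irreducible π) {g : ℤ_[p][X]} {θ : OL p L}
    (hθ : aeval θ g = 0) (hg : g.Monic) (hirr : Irreducible (g.map PadicInt.toZMod))
    (hgen : ∀ b : OL p L, ∃ q : ℤ_[p][X], π ∣ b - aeval θ q)
    {S : IntermediateField ℚ_[p] L} (hS : IsUnramifiedSub p S) :
    S ≤ IntermediateField.adjoin ℚ_[p] {(θ : L)} := by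
  obtain ⟨_, _, hp⟩ := adjoinRoot_isDiscreteValuationRing hg hirr
  have hSp : Irreducible (p : OL p S) := hS
  obtain ⟨gS, θS, hgSm, -, -, hθS, hder, hgenS⟩ := exists_residue_generator hSp
  let j : OL p S →ₐ[ℤ_[p]] OL p L :=
    { toFun := fun a => ⟨((a : S) : L), a.2.map (S.val.restrictScalars ℤ_[p])⟩
      map_one' := rfl
      map_mul' := fun _ _ => rfl
      map_zero' := rfl
      map_add' := fun _ _ => rfl
      commutes' := fun _ => rfl }
  have hj : aeval (j θS) gS = 0 := by rw [aeval_algHom_apply, hθS, map_zero]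
  have hju : IsUnit (aeval (j θS) (derivative gS)) := by
    rw [aeval_algHom_apply]
    exact (isUnit_OL_of_not_dvd hSp hder).map j
  obtain ⟨q, hq⟩ := hgen (j θS)
  let β : AdjoinRoot g := AdjoinRoot.mk g q
  have hβ : rootHom hθ β = aeval θ q := rootHom_mk hθ q
  have hcong : ∀ r : ℤ_[p][X], π ∣ aeval (rootHom hθ β) r - aeval (j θS) r := by
    intro r
    have h1 := (r.map (algebraMap ℤ_[p] (OL p L))).sub_dvd_eval_sub (rootHom hθ β) (j θS)
    rw [eval_map_algebraMap, eval_map_algebraMap] at h1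
    refine dvd_trans ?_ h1
    rw [hβ, ← neg_sub]
    exact hq.neg_right
  have hndvd : ∀ x : AdjoinRoot g, ¬ (p : AdjoinRoot g) ∣ x → IsUnit x := by
    intro x hx
    by_contra hu
    have := (IsLocalRing.mem_maximalIdeal x).2 hu
    rw [hp.maximalIdeal_eq, Ideal.mem_span_singleton] at this
    exact hx this
  have hcomp : AdicComplete (p : AdjoinRoot g) := by
    have hfree : Module.Free ℤ_[p] (AdjoinRoot g) := .of_basis (AdjoinRoot.powerBasis' hg).basis
    have hfin : Module.Finite ℤ_[p] (AdjoinRoot g) := .of_basis (AdjoinRoot.powerBasis' hg).basis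
    have := (adicComplete_padicInt (p := p)).of_finite_free (B := AdjoinRoot g)
    rwa [map_natCast] at this
  obtain ⟨γ, hγ, hγβ⟩ := hcomp.hensel (hgSm.map (algebraMap ℤ_[p] (AdjoinRoot g))) β
    (by
      by_contra hcon
      have h1 := (hndvd _ hcon).map (rootHom hθ)
      rw [eval_map_algebraMap, ← aeval_algHom_apply] at h1
      have h2 := hcong gS
      rw [hj, sub_zero] at h2
      exact hπ.not_isUnit (isUnit_of_dvd_unit h2 h1))
    (by
      refine hndvd _ fun hcon => ?_
      have h1 := map_dvd (rootHom hθ) hcon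
      rw [derivative_map, eval_map_algebraMap, ← aeval_algHom_apply, map_natCast] at h1
      have h2 := dvd_sub ((dvd_p hπ).trans h1) (hcong (derivative gS))
      rw [sub_sub_cancel] at h2
      exact hπ.not_isUnit (isUnit_of_dvd_unit h2 hju))
  have hγθ : j θS = rootHom hθ γ := by
    refine eq_of_simple_root (gS.map (algebraMap ℤ_[p] (OL p L))) (c := π) ?_ ?_ ?_ ?_
    · rw [eval_map_algebraMap, hj]
    · rw [eval_map_algebraMap] at hγ ⊢
      rw [aeval_algHom_apply, hγ, map_zero]
    · have h1 := map_dvd (rootHom hθ) hγβ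
      rw [map_natCast, map_sub, hβ] at h1
      have h2 := dvd_sub ((dvd_p hπ).trans h1) hq
      rw [sub_sub_sub_comm, sub_self, sub_zero] at h2
      exact h2
    · rw [derivative_map, eval_map_algebraMap]
      exact fun h => hπ.not_isUnit (isUnit_of_dvd_unit h hju)
  have hjmem : ((θS : S) : L) ∈ IntermediateField.adjoin ℚ_[p] {(θ : L)} := by
    obtain ⟨r, hr⟩ := AdjoinRoot.mk_surjective γ
    have h1 := congrArg Subtype.val hγθ
    rw [← hr, rootHom_mk] at h1
    change ((θS : S) : L) = _ at h1
    rw [h1]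
    exact aeval_mem_adjoin θ r
  intro x hx
  have halg : IsAlgebraic ℤ_[p] (⟨x, hx⟩ : S) :=
    (IsFractionRing.isAlgebraic_iff ℤ_[p] ℚ_[p] S).2 (.of_finite ℚ_[p] (⟨x, hx⟩ : S))
  obtain ⟨b, hb0, hb⟩ := halg.exists_integral_multiple
  obtain ⟨r, hr⟩ := eq_aeval_of_unramified hgenS ⟨_, hb⟩
  have h1 : b • x = aeval ((θS : S) : L) r := by
    have h2 := congrArg (fun a : OL p S => ((a : S) : L)) hr
    have h3 : (((aeval θS r : OL p S) : S) : L) = aeval ((θS : S) : L) r := by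
      rw [coe_aeval_OL]
      exact (aeval_algHom_apply (S.val.restrictScalars ℤ_[p]) (θS : S) r).symm
    exact h2.trans h3
  have h4 : b • x ∈ IntermediateField.adjoin ℚ_[p] {(θ : L)} := by
    rw [h1, ← aeval_map_algebraMap ℚ_[p]]
    refine (IntermediateField.adjoin_simple_le_iff.2 hjmem) ?_
    exact IntermediateField.algebra_adjoin_le_adjoin _ _ (aeval_mem_adjoin_singleton _ _)
  have hb1 : algebraMap ℤ_[p] ℚ_[p] b ≠ 0 := by
    rwa [Ne, FaithfulSMul.algebraMap_eq_zero_iff]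
  have h5 : x = (algebraMap ℤ_[p] ℚ_[p] b)⁻¹ • (b • x) := by
    rw [← algebraMap_smul ℚ_[p] b x, smul_smul, inv_mul_cancel₀ hb1, one_smul]
  rw [h5]
  exact IntermediateField.smul_mem _ h4

/-- The ring of integers of `L^nr` is generated by a root of an unramified polynomial. -/
theorem exists_OLnr_generator {π : OL p L} (hπ : Irreducible π) :
    ∃ (g : ℤ_[p][X]) (θ : OLnr p L), g.Monic ∧ g.natDegree = residueDegree p L π ∧
      Irreducible (g.map PadicInt.toZMod) ∧ aeval θ g = 0 ∧
      (∀ a : OLnr p L, ∃ q : ℤ_[p][X], a = aeval θ q) ∧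
      ∀ b : OL p L, ∃ a : OLnr p L, π ∣ b - a := by
  obtain ⟨g, θ, hgm, hgd, hirr, hθ, -, hgen⟩ := exists_residue_generator hπ
  have hmax : maxUnramified p L = IntermediateField.adjoin ℚ_[p] {(θ : L)} :=
    le_antisymm (sSup_le fun S hS => le_adjoin_of_isUnramifiedSub hπ hθ hgm hirr hgen hS)
      (le_sSup (isUnramifiedSub_adjoin hθ hgm hirr))
  have hmem : ∀ x : OL p L,
      x ∈ OLnr p L ↔ (x : L) ∈ IntermediateField.adjoin ℚ_[p] {(θ : L)} := fun x => by
    rw [← hmax]; rfl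
  have hθmem : θ ∈ OLnr p L := (hmem θ).2 (IntermediateField.mem_adjoin_simple_self _ _)
  have hcoe : ∀ q : ℤ_[p][X], ((aeval (⟨θ, hθmem⟩ : OLnr p L) q : OLnr p L) : OL p L) = aeval θ q :=
    fun q => (aeval_algHom_apply (OLnr p L).val _ q).symm
  refine ⟨g, ⟨θ, hθmem⟩, hgm, hgd, hirr, Subtype.ext ?_, fun a => ?_, fun b => ?_⟩
  · rw [hcoe, hθ]; rfl
  · obtain ⟨q, hq⟩ := exists_aeval_of_mem_adjoin hθ hgm hirr a ((hmem a).1 a.2)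
    exact ⟨q, Subtype.ext (by rw [hq, hcoe])⟩
  · obtain ⟨q, hq⟩ := hgen b
    exact ⟨aeval ⟨θ, hθmem⟩ q, by rwa [hcoe]⟩

instance : IsDiscreteValuationRing (OLnr p L) := by
  obtain ⟨π, hπ⟩ := IsDiscreteValuationRing.exists_irreducible (OL p L)
  obtain ⟨g, θ, hgm, -, hirr, hθ, hgen, -⟩ := exists_OLnr_generator hπ
  obtain ⟨_, _, -⟩ := adjoinRoot_isDiscreteValuationRing hgm hirr
  have hθ' : aeval (θ : OL p L) g = 0 := by
    rw [← Subalgebra.coe_val, aeval_algHom_apply, hθ, map_zero]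
  let φ : AdjoinRoot g →ₐ[ℤ_[p]] OLnr p L := AdjoinRoot.liftAlgHom g (Algebra.ofId _ _) θ hθ
  have hφ : ∀ q, φ (AdjoinRoot.mk g q) = aeval θ q := fun q =>
    AdjoinRoot.lift_mk (i := (Algebra.ofId ℤ_[p] (OLnr p L)).toRingHom) hθ q
  have hinj : Function.Injective φ := fun x y hxy => by
    obtain ⟨x, rfl⟩ := AdjoinRoot.mk_surjective x
    obtain ⟨y, rfl⟩ := AdjoinRoot.mk_surjective y
    refine rootHom_injective hθ' hgm hirr ?_
    rw [rootHom_mk, rootHom_mk, ← Subalgebra.coe_val, aeval_algHom_apply, aeval_algHom_apply,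
      ← hφ, ← hφ, hxy]
  have hsurj : Function.Surjective φ := fun a => by
    obtain ⟨q, rfl⟩ := hgen a
    exact ⟨AdjoinRoot.mk g q, hφ q⟩
  exact IsDiscreteValuationRing.RingEquivClass.isDiscreteValuationRing (AlgEquiv.ofBijective φ ⟨hinj, hsurj⟩)

instance : Module.Finite (OLnr p L) (OL p L) := .of_restrictScalars_finite ℤ_[p] _ _

instance : Module.Free (OLnr p L) (OL p L) := by
  have : Module.IsTorsionFree (OLnr p L) (OL p L) := inferInstance
  infer_instance

end LocalField

open Polynomial

/-! ### The embeddings of the ring of integers of `L^nr` in `W(k)` -/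

section Embeddings

variable {p : ℕ} [Fact p.Prime] {k : Type*} [Field k] [CharP k p] [PerfectRing k p]

theorem adicComplete_witt : AdicComplete (p : WittVector p k) := by
  rw [adicComplete_iff]; infer_instance

theorem dvd_witt_iff (x : WittVector p k) :
    (p : WittVector p k) ∣ x ↔ WittVector.constantCoeff x = 0 := by
  rw [← Ideal.mem_span_singleton]
  exact WittVector.mem_span_p_iff_coeff_zero_eq_zero x

theorem isUnit_witt_of_not_dvd {x : WittVector p k} (h : ¬ (p : WittVector p k) ∣ x) :
    IsUnit x := by
  rw [dvd_witt_iff] at h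
  exact WittVector.isUnit_of_coeff_zero_ne_zero x h

theorem natCast_p_ne_zero_witt : (p : WittVector p k) ≠ 0 := WittVector.p_nonzero p k

/-- A `p`-adic integer is a natural number modulo each `p^n`, and `W(k)` is separated for the powers
of `p`. Hence every embedding `τ` is automatically `ℤ_p`-linear. -/
theorem padicInt_hom_witt_unique (r s : ℤ_[p] →+* WittVector p k) : r = s := by
  ext1 a
  rw [← sub_eq_zero]
  refine adicComplete_witt.separated _ fun n => ?_
  obtain ⟨b, hb⟩ := Ideal.mem_span_singleton.1 (PadicInt.appr_spec n a)
  have h : ∀ t : ℤ_[p] →+* WittVector p k, t a = (a.appr n : WittVector p k) + (p : WittVector p k) ^ n * t b := by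
    intro t
    rw [← map_natCast t, ← map_natCast t, ← map_pow, ← map_mul, ← map_add, ← hb, add_sub_cancel]
  rw [h r, h s, add_sub_add_left_eq_sub, ← mul_sub]
  exact dvd_mul_right _ _

theorem constantCoeff_frobenius (x : WittVector p k) :
    WittVector.constantCoeff (WittVector.frobenius x) = WittVector.constantCoeff x ^ p :=
  WittVector.coeff_frobenius_charP p x 0

variable {L : Type*} [Field L] [Algebra ℚ_[p] L] [Algebra ℤ_[p] L]
  [IsScalarTower ℤ_[p] ℚ_[p] L]

theorem Emb.map_aeval (τ : Emb p L k) (r : ℤ_[p] →+* WittVector p k) (θ : OLnr p L) (q : ℤ_[p][X]) :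
    τ (aeval θ q) = q.eval₂ r (τ θ) := by
  rw [aeval_def, hom_eval₂, padicInt_hom_witt_unique r]

theorem Emb.frobenius_frobInv (τ : Emb p L k) (a : OLnr p L) :
    WittVector.frobenius (τ.frobInv a) = τ a :=
  (WittVector.frobeniusEquiv p k).apply_symm_apply _

theorem Emb.frobInv_injective : Function.Injective (Emb.frobInv : Emb p L k → Emb p L k) := by
  intro τ τ' h
  ext1 a
  rw [← Emb.frobenius_frobInv, h, Emb.frobenius_frobInv]

variable [FiniteDimensional ℚ_[p] L]

/-- An embedding is determined by its reduction at a generator. -/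
theorem Emb.eq_of_constantCoeff_eq {g : ℤ_[p][X]} {θ : OLnr p L}
    (hirr : Irreducible (g.map PadicInt.toZMod)) (hθ : aeval θ g = 0)
    (hgen : ∀ a : OLnr p L, ∃ q : ℤ_[p][X], a = aeval θ q) {τ τ' : Emb p L k}
    (h : WittVector.constantCoeff (τ θ) = WittVector.constantCoeff (τ' θ)) : τ = τ' := by
  let : Algebra (ZMod p) k := ZMod.algebra k p
  let r : ℤ_[p] →+* WittVector p k := padicToWitt p k
  let : Algebra ℤ_[p] (WittVector p k) := r.toAlgebra
  have hroot : ∀ τ : Emb p L k, aeval (τ θ) g = 0 := fun τ => by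
    rw [aeval_def, ← Emb.map_aeval τ, hθ, map_zero]
  have hx : aeval (WittVector.constantCoeff (τ θ)) (g.map (PadicInt.toZMod (p := p))) = 0 := by
    rw [← hom_aeval_padicInt, hroot, map_zero]
  have hsep : aeval (WittVector.constantCoeff (τ θ))
      (derivative (g.map (PadicInt.toZMod (p := p)))) ≠ 0 :=
    (PerfectField.separable_of_irreducible hirr).aeval_derivative_ne_zero hx
  have h1 : τ θ = τ' θ := by
    refine eq_of_simple_root (g.map r) (c := (p : WittVector p k)) ?_ ?_ ?_ ?_
    · rw [eval_map]; exact hroot τ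
    · rw [eval_map]; exact hroot τ'
    · rw [dvd_witt_iff, map_sub, sub_eq_zero]; exact h.symm
    · rw [dvd_witt_iff, derivative_map, eval_map]
      rw [derivative_map, ← hom_aeval_padicInt] at hsep
      exact hsep
  ext1 a
  obtain ⟨q, rfl⟩ := hgen a
  rw [Emb.map_aeval τ r, Emb.map_aeval τ' r, h1]

/-- The residue of `τ θ` identifies `𝒯` with a set of roots of `g₀` in `k`, and `σ⁻¹` with the
extraction of `p`-th roots. The structure of `𝒯` is then a matter of finite fields. -/
theorem exists_emb_reduction {π : OL p L} (hπ : Irreducible π) :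
    ∃ (g₀ : (ZMod p)[X]) (x : Emb p L k → k), g₀.natDegree = residueDegree p L π ∧
      Irreducible g₀ ∧ (∀ τ, (g₀.map (ZMod.castHom dvd_rfl k)).eval (x τ) = 0) ∧
      Function.Injective x ∧ ∀ τ, x τ.frobInv ^ p = x τ := by
  obtain ⟨g, θ, hgm, hgd, hirr, hθ, hgen, -⟩ := exists_OLnr_generator hπ
  let : Algebra (ZMod p) k := ZMod.algebra k p
  let r : ℤ_[p] →+* WittVector p k := padicToWitt p k
  let : Algebra ℤ_[p] (WittVector p k) := r.toAlgebra
  let x : Emb p L k → k := fun τ => WittVector.constantCoeff (τ θ)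
  have hroot : ∀ τ : Emb p L k, aeval (τ θ) g = 0 := fun τ => by
    rw [aeval_def, ← Emb.map_aeval τ, hθ, map_zero]
  have hx : ∀ τ, aeval (x τ) (g.map (PadicInt.toZMod (p := p))) = 0 := fun τ => by
    rw [← hom_aeval_padicInt, hroot, map_zero]
  refine ⟨g.map PadicInt.toZMod, x, ?_, hirr, fun τ => ?_, fun τ τ' h => ?_, fun τ => ?_⟩
  · rw [hgm.natDegree_map, hgd]
  · rw [eval_map]
    exact hx τ
  · exact Emb.eq_of_constantCoeff_eq hirr hθ hgen h
  · change WittVector.constantCoeff (τ.frobInv θ) ^ p = _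
    rw [← constantCoeff_frobenius, Emb.frobenius_frobInv]

/-- The irreducible `g₀` divides every polynomial over `𝔽_p` vanishing at `x`, and it divides
`X^(p^n) - X` exactly when its degree divides `n`. -/
theorem pow_eq_self_iff_dvd {g₀ : (ZMod p)[X]} (hg : Irreducible g₀) {x : k}
    (hx : (g₀.map (ZMod.castHom dvd_rfl k)).eval x = 0) (n : ℕ) :
    x ^ p ^ n = x ↔ g₀.natDegree ∣ n := by
  let : Algebra (ZMod p) k := ZMod.algebra k p
  have hx' : aeval x g₀ = 0 := by rwa [eval_map] at hx
  have hdvd : ∀ q : (ZMod p)[X], g₀ ∣ q ↔ aeval x q = 0 := by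
    intro q
    constructor
    · rintro ⟨z, rfl⟩
      rw [map_mul, hx', zero_mul]
    · intro hq
      by_contra hcon
      obtain ⟨a, b, hab⟩ := hg.coprime_iff_not_dvd.2 hcon
      have := congrArg (aeval x) hab
      rw [map_add, map_mul, map_mul, hx', hq, mul_zero, mul_zero, add_zero, map_one] at this
      exact zero_ne_one this
  rw [hg.natDegree_dvd_iff_dvd_X_pow_card_pow_sub_X, Nat.card_zmod, hdvd, map_sub, map_pow, aeval_X,
    sub_eq_zero]

theorem Emb.frobInv_iterate_eq_iff {π : OL p L} (hπ : Irreducible π) (τ : Emb p L k) (n : ℕ) :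
    Emb.frobInv^[n] τ = τ ↔ residueDegree p L π ∣ n := by
  obtain ⟨g₀, x, hd, hirr, hroot, hinj, hfrob⟩ := exists_emb_reduction (k := k) hπ
  have hit : ∀ n, x (Emb.frobInv^[n] τ) ^ p ^ n = x τ := by
    intro n
    induction n with
    | zero => simp
    | succ n ih => rw [Function.iterate_succ_apply', pow_succ', pow_mul, hfrob, ih]
  rw [← hd, ← pow_eq_self_iff_dvd hirr (hroot (Emb.frobInv^[n] τ)), hit, ← hinj.eq_iff, eq_comm]

theorem Emb.frobInv_iterate_residueDegree {π : OL p L} (hπ : Irreducible π) (τ : Emb p L k) :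
    Emb.frobInv^[residueDegree p L π] τ = τ :=
  (Emb.frobInv_iterate_eq_iff hπ τ _).2 dvd_rfl

/-- The orbit of `τ` has exactly `f` elements, and `g₀`, of degree `f`, has no room for another
root. So `𝒯` is one cycle under `σ⁻¹`, and a sum over `𝒯` is a sum over the iterates. -/
theorem Emb.bijective_frobInv_iterate {π : OL p L} (hπ : Irreducible π) (τ : Emb p L k) :
    Function.Bijective fun j : Fin (residueDegree p L π) => Emb.frobInv^[(j : ℕ)] τ := by
  classical
  have hinjτ : Function.Injective fun j : Fin (residueDegree p L π) => Emb.frobInv^[(j : ℕ)] τ := by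
    have key : ∀ a b : Fin (residueDegree p L π), (a : ℕ) ≤ b →
        Emb.frobInv^[(a : ℕ)] τ = Emb.frobInv^[(b : ℕ)] τ → a = b := by
      intro a b hab h
      obtain ⟨c, hc⟩ := Nat.exists_eq_add_of_le hab
      rw [hc, Function.iterate_add_apply] at h
      have h1 := (Emb.frobInv_injective.iterate (a : ℕ) h).symm
      rw [Emb.frobInv_iterate_eq_iff hπ] at h1
      have h2 := Nat.eq_zero_of_dvd_of_lt h1 (by omega)
      exact Fin.ext (by omega)
    intro a b h
    rcases le_total (a : ℕ) b with hab | hab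
    · exact key a b hab h
    · exact (key b a hab h.symm).symm
  refine ⟨hinjτ, fun τ' => ?_⟩
  obtain ⟨g₀, x, hd, hirr, hroot, hinj, -⟩ := exists_emb_reduction (k := k) hπ
  have hne : g₀.map (ZMod.castHom dvd_rfl k) ≠ 0 := Polynomial.map_ne_zero hirr.ne_zero
  let s : Finset k := Finset.univ.image fun j : Fin (residueDegree p L π) =>
    x (Emb.frobInv^[(j : ℕ)] τ)
  have hs : s.card = residueDegree p L π :=
    (Finset.card_image_of_injective _ (hinj.comp hinjτ)).trans (Finset.card_fin _)
  by_contra hcon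
  have hnot : x τ' ∉ s := by
    intro hmem
    obtain ⟨j, -, hj⟩ := Finset.mem_image.1 hmem
    exact hcon ⟨j, hinj hj⟩
  have hsub : (insert (x τ') s).val ⊆ (g₀.map (ZMod.castHom dvd_rfl k)).roots := by
    intro y hy
    rw [mem_roots hne]
    rw [Finset.mem_val] at hy
    rcases Finset.mem_insert.1 hy with rfl | hy
    · exact hroot τ'
    · obtain ⟨j, -, rfl⟩ := Finset.mem_image.1 hy
      exact hroot _
  have h1 := Polynomial.card_le_degree_of_subset_roots hsub
  rw [Finset.card_insert_of_notMem hnot, hs, natDegree_map, hd] at h1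
  omega

end Embeddings

/-! ### The discrete valuation ring `W_{O_L,τ}(k)` -/

namespace WOL

variable {p : ℕ} [Fact p.Prime] {k : Type*} [Field k]
  {L : Type*} [Field L] [Algebra ℚ_[p] L] [Algebra ℤ_[p] L]
  [IsScalarTower ℤ_[p] ℚ_[p] L]

theorem induction_on' {τ : Emb p L k} {P : WOL τ → Prop} (r : WOL τ)
    (hmul : ∀ x a, P (ofWitt τ x * ofInt τ a)) (hadd : ∀ r s, P r → P s → P (r + s)) : P r := by
  induction r using TensorProduct.induction_on with
  | zero => simpa using hmul 0 0
  | tmul c a => simpa [ofWitt_mul_ofInt] using hmul ((WTau.of τ).symm c) a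
  | add r s hr hs => exact hadd r s hr hs

theorem hom_ext {τ : Emb p L k} {S : Type*} [CommRing S] {φ ψ : WOL τ →+* S}
    (h1 : ∀ x, φ (ofWitt τ x) = ψ (ofWitt τ x)) (h2 : ∀ a, φ (ofInt τ a) = ψ (ofInt τ a)) :
    φ = ψ := by
  refine RingHom.ext fun r => ?_
  induction r using induction_on' with
  | hmul x a => rw [map_mul, map_mul, h1, h2]
  | hadd r s hr hs => rw [RingHom.map_add, RingHom.map_add, hr, hs]

theorem lift_mul {τ : Emb p L k} {S : Type*} [CommRing S] (g : WittVector p k →+* S)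
    (h : OL p L →+* S) (H : ∀ a : OLnr p L, g (τ a) = h a) (x : WittVector p k) (a : OL p L) :
    lift g h H (ofWitt τ x * ofInt τ a) = g x * h a := by
  rw [ofWitt_mul_ofInt]
  exact tensorLift_tmul (R := OLnr p L) (A := WTau τ) (B := OL p L)
    (g.comp (WTau.of τ).symm.toRingHom) h (fun _ _ => Commute.all _ _) H (WTau.of τ x) a

@[simp]
theorem lift_ofWitt {τ : Emb p L k} {S : Type*} [CommRing S] (g : WittVector p k →+* S)
    (h : OL p L →+* S) (H : ∀ a : OLnr p L, g (τ a) = h a) (x : WittVector p k) :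
    lift g h H (ofWitt τ x) = g x := by
  simpa using lift_mul g h H x 1

@[simp]
theorem lift_ofInt {τ : Emb p L k} {S : Type*} [CommRing S] (g : WittVector p k →+* S)
    (h : OL p L →+* S) (H : ∀ a : OLnr p L, g (τ a) = h a) (a : OL p L) :
    lift g h H (ofInt τ a) = h a := by
  simpa using lift_mul g h H 1 a

variable [CharP k p] [PerfectRing k p] [FiniteDimensional ℚ_[p] L] (τ : Emb p L k)

theorem adicComplete_p : AdicComplete (p : WOL τ) := by
  have h : AdicComplete (p : WTau τ) := adicComplete_witt (p := p) (k := k)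
  have := h.of_finite_free (B := WOL τ)
  rwa [map_natCast] at this

theorem associated_p {π : OL p L} {e : ℕ} (h : Associated (p : OL p L) (π ^ e)) :
    Associated (p : WOL τ) (ofInt τ π ^ e) := by
  have := h.map (ofInt τ)
  rwa [map_natCast, map_pow] at this

theorem adicComplete_ofInt {π : OL p L} (hπ : Irreducible π) : AdicComplete (ofInt τ π) := by
  obtain ⟨e, he, h⟩ := exists_associated_p hπ
  exact (adicComplete_p τ).of_associated_pow he (associated_p τ h)

/-- An element of `O_L` is congruent modulo `π` to an integer of `L^nr`, which can be moved across
the tensor product. Hence the residue field of `W_{O_L,τ}(k)` is a quotient of `W(k)`. -/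
theorem exists_ofWitt_sub {π : OL p L} (hπ : Irreducible π) (r : WOL τ) :
    ∃ x, ofInt τ π ∣ r - ofWitt τ x := by
  obtain ⟨-, -, -, -, -, -, -, hres⟩ := exists_OLnr_generator hπ
  induction r using induction_on' with
  | hmul x a =>
    obtain ⟨b, hb⟩ := hres a
    refine ⟨x * τ b, ?_⟩
    rw [map_mul, ofWitt_apply_eq, ← mul_sub, ← map_sub]
    exact (map_dvd (ofInt τ) hb).mul_left _
  | hadd r s hr hs =>
    obtain ⟨x, hx⟩ := hr
    obtain ⟨y, hy⟩ := hs
    refine ⟨x + y, ?_⟩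
    rw [map_add, add_sub_add_comm]
    exact dvd_add hx hy

instance : IsDomain (WTau τ) := inferInstanceAs (IsDomain (WittVector p k))
instance : Nontrivial (WTau τ) := IsDomain.toNontrivial

instance : Nontrivial (WOL τ) := by
  have hb : Nonempty (Module.Free.ChooseBasisIndex (OLnr p L) (OL p L)) :=
    Module.Free.instNonemptyChooseBasisIndexOfNontrivial _ _
  exact ⟨⟨_, 0, ((Module.Free.chooseBasis (OLnr p L) (OL p L)).baseChange (WTau τ)).ne_zero hb.some⟩⟩

theorem p_mul_eq_zero (r : WOL τ) (h : (p : WOL τ) * r = 0) : r = 0 := by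
  have : (p : WTau τ) • r = 0 := by rw [Nat.cast_smul_eq_nsmul, nsmul_eq_mul]; exact h
  exact (smul_eq_zero.1 this).resolve_left natCast_p_ne_zero_witt

theorem not_isUnit_p : ¬ IsUnit (p : WOL τ) := by
  rintro ⟨u, hu⟩
  let b := Module.Free.chooseBasis (WTau τ) (WOL τ)
  obtain ⟨i⟩ : Nonempty (Module.Free.ChooseBasisIndex (WTau τ) (WOL τ)) := inferInstance
  have h1 : b i = (p : WTau τ) • (((u⁻¹ : (WOL τ)ˣ) : WOL τ) * b i) := by
    rw [Nat.cast_smul_eq_nsmul, nsmul_eq_mul, ← hu, ← mul_assoc, Units.mul_inv, one_mul]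
  have h2 := congrArg (fun r => b.repr r i) h1
  simp only [map_smul, Module.Basis.repr_self, Finsupp.single_eq_same, Finsupp.smul_apply,
    smul_eq_mul] at h2
  have h3 : IsUnit (p : WittVector p k) := isUnit_of_dvd_one (Dvd.intro _ h2.symm)
  exact (WittVector.irreducible p).not_isUnit h3

/-- The ring is finite free over `W(k)`, hence complete for `p` and for `π`, and an element not
divisible by `π` is congruent to a unit of `W(k)`. No irreducibility of an Eisenstein polynomial is
needed. -/
theorem exists_isDomain_isDiscreteValuationRing {π : OL p L} (hπ : Irreducible π) :
    ∃ _ : IsDomain (WOL τ), IsDiscreteValuationRing (WOL τ) ∧ Irreducible (ofInt τ π) := by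
  obtain ⟨e, he, h⟩ := exists_associated_p hπ
  have hass := associated_p τ h
  have hdvd : ofInt τ π ∣ (p : WOL τ) := (dvd_pow_self _ he.ne').trans hass.symm.dvd
  refine isDiscreteValuationRing_of_adicComplete (adicComplete_ofInt τ hπ) (fun r hr => ?_)
    (fun hu => ?_) fun r hr => ?_
  · obtain ⟨c, hc⟩ := hdvd
    exact p_mul_eq_zero τ r (by rw [hc, mul_assoc, mul_comm c, ← mul_assoc, hr, zero_mul])
  · exact not_isUnit_p τ (hass.symm.isUnit (hu.pow e))
  · obtain ⟨x, hx⟩ := exists_ofWitt_sub τ hπ r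
    have hxp : ¬ (p : WittVector p k) ∣ x := fun hpx => hr (by
      have h1 := hdvd.trans (by simpa using map_dvd (ofWitt τ) hpx)
      simpa using dvd_add hx h1)
    obtain ⟨y, hy⟩ := (isUnit_witt_of_not_dvd hxp).exists_right_inv
    refine ⟨ofWitt τ y, ?_⟩
    have : r * ofWitt τ y - 1 = (r - ofWitt τ x) * ofWitt τ y := by
      rw [sub_mul, ← map_mul, hy, map_one]
    rw [this]
    exact hx.mul_right _

instance : IsDomain (WOL τ) := by
  obtain ⟨π, hπ⟩ := IsDiscreteValuationRing.exists_irreducible (OL p L)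
  exact (exists_isDomain_isDiscreteValuationRing τ hπ).1

instance : IsDiscreteValuationRing (WOL τ) := by
  obtain ⟨π, hπ⟩ := IsDiscreteValuationRing.exists_irreducible (OL p L)
  exact (exists_isDomain_isDiscreteValuationRing τ hπ).2.1

theorem irreducible_ofInt {π : OL p L} (hπ : Irreducible π) : Irreducible (ofInt τ π) :=
  (exists_isDomain_isDiscreteValuationRing τ hπ).2.2

/-- The morphism `s ⊗ 1 : W_{O_L,τ}(k) → W_{O_L,τ'}(k')`, for `s : W(k) → W(k')`. -/
def mapHom {k k' : Type*} [Field k] [Field k'] {τ : Emb p L k} {τ' : Emb p L k'}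
    (s : WittVector p k →+* WittVector p k') (H : ∀ a, s (τ a) = τ' a) : WOL τ →+* WOL τ' :=
  lift ((ofWitt τ').comp s) (ofInt τ') fun a =>
    (congrArg (ofWitt τ') (H a)).trans (ofWitt_apply_eq a)

theorem mapHom_ofWitt {k k' : Type*} [Field k] [Field k'] {τ : Emb p L k} {τ' : Emb p L k'}
    (s : WittVector p k →+* WittVector p k') (H : ∀ a, s (τ a) = τ' a) (x : WittVector p k) :
    mapHom s H (ofWitt τ x) = ofWitt τ' (s x) :=
  lift_ofWitt _ _ _ x

theorem mapHom_ofInt {k k' : Type*} [Field k] [Field k'] {τ : Emb p L k} {τ' : Emb p L k'}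
    (s : WittVector p k →+* WittVector p k') (H : ∀ a, s (τ a) = τ' a) (a : OL p L) :
    mapHom s H (ofInt τ a) = ofInt τ' a :=
  lift_ofInt _ _ _ a

/-- The isomorphism `s ⊗ 1 : W_{O_L,τ}(k) ≃ W_{O_L,τ'}(k')`, for `s : W(k) → W(k')` with
inverse `t`. -/
def mapEquiv {k k' : Type*} [Field k] [Field k'] {τ : Emb p L k} {τ' : Emb p L k'}
    (s : WittVector p k →+* WittVector p k') (t : WittVector p k' →+* WittVector p k)
    (hst : ∀ x, s (t x) = x) (hts : ∀ x, t (s x) = x) (H : ∀ a, s (τ a) = τ' a) :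
    WOL τ ≃+* WOL τ' :=
  RingEquiv.ofRingHom (mapHom s H) (mapHom t fun a => by rw [← H a, hts])
    (hom_ext (fun x => by
        rw [RingHom.comp_apply, mapHom_ofWitt, mapHom_ofWitt, hst, RingHom.id_apply])
      fun a => by rw [RingHom.comp_apply, mapHom_ofInt, mapHom_ofInt, RingHom.id_apply])
    (hom_ext (fun x => by
        rw [RingHom.comp_apply, mapHom_ofWitt, mapHom_ofWitt, hts, RingHom.id_apply])
      fun a => by rw [RingHom.comp_apply, mapHom_ofInt, mapHom_ofInt, RingHom.id_apply])

/-- The isomorphism `σ ⊗ 1 : W_{O_L,σ⁻¹τ}(k) ≃ W_{O_L,τ}(k)`. -/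
def frobEquiv (τ : Emb p L k) : WOL τ.frobInv ≃+* WOL τ :=
  mapEquiv WittVector.frobenius
    ((WittVector.frobeniusEquiv p k).symm : WittVector p k →+* WittVector p k)
    (WittVector.frobeniusEquiv p k).apply_symm_apply
    (WittVector.frobeniusEquiv p k).symm_apply_apply (Emb.frobenius_frobInv τ)

theorem frobEquiv_ofWitt (x : WittVector p k) :
    frobEquiv τ (ofWitt τ.frobInv x) = ofWitt τ (WittVector.frobenius x) :=
  mapHom_ofWitt WittVector.frobenius (Emb.frobenius_frobInv τ) x

theorem frobEquiv_ofInt (a : OL p L) : frobEquiv τ (ofInt τ.frobInv a) = ofInt τ a :=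
  mapHom_ofInt WittVector.frobenius (Emb.frobenius_frobInv τ) a

/-- As `σ^{-f} τ = τ`, the map `σ^f` fixes the image of `τ`; this makes `σ^f ⊗ 1` well defined on
`W_{O_L,τ}(k)`. -/
theorem frobenius_iterate_apply {π : OL p L} (hπ : Irreducible π) (a : OLnr p L) :
    WittVector.frobenius^[residueDegree p L π] (τ a) = τ a := by
  have h : ∀ n (τ : Emb p L k), WittVector.frobenius^[n] (Emb.frobInv^[n] τ a) = τ a := by
    intro n
    induction n with
    | zero => intro τ; rfl
    | succ n ih =>
      intro τ
      rw [Function.iterate_succ_apply', Function.iterate_succ_apply, ih, Emb.frobenius_frobInv]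
  have h1 := h (residueDegree p L π) τ
  rwa [Emb.frobInv_iterate_residueDegree hπ] at h1

/-- The iterates of the Frobenius of `W(k)`. -/
def frobIter (n : ℕ) : WittVector p k →+* WittVector p k where
  toFun := WittVector.frobenius^[n]
  map_one' := iterate_map_one _ n
  map_mul' := iterate_map_mul _ n
  map_zero' := iterate_map_zero _ n
  map_add' := iterate_map_add _ n

/-- The iterates of the inverse of the Frobenius of `W(k)`. -/
def frobInvIter (n : ℕ) : WittVector p k →+* WittVector p k where
  toFun := (WittVector.frobeniusEquiv p k).symm^[n]
  map_one' := iterate_map_one _ n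
  map_mul' := iterate_map_mul _ n
  map_zero' := iterate_map_zero _ n
  map_add' := iterate_map_add _ n

/-- The automorphism `σ^f ⊗ 1` of `W_{O_L,τ}(k)`. -/
def frobPow {π : OL p L} (hπ : Irreducible π) : WOL τ ≃+* WOL τ :=
  mapEquiv (frobIter (residueDegree p L π)) (frobInvIter (residueDegree p L π))
    (Function.LeftInverse.iterate (WittVector.frobeniusEquiv p k).apply_symm_apply _)
    (Function.LeftInverse.iterate (WittVector.frobeniusEquiv p k).symm_apply_apply _)
    (frobenius_iterate_apply τ hπ)

theorem frobPow_ofWitt {π : OL p L} (hπ : Irreducible π) (x : WittVector p k) :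
    frobPow τ hπ (ofWitt τ x) = ofWitt τ (WittVector.frobenius^[residueDegree p L π] x) :=
  mapHom_ofWitt (frobIter (residueDegree p L π)) (frobenius_iterate_apply τ hπ) x

theorem frobPow_ofInt {π : OL p L} (hπ : Irreducible π) (a : OL p L) :
    frobPow τ hπ (ofInt τ a) = ofInt τ a :=
  mapHom_ofInt (frobIter (residueDegree p L π)) (frobenius_iterate_apply τ hπ) a

end WOL

/-! ### Semilinear algebra over a discrete valuation ring and a valued extension -/

/-- A ring `R` with an automorphism `σ` fixing `ϖ`, mapped to a valued field `K` with an isometric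
automorphism extending `σ`. -/
structure SlopeSetting (R K : Type*) [CommRing R] [Field K] where
  ϖ : R
  σ : R ≃+* R
  σ_ϖ : σ ϖ = ϖ
  ι : R →+* K
  φ : K ≃+* K
  φ_ι : ∀ r, φ (ι r) = ι (σ r)
  v : AddValuation K (WithTop ℚ)
  v_φ : ∀ x, v (φ x) = v x
  v_ι : ∀ r, 0 ≤ v (ι r)
  w : ℚ
  w_pos : 0 < w
  v_ϖ : v (ι ϖ) = (w : WithTop ℚ)

namespace SlopeSetting

variable {R K : Type*} [CommRing R] [Field K] (S : SlopeSetting R K)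

/-- The valuation of `x`, in units of the valuation of `ϖ`, is at least `c`. -/
def Ge (c : ℚ) (x : K) : Prop := ((c * S.w : ℚ) : WithTop ℚ) ≤ S.v x

variable {S}

theorem Ge.mul {c d : ℚ} {x y : K} (hx : S.Ge c x) (hy : S.Ge d y) : S.Ge (c + d) (x * y) := by
  unfold Ge at *
  rw [AddValuation.map_mul, add_mul, WithTop.coe_add]
  exact add_le_add hx hy

theorem Ge.add {c : ℚ} {x y : K} (hx : S.Ge c x) (hy : S.Ge c y) : S.Ge c (x + y) :=
  AddValuation.map_le_add S.v hx hy

theorem ge_zero (c : ℚ) : S.Ge c 0 := by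
  unfold Ge; rw [AddValuation.map_zero]; exact le_top

theorem Ge.sum {ι : Type*} {s : Finset ι} {c : ℚ} {f : ι → K} (h : ∀ i ∈ s, S.Ge c (f i)) :
    S.Ge c (∑ i ∈ s, f i) :=
  AddValuation.map_le_sum S.v h

theorem Ge.mono {c d : ℚ} {x : K} (h : S.Ge c x) (hd : d ≤ c) : S.Ge d x := by
  refine le_trans ?_ h
  exact_mod_cast mul_le_mul_of_nonneg_right hd S.w_pos.le

theorem Ge.neg {c : ℚ} {x : K} (h : S.Ge c x) : S.Ge c (-x) := by
  unfold Ge; rw [AddValuation.map_neg]; exact h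

theorem Ge.sub {c : ℚ} {x y : K} (hx : S.Ge c x) (hy : S.Ge c y) : S.Ge c (x - y) := by
  rw [sub_eq_add_neg]; exact hx.add hy.neg

theorem ge_φ_iff {c : ℚ} {x : K} : S.Ge c (S.φ x) ↔ S.Ge c x := by
  unfold Ge; rw [S.v_φ]

theorem ge_one : S.Ge 0 1 := by
  unfold Ge; rw [zero_mul, AddValuation.map_one]; rfl

theorem ge_ι (r : R) : S.Ge 0 (S.ι r) := by
  unfold Ge; rw [zero_mul]; exact S.v_ι r

theorem v_ϖ_pow (n : ℕ) : S.v (S.ι (S.ϖ ^ n)) = ((n * S.w : ℚ) : WithTop ℚ) := by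
  rw [map_pow, AddValuation.map_pow, S.v_ϖ]
  rw [← WithTop.coe_nsmul, nsmul_eq_mul]

theorem ge_ϖ_pow (n : ℕ) : S.Ge n (S.ι S.ϖ ^ n) := by
  unfold Ge; rw [← map_pow, v_ϖ_pow]

theorem exists_ge (x : K) : ∃ c, S.Ge c x := by
  unfold Ge
  rcases eq_or_ne (S.v x) ⊤ with h | h
  · exact ⟨0, by rw [h]; exact le_top⟩
  · obtain ⟨a, ha⟩ := WithTop.ne_top_iff_exists.1 h
    exact ⟨a / S.w, by rw [← ha, div_mul_cancel₀ _ S.w_pos.ne']⟩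

theorem eq_zero_of_forall_ge {x : K} (h : ∀ n : ℕ, S.Ge n x) : x = 0 := by
  by_contra hx
  obtain ⟨a, ha⟩ := WithTop.ne_top_iff_exists.1 (mt (AddValuation.top_iff S.v).1 hx)
  obtain ⟨n, hn⟩ := exists_nat_gt (a / S.w)
  have h1 := h n
  unfold Ge at h1
  rw [← ha] at h1
  have h2 : (n : ℚ) * S.w ≤ a := by exact_mod_cast h1
  rw [div_lt_iff₀ S.w_pos] at hn
  linarith

theorem eq_zero_of_unbounded {x : K} (h : ∀ n : ℕ, ∃ c : ℚ, (n : ℚ) ≤ c ∧ S.Ge c x) : x = 0 :=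
  eq_zero_of_forall_ge fun n => by
    obtain ⟨c, hc, hx⟩ := h n
    exact hx.mono hc

theorem v_unit (u : Rˣ) : S.v (S.ι u) = 0 := by
  have h1 : S.v (S.ι u) + S.v (S.ι (u⁻¹ : Rˣ)) = 0 := by
    rw [← AddValuation.map_mul, ← map_mul, Units.mul_inv, map_one, AddValuation.map_one]
  refine le_antisymm ?_ (S.v_ι _)
  rw [← h1]
  exact le_add_of_nonneg_right (S.v_ι _)

section DVR

variable [IsDomain R] [IsDiscreteValuationRing R]

/-- On `R` the valuation is `w` times the order at `ϖ`. This is the dictionary between estimates in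
`K` and divisibility in `R`. -/
theorem ge_natCast_iff (hϖ : Irreducible S.ϖ) (n : ℕ) (r : R) :
    S.Ge n (S.ι r) ↔ S.ϖ ^ n ∣ r := by
  constructor
  · intro h
    rcases eq_or_ne r 0 with rfl | hr
    · exact dvd_zero _
    obtain ⟨m, u, hu⟩ := IsDiscreteValuationRing.eq_unit_mul_pow_irreducible hr hϖ
    unfold Ge at h
    rw [hu, map_mul, AddValuation.map_mul, v_unit, zero_add, v_ϖ_pow] at h
    have h2 : (n : ℚ) * S.w ≤ m * S.w := by exact_mod_cast h
    have h3 : (n : ℚ) ≤ m := le_of_mul_le_mul_right h2 S.w_pos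
    rw [hu]
    exact (pow_dvd_pow _ (by exact_mod_cast h3)).mul_left _
  · rintro ⟨s, rfl⟩
    rw [map_mul, map_pow]
    simpa using (ge_ϖ_pow n).mul (ge_ι s)

theorem ι_injective (hϖ : Irreducible S.ϖ) : Function.Injective S.ι := by
  rw [injective_iff_map_eq_zero]
  intro r hr
  by_contra hr0
  obtain ⟨m, u, hu⟩ := IsDiscreteValuationRing.eq_unit_mul_pow_irreducible hr0 hϖ
  have h := congrArg S.v hr
  rw [hu, map_mul, AddValuation.map_mul, v_unit, zero_add, v_ϖ_pow, AddValuation.map_zero] at h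
  exact WithTop.coe_ne_top h

end DVR

/-! Matrices with entries of bounded valuation -/

variable (S) in
/-- All the entries of `A` have valuation at least `c`. -/
def MB {m n : Type*} (c : ℚ) (A : Matrix m n K) : Prop := ∀ i j, S.Ge c (A i j)

theorem MB.mono {m n : Type*} {c d : ℚ} {A : Matrix m n K} (h : S.MB c A) (hd : d ≤ c) :
    S.MB d A := fun i j => (h i j).mono hd

theorem MB.mul {l m n : Type*} [Fintype m] {c d : ℚ} {A : Matrix l m K} {B : Matrix m n K}
    (hA : S.MB c A) (hB : S.MB d B) : S.MB (c + d) (A * B) := fun i j => by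
  rw [Matrix.mul_apply]
  exact Ge.sum fun k _ => (hA i k).mul (hB k j)

theorem MB.add {m n : Type*} {c : ℚ} {A B : Matrix m n K} (hA : S.MB c A) (hB : S.MB c B) :
    S.MB c (A + B) := fun i j => (hA i j).add (hB i j)

theorem MB.sub {m n : Type*} {c : ℚ} {A B : Matrix m n K} (hA : S.MB c A) (hB : S.MB c B) :
    S.MB c (A - B) := fun i j => (hA i j).sub (hB i j)

theorem mb_one {n : Type*} [DecidableEq n] : S.MB 0 (1 : Matrix n n K) := fun i j => by
  rw [Matrix.one_apply]
  split_ifs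
  · exact ge_one
  · exact ge_zero _

theorem mb_zero {m n : Type*} (c : ℚ) : S.MB c (0 : Matrix m n K) := fun _ _ => ge_zero _

theorem mb_ι {m n : Type*} (A : Matrix m n R) : S.MB 0 (A.map S.ι) := fun _ _ => ge_ι _

theorem MB.map_φ {m n : Type*} {c : ℚ} {A : Matrix m n K} (h : S.MB c A) : S.MB c (A.map S.φ) :=
  fun i j => ge_φ_iff.2 (h i j)

theorem ge_iterate_φ_iff {c : ℚ} {x : K} (n : ℕ) : S.Ge c (S.φ^[n] x) ↔ S.Ge c x := by
  induction n with
  | zero => rfl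
  | succ n ih => rw [Function.iterate_succ_apply', ge_φ_iff, ih]

theorem mb_map_iterate_φ_iff {m n : Type*} {c : ℚ} {A : Matrix m n K} (j : ℕ) :
    S.MB c (A.map S.φ^[j]) ↔ S.MB c A :=
  forall_congr' fun _ => forall_congr' fun _ => ge_iterate_φ_iff j

theorem exists_mb {m n : Type*} [Finite m] [Finite n] (A : Matrix m n K) :
    ∃ c : ℕ, S.MB (-c) A := by
  cases nonempty_fintype m
  cases nonempty_fintype n
  choose c hc using fun ij : m × n => exists_ge (S := S) (A ij.1 ij.2)
  obtain ⟨N, hN⟩ := exists_nat_ge (∑ ij, |c ij|)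
  refine ⟨N, fun i j => (hc (i, j)).mono ?_⟩
  have h1 : |c (i, j)| ≤ ∑ ij, |c ij| :=
    Finset.single_le_sum (fun ij _ => abs_nonneg (c ij)) (Finset.mem_univ (i, j))
  have h2 := neg_abs_le (c (i, j))
  linarith

theorem eq_zero_of_mb_unbounded {m n : Type*} {A : Matrix m n K}
    (h : ∀ n : ℕ, ∃ c : ℚ, (n : ℚ) ≤ c ∧ S.MB c A) : A = 0 := by
  ext i j
  exact eq_zero_of_unbounded fun n => by
    obtain ⟨c, hc, hA⟩ := h n
    exact ⟨c, hc, hA i j⟩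

end SlopeSetting

/-! Iterates of semilinear maps -/

section Twist

variable {A B : Type*} [CommRing A] [CommRing B] {n m : Type*} [Fintype n] [DecidableEq n]
  [Fintype m] [DecidableEq m]

/-- The matrix of the `j`-th iterate of the `s`-linear map with matrix `X`. -/
def twist (s : A →+* A) (X : Matrix n n A) : ℕ → Matrix n n A
  | 0 => 1
  | j + 1 => X * (twist s X j).map s

/-- The inverse of `twist s X j`, given the inverse `Z` of `X`. -/
def twistInv (s : A →+* A) (Z : Matrix n n A) : ℕ → Matrix n n A
  | 0 => 1
  | j + 1 => (twistInv s Z j).map s * Z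

theorem map_iterate_succ (s : A →+* A) {l r : Type*} (P : Matrix l r A) (j : ℕ) :
    P.map s^[j + 1] = (P.map s^[j]).map s := by
  ext a b
  simp only [Matrix.map_apply, Function.iterate_succ_apply']

theorem map_iterate_mul (s : A →+* A) {l r : Type*} (P : Matrix l n A) (Q : Matrix n r A) (j : ℕ) :
    (P * Q).map s^[j] = P.map s^[j] * Q.map s^[j] := by
  induction j with
  | zero => simp
  | succ j ih => rw [map_iterate_succ, ih, Matrix.map_mul, ← map_iterate_succ, ← map_iterate_succ]

theorem twist_mul_map {s : A →+* A} {X : Matrix n n A} {P : Matrix n m A} {Y : Matrix m m A}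
    (h : X * P.map s = P * Y) (j : ℕ) : twist s X j * P.map s^[j] = P * twist s Y j := by
  induction j with
  | zero => simp [twist]
  | succ j ih =>
    rw [twist, map_iterate_succ, Matrix.mul_assoc, ← Matrix.map_mul, ih, Matrix.map_mul,
      ← Matrix.mul_assoc, h, twist, Matrix.mul_assoc]

theorem twistInv_mul {s : A →+* A} {X Z : Matrix n n A} (h : Z * X = 1) (j : ℕ) :
    twistInv s Z j * twist s X j = 1 := by
  induction j with
  | zero => simp [twist, twistInv]
  | succ j ih =>
    rw [twist, twistInv, Matrix.mul_assoc, ← Matrix.mul_assoc Z, h, Matrix.one_mul,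
      ← Matrix.map_mul, ih]
    exact Matrix.map_one _ (map_zero s) (map_one s)

theorem twist_map {s : A →+* A} {t : B →+* B} (f : A →+* B) (h : ∀ a, t (f a) = f (s a))
    (X : Matrix n n A) (j : ℕ) : (twist s X j).map f = twist t (X.map f) j := by
  induction j with
  | zero => exact Matrix.map_one _ (map_zero f) (map_one f)
  | succ j ih =>
    rw [twist, twist, Matrix.map_mul, ← ih]
    congr 1
    ext a b
    simp only [Matrix.map_apply, h]

theorem twist_fromBlocks_zero₁₂ (s : A →+* A) (P : Matrix n n A) (Q : Matrix m n A)
    (T : Matrix m m A) (j : ℕ) :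
    ∃ Q', twist s (Matrix.fromBlocks P 0 Q T) j =
      Matrix.fromBlocks (twist s P j) 0 Q' (twist s T j) := by
  induction j with
  | zero => exact ⟨0, by simp [twist]⟩
  | succ j ih =>
    obtain ⟨Q', hQ⟩ := ih
    refine ⟨Q * (twist s P j).map s + T * Q'.map s, ?_⟩
    rw [twist, hQ, Matrix.fromBlocks_map, Matrix.fromBlocks_multiply]
    simp [twist, Matrix.map_zero]

theorem SlopeSetting.MB.twist {R K : Type*} [CommRing R] [Field K] {S : SlopeSetting R K} {c : ℚ}
    {Y : Matrix n n K} (h : S.MB c Y) (j : ℕ) : S.MB (c * j) (twist (S.φ : K →+* K) Y j) := by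
  induction j with
  | zero => simpa [HodgeNewton.twist] using mb_one
  | succ j ih =>
    have := h.mul ih.map_φ
    rw [Nat.cast_succ, mul_add, mul_one, add_comm]
    exact this

theorem SlopeSetting.MB.twistInv {R K : Type*} [CommRing R] [Field K] {S : SlopeSetting R K} {c : ℚ}
    {Y : Matrix n n K} (h : S.MB c Y) (j : ℕ) : S.MB (c * j) (twistInv (S.φ : K →+* K) Y j) := by
  induction j with
  | zero => simpa [HodgeNewton.twistInv] using mb_one
  | succ j ih =>
    have := ih.map_φ.mul h
    rw [Nat.cast_succ, mul_add, mul_one]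
    exact this

end Twist

/-! ### Splitting a semilinear map by slopes over the valued field -/

namespace SlopeSetting

variable {R K : Type*} [CommRing R] [Field K] {S : SlopeSetting R K}

theorem ι_ϖ_ne_zero : S.ι S.ϖ ≠ 0 := fun h => by
  have h1 := S.v_ϖ
  rw [h, AddValuation.map_zero] at h1
  exact WithTop.coe_ne_top h1.symm

theorem φ_ι_ϖ_pow (n : ℕ) : S.φ (S.ι S.ϖ ^ n) = S.ι S.ϖ ^ n := by
  rw [map_pow, S.φ_ι, S.σ_ϖ]

/-- Multiplying the `l`-th basis vector by `ϖ^(N l)` multiplies the entry `(i, j)` by `ϖ^(N (j -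
i))`. This keeps the diagonal and pushes the entries above it, for `Y` and its inverse, as far as
desired. Since `σ` fixes `ϖ`, the semilinear change of basis is an ordinary conjugation. -/
theorem exists_scaled {h : ℕ} {X P Y : Matrix (Fin h) (Fin h) K} (hP : IsUnit P.det)
    (hX : X * P.map S.φ = P * Y) (hY : ∀ i j, j < i → Y i j = 0) (hd : ∀ l, Y l l ≠ 0) (C : ℚ) :
    ∃ P' Y' Z : Matrix (Fin h) (Fin h) K, IsUnit P'.det ∧ X * P'.map S.φ = P' * Y' ∧ Z * Y' = 1 ∧
      (∀ i j, j < i → Y' i j = 0) ∧ (∀ i j, j < i → Z i j = 0) ∧ (∀ l, Y' l l = Y l l) ∧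
      (∀ l, Z l l = (Y l l)⁻¹) ∧ ∀ i j, i ≠ j → S.Ge C (Y' i j) ∧ S.Ge C (Z i j) := by
  classical
  have htri : Y.BlockTriangular id := fun i j hij => hY i j hij
  have hdet : IsUnit Y.det := by
    rw [Matrix.det_of_isUpperTriangular htri]
    exact (Finset.prod_ne_zero_iff.2 fun l _ => hd l).isUnit
  have hinv : Invertible Y := Y.invertibleOfIsUnitDet hdet
  have hZ : Y⁻¹.BlockTriangular id := Matrix.blockTriangular_inv_of_blockTriangular htri
  have hZY : Y⁻¹ * Y = 1 := Matrix.nonsing_inv_mul Y hdet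
  have hZd : ∀ l, Y⁻¹ l l = (Y l l)⁻¹ := fun l => by
    have h1 := congrFun (congrFun hZY l) l
    rw [Matrix.mul_apply, Finset.sum_eq_single l, Matrix.one_apply_eq] at h1
    · exact eq_inv_of_mul_eq_one_left h1
    · intro j _ hj
      rcases lt_or_gt_of_ne hj with hj | hj
      · rw [hZ hj, zero_mul]
      · rw [htri hj, mul_zero]
    · simp
  obtain ⟨c₁, hc₁⟩ := exists_mb (S := S) Y
  obtain ⟨c₂, hc₂⟩ := exists_mb (S := S) Y⁻¹
  obtain ⟨N, hN⟩ := exists_nat_ge (|C| + c₁ + c₂)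
  set t := S.ι S.ϖ with ht
  have ht0 : ∀ n, t ^ n ≠ 0 := fun n => pow_ne_zero n ι_ϖ_ne_zero
  set Δ : Matrix (Fin h) (Fin h) K := Matrix.diagonal fun l => t ^ (N * (l : ℕ)) with hΔ
  set Δ' : Matrix (Fin h) (Fin h) K := Matrix.diagonal fun l => (t ^ (N * (l : ℕ)))⁻¹ with hΔ'
  have hΔΔ' : Δ * Δ' = 1 := by
    rw [hΔ, hΔ', Matrix.diagonal_mul_diagonal, ← Matrix.diagonal_one]
    congr 1
    funext l
    exact mul_inv_cancel₀ (ht0 _)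
  have hΔφ : Δ.map S.φ = Δ := by
    rw [hΔ, Matrix.diagonal_map (map_zero S.φ)]
    congr 1
    funext l
    exact φ_ι_ϖ_pow _
  have hentry : ∀ (V : Matrix (Fin h) (Fin h) K) i j,
      (Δ' * V * Δ) i j = (t ^ (N * (i : ℕ)))⁻¹ * V i j * t ^ (N * (j : ℕ)) := fun V i j => by
    rw [hΔ, hΔ', Matrix.mul_diagonal, Matrix.diagonal_mul]
  have hdiag : ∀ (V : Matrix (Fin h) (Fin h) K) l, (Δ' * V * Δ) l l = V l l := fun V l => by
    rw [hentry, mul_right_comm, inv_mul_cancel₀ (ht0 _), one_mul]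
  have hlow : ∀ (V : Matrix (Fin h) (Fin h) K), V.BlockTriangular id →
      ∀ i j, j < i → (Δ' * V * Δ) i j = 0 := fun V hV i j hij => by
    rw [hentry, hV hij, mul_zero, zero_mul]
  have hge : ∀ (V : Matrix (Fin h) (Fin h) K) (c : ℕ), V.BlockTriangular id → S.MB (-c) V →
      |C| + c ≤ N → ∀ i j, i ≠ j → S.Ge C ((Δ' * V * Δ) i j) := by
    intro V c hV hc hcN i j hij
    rcases lt_or_gt_of_ne hij with hij | hij
    · have h1 : (Δ' * V * Δ) i j = V i j * t ^ (N * ((j : ℕ) - i)) := by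
        rw [hentry, mul_comm, ← mul_assoc, mul_comm]
        congr 1
        rw [← div_eq_mul_inv, div_eq_iff (ht0 _), ← pow_add, ← mul_add]
        congr 2
        have : (i : ℕ) < j := hij
        omega
      rw [h1]
      refine ((hc i j).mul (ge_ϖ_pow _)).mono ?_
      have h2 : (1 : ℕ) ≤ (j : ℕ) - i := by
        have : (i : ℕ) < j := hij
        omega
      have h3 : (N : ℚ) ≤ ((N * ((j : ℕ) - i) : ℕ) : ℚ) := by
        exact_mod_cast Nat.le_mul_of_pos_right N h2
      have h4 := le_abs_self C
      linarith
    · rw [hlow V hV i j hij]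
      exact ge_zero _
  have hc₁0 : (0 : ℚ) ≤ c₁ := Nat.cast_nonneg _
  have hc₂0 : (0 : ℚ) ≤ c₂ := Nat.cast_nonneg _
  refine ⟨P * Δ, Δ' * Y * Δ, Δ' * Y⁻¹ * Δ, ?_, ?_, ?_, hlow Y htri, hlow _ hZ, hdiag Y,
    fun l => by rw [hdiag, hZd], fun i j hij =>
      ⟨hge Y c₁ htri hc₁ (by linarith) i j hij, hge _ c₂ hZ hc₂ (by linarith) i j hij⟩⟩
  · rw [Matrix.det_mul]
    refine hP.mul ?_
    rw [hΔ, Matrix.det_diagonal]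
    exact (Finset.prod_ne_zero_iff.2 fun l _ => ht0 _).isUnit
  · have h1 : (P * Δ).map S.φ = P.map S.φ * Δ.map S.φ := Matrix.map_mul
    rw [h1, hΔφ, ← Matrix.mul_assoc, hX]
    calc P * Y * Δ = P * (Δ * Δ') * Y * Δ := by rw [hΔΔ', Matrix.mul_one]
      _ = P * Δ * (Δ' * Y * Δ) := by simp only [Matrix.mul_assoc]
  · have h1 : Δ' * Δ = 1 := mul_eq_one_comm.1 hΔΔ'
    calc Δ' * Y⁻¹ * Δ * (Δ' * Y * Δ) = Δ' * (Y⁻¹ * (Δ * Δ') * Y) * Δ := by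
          simp only [Matrix.mul_assoc]
      _ = 1 := by rw [hΔΔ', Matrix.mul_one, hZY, Matrix.mul_one, h1]

/-- Over `K`, the `σ`-linear map with matrix `X` has a stable subspace (indexed by `n₁`) on which it
expands valuations by at most `α`, and acts on the quotient (indexed by `n₂`) by raising valuations
by at least `β`. -/
structure Split (S : SlopeSetting R K) {n : Type*} [Fintype n] [DecidableEq n] (X : Matrix n n R)
    (α β : ℚ) (n₁ n₂ : Type*) [Fintype n₁] [DecidableEq n₁] [Fintype n₂] [DecidableEq n₂] where
  P₁ : Matrix n n₁ K
  P₂ : Matrix n n₂ K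
  Q₁ : Matrix n₁ n K
  Q₂ : Matrix n₂ n K
  Q₁P₁ : Q₁ * P₁ = 1
  Q₂P₂ : Q₂ * P₂ = 1
  Q₂P₁ : Q₂ * P₁ = 0
  PQ : P₁ * Q₁ + P₂ * Q₂ = 1
  A : Matrix n₁ n₁ K
  B : Matrix n₁ n₂ K
  D : Matrix n₂ n₂ K
  Z : Matrix n₁ n₁ K
  eq₁ : X.map S.ι * P₁.map S.φ = P₁ * A
  eq₂ : X.map S.ι * P₂.map S.φ = P₁ * B + P₂ * D
  ZA : Z * A = 1
  mbZ : S.MB (-α) Z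
  mbB : S.MB β B
  mbD : S.MB β D

/-- The bijection between `{1, …, h}` and the disjoint union of its first `i` and last `h - i`
elements. -/
def splitEquiv {i h : ℕ} (hi : i ≤ h) : Fin i ⊕ Fin (h - i) ≃ Fin h :=
  finSumFinEquiv.trans (finCongr (by omega))

theorem splitEquiv_inl {i h : ℕ} (hi : i ≤ h) (a : Fin i) :
    splitEquiv hi (Sum.inl a) = Fin.castLE hi a := rfl

theorem splitEquiv_inr {i h : ℕ} (hi : i ≤ h) (b : Fin (h - i)) :
    splitEquiv hi (Sum.inr b) = ⟨i + b, by omega⟩ := rfl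

theorem submatrix_mul_splitEquiv {i h : ℕ} (hi : i ≤ h) {l m r s : Type*}
    (U : Matrix l (Fin h) K) (V : Matrix (Fin h) m K) (f : r → l) (g : s → m) :
    (U * V).submatrix f g =
      U.submatrix f (splitEquiv hi ∘ Sum.inl) * V.submatrix (splitEquiv hi ∘ Sum.inl) g +
        U.submatrix f (splitEquiv hi ∘ Sum.inr) * V.submatrix (splitEquiv hi ∘ Sum.inr) g := by
  ext a b
  simp only [Matrix.submatrix_apply, Matrix.mul_apply, Matrix.add_apply, Function.comp_apply]
  rw [← (splitEquiv hi).sum_comp, Fintype.sum_sum_type]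

/-- The first `i` vectors of a triangularizing basis span a stable subspace. After rescaling, the
entries off the diagonal are negligible, so the bounds on `A⁻¹`, `B` and `D` are those of the
diagonal entries. -/
theorem exists_split {h i : ℕ} (hi : i ≤ h) {X : Matrix (Fin h) (Fin h) R}
    {P Y : Matrix (Fin h) (Fin h) K} (hP : IsUnit P.det) (hX : X.map S.ι * P.map S.φ = P * Y)
    (hY : ∀ i j, j < i → Y i j = 0) {s : Fin h → ℚ} (hv : ∀ l, S.v (Y l l) = (s l * S.w : ℚ))
    {α β : ℚ} (hα : ∀ l : Fin i, s (Fin.castLE hi l) ≤ α)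
    (hβ : ∀ l : Fin (h - i), β ≤ s ⟨i + l, by omega⟩) :
    ∃ T : S.Split X α β (Fin i) (Fin (h - i)),
      (∀ a b, b < a → T.A a b = 0) ∧ (∀ a, S.v (T.A a a) = (s (Fin.castLE hi a) * S.w : ℚ)) ∧
      (∀ a b, b < a → T.D a b = 0) ∧ (∀ a, S.v (T.D a a) = (s ⟨i + a, by omega⟩ * S.w : ℚ)) := by
  have hd : ∀ l, Y l l ≠ 0 := fun l h0 => by
    have h1 := hv l
    rw [h0, AddValuation.map_zero] at h1
    exact WithTop.coe_ne_top h1.symm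
  -- The constant `|α| + |β|` is at least both `-α` and `β`, the bounds required for the entries off
  -- the diagonal.
  obtain ⟨P', Y', Z, hP', hX', hZY, hY'l, hZl, hY'd, hZd, hge⟩ :=
    exists_scaled hP hX hY hd (|α| + |β|)
  have hβ' : β ≤ |α| + |β| := by
    have := le_abs_self β
    have := abs_nonneg α
    linarith
  have hα' : -α ≤ |α| + |β| := by
    have := neg_le_abs α
    have := abs_nonneg β
    linarith
  set e := splitEquiv hi with he
  have hlt : ∀ (a : Fin i) (b : Fin (h - i)), e (Sum.inl a) < e (Sum.inr b) := fun a b => by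
    rw [he, splitEquiv_inl, splitEquiv_inr]
    change (a : ℕ) < i + b
    omega
  have hlt₁ : ∀ a b : Fin i, b < a → e (Sum.inl b) < e (Sum.inl a) := fun a b hab => hab
  have hlt₂ : ∀ a b : Fin (h - i), b < a → e (Sum.inr b) < e (Sum.inr a) := fun a b hab => by
    rw [he, splitEquiv_inr, splitEquiv_inr]
    change i + (b : ℕ) < i + a
    have : (b : ℕ) < a := hab
    omega
  have hY'0 : Y'.submatrix (e ∘ Sum.inr) (e ∘ Sum.inl) = 0 := by
    ext a b
    exact hY'l _ _ (hlt b a)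
  have hvinv : ∀ l, S.v (Y l l)⁻¹ = ((-s l * S.w : ℚ) : WithTop ℚ) := fun l => by
    have h1 : S.v (Y l l)⁻¹ + S.v (Y l l) = 0 := by
      rw [← AddValuation.map_mul, inv_mul_cancel₀ (hd l), AddValuation.map_one]
    rw [hv l] at h1
    have h3 : S.v (Y l l)⁻¹ ≠ ⊤ := by
      rw [Ne, AddValuation.top_iff]
      exact inv_ne_zero (hd l)
    obtain ⟨a, ha⟩ := WithTop.ne_top_iff_exists.1 h3
    rw [← ha] at h1 ⊢
    have h4 : a + s l * S.w = 0 := by exact_mod_cast h1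
    have h5 : a = -s l * S.w := by linarith
    rw [h5]
  have hinv : P'⁻¹ * P' = 1 := Matrix.nonsing_inv_mul _ hP'
  refine ⟨{ P₁ := P'.submatrix id (e ∘ Sum.inl), P₂ := P'.submatrix id (e ∘ Sum.inr)
            Q₁ := P'⁻¹.submatrix (e ∘ Sum.inl) id, Q₂ := P'⁻¹.submatrix (e ∘ Sum.inr) id
            Q₁P₁ := ?_, Q₂P₂ := ?_, Q₂P₁ := ?_, PQ := ?_
            A := Y'.submatrix (e ∘ Sum.inl) (e ∘ Sum.inl)
            B := Y'.submatrix (e ∘ Sum.inl) (e ∘ Sum.inr)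
            D := Y'.submatrix (e ∘ Sum.inr) (e ∘ Sum.inr)
            Z := Z.submatrix (e ∘ Sum.inl) (e ∘ Sum.inl)
            eq₁ := ?_, eq₂ := ?_, ZA := ?_, mbZ := ?_, mbB := ?_, mbD := ?_ }, ?_, ?_, ?_, ?_⟩
  · rw [← Matrix.submatrix_mul _ _ _ id _ Function.bijective_id, hinv]
    exact Matrix.submatrix_one _ (e.injective.comp Sum.inl_injective)
  · rw [← Matrix.submatrix_mul _ _ _ id _ Function.bijective_id, hinv]
    exact Matrix.submatrix_one _ (e.injective.comp Sum.inr_injective)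
  · rw [← Matrix.submatrix_mul _ _ _ id _ Function.bijective_id, hinv]
    ext a b
    exact Matrix.one_apply_ne fun h0 => Sum.inr_ne_inl (e.injective h0)
  · rw [← submatrix_mul_splitEquiv hi, Matrix.mul_nonsing_inv _ hP', Matrix.submatrix_id_id]
  · have h1 := submatrix_mul_splitEquiv hi P' Y' id (e ∘ Sum.inl)
    rw [hY'0, Matrix.mul_zero, add_zero, ← hX',
      Matrix.submatrix_mul _ _ id id _ Function.bijective_id] at h1
    exact h1
  · have h1 := submatrix_mul_splitEquiv hi P' Y' id (e ∘ Sum.inr)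
    rw [← hX', Matrix.submatrix_mul _ _ id id _ Function.bijective_id] at h1
    exact h1
  · have h1 := submatrix_mul_splitEquiv hi Z Y' (e ∘ Sum.inl) (e ∘ Sum.inl)
    rw [hY'0, Matrix.mul_zero, add_zero, hZY] at h1
    rw [← h1]
    exact Matrix.submatrix_one _ (e.injective.comp Sum.inl_injective)
  · intro a b
    rcases eq_or_ne a b with rfl | hab
    · change S.Ge (-α) (Z (e (Sum.inl a)) (e (Sum.inl a)))
      rw [hZd]
      unfold Ge
      rw [hvinv]
      exact_mod_cast mul_le_mul_of_nonneg_right (neg_le_neg (hα a)) S.w_pos.le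
    · exact (hge _ _ fun h0 => hab (Sum.inl_injective (e.injective h0))).2.mono hα'
  · exact fun a b => (hge _ _ (hlt a b).ne).1.mono hβ'
  · intro a b
    rcases eq_or_ne a b with rfl | hab
    · change S.Ge β (Y' (e (Sum.inr a)) (e (Sum.inr a)))
      rw [hY'd]
      unfold Ge
      rw [hv]
      exact_mod_cast mul_le_mul_of_nonneg_right (hβ a) S.w_pos.le
    · exact (hge _ _ fun h0 => hab (Sum.inr_injective (e.injective h0))).1.mono hβ'
  · exact fun a b hab => hY'l _ _ (hlt₁ a b hab)
  · intro a
    change S.v (Y' (e (Sum.inl a)) (e (Sum.inl a))) = _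
    rw [hY'd, hv]
    rfl
  · exact fun a b hab => hY'l _ _ (hlt₂ a b hab)
  · intro a
    change S.v (Y' (e (Sum.inr a)) (e (Sum.inr a))) = _
    rw [hY'd, hv]
    rfl

/-- A `σ`-linear map whose matrix over `K` is equivalent to `A` expands valuations by at most `α` if
`A` does. -/
theorem exists_twist_inverse_of_eq {m : Type*} [Fintype m] [DecidableEq m] {α : ℚ} {A' : Matrix m m R}
    {P A Z : Matrix m m K} (hP : IsUnit P.det) (h : A'.map S.ι * P.map S.φ = P * A)
    (hZ : Z * A = 1) (hZα : S.MB (-α) Z) : ∃ c : ℕ, ∀ j : ℕ, ∃ W : Matrix m m K,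
      (twist (S.σ : R →+* R) A' j).map S.ι * W = 1 ∧ S.MB (-α * j - c) W := by
  obtain ⟨c₁, hc₁⟩ := exists_mb (S := S) P
  obtain ⟨c₂, hc₂⟩ := exists_mb (S := S) P⁻¹
  refine ⟨c₁ + c₂, fun j => ⟨P.map S.φ^[j] * twistInv (S.φ : K →+* K) Z j * P⁻¹, ?_, ?_⟩⟩
  · have h1 := twist_mul_map (s := (S.φ : K →+* K)) h j
    rw [← twist_map (s := (S.σ : R →+* R)) (t := (S.φ : K →+* K)) S.ι S.φ_ι] at h1
    have h2 := mul_eq_one_comm.1 (twistInv_mul (s := (S.φ : K →+* K)) hZ j)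
    have h3 : (twist (S.σ : R →+* R) A' j).map S.ι * P.map S.φ^[j] =
      P * twist (S.φ : K →+* K) A j := h1
    rw [Matrix.mul_assoc (P.map _), ← Matrix.mul_assoc, h3, Matrix.mul_assoc,
      ← Matrix.mul_assoc (twist _ _ _), h2, Matrix.one_mul, Matrix.mul_nonsing_inv _ hP]
  · refine ((((mb_map_iterate_φ_iff j).2 hc₁).mul (hZα.twistInv j)).mul hc₂).mono ?_
    push_cast
    linarith

namespace Split

variable {n n₁ n₂ : Type*} [Fintype n] [DecidableEq n] [Fintype n₁] [DecidableEq n₁] [Fintype n₂]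
  [DecidableEq n₂] {X : Matrix n n R} {α β : ℚ}

theorem mul_map_mul_map_mul {n' l r : Type*} [Fintype n'] {V : Matrix n' n R} {V' : Matrix n n' R}
    (h : V' * V = 1) (Q : Matrix l n K) (P : Matrix n r K) :
    Q * V'.map S.ι * (V.map S.ι * P) = Q * P := by
  rw [Matrix.mul_assoc, ← Matrix.mul_assoc (V'.map S.ι), ← Matrix.map_mul, h,
    Matrix.map_one _ (map_zero S.ι) (map_one S.ι), Matrix.one_mul]

theorem map_mul_map_map {n' r : Type*} [Fintype n'] {X' : Matrix n' n' R} {V : Matrix n' n R}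
    (hX : X' * V.map S.σ = V * X) (P : Matrix n r K) :
    X'.map S.ι * (V.map S.ι * P).map S.φ = V.map S.ι * (X.map S.ι * P.map S.φ) := by
  have h1 : (V.map S.ι).map S.φ = (V.map S.σ).map S.ι := by
    ext a b
    exact S.φ_ι _
  have h2 : (V.map S.ι * P).map S.φ = (V.map S.ι).map S.φ * P.map S.φ := Matrix.map_mul
  have h3 : X'.map S.ι * (V.map S.σ).map S.ι = V.map S.ι * X.map S.ι := by
    rw [← Matrix.map_mul, hX, Matrix.map_mul]
  rw [h2, h1, ← Matrix.mul_assoc, h3, Matrix.mul_assoc]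

/-- The splitting attached to a change of basis. -/
def changeBasis {n' : Type*} [Fintype n'] [DecidableEq n'] (T : S.Split X α β n₁ n₂)
    {X' : Matrix n' n' R} {V : Matrix n' n R} {V' : Matrix n n' R} (h : V * V' = 1)
    (h' : V' * V = 1) (hX : X' * V.map S.σ = V * X) : S.Split X' α β n₁ n₂ where
  P₁ := V.map S.ι * T.P₁
  P₂ := V.map S.ι * T.P₂
  Q₁ := T.Q₁ * V'.map S.ι
  Q₂ := T.Q₂ * V'.map S.ι
  Q₁P₁ := by rw [mul_map_mul_map_mul h', T.Q₁P₁]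
  Q₂P₂ := by rw [mul_map_mul_map_mul h', T.Q₂P₂]
  Q₂P₁ := by rw [mul_map_mul_map_mul h', T.Q₂P₁]
  PQ := by
    simp only [Matrix.mul_assoc]
    rw [← Matrix.mul_add, ← Matrix.mul_assoc T.P₁, ← Matrix.mul_assoc T.P₂, ← Matrix.add_mul, T.PQ,
      Matrix.one_mul, ← Matrix.map_mul, h, Matrix.map_one _ (map_zero S.ι) (map_one S.ι)]
  A := T.A
  B := T.B
  D := T.D
  Z := T.Z
  eq₁ := by rw [map_mul_map_map hX, T.eq₁, Matrix.mul_assoc]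
  eq₂ := by rw [map_mul_map_map hX, T.eq₂, Matrix.mul_add, Matrix.mul_assoc, Matrix.mul_assoc]
  ZA := T.ZA
  mbZ := T.mbZ
  mbB := T.mbB
  mbD := T.mbD

theorem twist_eq₁ (T : S.Split X α β n₁ n₂) (m : ℕ) :
    (twist (S.σ : R →+* R) X m).map S.ι * T.P₁.map S.φ^[m] =
      T.P₁ * twist (S.φ : K →+* K) T.A m := by
  rw [twist_map (s := (S.σ : R →+* R)) (t := (S.φ : K →+* K)) S.ι S.φ_ι X m]
  exact twist_mul_map (s := (S.φ : K →+* K)) T.eq₁ m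

theorem mb_twistInv (T : S.Split X α β n₁ n₂) (m : ℕ) :
    S.MB (-α * m) (twistInv (S.φ : K →+* K) T.Z m) :=
  T.mbZ.twistInv m

/-- A vector in the stable subspace cannot be contracted faster than `α`. -/
theorem eq_zero_of_growth (T : S.Split X α β n₁ n₂) {l : Type*} {ρ : ℚ} (hρ : α < ρ)
    (z : Matrix n₁ l K) (c : ℕ)
    (h : ∀ m : ℕ, S.MB (ρ * m - c) ((twist (S.σ : R →+* R) X m).map S.ι *
      (T.P₁ * z).map S.φ^[m])) : z = 0 := by
  obtain ⟨q, hq⟩ := exists_mb (S := S) T.Q₁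
  refine eq_zero_of_mb_unbounded (S := S) fun N => ?_
  obtain ⟨m, hm⟩ := exists_nat_ge ((N + c + q : ℚ) / (ρ - α))
  rw [div_le_iff₀ (by linarith)] at hm
  refine ⟨-α * m + (-q + (ρ * m - c)), by linarith, ?_⟩
  rw [← mb_map_iterate_φ_iff m]
  -- Undoing the `m`-th iterate on the stable subspace costs at most `α m`, while the hypothesis
  -- gains `ρ m`. As `φ` preserves valuations, the bound concerns `z` itself and tends to infinity.
  have h1 : z.map S.φ^[m] = twistInv (S.φ : K →+* K) T.Z m * (T.Q₁ *
      ((twist (S.σ : R →+* R) X m).map S.ι * (T.P₁ * z).map S.φ^[m])) := by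
    have h2 : (T.P₁ * z).map S.φ^[m] = T.P₁.map S.φ^[m] * z.map S.φ^[m] :=
      map_iterate_mul (S.φ : K →+* K) T.P₁ z m
    rw [h2, ← Matrix.mul_assoc (Matrix.map _ _), T.twist_eq₁, Matrix.mul_assoc T.P₁,
      ← Matrix.mul_assoc T.Q₁, T.Q₁P₁, Matrix.one_mul, ← Matrix.mul_assoc, twistInv_mul T.ZA,
      Matrix.one_mul]
  rw [h1]
  exact (T.mb_twistInv m).mul (hq.mul (h m))

/-- The iterates of an integral matrix keep a bounded vector bounded; with `ρ = 0 > α` the stable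
subspace would be zero. -/
theorem nonneg_of_nonempty (T : S.Split X α β n₁ n₂) [Nonempty n₁] : 0 ≤ α := by
  by_contra hα
  obtain ⟨c, hc⟩ := exists_mb (S := S) T.P₁
  have h1 : (1 : Matrix n₁ n₁ K) = 0 := by
    refine T.eq_zero_of_growth (not_le.1 hα) 1 c fun m => ?_
    rw [Matrix.mul_one]
    refine ((mb_ι _).mul ((mb_map_iterate_φ_iff m).2 hc)).mono ?_
    simp
  exact one_ne_zero h1

section LowerTriangular

variable {r₁ r₂ : Type*} [Fintype r₁] [DecidableEq r₁] [Fintype r₂] [DecidableEq r₂]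
  {A' : Matrix r₁ r₁ R} {C' : Matrix r₂ r₁ R} {D' : Matrix r₂ r₂ R}

/-- A vector of the stable subspace without first coordinates evolves through `D'` alone, hence
grows at rate `ρ > α`, and vanishes by `eq_zero_of_growth`. -/
theorem toRows₁_injective (T : S.Split (Matrix.fromBlocks A' 0 C' D') α β n₁ n₂) {ρ : ℚ}
    (hρ : α < ρ) {c : ℕ}
    (hD : ∀ m : ℕ, S.MB (ρ * m - c) ((twist (S.σ : R →+* R) D' m).map S.ι))
    {l : Type*} [Finite l] (z : Matrix n₁ l K) (hz : T.P₁.toRows₁ * z = 0) : z = 0 := by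
  obtain ⟨q, hq⟩ := exists_mb (S := S) (T.P₁ * z)
  refine T.eq_zero_of_growth hρ z (c + q) fun m => ?_
  obtain ⟨C'', hC''⟩ := twist_fromBlocks_zero₁₂ (S.σ : R →+* R) A' C' D' m
  have hz' : ∀ a b, ((T.P₁ * z).map S.φ^[m]) (Sum.inl a) b = 0 := fun a b => by
    have h1 : (T.P₁ * z) (Sum.inl a) b = 0 := congrFun (congrFun hz a) b
    rw [Matrix.map_apply, h1]
    exact Function.iterate_fixed (map_zero S.φ) m
  rw [hC'']
  rintro (a | a) b
  · rw [Matrix.mul_apply, Fintype.sum_sum_type]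
    simp only [hz', mul_zero, Finset.sum_const_zero, zero_add, Matrix.map_apply,
      Matrix.fromBlocks_apply₁₂, Matrix.zero_apply, map_zero, zero_mul]
    exact ge_zero _
  · rw [Matrix.mul_apply, Fintype.sum_sum_type]
    simp only [hz', mul_zero, Finset.sum_const_zero, zero_add, Matrix.map_apply,
      Matrix.fromBlocks_apply₂₂]
    refine Ge.sum fun j _ => ?_
    refine ((hD m a j).mul ((ge_iterate_φ_iff m).2 (hq (Sum.inr j) b))).mono ?_
    push_cast
    linarith

theorem card_le (T : S.Split (Matrix.fromBlocks A' 0 C' D') α β n₁ n₂) {ρ : ℚ}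
    (hρ : α < ρ) {c : ℕ}
    (hD : ∀ m : ℕ, S.MB (ρ * m - c) ((twist (S.σ : R →+* R) D' m).map S.ι)) :
    Fintype.card n₁ ≤ Fintype.card r₁ := by
  have h1 : Function.Injective T.P₁.toRows₁.mulVecLin := by
    rw [injective_iff_map_eq_zero]
    intro z hz
    have h2 := T.toRows₁_injective hρ hD (Matrix.replicateCol Unit z) (by
      rw [← Matrix.replicateCol_mulVec]
      change T.P₁.toRows₁.mulVec z = 0 at hz
      rw [hz]
      rfl)
    ext a
    exact congrFun (congrFun h2 a) ()
  simpa using LinearMap.finrank_le_finrank_of_injective h1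

theorem toRows₁_eq (T : S.Split (Matrix.fromBlocks A' 0 C' D') α β n₁ n₂) :
    A'.map S.ι * T.P₁.toRows₁.map S.φ = T.P₁.toRows₁ * T.A := by
  ext a b
  have h := congrFun (congrFun T.eq₁ (Sum.inl a)) b
  rw [Matrix.mul_apply, Fintype.sum_sum_type] at h
  simpa [Matrix.mul_apply] using h

end LowerTriangular

section Square

variable {r₂ : Type*} [Fintype r₂] [DecidableEq r₂]
  {A' : Matrix n₁ n₁ R} {C' : Matrix r₂ n₁ R} {D' : Matrix r₂ r₂ R}

theorem det_toRows₁_ne_zero (T : S.Split (Matrix.fromBlocks A' 0 C' D') α β n₁ n₂) {ρ : ℚ}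
    (hρ : α < ρ) {c : ℕ}
    (hD : ∀ m : ℕ, S.MB (ρ * m - c) ((twist (S.σ : R →+* R) D' m).map S.ι)) :
    T.P₁.toRows₁.det ≠ 0 := fun h => by
  obtain ⟨z, hz0, hz⟩ := Matrix.exists_mulVec_eq_zero_iff.2 h
  refine hz0 ?_
  have h2 := T.toRows₁_injective hρ hD (Matrix.replicateCol Unit z) (by
    rw [← Matrix.replicateCol_mulVec, hz]
    rfl)
  ext a
  exact congrFun (congrFun h2 a) ()

/-- Over `K` the block `A'` is equivalent to `T.A` by the semilinear change of basis with matrix the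
first rows of `T.P₁`. The determinant of this matrix appears once through `φ`, which preserves
valuations, so it cancels. -/
theorem v_det (T : S.Split (Matrix.fromBlocks A' 0 C' D') α β n₁ n₂)
    (h : T.P₁.toRows₁.det ≠ 0) : S.v (S.ι A'.det) = S.v T.A.det := by
  have h1 := congrArg (fun M => S.v (Matrix.det M)) T.toRows₁_eq
  have h2 : (A'.map S.ι).det = S.ι A'.det := (RingHom.map_det S.ι A').symm
  have h3 : (T.P₁.toRows₁.map S.φ).det = S.φ T.P₁.toRows₁.det :=
    (RingHom.map_det (S.φ : K →+* K) T.P₁.toRows₁).symm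
  simp only [Matrix.det_mul, AddValuation.map_mul, h2, h3, S.v_φ] at h1
  rw [add_comm] at h1
  exact WithTop.add_left_cancel (mt (AddValuation.top_iff _).1 h) h1

theorem exists_twist_inverse (T : S.Split (Matrix.fromBlocks A' 0 C' D') α β n₁ n₂)
    (h : T.P₁.toRows₁.det ≠ 0) : ∃ c : ℕ, ∀ m : ℕ, ∃ W : Matrix n₁ n₁ K,
      (twist (S.σ : R →+* R) A' m).map S.ι * W = 1 ∧ S.MB (-α * m - c) W :=
  exists_twist_inverse_of_eq h.isUnit T.toRows₁_eq T.ZA T.mbZ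

end Square

section BlockDiagonal

variable {A' : Matrix n₁ n₁ R} {D' : Matrix n₂ n₂ R}

/-- These rows intertwine `T.A` with `D'`. Writing them as the `m`-th iterate of `D'`, times
themselves twisted, times the inverse of the `m`-th iterate of `T.A` gives a valuation at least `(ρ
- α) m` up to a constant. -/
theorem toRows₂_eq_zero (T : S.Split (Matrix.fromBlocks A' 0 0 D') α β n₁ n₂) {ρ : ℚ}
    (hρ : α < ρ) {c : ℕ}
    (hD : ∀ m : ℕ, S.MB (ρ * m - c) ((twist (S.σ : R →+* R) D' m).map S.ι)) :
    T.P₁.toRows₂ = 0 := by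
  have heq : D'.map S.ι * T.P₁.toRows₂.map S.φ = T.P₁.toRows₂ * T.A := by
    ext a b
    have h := congrFun (congrFun T.eq₁ (Sum.inr a)) b
    rw [Matrix.mul_apply, Fintype.sum_sum_type] at h
    simpa [Matrix.mul_apply] using h
  set P := T.P₁.toRows₂
  obtain ⟨q, hq⟩ := exists_mb (S := S) P
  refine eq_zero_of_mb_unbounded (S := S) fun N => ?_
  obtain ⟨m, hm⟩ := exists_nat_ge ((N + c + q : ℚ) / (ρ - α))
  rw [div_le_iff₀ (by linarith)] at hm
  refine ⟨(ρ * m - c) + -q + -α * m, by linarith, ?_⟩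
  have h1 := twist_mul_map (s := (S.φ : K →+* K)) heq m
  rw [← twist_map (s := (S.σ : R →+* R)) (t := (S.φ : K →+* K)) S.ι S.φ_ι] at h1
  have h2 := mul_eq_one_comm.1 (twistInv_mul (s := (S.φ : K →+* K)) T.ZA m)
  have h3 : P = (twist (S.σ : R →+* R) D' m).map S.ι * P.map S.φ^[m] *
      twistInv (S.φ : K →+* K) T.Z m := by
    have h4 : (twist (S.σ : R →+* R) D' m).map S.ι * P.map S.φ^[m] =
      P * twist (S.φ : K →+* K) T.A m := h1
    rw [h4, Matrix.mul_assoc, h2, Matrix.mul_one]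
  rw [h3]
  exact ((hD m).mul ((mb_map_iterate_φ_iff m).2 hq)).mul (T.mb_twistInv m)

theorem toRows₂_eq (T : S.Split (Matrix.fromBlocks A' 0 0 D') α β n₁ n₂)
    (h : T.P₁.toRows₂ = 0) :
    D'.map S.ι * T.P₂.toRows₂.map S.φ = T.P₂.toRows₂ * T.D := by
  ext a b
  have h1 := congrFun (congrFun T.eq₂ (Sum.inr a)) b
  rw [Matrix.mul_apply, Fintype.sum_sum_type, Matrix.add_apply] at h1
  have h2 : (T.P₁ * T.B) (Sum.inr a) b = (T.P₁.toRows₂ * T.B) a b := rfl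
  rw [h2, h, Matrix.zero_mul, Matrix.zero_apply, zero_add] at h1
  simpa [Matrix.mul_apply] using h1

/-- The stable subspace has no second coordinates, so the change of basis `(P₁ | P₂)` is block upper
triangular and its diagonal blocks are invertible. -/
theorem isUnit_det_toRows₁ (T : S.Split (Matrix.fromBlocks A' 0 0 D') α β n₁ n₂)
    (h : T.P₁.toRows₂ = 0) : IsUnit T.P₁.toRows₁.det := by
  refine Matrix.isUnit_det_of_left_inverse (B := T.Q₁.toCols₁) ?_
  have h1 := T.Q₁P₁
  rw [← Matrix.fromRows_toRows T.P₁, ← Matrix.fromCols_toCols T.Q₁,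
    Matrix.fromCols_mul_fromRows, h, Matrix.mul_zero, add_zero] at h1
  exact h1

theorem isUnit_det_toRows₂ (T : S.Split (Matrix.fromBlocks A' 0 0 D') α β n₁ n₂)
    (h : T.P₁.toRows₂ = 0) : IsUnit T.P₂.toRows₂.det := by
  refine Matrix.isUnit_det_of_right_inverse (B := T.Q₂.toCols₂) ?_
  ext a b
  have h1 := congrFun (congrFun T.PQ (Sum.inr a)) (Sum.inr b)
  have h2 : (T.P₁ * T.Q₁) (Sum.inr a) (Sum.inr b) = (T.P₁.toRows₂ * T.Q₁) a (Sum.inr b) := rfl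
  rw [Matrix.add_apply, h2, h, Matrix.zero_mul, Matrix.zero_apply, zero_add] at h1
  refine Eq.trans h1 ?_
  simp [Matrix.one_apply]

end BlockDiagonal

end Split

/-! ### Integrality in the valued field -/

section Integral

variable [IsDomain R] [IsDiscreteValuationRing R]

/-- Inside `K` the element `x` is the fraction `r / d`, and its valuation being nonnegative means
that `d` divides `r`. -/
theorem exists_ι_eq (hϖ : Irreducible S.ϖ) {d r : R} (hd : d ≠ 0) {x : K}
    (h : S.ι d * x = S.ι r) (hx : S.Ge 0 x) : ∃ s, S.ι s = x := by
  obtain ⟨n, u, hu⟩ := IsDiscreteValuationRing.eq_unit_mul_pow_irreducible hd hϖ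
  have h1 : S.Ge n (S.ι r) := by
    rw [← h, hu, map_mul, map_pow, mul_comm (S.ι u), mul_assoc]
    simpa using (ge_ϖ_pow n).mul ((ge_ι (u : R)).mul hx)
  obtain ⟨s, hs⟩ := (ge_natCast_iff hϖ n r).1 h1
  refine ⟨(u⁻¹ : Rˣ) * s, ?_⟩
  have hd' : S.ι d ≠ 0 := fun h0 => hd (ι_injective hϖ (by rw [h0, map_zero]))
  refine mul_left_cancel₀ hd' ?_
  rw [h, ← map_mul, hs, hu]
  congr 1
  calc (u : R) * S.ϖ ^ n * ((u⁻¹ : Rˣ) * s) = (u * (u⁻¹ : Rˣ) : R) * (S.ϖ ^ n * s) := by ring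
    _ = _ := by rw [Units.mul_inv, one_mul]

/-- As `det A • W` is the adjugate of `A`, the entries of `W` are fractions of elements of `R`;
multiplied by `ϖ^N` they have nonnegative valuation. -/
theorem exists_integral_inverse {n : Type*} [Fintype n] [DecidableEq n] (hϖ : Irreducible S.ϖ)
    {A : Matrix n n R} {W : Matrix n n K} (h : A.map S.ι * W = 1) {N : ℕ} (hW : S.MB (-N) W) :
    ∃ W' : Matrix n n R, A * W' = S.ϖ ^ N • 1 := by
  have h1 : (A.map S.ι).det = S.ι A.det := (RingHom.map_det S.ι A).symm
  have hdet : A.det ≠ 0 := fun h0 => by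
    have h2 := congrArg Matrix.det h
    rw [Matrix.det_mul, h1, h0, map_zero, zero_mul, Matrix.det_one] at h2
    exact zero_ne_one h2
  have h3 : S.ι A.det • W = A.adjugate.map S.ι := by
    have h4 : A.adjugate.map S.ι * A.map S.ι = S.ι A.det • 1 := by
      rw [← Matrix.map_mul, Matrix.adjugate_mul]
      ext a b
      simp [Matrix.one_apply, apply_ite S.ι]
    calc S.ι A.det • W = A.adjugate.map S.ι * A.map S.ι * W := by
          rw [h4, Matrix.smul_mul, Matrix.one_mul]
      _ = _ := by rw [Matrix.mul_assoc, h, Matrix.mul_one]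
  have h5 : ∀ a b, ∃ s, S.ι s = S.ι S.ϖ ^ N * W a b := fun a b => by
    refine exists_ι_eq hϖ (r := S.ϖ ^ N * A.adjugate a b) hdet ?_ ?_
    · have h6 : S.ι A.det * W a b = S.ι (A.adjugate a b) := congrFun (congrFun h3 a) b
      rw [mul_left_comm, h6, map_mul, map_pow]
    · simpa using (ge_ϖ_pow (S := S) N).mul (hW a b)
  choose W' hW' using h5
  refine ⟨Matrix.of W', ?_⟩
  ext a b
  refine ι_injective hϖ ?_
  have h6 : (A.map S.ι * W) a b = (1 : Matrix n n K) a b := by rw [h]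
  rw [Matrix.mul_apply] at h6
  rw [Matrix.mul_apply, map_sum]
  simp only [map_mul, Matrix.of_apply, hW', Matrix.smul_apply, smul_eq_mul, map_pow]
  simp only [mul_left_comm _ (S.ι S.ϖ ^ N)]
  rw [← Finset.mul_sum]
  change S.ι S.ϖ ^ N * ∑ x, (A.map S.ι) a x * W x b = _
  rw [h6]
  simp [Matrix.one_apply, apply_ite S.ι]

end Integral

end SlopeSetting

/-! ### Limits and compactness over a complete discrete valuation ring -/

open Filter in
theorem AdicComplete.exists_limit_of_eventually {R : Type*} [CommRing R] {c : R}
    (H : AdicComplete c) (x : ℕ → R) (hx : ∀ N, ∃ n₀, ∀ n ≥ n₀, c ^ N ∣ x (n + 1) - x n) :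
    ∃ l, ∀ N, ∀ᶠ n in atTop, c ^ N ∣ l - x n := by
  choose m hm using hx
  -- Partial sums make the thresholds nondecreasing, so the extracted sequence is Cauchy at the
  -- prescribed speed.
  set M : ℕ → ℕ := fun k => ∑ j ∈ Finset.range (k + 1), m j with hM
  have hmM : ∀ k, m k ≤ M k := fun k =>
    Finset.single_le_sum (f := m) (fun _ _ => Nat.zero_le _) (Finset.self_mem_range_succ k)
  have hMs : ∀ k, M k ≤ M (k + 1) := fun k => by
    rw [hM]
    simp only
    rw [Finset.sum_range_succ _ (k + 1)]
    exact Nat.le_add_right _ _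
  have key : ∀ k n n', M k ≤ n → n ≤ n' → c ^ k ∣ x n' - x n := by
    intro k n n' hn hnn'
    induction n', hnn' using Nat.le_induction with
    | base => simp
    | succ n' hnn' ih =>
      have h1 := dvd_add (hm k n' ((hmM k).trans (hn.trans hnn'))) ih
      rwa [sub_add_sub_cancel] at h1
  obtain ⟨l, hl⟩ := H.exists_limit (fun k => x (M k)) fun k => key k _ _ le_rfl (hMs k)
  refine ⟨l, fun N => eventually_atTop.2 ⟨M N, fun n hn => ?_⟩⟩
  have h1 := dvd_sub (hl N) (key N _ n le_rfl hn)
  rwa [sub_sub_sub_cancel_right] at h1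

theorem isArtinian_quotient_pow {R : Type*} [CommRing R] [IsDomain R] [IsDiscreteValuationRing R]
    {ϖ : R} (hϖ : Irreducible ϖ) (g : ℕ) : IsArtinian R (R ⧸ Ideal.span {ϖ ^ g}) := by
  have h1 : IsLocalRing.maximalIdeal R ^ g = Ideal.span {ϖ ^ g} := by
    rw [hϖ.maximalIdeal_eq, Ideal.span_singleton_pow]
  have h2 := IsDiscreteValuationRing.length_quotient_pow_maximalIdeal R g
  rw [h1] at h2
  have h3 : IsFiniteLength R (R ⧸ Ideal.span {ϖ ^ g}) :=
    Module.length_ne_top_iff.1 (by rw [h2]; exact ENat.natCast_ne_top g)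
  exact (isFiniteLength_iff_isNoetherian_isArtinian.1 h3).2

/-- Elements of a decreasing chain of open submodules lift, modulo `ϖ`, to its intersection. -/
theorem exists_mem_forall_dvd_sub {R : Type*} [CommRing R] [IsDomain R] [IsDiscreteValuationRing R]
    {ϖ : R} (hϖ : Irreducible ϖ) (H : AdicComplete ϖ) {n : Type*} [Finite n]
    (L : ℕ → Submodule R (n → R)) (hanti : Antitone L)
    (hopen : ∀ M, ∃ t : ℕ, ∀ x : n → R, (∀ a, ϖ ^ t ∣ x a) → x ∈ L M) :
    ∃ M₀, ∀ x ∈ L M₀, ∃ y, (∀ M, y ∈ L M) ∧ ∀ a, ϖ ∣ x a - y a := by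
  -- Modulo `ϖ^g` the images of the `L M` decrease in an Artinian module, hence are constant from
  -- some `M₀` on: the Mittag-Leffler condition.
  have hstab : ∀ g : ℕ, ∃ M₀, ∀ x ∈ L M₀, ∀ M, ∃ y ∈ L M, ∀ a, ϖ ^ g ∣ x a - y a := by
    intro g
    have := isArtinian_quotient_pow hϖ g
    set q : (n → R) →ₗ[R] (n → R ⧸ Ideal.span {ϖ ^ g}) :=
      (Submodule.mkQ (Ideal.span {ϖ ^ g})).compLeft n with hq
    obtain ⟨M₀, hM₀⟩ := IsArtinian.monotone_stabilizes (R := R)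
      (M := n → R ⧸ Ideal.span {ϖ ^ g})
      ⟨fun M => OrderDual.toDual ((L M).map q), fun M M' h => Submodule.map_mono (hanti h)⟩
    refine ⟨M₀, fun x hx M => ?_⟩
    have h1 : (L M₀).map q = (L (max M₀ M)).map q := hM₀ _ (le_max_left _ _)
    have h2 : q x ∈ (L (max M₀ M)).map q := h1 ▸ Submodule.mem_map_of_mem hx
    obtain ⟨y, hy, hyx⟩ := h2
    refine ⟨y, hanti (le_max_right _ _) hy, fun a => ?_⟩
    have h3 : (Submodule.mkQ (Ideal.span {ϖ ^ g})) (y a) =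
        (Submodule.mkQ (Ideal.span {ϖ ^ g})) (x a) := congrFun hyx a
    rw [Submodule.mkQ_apply, Submodule.mkQ_apply] at h3
    exact Ideal.mem_span_singleton.1 ((Submodule.Quotient.eq _).1 h3.symm)
  choose M₀ hM₀ using hstab
  refine ⟨M₀ 1, fun x hx => ?_⟩
  have hstep : ∀ (g : ℕ) (x : n → R), x ∈ L (M₀ g) →
      ∃ y ∈ L (M₀ (g + 1)), ∀ a, ϖ ^ g ∣ x a - y a := fun g x hx => hM₀ g x hx _
  choose! next hnext hnext' using hstep
  -- Each `s g` is chosen in the stable range for `g + 1`, so that it can be corrected once more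
  -- modulo the next power of `ϖ`.
  let s : ℕ → n → R := fun g => Nat.rec x (fun j z => next (j + 1) z) g
  have hs : ∀ g, s g ∈ L (M₀ (g + 1)) := fun g => by
    induction g with
    | zero => exact hx
    | succ g ih => exact hnext (g + 1) (s g) ih
  have hs' : ∀ g a, ϖ ^ (g + 1) ∣ s (g + 1) a - s g a := fun g a =>
    dvd_sub_comm.1 (hnext' (g + 1) (s g) (hs g) a)
  choose y hy using fun a => H.exists_limit (fun g => s g a) fun g =>
    (pow_dvd_pow ϖ (Nat.le_succ g)).trans (hs' g a)
  refine ⟨y, fun M => ?_, fun a => ?_⟩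
  -- The limit agrees modulo `ϖ^t` with an element of `L M`, and `L M` contains every vector
  -- divisible by `ϖ^t`.
  · obtain ⟨t, ht⟩ := hopen M
    obtain ⟨z, hz, hzs⟩ := hM₀ (t + 1) (s t) (hs t) M
    have h1 : y = z + (y - z) := by abel
    rw [h1]
    refine add_mem hz (ht _ fun a => ?_)
    have h2 := dvd_add (hy a t) ((pow_dvd_pow ϖ (Nat.le_succ t)).trans (hzs a))
    rwa [sub_add_sub_cancel] at h2
  · have h1 : ϖ ∣ y a - s 1 a := by simpa using hy a 1
    have h2 : ϖ ∣ s 1 a - s 0 a := by simpa using hs' 0 a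
    have h3 := dvd_add h1 h2
    rw [sub_add_sub_cancel] at h3
    exact dvd_sub_comm.1 h3

/-- Smith normal form of a matrix with independent columns. -/
theorem exists_smith {R : Type*} [CommRing R] [IsDomain R] [IsPrincipalIdealRing R] {r n : Type*}
    [Fintype r] [DecidableEq r] [Fintype n] [DecidableEq n] (Θ : Matrix r n R)
    (hΘ : Function.Injective Θ.mulVec) :
    ∃ (d : ℕ) (V : Matrix n (Fin d) R) (V' : Matrix (Fin d) n R) (W : Matrix r (Fin d) R)
      (W' : Matrix (Fin d) r R) (a : Fin d → R), V * V' = 1 ∧ V' * V = 1 ∧ W' * W = 1 ∧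
      Θ * V = W * Matrix.diagonal a := by
  obtain ⟨d, N⟩ := Submodule.smithNormalForm (Pi.basisFun R r) (LinearMap.range Θ.mulVecLin)
  have hinj : Function.Injective Θ.mulVecLin := hΘ
  let v : Module.Basis (Fin d) R (n → R) := N.bN.map (LinearEquiv.ofInjective _ hinj).symm
  have hv : ∀ j, Θ.mulVec (v j) = N.a j • N.bM (N.f j) := fun j => by
    rw [← N.snf j]
    change ((LinearEquiv.ofInjective _ hinj (v j) : LinearMap.range Θ.mulVecLin) : r → R) = _
    simp [v]
  refine ⟨d, (Pi.basisFun R n).toMatrix v, v.toMatrix (Pi.basisFun R n),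
    (Pi.basisFun R r).toMatrix (N.bM ∘ N.f), (N.bM.toMatrix (Pi.basisFun R r)).submatrix N.f id,
    N.a, Module.Basis.toMatrix_mul_toMatrix_flip _ _, Module.Basis.toMatrix_mul_toMatrix_flip _ _,
    ?_, ?_⟩
  · have h1 : (Pi.basisFun R r).toMatrix (N.bM ∘ N.f) =
        ((Pi.basisFun R r).toMatrix N.bM).submatrix id N.f := rfl
    rw [h1, ← Matrix.submatrix_mul _ _ _ id _ Function.bijective_id,
      Module.Basis.toMatrix_mul_toMatrix_flip]
    exact Matrix.submatrix_one _ N.f.injective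
  · ext a b
    rw [Matrix.mul_diagonal]
    have h1 := congrFun (hv b) a
    simp only [Module.Basis.toMatrix_apply, Pi.basisFun_repr, Function.comp_apply]
    rw [Pi.smul_apply, smul_eq_mul, mul_comm] at h1
    rw [← h1, Matrix.mul_apply]
    simp [Matrix.mulVec, dotProduct, Module.Basis.toMatrix_apply]

/-! ### The fixed point of the graph transform -/

namespace SlopeSetting

variable {R K : Type*} [CommRing R] [Field K] {S : SlopeSetting R K} [IsDomain R]
  [IsDiscreteValuationRing R]

theorem mb_natCast_iff (hϖ : Irreducible S.ϖ) {m n : Type*} (N : ℕ) (A : Matrix m n R) :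
    S.MB N (A.map S.ι) ↔ ∀ i j, S.ϖ ^ N ∣ A i j :=
  forall_congr' fun _ => forall_congr' fun _ => ge_natCast_iff hϖ N _

open Filter in
/-- The invariant complement of the slow part, as the fixed point of a contraction. -/
theorem exists_fixed_matrix (hϖ : Irreducible S.ϖ) (H : AdicComplete S.ϖ) {n₁ n₂ : Type*}
    [Fintype n₁] [DecidableEq n₁] [Fintype n₂] [DecidableEq n₂] {A : Matrix n₁ n₁ R}
    {C : Matrix n₂ n₁ R} {D : Matrix n₂ n₂ R}
    (hstep : ∀ Z : Matrix n₂ n₁ R, ∃ Z' : Matrix n₂ n₁ R, Z' * A = C + D * Z.map S.σ) {α ρ : ℚ} (hρ : α < ρ)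
    {c₁ c₂ : ℕ} (hD : ∀ m : ℕ, S.MB (ρ * m - c₁) ((twist (S.σ : R →+* R) D m).map S.ι))
    (hA : ∀ m : ℕ, ∃ W : Matrix n₁ n₁ K,
      (twist (S.σ : R →+* R) A m).map S.ι * W = 1 ∧ S.MB (-α * m - c₂) W) :
    ∃ Z : Matrix n₂ n₁ R, Z * A = C + D * Z.map S.σ := by
  choose g hg using hstep
  set z : ℕ → Matrix n₂ n₁ R := fun m => g^[m] 0 with hz
  have hzs : ∀ m, z (m + 1) * A = C + D * (z m).map S.σ := fun m => by
    rw [hz]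
    simp only
    rw [Function.iterate_succ_apply', hg]
  have hmap : ∀ U V : Matrix n₂ n₁ R, (U - V).map S.σ = U.map S.σ - V.map S.σ := fun U V => by
    ext a b
    simp
  -- Differences of consecutive iterates satisfy the homogeneous equation, which telescopes into the
  -- iterates of `A` and `D`.
  have hδ : ∀ m, (z (m + 1) - z m) * twist (S.σ : R →+* R) A m =
      twist (S.σ : R →+* R) D m * (z 1 - z 0).map S.σ^[m] := by
    intro m
    induction m with
    | zero => simp [twist]
    | succ m ih =>
      have h1 : (z (m + 2) - z (m + 1)) * A = D * (z (m + 1) - z m).map S.σ := by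
        rw [Matrix.sub_mul, hzs, hzs, hmap, Matrix.mul_sub]
        abel
      have h2 : (z 1 - z 0).map S.σ^[m + 1] = ((z 1 - z 0).map S.σ^[m]).map S.σ :=
        map_iterate_succ (S.σ : R →+* R) _ m
      have h3 := congrArg (fun U => D * Matrix.map U (S.σ : R →+* R)) ih
      simp only [Matrix.map_mul] at h3
      rw [twist, twist, ← Matrix.mul_assoc, h1, h2, Matrix.mul_assoc D, Matrix.mul_assoc D]
      exact h3
  -- Inverting the iterate of `A` over `K`, the `m`-th difference has order at least `(ρ - α) m - c₁
  -- - c₂`.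
  have hdvd : ∀ N, ∃ n₀, ∀ m ≥ n₀, ∀ a b, S.ϖ ^ N ∣ (z (m + 1) - z m) a b := by
    intro N
    obtain ⟨n₀, hn₀⟩ := exists_nat_ge ((N + c₁ + c₂ : ℚ) / (ρ - α))
    rw [div_le_iff₀ (by linarith)] at hn₀
    refine ⟨n₀, fun m hm => ?_⟩
    rw [← mb_natCast_iff hϖ]
    obtain ⟨W, hW, hWm⟩ := hA m
    have h1 : (z (m + 1) - z m).map S.ι = (twist (S.σ : R →+* R) D m).map S.ι *
        ((z 1 - z 0).map S.σ^[m]).map S.ι * W := by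
      rw [← Matrix.map_mul, ← hδ, Matrix.map_mul, Matrix.mul_assoc, hW, Matrix.mul_one]
    rw [h1]
    refine (((hD m).mul (mb_ι _)).mul hWm).mono ?_
    have h2 : (n₀ : ℚ) * (ρ - α) ≤ m * (ρ - α) :=
      mul_le_mul_of_nonneg_right (by exact_mod_cast hm) (by linarith)
    linarith
  choose Z hZ using fun (a : n₂) (b : n₁) => H.exists_limit_of_eventually (fun m => z m a b)
    fun N => by
      obtain ⟨n₀, h⟩ := hdvd N
      exact ⟨n₀, fun m hm => h m hm a b⟩
  refine ⟨Matrix.of Z, ?_⟩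
  rw [← sub_eq_zero]
  ext a b
  refine H.separated _ fun N => ?_
  have h1 : ∀ᶠ m in atTop, ∀ a b, S.ϖ ^ N ∣ Z a b - z m a b :=
    eventually_all.2 fun a => eventually_all.2 fun b => hZ a b N
  obtain ⟨m, hm⟩ := eventually_atTop.1 h1
  have h2 : Matrix.of Z * A - (C + D * (Matrix.of Z).map S.σ) =
      (Matrix.of Z - z (m + 1)) * A - D * (Matrix.of Z - z m).map S.σ := by
    rw [Matrix.sub_mul, hzs, hmap, Matrix.mul_sub]
    abel
  rw [h2, Matrix.sub_apply, Matrix.mul_apply, Matrix.mul_apply]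
  refine dvd_sub (Finset.dvd_sum fun j _ => ?_) (Finset.dvd_sum fun j _ => ?_)
  · exact (hm (m + 1) (Nat.le_succ m) a j).mul_right _
  · refine Dvd.dvd.mul_left ?_ _
    have h3 := map_dvd S.σ (hm m le_rfl j b)
    rwa [map_pow, S.σ_ϖ] at h3

end SlopeSetting

/-! ### Integral vectors of the slow part -/

namespace SlopeSetting

variable {R K : Type*} [CommRing R] [Field K] {S : SlopeSetting R K}

theorem iterate_φ_ι (l : ℕ) (r : R) : S.φ^[l] (S.ι r) = S.ι (S.σ^[l] r) :=
  (Function.Semiconj.iterate_right (f := S.ι) (ga := S.σ) (gb := S.φ)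
    (fun r => (S.φ_ι r).symm) l r).symm

theorem iterate_σ_symm (l : ℕ) (r : R) : S.σ^[l] (S.σ.symm^[l] r) = r :=
  Function.LeftInverse.iterate S.σ.apply_symm_apply l r

theorem iterate_σ_ϖ_pow (l k : ℕ) : S.σ^[l] (S.ϖ ^ k) = S.ϖ ^ k :=
  Function.iterate_fixed (by rw [map_pow, S.σ_ϖ]) l

/-- The order of `a` is at most `T - 1`, so dividing by `a` wins one unit. This gain is what
`exists_slow_approx` iterates. -/
theorem Ge.of_not_dvd [IsDomain R] [IsDiscreteValuationRing R] (hϖ : Irreducible S.ϖ) {T : ℕ}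
    {a : R} (ha : ¬ S.ϖ ^ T ∣ a) {γ : ℚ} {x : K} (h : S.Ge (T + γ) (S.ι a * x)) :
    S.Ge (γ + 1) x := by
  have ha0 : a ≠ 0 := fun h0 => ha (h0 ▸ dvd_zero _)
  obtain ⟨k, u, hu⟩ := IsDiscreteValuationRing.eq_unit_mul_pow_irreducible ha0 hϖ
  have hk : k < T := by
    by_contra hk
    exact ha (hu ▸ (pow_dvd_pow _ (not_lt.1 hk)).mul_left _)
  unfold Ge at h ⊢
  rw [hu, AddValuation.map_mul, map_mul S.ι, AddValuation.map_mul, v_unit, zero_add, v_ϖ_pow] at h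
  rcases eq_or_ne (S.v x) ⊤ with hx | hx
  · rw [hx]
    exact le_top
  obtain ⟨y, hy⟩ := WithTop.ne_top_iff_exists.1 hx
  rw [← hy] at h ⊢
  have h1 : (T + γ) * S.w ≤ k * S.w + y := by exact_mod_cast h
  have h2 : (k + 1 : ℚ) * S.w ≤ T * S.w :=
    mul_le_mul_of_nonneg_right (by exact_mod_cast hk) S.w_pos.le
  have h3 : (γ + 1) * S.w ≤ y := by linarith
  exact_mod_cast h3

namespace Split

variable {n n₁ n₂ : Type*} [Fintype n] [DecidableEq n] [Fintype n₁] [DecidableEq n₁] [Fintype n₂]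
  [DecidableEq n₂] {X : Matrix n n R} {α β : ℚ} (T : S.Split X α β n₁ n₂)

/-- Approximations of the graph of the slow part over `K`. -/
def graph : ℕ → Matrix n₁ n₂ K
  | 0 => 0
  | m + 1 => (T.Z * (graph m * T.D - T.B)).map S.φ.symm

/-- Multiplication by `Z` loses at most `α`, while both `D` and `B` gain `β ≥ α`. -/
theorem mb_graph (hαβ : α ≤ β) (m : ℕ) : S.MB 0 (T.graph m) := by
  induction m with
  | zero => exact mb_zero 0
  | succ m ih =>
    have h1 : S.MB (-α + β) (T.Z * (T.graph m * T.D - T.B)) :=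
      T.mbZ.mul (((ih.mul T.mbD).mono (by simp)).sub T.mbB)
    intro i j
    rw [graph, Matrix.map_apply, ← ge_φ_iff, S.φ.apply_symm_apply]
    exact (h1 i j).mono (by linarith)

/-- Approximations of a basis of the slow part over `K`. -/
def slow (m : ℕ) : Matrix n n₂ K := T.P₁ * T.graph m + T.P₂

/-- The recursion defining `graph` is this equation solved for its `P₁`-component: `A Z (graph m D -
B) + B = graph m D`. -/
theorem map_mul_slow (m : ℕ) :
    X.map S.ι * (T.slow (m + 1)).map S.φ = T.slow m * T.D := by
  have h1 : (T.slow (m + 1)).map S.φ =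
      T.P₁.map S.φ * (T.Z * (T.graph m * T.D - T.B)) + T.P₂.map S.φ := by
    have h2 : (T.graph (m + 1)).map S.φ = T.Z * (T.graph m * T.D - T.B) := by
      ext i j
      rw [graph, Matrix.map_apply, Matrix.map_apply, S.φ.apply_symm_apply]
    rw [← h2]
    exact (Matrix.map_add S.φ (map_add S.φ) _ _).trans (congrArg (· + _) Matrix.map_mul)
  have h3 : T.A * T.Z = 1 := mul_eq_one_comm.1 T.ZA
  rw [h1, Matrix.mul_add, ← Matrix.mul_assoc, T.eq₁, T.eq₂, Matrix.mul_assoc,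
    ← Matrix.mul_assoc T.A, h3, Matrix.one_mul, slow, Matrix.add_mul, Matrix.mul_sub,
    Matrix.mul_assoc]
  abel

/-- The `l`-th iterate carries `slow (m + l)` into the span of `slow m` through the `l`-th iterate
of `D`, which gains `β l`. Working at finite levels avoids taking a limit in `K`. -/
theorem twist_mul_slow (l m : ℕ) :
    (twist (S.σ : R →+* R) X l).map S.ι * (T.slow (m + l)).map S.φ^[l] =
      T.slow m * twist (S.φ : K →+* K) T.D l := by
  rw [twist_map (s := (S.σ : R →+* R)) (t := (S.φ : K →+* K)) S.ι S.φ_ι]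
  induction l generalizing m with
  | zero => simp [twist]
  | succ l ih =>
    have h1 : (T.slow (m + (l + 1))).map S.φ^[l + 1] =
        ((T.slow (m + 1 + l)).map S.φ^[l]).map S.φ := by
      rw [show m + (l + 1) = m + 1 + l by ring]
      exact map_iterate_succ (S.φ : K →+* K) _ l
    have h2 := congrArg (fun U => Matrix.map U (S.φ : K →+* K)) (ih (m + 1))
    simp only [Matrix.map_mul] at h2
    rw [twist, twist, h1, Matrix.mul_assoc]
    refine (congrArg (X.map S.ι * ·) h2).trans ?_
    change X.map S.ι * ((T.slow (m + 1)).map S.φ * _) = _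
    rw [← Matrix.mul_assoc, map_mul_slow, Matrix.mul_assoc]

theorem Q₂_mul_slow (m : ℕ) : T.Q₂ * T.slow m = 1 := by
  rw [slow, Matrix.mul_add, ← Matrix.mul_assoc, T.Q₂P₁, Matrix.zero_mul, zero_add, T.Q₂P₂]

theorem exists_mb_slow (hαβ : α ≤ β) : ∃ c : ℕ, ∀ m, S.MB (-c) (T.slow m) := by
  obtain ⟨c₁, h₁⟩ := exists_mb (S := S) T.P₁
  obtain ⟨c₂, h₂⟩ := exists_mb (S := S) T.P₂
  refine ⟨c₁ + c₂, fun m => ?_⟩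
  have hc₁ : (0 : ℚ) ≤ c₁ := Nat.cast_nonneg _
  have hc₂ : (0 : ℚ) ≤ c₂ := Nat.cast_nonneg _
  push_cast
  exact ((h₁.mul (T.mb_graph hαβ m)).mono (by linarith)).add (h₂.mono (by linarith))

variable [IsDomain R] [IsDiscreteValuationRing R]

/-- Sufficiently many independent vectors satisfying finitely many of the growth conditions that
define the slow part. -/
theorem exists_slow_approx (T : S.Split X α β n₁ n₂) (hαβ : α ≤ β) (hϖ : Irreducible S.ϖ) {b : ℕ → ℕ}
    (hb : ∀ l, (b l : ℚ) ≤ β * l) : ∃ c : ℕ, ∀ M : ℕ, ∃ (U : Matrix n n₂ R) (U' : Matrix n₂ n R),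
      U' * U = 1 ∧ ∀ l ≤ M, ∀ a j,
        S.ϖ ^ b l ∣ S.ϖ ^ c * ((twist (S.σ : R →+* R) X l).map S.σ.symm^[l] * U) a j := by
  classical
  obtain ⟨cP, hcP⟩ := T.exists_mb_slow hαβ
  obtain ⟨cQ, hcQ⟩ := exists_mb (S := S) T.Q₂
  refine ⟨cP + cQ, fun M => ?_⟩
  -- Any common upper bound of the `b l` would do; it normalizes all the conditions to divisibility
  -- by the single power `ϖ^t`.
  set t := ∑ l ∈ Finset.range (M + 1), b l with ht
  have hbt : ∀ l ≤ M, b l ≤ t := fun l hl =>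
    Finset.single_le_sum (f := b) (fun _ _ => Nat.zero_le _) (Finset.mem_range.2 (by omega))
  -- Applying `σ^{-l}` turns the `σ^l`-linear condition of level `l` into a linear one; the levels
  -- are stacked in `Θ`.
  set N : ℕ → Matrix n n R := fun l => S.ϖ ^ (t - b l + (cP + cQ)) •
    (twist (S.σ : R →+* R) X l).map S.σ.symm^[l] with hN
  set Θ : Matrix (Fin (M + 1) × n) n R := Matrix.of fun la j => N la.1 la.2 j with hΘ
  have hϖ0 : ∀ k, S.ϖ ^ k ≠ 0 := fun k => pow_ne_zero k hϖ.ne_zero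
  -- The rows of level `0` form a nonzero scalar matrix.
  have hinj : Function.Injective Θ.mulVec := by
    intro x y hxy
    ext a
    have h1 := congrFun hxy (0, a)
    have h2 : ∀ x : n → R, Θ.mulVec x (0, a) = S.ϖ ^ (t - b 0 + (cP + cQ)) * x a := fun x => by
      simp [hΘ, hN, Matrix.mulVec, dotProduct, twist, Matrix.one_apply]
    rw [h2, h2] at h1
    exact mul_left_cancel₀ (hϖ0 _) h1
  obtain ⟨d, V, V', W, W', a, hVV', hV'V, hW'W, hΘV⟩ := exists_smith Θ hinj
  -- For a combination `u` of the columns of `slow M`, all of `Θ u` gains `t`. The exponent `cP +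
  -- cQ` pays for the denominators of `slow` and for recovering the coefficients `z = Q₂ u`.
  have hgrow : ∀ (z : Matrix n₂ Unit K) (γ : ℚ), S.MB γ (T.slow M * z) →
      S.MB (t + γ) (Θ.map S.ι * (T.slow M * z)) := by
    rintro z γ hγ ⟨⟨l, hl⟩, i⟩ j
    have hl' : l ≤ M := by omega
    have h1 : (Θ.map S.ι * (T.slow M * z)) (⟨l, hl⟩, i) j =
        ((N l).map S.ι * (T.slow M * z)) i j := rfl
    rw [h1, ← ge_iterate_φ_iff l]
    have h2 : ((N l).map S.ι * (T.slow M * z)).map S.φ^[l] =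
        S.ι (S.ϖ ^ (t - b l + (cP + cQ))) • (T.slow (M - l) * twist (S.φ : K →+* K) T.D l *
          z.map S.φ^[l]) := by
      have h3 : (((N l).map S.ι).map S.φ^[l]) = S.ι (S.ϖ ^ (t - b l + (cP + cQ))) •
          (twist (S.σ : R →+* R) X l).map S.ι := by
        ext i j
        rw [Matrix.map_apply, Matrix.map_apply, iterate_φ_ι, hN]
        simp only [Matrix.smul_apply, smul_eq_mul, Matrix.map_apply]
        rw [iterate_map_mul, iterate_σ_ϖ_pow, iterate_σ_symm, map_mul]
      have h4 : ((N l).map S.ι * (T.slow M * z)).map S.φ^[l] =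
          ((N l).map S.ι).map S.φ^[l] * ((T.slow M).map S.φ^[l] * z.map S.φ^[l]) :=
        (map_iterate_mul (S.φ : K →+* K) _ _ l).trans
          (congrArg _ (map_iterate_mul (S.φ : K →+* K) _ _ l))
      rw [h4, h3, Matrix.smul_mul, ← Matrix.mul_assoc]
      congr 2
      have h5 := T.twist_mul_slow l (M - l)
      rwa [Nat.sub_add_cancel hl'] at h5
    have h6 : z = T.Q₂ * (T.slow M * z) := by
      rw [← Matrix.mul_assoc, Q₂_mul_slow, Matrix.one_mul]
    have h7 : S.MB (-cQ + γ) z := by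
      rw [h6]
      exact hcQ.mul hγ
    have h8 := ((hcP (M - l)).mul (T.mbD.twist l)).mul ((mb_map_iterate_φ_iff l).2 h7)
    have h9 := congrFun (congrFun h2 i) j
    rw [Matrix.map_apply] at h9
    rw [h9, Matrix.smul_apply, smul_eq_mul, map_pow]
    refine ((ge_ϖ_pow _).mul (h8 i j)).mono ?_
    have h10 := hb l
    push_cast [Nat.cast_sub (hbt l hl')]
    linarith
  -- The columns of `V` with index in `J` satisfy all the conditions. If there were too few of them,
  -- a nonzero combination `u` of the columns of `slow M` would have no coordinate along them.
  set J := {i : Fin d // S.ϖ ^ t ∣ a i}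
  have hcard : Fintype.card n₂ ≤ Fintype.card J := by
    by_contra hlt
    set G : Matrix J n₂ K := (V'.map S.ι * T.slow M).submatrix Subtype.val id with hG
    have h1 : G.mulVecLin.ker ≠ ⊥ := LinearMap.ker_ne_bot_of_finrank_lt (by simpa using hlt)
    obtain ⟨z₀, hz₀, hz₀0⟩ := (Submodule.ne_bot_iff _).1 h1
    set z : Matrix n₂ Unit K := Matrix.replicateCol Unit z₀ with hz
    set u := T.slow M * z with hu
    have hGz : ∀ i : J, (V'.map S.ι * u) i () = 0 := fun i => by
      have h2 : G.mulVec z₀ = 0 := hz₀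
      rw [hu, ← Matrix.mul_assoc]
      exact congrFun h2 i
    have hVu : u = V.map S.ι * (V'.map S.ι * u) := by
      rw [← Matrix.mul_assoc, ← Matrix.map_mul, hVV', Matrix.map_one _ (map_zero _) (map_one _),
        Matrix.one_mul]
    have hau : W'.map S.ι * (Θ.map S.ι * u) = Matrix.diagonal (fun i => S.ι (a i)) *
        (V'.map S.ι * u) := by
      have h3 : W' * Θ = Matrix.diagonal a * V' := by
        calc W' * Θ = W' * (Θ * V) * V' := by
              rw [Matrix.mul_assoc, Matrix.mul_assoc, hVV', Matrix.mul_one]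
          _ = _ := by rw [hΘV, ← Matrix.mul_assoc, hW'W, Matrix.one_mul]
      have h4 : Matrix.diagonal (fun i => S.ι (a i)) = (Matrix.diagonal a).map S.ι :=
        (Matrix.diagonal_map (map_zero S.ι)).symm
      rw [← Matrix.mul_assoc, ← Matrix.map_mul, h3, Matrix.map_mul, Matrix.mul_assoc, h4]
    -- The remaining coordinates of `u` are multiplied in `Θ` by elements not divisible by `ϖ^t`, so
    -- the gain `t` improves the bound on `u` by one unit. Iterating, `u = 0`.
    have himp : ∀ γ, S.MB γ u → S.MB (γ + 1) u := by
      intro γ hγ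
      have h5 : S.MB (t + γ) (W'.map S.ι * (Θ.map S.ι * u)) := by
        have := (mb_ι (S := S) W').mul (hgrow z γ hγ)
        rwa [zero_add] at this
      rw [hVu]
      have h6 : S.MB (γ + 1) (V'.map S.ι * u) := by
        intro i j
        by_cases hi : S.ϖ ^ t ∣ a i
        · rw [hGz ⟨i, hi⟩]
          exact ge_zero _
        · refine Ge.of_not_dvd hϖ hi ?_
          have h7 := h5 i j
          rwa [hau, Matrix.diagonal_mul] at h7
      have := (mb_ι (S := S) V).mul h6
      rwa [zero_add] at this
    obtain ⟨c, hc⟩ := exists_mb (S := S) u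
    have hall : ∀ k : ℕ, S.MB (-c + k) u := fun k => by
      induction k with
      | zero => simpa using hc
      | succ k ih =>
        have := himp _ ih
        rwa [add_assoc, ← Nat.cast_succ] at this
    have hu0 : u = 0 := eq_zero_of_mb_unbounded (S := S) fun k => ⟨-c + (c + k : ℕ), by
      push_cast
      linarith, hall _⟩
    have hz0 : z = 0 := by
      have h8 : T.Q₂ * u = z := by rw [hu, ← Matrix.mul_assoc, Q₂_mul_slow, Matrix.one_mul]
      rw [← h8, hu0, Matrix.mul_zero]
    refine hz₀0 (funext fun i => congrFun (congrFun hz0 i) ())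
  obtain ⟨f⟩ := Function.Embedding.nonempty_of_card_le hcard
  refine ⟨V.submatrix id fun j => (f j).1, V'.submatrix (fun j => (f j).1) id, ?_, ?_⟩
  · rw [← Matrix.submatrix_mul _ _ _ id _ Function.bijective_id, hV'V]
    exact Matrix.submatrix_one _ (Subtype.val_injective.comp f.injective)
  · intro l hl i j
    have h1 : (Θ * V) (⟨l, by omega⟩, i) (f j).1 = (W * Matrix.diagonal a) (⟨l, by omega⟩, i)
      (f j).1 := by rw [hΘV]
    rw [Matrix.mul_diagonal] at h1
    have h2 : S.ϖ ^ t ∣ (Θ * V) (⟨l, by omega⟩, i) (f j).1 := h1 ▸ (f j).2.mul_left _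
    have h3 : (Θ * V) (⟨l, by omega⟩, i) (f j).1 = S.ϖ ^ (t - b l) * (S.ϖ ^ (cP + cQ) *
        ((twist (S.σ : R →+* R) X l).map S.σ.symm^[l] * V.submatrix id fun j => (f j).1) i j) := by
      have h4 : (Θ * V) (⟨l, by omega⟩, i) (f j).1 = (N l * V) i (f j).1 := rfl
      rw [h4, hN]
      simp only
      rw [Matrix.smul_mul, Matrix.smul_apply, smul_eq_mul, pow_add, mul_assoc]
      rfl
    rw [h3] at h2
    refine (mul_dvd_mul_iff_left (hϖ0 (t - b l))).1 ?_
    rwa [← pow_add, Nat.sub_add_cancel (hbt l hl)]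

/-- There are sufficiently many independent vectors in the slow part. -/
theorem exists_slow_vectors (T : S.Split X α β n₁ n₂) (hαβ : α ≤ β) (hϖ : Irreducible S.ϖ) (H : AdicComplete S.ϖ)
    {b : ℕ → ℕ} (hb : ∀ l, (b l : ℚ) ≤ β * l) :
    ∃ (c : ℕ) (U : Matrix n n₂ R), (∀ z : n₂ → R, U.mulVec z = 0 → z = 0) ∧ ∀ l a j,
      S.ϖ ^ b l ∣ S.ϖ ^ c * (twist (S.σ : R →+* R) X l * U.map S.σ^[l]) a j := by
  obtain ⟨c, hc⟩ := T.exists_slow_approx hαβ hϖ hb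
  let N : ℕ → Matrix n n R := fun l => (twist (S.σ : R →+* R) X l).map S.σ.symm^[l]
  let L : ℕ → Submodule R (n → R) := fun M =>
    { carrier := {x | ∀ l ≤ M, ∀ a, S.ϖ ^ b l ∣ S.ϖ ^ c * (N l).mulVec x a}
      add_mem' := fun {x y} hx hy l hl a => by
        rw [Matrix.mulVec_add, Pi.add_apply, mul_add]
        exact dvd_add (hx l hl a) (hy l hl a)
      zero_mem' := fun l hl a => by simp
      smul_mem' := fun r x hx l hl a => by
        rw [Matrix.mulVec_smul, Pi.smul_apply, smul_eq_mul, mul_left_comm]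
        exact (hx l hl a).mul_left r }
  have hanti : Antitone L := fun M M' h x hx l hl a => hx l (hl.trans h) a
  have hopen : ∀ M, ∃ t : ℕ, ∀ x : n → R, (∀ a, S.ϖ ^ t ∣ x a) → x ∈ L M := fun M => by
    refine ⟨∑ l ∈ Finset.range (M + 1), b l, fun x hx l hl a => Dvd.dvd.mul_left ?_ _⟩
    refine Finset.dvd_sum fun j _ => Dvd.dvd.mul_left ((pow_dvd_pow _ ?_).trans (hx j)) _
    exact Finset.single_le_sum (f := b) (fun _ _ => Nat.zero_le _) (Finset.mem_range.2 (by omega))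
  obtain ⟨M₀, hM₀⟩ := exists_mem_forall_dvd_sub hϖ H L hanti hopen
  obtain ⟨U, U', hU'U, hU⟩ := hc M₀
  choose y hyL hy using fun j : n₂ => hM₀ (fun i => U i j) fun l hl a => hU l hl a j
  refine ⟨c, Matrix.of fun i j => y j i, fun z hz => ?_, fun l a j => ?_⟩
  -- The limit vectors are congruent to `U` modulo `ϖ`, so their product with `U'` reduces to the
  -- identity and has nonzero determinant.
  · have h1 : (U' * Matrix.of fun i j => y j i).map (IsLocalRing.residue R) = 1 := by
      have h2 : (Matrix.of fun i j => y j i).map (IsLocalRing.residue R) =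
          U.map (IsLocalRing.residue R) := by
        ext i j
        rw [Matrix.map_apply, Matrix.map_apply, ← sub_eq_zero, ← map_sub,
          IsLocalRing.residue_eq_zero_iff, hϖ.maximalIdeal_eq, Ideal.mem_span_singleton]
        exact dvd_sub_comm.1 (hy j i)
      rw [Matrix.map_mul, h2, ← Matrix.map_mul, hU'U]
      exact Matrix.map_one _ (map_zero _) (map_one _)
    refine Matrix.eq_zero_of_mulVec_eq_zero (M := U' * Matrix.of fun i j => y j i) ?_ ?_
    · intro h0
      have h3 := congrArg Matrix.det h1
      rw [Matrix.det_one] at h3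
      have h4 := RingHom.map_det (IsLocalRing.residue R) (U' * Matrix.of fun i j => y j i)
      rw [h0, map_zero] at h4
      exact zero_ne_one (h4.trans h3)
    · rw [← Matrix.mulVec_mulVec, hz, Matrix.mulVec_zero]
  · have h1 := hyL j l l le_rfl a
    have h2 : S.σ^[l] ((N l).mulVec (y j) a) =
        (twist (S.σ : R →+* R) X l * (Matrix.of fun i j => y j i).map S.σ^[l]) a j := by
      have h3 : (N l * Matrix.of fun i j => y j i).map S.σ^[l] =
          (N l).map S.σ^[l] * (Matrix.of fun i j => y j i).map S.σ^[l] :=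
        map_iterate_mul (S.σ : R →+* R) _ _ l
      have h4 : (N l).map S.σ^[l] = twist (S.σ : R →+* R) X l := by
        ext i j
        exact iterate_σ_symm l _
      rw [← h4, ← h3]
      rfl
    obtain ⟨r, hr⟩ := h1
    refine ⟨S.σ^[l] r, ?_⟩
    rw [← h2, ← iterate_σ_ϖ_pow l c, ← iterate_map_mul, hr, iterate_map_mul, iterate_σ_ϖ_pow]

end Split
end SlopeSetting

/-! ### Elementary divisors over a discrete valuation ring -/

/-- Sorted increasingly, the image of `g` has its `m`-th element at least `m`, and `s` is monotone.
-/
theorem sum_castLE_le {h i : ℕ} (hi : i ≤ h) {s : Fin h → ℕ} (hs : Monotone s) {g : Fin i → Fin h}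
    (hg : Function.Injective g) : ∑ j, s (Fin.castLE hi j) ≤ ∑ j, s (g j) := by
  classical
  set T : Finset (Fin h) := Finset.univ.map ⟨g, hg⟩ with hT
  have hc : T.card = i := by simp [hT]
  have h1 : ∑ j, s (g j) = ∑ x ∈ T, s x := by
    rw [hT, Finset.sum_map]
    rfl
  have h2 : ∑ x ∈ T, s x = ∑ j, s (T.orderEmbOfFin hc j) := by
    conv_lhs => rw [← Finset.map_orderEmbOfFin_univ T hc, Finset.sum_map]
    rfl
  rw [h1, h2]
  refine Finset.sum_le_sum fun j _ => hs ?_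
  have h3 : ∀ (m : ℕ) (hm : m < i), m ≤ (T.orderEmbOfFin hc ⟨m, hm⟩ : ℕ) := by
    intro m
    induction m with
    | zero => intro _; exact Nat.zero_le _
    | succ m ih =>
      intro hm
      have h4 := ih (by omega)
      have h5 : T.orderEmbOfFin hc ⟨m, by omega⟩ < T.orderEmbOfFin hc ⟨m + 1, hm⟩ :=
        (T.orderEmbOfFin hc).strictMono (Nat.lt_succ_self m)
      have h6 : (T.orderEmbOfFin hc ⟨m, by omega⟩ : ℕ) < T.orderEmbOfFin hc ⟨m + 1, hm⟩ := h5
      omega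
  exact h3 j j.2

theorem lt_iff_le_card {h : ℕ} {s : Fin h → ℕ} (hs : Monotone s) (n : ℕ) (i : Fin h) :
    n < s i ↔ h - i ≤ (Finset.univ.filter fun j => n < s j).card := by
  constructor
  · intro hi
    rw [← Fin.card_Ici]
    exact Finset.card_le_card fun j hj =>
      Finset.mem_filter.2 ⟨Finset.mem_univ _, hi.trans_le (hs (Finset.mem_Ici.1 hj))⟩
  · intro hc
    by_contra hi
    have h1 : (Finset.univ.filter fun j => n < s j).card ≤ (Finset.Ioi i).card :=
      Finset.card_le_card fun j hj => by
        rw [Finset.mem_Ioi]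
        by_contra hji
        have := hs (not_lt.1 hji)
        have := (Finset.mem_filter.1 hj).2
        omega
    rw [Fin.card_Ioi] at h1
    have := i.2
    omega

/-- Differences in `n` of these sums count the entries larger than `n`, and these counts determine a
sorted sequence. -/
theorem eq_of_sum_min {h : ℕ} {s t : Fin h → ℕ} (hs : Monotone s) (ht : Monotone t)
    (H : ∀ n, ∑ i, min n (s i) = ∑ i, min n (t i)) : s = t := by
  have key : ∀ (s : Fin h → ℕ) n, ∑ i, min (n + 1) (s i) =
      ∑ i, min n (s i) + (Finset.univ.filter fun j => n < s j).card := fun s n => by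
    rw [Finset.card_filter, ← Finset.sum_add_distrib]
    refine Finset.sum_congr rfl fun i _ => ?_
    split_ifs <;> omega
  have hc : ∀ n, (Finset.univ.filter fun j => n < s j).card =
      (Finset.univ.filter fun j => n < t j).card := fun n => by
    have h1 := key s n
    have h2 := key t n
    have h3 := H n
    have h4 := H (n + 1)
    omega
  funext i
  refine eq_of_forall_lt_iff fun n => ?_
  rw [lt_iff_le_card hs, lt_iff_le_card ht, hc]

/-- If a sorted sequence is split in two sorted parts, and the sum of the first part is the smallest
possible, then the parts are the initial and the final segments. -/
theorem eq_first_last {h i : ℕ} (hi : i ≤ h) {s : Fin h → ℕ} (hs : Monotone s) {c : Fin i → ℕ}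
    (hc : Monotone c) {c' : Fin (h - i) → ℕ} (hc' : Monotone c')
    (g : Fin i ⊕ Fin (h - i) ≃ Fin h) (hg : ∀ j, s (g j) = Sum.elim c c' j)
    (hsum : ∑ j, c j = ∑ j, s (Fin.castLE hi j)) :
    (∀ j, c j = s (Fin.castLE hi j)) ∧ ∀ j : Fin (h - i), c' j = s ⟨i + j, by omega⟩ := by
  have hinj : Function.Injective fun j => g (Sum.inl j) := g.injective.comp Sum.inl_injective
  -- An entry is its truncation at `n` plus its excess over `n`. The initial segment minimizes the
  -- sums of both; as the total sums agree, so do the truncated sums, for every `n`.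
  have hmin : ∀ n, ∑ j, min n (c j) = ∑ j, min n (s (Fin.castLE hi j)) := by
    intro n
    have h1 : ∑ j, min n (s (Fin.castLE hi j)) ≤ ∑ j, min n (s (g (Sum.inl j))) :=
      sum_castLE_le hi (s := fun j => min n (s j))
        (fun a b hab => min_le_min le_rfl (hs hab)) hinj
    have h2 : ∑ j, (s (Fin.castLE hi j) - n) ≤ ∑ j, (s (g (Sum.inl j)) - n) :=
      sum_castLE_le hi (s := fun j => s j - n) (fun a b hab => Nat.sub_le_sub_right (hs hab) n) hinj
    have h3 : ∀ u : Fin i → ℕ, ∑ j, u j = ∑ j, min n (u j) + ∑ j, (u j - n) := fun u => by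
      rw [← Finset.sum_add_distrib]
      exact Finset.sum_congr rfl fun j _ => by omega
    simp only [hg, Sum.elim_inl] at h1 h2
    have h4 := h3 c
    have h5 := h3 fun j => s (Fin.castLE hi j)
    omega
  have hall : ∀ u : Fin h → ℕ, ∑ j, u j = ∑ j, u (Fin.castLE hi j) +
      ∑ j : Fin (h - i), u ⟨i + j, by omega⟩ := fun u => by
    rw [← (SlopeSetting.splitEquiv hi).sum_comp, Fintype.sum_sum_type]
    rfl
  have h1 : c = fun j => s (Fin.castLE hi j) := eq_of_sum_min hc (fun a b hab => hs hab) hmin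
  have h2 : c' = fun j : Fin (h - i) => s ⟨i + j, by omega⟩ := by
    refine eq_of_sum_min hc' (fun a b hab => hs (Nat.add_le_add_left (Fin.le_def.1 hab) i))
      fun n => ?_
    have h3 := hall fun j => min n (s j)
    rw [← g.sum_comp, Fintype.sum_sum_type] at h3
    simp only [hg, Sum.elim_inl, Sum.elim_inr] at h3
    have h4 := hmin n
    omega
  exact ⟨fun j => congrFun h1 j, fun j => congrFun h2 j⟩

section ElementaryDivisors

variable {R : Type*} [CommRing R] [IsDomain R] [IsDiscreteValuationRing R] {ϖ : R}

theorem length_quotient_span_pow (hϖ : Irreducible ϖ) (g : ℕ) :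
    Module.length R (R ⧸ Ideal.span {ϖ ^ g}) = g := by
  rw [← IsDiscreteValuationRing.length_quotient_pow_maximalIdeal R g, hϖ.maximalIdeal_eq,
    Ideal.span_singleton_pow]

/-- Tensoring with `R/(ϖ^a)` when `b ≤ a` does not change `R/(ϖ^b)`. -/
theorem length_quotient_tensor (hϖ : Irreducible ϖ) (a b : ℕ) :
    Module.length R ((R ⧸ Ideal.span {ϖ ^ a}) ⊗[R] (R ⧸ Ideal.span {ϖ ^ b})) =
      (min a b : ℕ) := by
  wlog hab : b ≤ a generalizing a b
  · rw [(TensorProduct.comm R _ _).length_eq, this b a (by omega), min_comm]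
  rw [min_eq_right hab, ← length_quotient_span_pow hϖ b]
  refine LinearEquiv.length_eq ((TensorProduct.quotTensorEquivQuotSMul _ _).trans
    (Submodule.quotEquivOfEqBot _ ?_))
  rw [eq_bot_iff, Submodule.smul_le]
  intro r hr x _
  obtain ⟨y, rfl⟩ := Ideal.Quotient.mk_surjective x
  have h1 : r • Ideal.Quotient.mk (Ideal.span {ϖ ^ b}) y = Ideal.Quotient.mk _ (r * y) := rfl
  rw [Submodule.mem_bot, h1, Ideal.Quotient.eq_zero_iff_mem, Ideal.mem_span_singleton]
  exact ((pow_dvd_pow ϖ hab).trans (Ideal.mem_span_singleton.1 hr)).mul_right _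

/-- Uniqueness of elementary divisors. -/
theorem elementary_divisors_unique (hϖ : Irreducible ϖ) {h : ℕ} {s t : Fin h → ℕ} (hs : Monotone s)
    (ht : Monotone t) (e : ((i : Fin h) → R ⧸ Ideal.span {ϖ ^ s i}) ≃ₗ[R]
      ((i : Fin h) → R ⧸ Ideal.span {ϖ ^ t i})) : s = t := by
  -- The lengths after tensoring with `R/(ϖ^n)` are isomorphism invariants that determine the sorted
  -- exponents.
  have key : ∀ (s : Fin h → ℕ) (n : ℕ), Module.length R ((R ⧸ Ideal.span {ϖ ^ n}) ⊗[R]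
      ((i : Fin h) → R ⧸ Ideal.span {ϖ ^ s i})) = ((∑ i, min n (s i) : ℕ) : ℕ∞) := fun s n => by
    rw [(TensorProduct.piRight R R (R ⧸ Ideal.span {ϖ ^ n})
      fun i => R ⧸ Ideal.span {ϖ ^ s i}).length_eq, Module.length_pi_of_fintype, Nat.cast_sum]
    exact Finset.sum_congr rfl fun i _ => length_quotient_tensor hϖ n (s i)
  refine eq_of_sum_min hs ht fun n => ?_
  have h1 := (LinearEquiv.lTensor (R ⧸ Ideal.span {ϖ ^ n}) e).length_eq
  rw [key, key] at h1
  exact_mod_cast h1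

variable {M : Type*} [AddCommGroup M] [Module R M]

/-- The quotient by a submodule defined by divisibility of coordinates. -/
theorem nonempty_quotient_equiv {h : ℕ} {I : Submodule R M} (v : Module.Basis (Fin h) R M)
    {s : Fin h → ℕ} (hv : ∀ x, x ∈ I ↔ ∀ i, ϖ ^ s i ∣ v.repr x i) :
    Nonempty ((M ⧸ I) ≃ₗ[R] ((i : Fin h) → R ⧸ Ideal.span {ϖ ^ s i})) := by
  let q : M →ₗ[R] ((i : Fin h) → R ⧸ Ideal.span {ϖ ^ s i}) :=
    LinearMap.pi fun i => (Submodule.mkQ (Ideal.span {ϖ ^ s i})).comp (v.coord i)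
  have hker : LinearMap.ker q = I := by
    ext x
    rw [LinearMap.mem_ker, hv, funext_iff]
    refine forall_congr' fun i => ?_
    rw [← Ideal.mem_span_singleton, ← Submodule.Quotient.mk_eq_zero]
    rfl
  have hsurj : Function.Surjective q := by
    intro y
    choose z hz using fun i => Submodule.mkQ_surjective (Ideal.span {ϖ ^ s i}) (y i)
    refine ⟨v.equivFun.symm z, funext fun i => ?_⟩
    rw [← hz i]
    change (Submodule.mkQ (Ideal.span {ϖ ^ s i})) (v.repr (v.equivFun.symm z) i) = _
    rw [← v.equivFun_apply, LinearEquiv.apply_symm_apply]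
  exact ⟨(Submodule.quotEquivOfEq _ _ hker.symm).trans (q.quotKerEquivOfSurjective hsurj)⟩

/-- Elementary divisors of a submodule of finite colength. -/
theorem exists_elementary_divisors (hϖ : Irreducible ϖ) {h : ℕ} (b : Module.Basis (Fin h) R M)
    {I : Submodule R M} {N : ℕ} (hN : ∀ x, ϖ ^ N • x ∈ I) :
    ∃ (s : Fin h → ℕ) (v : Module.Basis (Fin h) R M), Monotone s ∧
      ∀ x, x ∈ I ↔ ∀ i, ϖ ^ s i ∣ v.repr x i := by
  have := Module.Finite.of_basis b
  have := Module.Free.of_basis b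
  have hrank : Module.finrank R I = Module.finrank R M := by
    have h1 := Submodule.finrank_quotient_add_finrank I
    have h2 : Module.finrank R (M ⧸ I) = 0 := by
      rw [Module.finrank_eq_zero_iff_isTorsion]
      rintro ⟨x⟩
      refine ⟨⟨ϖ ^ N, mem_nonZeroDivisors_of_ne_zero (pow_ne_zero _ hϖ.ne_zero)⟩, ?_⟩
      exact (Submodule.Quotient.mk_eq_zero I).2 (hN x)
    omega
  obtain ⟨v, a, av, hav⟩ := Submodule.exists_smith_normal_form_of_rank_eq b hrank
  have ha : ∀ i, a i ≠ 0 := fun i h0 => av.ne_zero i (Subtype.ext (by rw [hav, h0, zero_smul]; rfl))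
  choose n u hn using fun i => IsDiscreteValuationRing.eq_unit_mul_pow_irreducible (ha i) hϖ
  have hmem : ∀ x, x ∈ I ↔ ∀ i, ϖ ^ n i ∣ v.repr x i := by
    intro x
    have hassoc : ∀ i, Associated (a i) (ϖ ^ n i) := fun i =>
      (hn i ▸ associated_unit_mul_left _ _ (u i).isUnit)
    simp only [← (hassoc _).dvd_iff_dvd_left]
    constructor
    · intro hx i
      have h1 : x = ∑ j, av.repr ⟨x, hx⟩ j • (a j • v j) := by
        conv_lhs => rw [show x = ((⟨x, hx⟩ : I) : M) from rfl, ← av.sum_repr ⟨x, hx⟩]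
        rw [Submodule.coe_sum]
        exact Finset.sum_congr rfl fun j _ => by rw [Submodule.coe_smul, hav]
      rw [h1, map_sum, Finsupp.finsetSum_apply]
      refine Finset.dvd_sum fun j _ => ?_
      rw [smul_smul, map_smul, v.repr_self, Finsupp.smul_apply, Finsupp.single_apply, smul_eq_mul]
      split_ifs with hji
      · rw [hji, mul_one]
        exact dvd_mul_left _ _
      · rw [mul_zero]
        exact dvd_zero _
    · intro hx
      rw [← v.sum_repr x]
      refine Submodule.sum_mem _ fun j _ => ?_
      obtain ⟨c, hc⟩ := hx j
      rw [hc, mul_comm, mul_smul, ← hav]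
      exact I.smul_mem _ (av j).2
  refine ⟨n ∘ Tuple.sort n, v.reindex (Tuple.sort n).symm, Tuple.monotone_sort n, fun x => ?_⟩
  rw [hmem, ← (Tuple.sort n).forall_congr_right]
  simp

/-- The minors of order `i` of vectors in a submodule with known elementary divisors. -/
theorem pow_sum_dvd_det {h i : ℕ} (hi : i ≤ h) {I : Submodule R M} {s : Fin h → ℕ}
    {v : Module.Basis (Fin h) R M} (hs : Monotone s)
    (hv : ∀ x, x ∈ I ↔ ∀ i, ϖ ^ s i ∣ v.repr x i) {x : Fin i → M} (hx : ∀ b, x b ∈ I)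
    (ℓ : Fin i → M →ₗ[R] R) :
    ϖ ^ ∑ j, s (Fin.castLE hi j) ∣ (Matrix.of fun a b => ℓ a (x b)).det := by
  choose t ht using fun b => (hv (x b)).1 (hx b)
  rw [← Matrix.det_transpose]
  have h1 : (Matrix.of fun a b => ℓ a (x b)).transpose =
      fun b => ∑ j, (ϖ ^ s j * t b j) • fun a => ℓ a (v j) := by
    funext b a
    simp only [Matrix.transpose_apply, Matrix.of_apply, Finset.sum_apply, Pi.smul_apply,
      smul_eq_mul]
    conv_lhs => rw [← v.sum_repr (x b)]
    rw [map_sum]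
    exact Finset.sum_congr rfl fun j _ => by rw [map_smul, smul_eq_mul, ht]
  have h2 : Matrix.det (fun b => ∑ j, (ϖ ^ s j * t b j) • fun a => ℓ a (v j)) =
      ∑ r : Fin i → Fin h, Matrix.det fun b => (ϖ ^ s (r b) * t b (r b)) • fun a => ℓ a (v (r b)) :=
    MultilinearMap.map_sum (Matrix.detRowAlternating (n := Fin i) (R := R)).toMultilinearMap
      (fun (b : Fin i) (j : Fin h) => (ϖ ^ s j * t b j) • fun a => ℓ a (v j))
  rw [h1, h2]
  refine Finset.dvd_sum fun r _ => ?_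
  have h3 : (Matrix.det fun b => (ϖ ^ s (r b) * t b (r b)) • fun a => ℓ a (v (r b))) =
      (∏ b, (ϖ ^ s (r b) * t b (r b))) * Matrix.det fun b a => ℓ a (v (r b)) :=
    MultilinearMap.map_smul_univ
      (Matrix.detRowAlternating (n := Fin i) (R := R)).toMultilinearMap _ _
  rw [h3]
  -- In the multilinear expansion, choices with a repeated index have two equal rows; an injective
  -- choice involves `i` distinct exponents, whose sum is at least that of the `i` smallest.
  by_cases hr : Function.Injective r
  · refine Dvd.dvd.mul_right ?_ _
    rw [Finset.prod_mul_distrib, Finset.prod_pow_eq_pow_sum]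
    exact (pow_dvd_pow ϖ (sum_castLE_le hi hs hr)).mul_right _
  · rw [Function.Injective] at hr
    push Not at hr
    obtain ⟨b, b', hbb', hne⟩ := hr
    have h4 : (Matrix.det fun b a => ℓ a (v (r b)) : R) = 0 :=
      Matrix.det_zero_of_row_eq hne (funext fun a => by rw [hbb'])
    exact (congrArg (_ * ·) h4).trans (mul_zero _) ▸ dvd_zero _

end ElementaryDivisors

/-- Cramer's rule: the entries of `C A⁻¹` are the quotients by `det A` of the minors in which a row
of `A` is replaced by a row of `C`. -/
theorem exists_mul_eq_of_dvd_minors {R : Type*} [CommRing R] [IsDomain R] {n₁ n₂ : Type*}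
    [Fintype n₁] [DecidableEq n₁] {A : Matrix n₁ n₁ R} {C : Matrix n₂ n₁ R} (hA : A.det ≠ 0)
    (h : ∀ a b, A.det ∣ (A.updateRow b (C a)).det) :
    ∃ Z : Matrix n₂ n₁ R, Z * A = C := by
  choose Z hZ using h
  refine ⟨Matrix.of Z, ?_⟩
  have h1 : ∀ a b, (C * A.adjugate) a b = A.det * Z a b := fun a b => by
    rw [← hZ, ← Matrix.cramer_transpose_apply, Matrix.cramer_eq_adjugate_mulVec,
      ← Matrix.adjugate_transpose, Matrix.mulVec_transpose]
    rfl
  ext a b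
  refine mul_left_cancel₀ hA ?_
  have h2 : (C * A.adjugate * A) a b = A.det * C a b := by
    rw [Matrix.mul_assoc, Matrix.adjugate_mul, Matrix.mul_smul, Matrix.mul_one, Matrix.smul_apply,
      smul_eq_mul]
  rw [← h2, Matrix.mul_apply, Matrix.mul_apply, Finset.mul_sum]
  exact Finset.sum_congr rfl fun j _ => by rw [h1, Matrix.of_apply, mul_assoc]

/-! ### Adjoining a root of a uniformizer -/

section RootExtension

open Polynomial

variable {R K : Type*} [CommRing R] [Field K] [IsDomain R] {j : R →+* K} {root : K} {m : ℕ} {ϖ : R}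

/-- The root is annihilated by `X^m - ϖ`, so `x` is a polynomial of degree less than `m` in the root
over the fraction field; then denominators are cleared. Uniqueness of the expression is not needed.
-/
theorem exists_eq_sum_root_pow (hj : Function.Injective j) (hm : 0 < m) (hroot : root ^ m = j ϖ)
    (htop : Subfield.closure (insert root (Set.range j)) = ⊤) (x : K) :
    ∃ d : R, d ≠ 0 ∧ ∃ c : ℕ → R, j d * x = ∑ a ∈ Finset.range m, j (c a) * root ^ a := by
  let K₀ := FractionRing R
  let g : K₀ →+* K := IsFractionRing.lift hj
  let _ : Algebra K₀ K := g.toAlgebra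
  have hg : ∀ r, algebraMap K₀ K (algebraMap R K₀ r) = j r := fun r =>
    IsFractionRing.lift_algebraMap hj r
  set q : K₀[X] := X ^ m - C (algebraMap R K₀ ϖ) with hq
  have hmonic : q.Monic := monic_X_pow_sub_C _ hm.ne'
  have hq0 : aeval root q = 0 := by
    rw [hq, map_sub, map_pow, aeval_X, aeval_C, hg, hroot, sub_self]
  have hint : IsIntegral K₀ root := ⟨q, hmonic, hq0⟩
  have hmem : x ∈ Algebra.adjoin K₀ {root} := by
    rw [← IntermediateField.adjoin_simple_toSubalgebra_of_isAlgebraic hint.isAlgebraic]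
    change x ∈ (IntermediateField.adjoin K₀ {root}).toSubfield
    have h1 : Subfield.closure (insert root (Set.range j)) ≤
        (IntermediateField.adjoin K₀ {root}).toSubfield := by
      rw [Subfield.closure_le, Set.insert_subset_iff]
      refine ⟨IntermediateField.mem_adjoin_simple_self K₀ root, ?_⟩
      rintro _ ⟨r, rfl⟩
      rw [← hg]
      exact (IntermediateField.adjoin K₀ {root}).algebraMap_mem _
    exact h1 (htop ▸ Subfield.mem_top x)
  rw [Algebra.adjoin_singleton_eq_range_aeval] at hmem
  obtain ⟨f, hf⟩ := hmem
  set r := f %ₘ q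
  have hr : aeval root r = x := (aeval_modByMonic_eq_self_of_root hq0).trans hf
  have hdeg : r.natDegree < m := by
    have h1 : q.natDegree = m := natDegree_X_pow_sub_C
    rw [← h1]
    refine natDegree_modByMonic_lt f hmonic fun h2 => ?_
    rw [h2, natDegree_one] at h1
    omega
  obtain ⟨d, hd⟩ := IsLocalization.exist_integer_multiples_of_finite (nonZeroDivisors R)
    fun a : Fin m => r.coeff a
  choose c hc using hd
  refine ⟨d, nonZeroDivisors.ne_zero d.2, fun a => if ha : a < m then c ⟨a, ha⟩ else 0, ?_⟩
  rw [← hr, aeval_eq_sum_range' hdeg, Finset.mul_sum]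
  refine Finset.sum_congr rfl fun a ha => ?_
  have ha' := Finset.mem_range.1 ha
  have h1 : algebraMap R K₀ (c ⟨a, ha'⟩) = algebraMap R K₀ d * r.coeff a := by
    rw [hc ⟨a, ha'⟩, ← Algebra.smul_def]
  simp only
  rw [dif_pos ha', ← hg (c _), h1, map_mul, hg, Algebra.smul_def, mul_assoc]

/-- A sum of elements of pairwise distinct valuations has the smallest of these valuations. -/
theorem exists_map_sum_eq {ι : Type*} (v : AddValuation K (WithTop ℚ)) (s : Finset ι) (t : ι → K)
    (hdist : ∀ a ∈ s, ∀ b ∈ s, v (t a) = v (t b) → v (t a) ≠ ⊤ → a = b) :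
    v (∑ a ∈ s, t a) = s.inf fun a => v (t a) := by
  classical
  refine le_antisymm ?_ (AddValuation.map_le_sum v fun i hi => Finset.inf_le hi)
  rcases s.eq_empty_or_nonempty with rfl | hs
  · simp
  obtain ⟨a, ha, hmin⟩ := s.exists_min_image (fun a => v (t a)) hs
  by_cases htop : v (t a) = ⊤
  · have : (s.inf fun a => v (t a)) = ⊤ :=
      (Finset.inf_eq_top_iff _ _).2 fun b hb => top_le_iff.1 (htop ▸ hmin b hb)
    rw [this]
    exact le_top
  refine le_trans (le_of_eq ?_) (Finset.le_inf hmin)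
  rw [← Finset.add_sum_erase s t ha]
  refine AddValuation.map_add_eq_of_lt_left v (AddValuation.map_lt_sum v htop fun b hb => ?_)
  have hb' := Finset.mem_erase.1 hb
  exact lt_of_le_of_ne (hmin b hb'.2) fun h => hb'.1 (hdist a ha b hb'.2 h htop).symm

/-- Up to a denominator, `x` is a sum of terms `c_a root^a` with `a < m`. The coefficients have
valuations in `ℤ w` and the root has valuation `w / m`, so the nonzero terms have distinct
valuations and the smallest one is that of the sum. The endomorphism fixes the root and preserves
the valuations of the coefficients. -/
theorem val_frob_eq [IsDiscreteValuationRing R] (hϖ : Irreducible ϖ)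
    (hj : Function.Injective j) (hm : 0 < m) (hroot : root ^ m = j ϖ)
    (htop : Subfield.closure (insert root (Set.range j)) = ⊤) {frob : K →+* K} {s : R →+* R}
    (hfs : ∀ r, frob (j r) = j (s r)) (hs : s ϖ = ϖ) (hfroot : frob root = root)
    (v : AddValuation K (WithTop ℚ)) (hv : ∀ r, 0 ≤ v (j r)) {w : ℚ} (hw : 0 < w)
    (hvϖ : v (j ϖ) = w) (x : K) : v (frob x) = v x := by
  have hunit : ∀ u : Rˣ, v (j u) = 0 := fun u => by
    have h1 : v (j u) + v (j (u⁻¹ : Rˣ)) = 0 := by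
      rw [← AddValuation.map_mul, ← map_mul, Units.mul_inv, map_one, AddValuation.map_one]
    refine le_antisymm ?_ (hv _)
    rw [← h1]
    exact le_add_of_nonneg_right (hv _)
  have hord : ∀ r : R, r ≠ 0 → ∃ n : ℕ, v (j r) = ((n * w : ℚ) : WithTop ℚ) ∧
      v (j (s r)) = v (j r) := fun r hr => by
    obtain ⟨n, u, rfl⟩ := IsDiscreteValuationRing.eq_unit_mul_pow_irreducible hr hϖ
    have h1 : ∀ u : Rˣ, v (j (u * ϖ ^ n)) = ((n * w : ℚ) : WithTop ℚ) := fun u => by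
      rw [map_mul j, AddValuation.map_mul, hunit, zero_add, map_pow j, AddValuation.map_pow, hvϖ,
        ← WithTop.coe_nsmul, nsmul_eq_mul]
    refine ⟨n, h1 u, ?_⟩
    have h2 : s (u * ϖ ^ n) = (Units.map (s : R →* R) u : Rˣ) * ϖ ^ n := by
      rw [map_mul, map_pow, hs]
      rfl
    rw [h2, h1, h1]
  have hs' : ∀ r, v (j (s r)) = v (j r) := fun r => by
    rcases eq_or_ne r 0 with rfl | hr
    · rw [map_zero]
    · exact (hord r hr).choose_spec.2
  have hm' : (0 : ℚ) < m := by exact_mod_cast hm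
  have hvroot : v root = ((w / m : ℚ) : WithTop ℚ) := by
    have h1 := congrArg v hroot
    rw [AddValuation.map_pow, hvϖ] at h1
    have h2 : v root ≠ ⊤ := fun h2 => by
      have h3 : root = 0 := (AddValuation.top_iff v).1 h2
      rw [h3, zero_pow hm.ne'] at hroot
      have h4 := hvϖ
      rw [← hroot, AddValuation.map_zero] at h4
      exact WithTop.coe_ne_top h4.symm
    obtain ⟨y, hy⟩ := WithTop.ne_top_iff_exists.1 h2
    rw [← hy, ← WithTop.coe_nsmul, nsmul_eq_mul] at h1
    have h5 : (m : ℚ) * y = w := by exact_mod_cast h1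
    rw [← hy, ← h5, mul_div_cancel_left₀ _ hm'.ne']
  have hterm : ∀ (c : R) (a : ℕ), v (j c * root ^ a) = v (j c) + ((a * (w / m) : ℚ) : WithTop ℚ) :=
    fun c a => by
      rw [AddValuation.map_mul, AddValuation.map_pow, hvroot, ← WithTop.coe_nsmul, nsmul_eq_mul]
  -- Equality of valuations reads `n m + a = n' m + b` with `a, b < m`.
  have hdist : ∀ c : ℕ → R, ∀ a ∈ Finset.range m, ∀ b ∈ Finset.range m,
      v (j (c a) * root ^ a) = v (j (c b) * root ^ b) → v (j (c a) * root ^ a) ≠ ⊤ → a = b := by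
    intro c a ha b hb hab hne
    have hca : c a ≠ 0 := fun h0 => hne (by rw [h0, map_zero, zero_mul, AddValuation.map_zero])
    have hcb : c b ≠ 0 := fun h0 =>
      hne (by rw [hab, h0, map_zero, zero_mul, AddValuation.map_zero])
    obtain ⟨n, hn, -⟩ := hord _ hca
    obtain ⟨n', hn', -⟩ := hord _ hcb
    rw [hterm, hterm, hn, hn'] at hab
    have h1 : n * w + a * (w / m) = n' * w + b * (w / m) := by exact_mod_cast hab
    have h2 : (n * m + a : ℚ) = n' * m + b := by
      field_simp at h1
      linarith
    have h3 : n * m + a = n' * m + b := by exact_mod_cast h2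
    have h4 := congrArg (· % m) h3
    simp only [Nat.mul_add_mod_self_right] at h4
    rwa [Nat.mod_eq_of_lt (Finset.mem_range.1 ha), Nat.mod_eq_of_lt (Finset.mem_range.1 hb)] at h4
  obtain ⟨d, hd, c, hc⟩ := exists_eq_sum_root_pow hj hm hroot htop x
  have hfc : j (s d) * frob x = ∑ a ∈ Finset.range m, j (s (c a)) * root ^ a := by
    have h1 := congrArg frob hc
    rw [map_mul, hfs, map_sum] at h1
    rw [h1]
    exact Finset.sum_congr rfl fun a _ => by rw [map_mul, map_pow, hfs, hfroot]
  have h1 : v (j (s d) * frob x) = v (j d * x) := by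
    rw [hfc, hc, exists_map_sum_eq v _ _ (hdist c), exists_map_sum_eq v _ _ (hdist fun a => s (c a))]
    refine Finset.inf_congr rfl fun a _ => ?_
    rw [hterm, hterm, hs']
  rw [AddValuation.map_mul, AddValuation.map_mul, hs'] at h1
  obtain ⟨n, hn, -⟩ := hord d hd
  rw [hn] at h1
  exact WithTop.add_left_cancel WithTop.coe_ne_top h1

theorem frob_surjective (htop : Subfield.closure (insert root (Set.range j)) = ⊤) {frob : K →+* K}
    {s : R →+* R} (hs : Function.Surjective s) (hfs : ∀ r, frob (j r) = j (s r))
    (hfroot : frob root = root) : Function.Surjective frob := by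
  rw [← RingHom.fieldRange_eq_top_iff, eq_top_iff, ← htop, Subfield.closure_le,
    Set.insert_subset_iff]
  refine ⟨⟨root, hfroot⟩, ?_⟩
  rintro _ ⟨r, rfl⟩
  obtain ⟨r', rfl⟩ := hs r
  exact ⟨j r', hfs r'⟩

end RootExtension

/-! ### The slope setting attached to a crystal -/

section Setting

variable {p : ℕ} [Fact p.Prime] {k : Type*} [Field k] [CharP k p] [PerfectRing k p]
    {L : Type*} [Field L] [Algebra ℚ_[p] L] [Algebra ℤ_[p] L] [IsScalarTower ℤ_[p] ℚ_[p] L]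
    [FiniteDimensional ℚ_[p] L] {τ : Emb p L k} {π : OL p L}

/-- The ramification index of `L`. -/
def ramIndex (hπ : Irreducible π) : ℕ := (exists_associated_p hπ).choose

theorem ramIndex_pos (hπ : Irreducible π) : 0 < ramIndex hπ := (exists_associated_p hπ).choose_spec.1

theorem associated_p_pow_ramIndex (hπ : Irreducible π) :
    Associated (p : OL p L) (π ^ ramIndex hπ) := (exists_associated_p hπ).choose_spec.2

/-- A non-negative valuation normalized by `v(p) = 1` takes the value `1 / e` on a uniformizer. -/
theorem val_uniformizer (hπ : Irreducible π) {A : Type*} [CommRing A] (j : OL p L →+* A)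
    (v : AddValuation A (WithTop ℚ)) (hv : ∀ a, 0 ≤ v (j a)) (hp : v (p : A) = 1) :
    v (j π) = ((1 / ramIndex hπ : ℚ) : WithTop ℚ) := by
  have he := ramIndex_pos hπ
  obtain ⟨u, hu⟩ := associated_p_pow_ramIndex hπ
  set e := ramIndex hπ
  have he' : (0 : ℚ) < e := by exact_mod_cast he
  have hunit : v (j u) = 0 := by
    have h1 : v (j u) + v (j (u⁻¹ : (OL p L)ˣ)) = 0 := by
      rw [← AddValuation.map_mul, ← map_mul, Units.mul_inv, map_one, AddValuation.map_one]
    refine le_antisymm ?_ (hv _)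
    rw [← h1]
    exact le_add_of_nonneg_right (hv _)
  have h1 : v (j (p : OL p L)) + v (j u) = v (j (π ^ e)) := by
    rw [← AddValuation.map_mul, ← map_mul, hu]
  rw [map_natCast, hp, hunit, add_zero, map_pow, AddValuation.map_pow] at h1
  have h2 : v (j π) ≠ ⊤ := fun h2 => by
    rw [h2] at h1
    have h3 : e • (⊤ : WithTop ℚ) = ⊤ := by
      obtain ⟨e', he'⟩ := Nat.exists_eq_succ_of_ne_zero he.ne'
      rw [he', succ_nsmul, WithTop.add_top]
    rw [h3] at h1
    exact WithTop.one_ne_top h1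
  obtain ⟨y, hy⟩ := WithTop.ne_top_iff_exists.1 h2
  rw [← hy] at h1 ⊢
  rw [← WithTop.coe_nsmul, nsmul_eq_mul] at h1
  have h3 : 1 = (e : ℚ) * y := by exact_mod_cast h1
  have h4 : y = 1 / e := by field_simp; linarith
  rw [h4]

instance : CharP (AlgebraicClosure k) p :=
  charP_of_injective_algebraMap (algebraMap k (AlgebraicClosure k)).injective p

instance : PerfectRing (AlgebraicClosure k) p :=
  PerfectField.toPerfectRing p

namespace WOL

theorem toBar_ofWitt (x : WittVector p k) :
    toBar (ofWitt τ x) = ofWitt τ.bar (WittVector.map (algebraMap k (AlgebraicClosure k)) x) :=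
  lift_ofWitt _ _ _ x

theorem toBar_ofInt (a : OL p L) : toBar (ofInt τ a) = ofInt τ.bar a :=
  lift_ofInt _ _ _ a

end WOL

theorem frobenius_iterate_map {k' : Type*} [Field k'] [CharP k' p] (g : k →+* k') (n : ℕ)
    (x : WittVector p k) : WittVector.frobenius^[n] (WittVector.map g x) =
      WittVector.map g (WittVector.frobenius^[n] x) := by
  induction n generalizing x with
  | zero => rfl
  | succ n ih =>
    rw [Function.iterate_succ_apply, Function.iterate_succ_apply, ← ih]
    congr 1
    ext m
    simp [WittVector.coeff_frobenius_charP, WittVector.map_coeff]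

namespace RootExt

variable (E : RootExt τ π)

theorem frob_incl (hπ : Irreducible π) (x : WOL τ.bar) :
    E.frob (E.incl x) = E.incl (WOL.frobPow τ.bar hπ x) := by
  have h : E.frob.comp E.incl = E.incl.comp (WOL.frobPow τ.bar hπ : WOL τ.bar →+* WOL τ.bar) :=
    WOL.hom_ext (fun x => (E.frob_witt x).trans
        (congrArg E.incl (WOL.frobPow_ofWitt τ.bar hπ x)).symm)
      fun a => (E.frob_int a).trans (congrArg E.incl (WOL.frobPow_ofInt τ.bar hπ a)).symm
  exact RingHom.congr_fun h x

theorem toBar_frobPow (hπ : Irreducible π) (x : WOL τ) :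
    WOL.frobPow τ.bar hπ (WOL.toBar x) = WOL.toBar (WOL.frobPow τ hπ x) := by
  have h : (WOL.frobPow τ.bar hπ : WOL τ.bar →+* WOL τ.bar).comp WOL.toBar =
      (WOL.toBar : WOL τ →+* WOL τ.bar).comp (WOL.frobPow τ hπ : WOL τ →+* WOL τ) := by
    refine WOL.hom_ext (fun x => ?_) fun a => ?_
    · have h1 := WOL.frobPow_ofWitt τ.bar hπ (WittVector.map (algebraMap k (AlgebraicClosure k)) x)
      rw [frobenius_iterate_map, ← WOL.toBar_ofWitt, ← WOL.toBar_ofWitt, ← WOL.frobPow_ofWitt τ hπ]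
        at h1
      exact h1
    · have h1 := WOL.frobPow_ofInt τ.bar hπ a
      rw [← WOL.toBar_ofInt] at h1
      nth_rewrite 2 [← WOL.frobPow_ofInt τ hπ a] at h1
      exact h1
  exact RingHom.congr_fun h x

theorem frob_bijective (hπ : Irreducible π) : Function.Bijective E.frob :=
  ⟨E.frob.injective, frob_surjective E.closure_eq_top
    (s := (WOL.frobPow τ.bar hπ : WOL τ.bar →+* WOL τ.bar)) (WOL.frobPow τ.bar hπ).surjective
    (E.frob_incl hπ) E.frob_root⟩

theorem val_incl_uniformizer (hπ : Irreducible π) :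
    E.val (E.incl (WOL.ofInt τ.bar π)) = ((1 / ramIndex hπ : ℚ) : WithTop ℚ) :=
  val_uniformizer hπ (E.incl.comp (WOL.ofInt τ.bar)) E.val (fun _ => E.val_nonneg _) E.val_p

theorem val_frob (hπ : Irreducible π) (x : E.K) : E.val (E.frob x) = E.val x := by
  have he : (0 : ℚ) < ramIndex hπ := by exact_mod_cast ramIndex_pos hπ
  exact val_frob_eq (WOL.irreducible_ofInt τ.bar hπ) E.incl_injective E.m_pos E.root_pow
    E.closure_eq_top (s := (WOL.frobPow τ.bar hπ : WOL τ.bar →+* WOL τ.bar)) (E.frob_incl hπ)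
    (WOL.frobPow_ofInt τ.bar hπ π) E.frob_root E.val E.val_nonneg (one_div_pos.2 he)
    (E.val_incl_uniformizer hπ) x

/-- The setting of semilinear algebra attached to an extension by a root of `π`. -/
def setting (hπ : Irreducible π) : SlopeSetting (WOL τ) E.K where
  ϖ := WOL.ofInt τ π
  σ := WOL.frobPow τ hπ
  σ_ϖ := WOL.frobPow_ofInt τ hπ π
  ι := E.ofWOL
  φ := RingEquiv.ofBijective E.frob (E.frob_bijective hπ)
  φ_ι x := (E.frob_incl hπ _).trans (congrArg E.incl (toBar_frobPow hπ x))
  v := E.val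
  v_φ := E.val_frob hπ
  v_ι x := E.val_nonneg _
  w := 1 / ramIndex hπ
  w_pos := one_div_pos.2 (by exact_mod_cast ramIndex_pos hπ)
  v_ϖ := (congrArg (fun x => E.val (E.incl x)) (WOL.toBar_ofInt π)).trans
    (E.val_incl_uniformizer hπ)

end RootExt

end Setting

/-! ### The components of a crystal -/

namespace Crystal

variable {p : ℕ} [Fact p.Prime] {k : Type*} [Field k] [CharP k p] [PerfectRing k p]
  {L : Type*} [Field L] [Algebra ℚ_[p] L] [Algebra ℤ_[p] L] [IsScalarTower ℤ_[p] ℚ_[p] L]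
  [FiniteDimensional ℚ_[p] L] {π : OL p L}
  {M : Type*} [AddCommGroup M] [Module (WittVector p k) M] (C : Crystal p k L M)

theorem coe_mul_smul (τ : Emb p L k) (c : WittVector p k) (a : OL p L) (x : C.comp τ) :
    (((WOL.ofWitt τ c * WOL.ofInt τ a) • x : C.comp τ) : M) = c • C.act a (x : M) := by
  rw [WOL.ofWitt_mul_ofInt]
  exact C.coe_tmul_smul τ _ a x

theorem coe_ofWitt_smul (τ : Emb p L k) (c : WittVector p k) (x : C.comp τ) :
    ((WOL.ofWitt τ c • x : C.comp τ) : M) = c • (x : M) := by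
  have h := C.coe_mul_smul τ c 1 x
  rwa [map_one, mul_one, map_one, Module.End.one_apply] at h

theorem coe_ofInt_smul (τ : Emb p L k) (a : OL p L) (x : C.comp τ) :
    ((WOL.ofInt τ a • x : C.comp τ) : M) = C.act a (x : M) := by
  have h := C.coe_mul_smul τ 1 a x
  rwa [map_one, one_mul, one_smul] at h

theorem F_mem_comp {τ : Emb p L k} {x : M} (hx : x ∈ C.comp τ.frobInv) : C.F x ∈ C.comp τ :=
  fun a => by
    rw [← C.act_F, hx a, LinearMap.map_smulₛₗ, Emb.frobenius_frobInv]

theorem iterate_F_mem_comp (n : ℕ) {τ : Emb p L k} {x : M} (hx : x ∈ C.comp (Emb.frobInv^[n] τ)) :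
    C.F^[n] x ∈ C.comp τ := by
  induction n generalizing τ with
  | zero => exact hx
  | succ n ih =>
    rw [Function.iterate_succ_apply']
    exact C.F_mem_comp (ih hx)

theorem iterate_F_add (n : ℕ) (x y : M) : C.F^[n] (x + y) = C.F^[n] x + C.F^[n] y :=
  iterate_map_add C.F n x y

theorem iterate_F_smul (n : ℕ) (c : WittVector p k) (x : M) :
    C.F^[n] (c • x) = WittVector.frobenius^[n] c • C.F^[n] x := by
  induction n with
  | zero => rfl
  | succ n ih => simp only [Function.iterate_succ_apply', ih, LinearMap.map_smulₛₗ]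

theorem iterate_F_act (n : ℕ) (a : OL p L) (x : M) : C.F^[n] (C.act a x) = C.act a (C.F^[n] x) := by
  induction n with
  | zero => rfl
  | succ n ih => simp only [Function.iterate_succ_apply', ih, C.act_F]

/-- A semilinear map between components, given by an additive map on `M`. -/
def semilinear {τ τ' : Emb p L k} (s : WOL τ →+* WOL τ') (G : M →+ M)
    (hmem : ∀ x ∈ C.comp τ, G x ∈ C.comp τ') (t : WittVector p k → WittVector p k)
    (hs : ∀ c, s (WOL.ofWitt τ c) = WOL.ofWitt τ' (t c))
    (hs' : ∀ a, s (WOL.ofInt τ a) = WOL.ofInt τ' a) (hG : ∀ c x, G (c • x) = t c • G x)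
    (hG' : ∀ a x, G (C.act a x) = C.act a (G x)) : C.comp τ →ₛₗ[s] C.comp τ' where
  toFun x := ⟨G x, hmem x x.2⟩
  map_add' x y := Subtype.ext (map_add G (x : M) y)
  map_smul' r x := by
    induction r using WOL.induction_on' with
    | hmul c a =>
      apply Subtype.ext
      rw [map_mul, hs, hs']
      refine Eq.trans ?_ (C.coe_mul_smul τ' _ _ _).symm
      change G (((WOL.ofWitt τ c * WOL.ofInt τ a) • x : C.comp τ) : M) = _
      rw [coe_mul_smul, hG, hG']
    | hadd r r' hr hr' =>
      apply Subtype.ext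
      have h1 := congrArg Subtype.val hr
      have h2 := congrArg Subtype.val hr'
      rw [add_smul, RingHom.map_add, add_smul]
      exact (map_add G _ _).trans (congrArg₂ (· + ·) h1 h2)

/-- The map `F_τ : M_{σ⁻¹τ} → M_τ`. -/
def compF (τ : Emb p L k) :
    C.comp τ.frobInv →ₛₗ[(WOL.frobEquiv τ : WOL τ.frobInv →+* WOL τ)] C.comp τ :=
  C.semilinear _ (C.F : M →+ M) (fun _ hx => C.F_mem_comp hx) WittVector.frobenius
    (WOL.frobEquiv_ofWitt τ) (WOL.frobEquiv_ofInt τ) (fun c x => LinearMap.map_smulₛₗ C.F c x)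
    (fun a x => C.act_F a x)

theorem coe_compF (τ : Emb p L k) (x : C.comp τ.frobInv) : (C.compF τ x : M) = C.F x := rfl

/-- The iterates of `F` as additive maps. -/
def iterateF (n : ℕ) : M →+ M where
  toFun := C.F^[n]
  map_zero' := iterate_map_zero C.F n
  map_add' := C.iterate_F_add n

/-- The map `F^f : M_τ → M_τ`. -/
def compFrob (hπ : Irreducible π) (τ : Emb p L k) :
    C.comp τ →ₛₗ[(WOL.frobPow τ hπ : WOL τ →+* WOL τ)] C.comp τ :=
  C.semilinear _ (C.iterateF (residueDegree p L π))
    (fun x hx => C.iterate_F_mem_comp _ (by rwa [Emb.frobInv_iterate_residueDegree hπ]))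
    WittVector.frobenius^[residueDegree p L π] (WOL.frobPow_ofWitt τ hπ) (WOL.frobPow_ofInt τ hπ)
    (C.iterate_F_smul _) (C.iterate_F_act _)

theorem coe_compFrob (hπ : Irreducible π) (τ : Emb p L k) (x : C.comp τ) :
    (C.compFrob hπ τ x : M) = C.F^[residueDegree p L π] x := rfl

section Decomposition

open Polynomial

theorem act_aeval {τ : Emb p L k} {θ : OLnr p L} {y : M} (hy : C.act θ y = τ θ • y)
    (q : ℤ_[p][X]) : C.act (aeval θ q : OLnr p L) y = τ (aeval θ q) • y := by
  induction q using Polynomial.induction_on' with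
  | add f g hf hg =>
    rw [map_add, map_add, Subalgebra.coe_add, map_add, LinearMap.add_apply, hf, hg, add_smul]
  | monomial n a =>
    have hpow : ∀ n : ℕ, C.act ((θ : OL p L) ^ n) y = τ (θ ^ n) • y := fun n => by
      induction n with
      | zero => simp
      | succ n ih =>
        rw [pow_succ, map_mul, Module.End.mul_apply, hy, map_smul, ih, smul_smul, pow_succ',
          map_mul]
    rw [aeval_monomial, map_mul, Subalgebra.coe_mul, map_mul, Module.End.mul_apply,
      Subalgebra.coe_pow, hpow, map_smul]
    have h1 : (τ.comp (algebraMap ℤ_[p] (OLnr p L))) = padicToWitt p k :=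
      padicInt_hom_witt_unique _ _
    have h2 : τ (algebraMap ℤ_[p] (OLnr p L) a) = padicToWitt p k a := RingHom.congr_fun h1 a
    have h3 : C.act (algebraMap ℤ_[p] (OLnr p L) a : OLnr p L) y = padicToWitt p k a • y :=
      C.act_padic a y
    rw [h3, h2, smul_smul, mul_comm]

/-- Unit differences make the factors `X - e_i θ` coprime, so a Bézout relation splits off one
eigenspace of `θ` at a time. An eigenvector of `θ` lies in the corresponding `M_τ` because `θ`
generates. -/
theorem mem_iSup_comp {I : Type*} {θ : OLnr p L}
    (hgen : ∀ a : OLnr p L, ∃ q : ℤ_[p][X], a = aeval θ q) (e : I → Emb p L k)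
    (hunit : ∀ i j, i ≠ j → IsUnit (e i θ - e j θ)) (s : Finset I) (x : M)
    (hx : aeval (C.act θ) (∏ i ∈ s, (X - Polynomial.C (e i θ))) x = 0) :
    x ∈ ⨆ τ, C.comp τ := by
  classical
  induction s using Finset.induction_on generalizing x with
  | empty =>
    rw [Finset.prod_empty, map_one, Module.End.one_apply] at hx
    rw [hx]
    exact zero_mem _
  | insert i s his ih =>
    rw [Finset.prod_insert his] at hx
    have hcop : IsCoprime (X - Polynomial.C (e i θ)) (∏ i ∈ s, (X - Polynomial.C (e i θ))) :=
      IsCoprime.prod_right fun j hj => isCoprime_X_sub_C_of_isUnit_sub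
        (hunit i j fun h => his (h ▸ hj))
    obtain ⟨u, v, huv⟩ := hcop
    set T := C.act θ
    set P := ∏ i ∈ s, (X - Polynomial.C (e i θ))
    have h1 : x = aeval T (u * (X - Polynomial.C (e i θ))) x + aeval T (v * P) x := by
      rw [← LinearMap.add_apply, ← map_add, huv, map_one, Module.End.one_apply]
    rw [h1]
    refine add_mem (ih _ ?_) (le_iSup C.comp (e i) ?_)
    · rw [← Module.End.mul_apply, ← map_mul,
        show P * (u * (X - Polynomial.C (e i θ))) = u * ((X - Polynomial.C (e i θ)) * P) by ring,
        map_mul, Module.End.mul_apply, hx, map_zero]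
    · have h2 : aeval T (X - Polynomial.C (e i θ)) (aeval T (v * P) x) = 0 := by
        rw [← Module.End.mul_apply, ← map_mul,
          show (X - Polynomial.C (e i θ)) * (v * P) = v * ((X - Polynomial.C (e i θ)) * P) by ring,
          map_mul, Module.End.mul_apply, hx, map_zero]
      intro a
      obtain ⟨q, rfl⟩ := hgen a
      refine C.act_aeval ?_ q
      rw [map_sub, aeval_X, aeval_C, LinearMap.sub_apply, sub_eq_zero] at h2
      exact h2

/-- The `f` embeddings send `θ` to `f` roots of `g` in `W(k)`, distinct modulo `p`; as `g` has
degree `f` it splits completely, and it annihilates the action of `θ`. -/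
theorem iSup_comp_eq_top (hπ : Irreducible π) (τ₀ : Emb p L k) : ⨆ τ, C.comp τ = ⊤ := by
  obtain ⟨g, θ, hgm, hgd, hirr, hθ, hgen, -⟩ := exists_OLnr_generator hπ
  set f := residueDegree p L π
  let e : Fin f → Emb p L k := fun j => Emb.frobInv^[(j : ℕ)] τ₀
  have he : Function.Bijective e := Emb.bijective_frobInv_iterate hπ τ₀
  let r : ℤ_[p] →+* WittVector p k := padicToWitt p k
  have hunit : ∀ i j, i ≠ j → IsUnit (e i θ - e j θ) := fun i j hij => by
    refine isUnit_witt_of_not_dvd fun hdvd => hij (he.1 ?_)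
    rw [dvd_witt_iff, map_sub, sub_eq_zero] at hdvd
    exact Emb.eq_of_constantCoeff_eq hirr hθ hgen hdvd
  have hprod : g.map r = ∏ i, (X - Polynomial.C (e i θ)) := by
    refine eq_of_monic_of_dvd_of_natDegree_le (monic_prod_X_sub_C _ _) (hgm.map r) ?_ ?_
    · refine Finset.prod_dvd_of_coprime (fun i _ j _ hij =>
        isCoprime_X_sub_C_of_isUnit_sub (hunit i j hij)) fun i _ => ?_
      rw [dvd_iff_isRoot, IsRoot, eval_map, ← Emb.map_aeval (e i) r, hθ, map_zero]
    · rw [hgm.natDegree_map, hgd, natDegree_finsetProd_X_sub_C_eq_card]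
      simp [f]
  rw [eq_top_iff]
  intro x _
  refine C.mem_iSup_comp hgen e hunit Finset.univ x ?_
  rw [← hprod, aeval_def, eval₂_map]
  have h1 : C.act (aeval θ g : OLnr p L) = eval₂ ((algebraMap (WittVector p k) _).comp r)
      (C.act θ) g := by
    have h2 : ((aeval θ g : OLnr p L) : OL p L) = eval₂ (algebraMap ℤ_[p] (OL p L)) θ g :=
      aeval_subalgebra_coe g _ θ
    rw [h2, hom_eval₂]
    congr 1
    ext a y
    exact C.act_padic a y
  rw [← h1, hθ]
  simp

end Decomposition

theorem smul_p_injective (C : Crystal p k L M) {x : M} (hx : (p : WittVector p k) • x = 0) : x = 0 := by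
  have := C.free
  exact (smul_eq_zero.1 hx).resolve_left natCast_p_ne_zero_witt

theorem act_p (x : M) : C.act (p : OL p L) x = (p : WittVector p k) • x := by
  have h := C.act_padic (p : ℤ_[p]) x
  rwa [map_natCast (algebraMap ℤ_[p] (OL p L)), map_natCast (padicToWitt p k)] at h

theorem act_injective (hπ : Irreducible π) {x : M} (hx : C.act π x = 0) : x = 0 := by
  obtain ⟨c, hc⟩ := (dvd_pow_self π (ramIndex_pos hπ).ne').trans
    (associated_p_pow_ramIndex hπ).symm.dvd
  refine C.smul_p_injective ?_
  rw [← C.act_p, hc, mul_comm, map_mul, Module.End.mul_apply, hx, map_zero]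

theorem act_pow_injective (hπ : Irreducible π) (n : ℕ) {x y : M}
    (h : C.act (π ^ n) x = C.act (π ^ n) y) : x = y := by
  rw [← sub_eq_zero] at h ⊢
  rw [← map_sub] at h
  induction n with
  | zero => simpa using h
  | succ n ih =>
    rw [pow_succ', map_mul, Module.End.mul_apply] at h
    exact ih (C.act_injective hπ h)

theorem mem_comp_of_act_pow_mem (hπ : Irreducible π) {τ : Emb p L k} (n : ℕ) {x : M}
    (h : C.act (π ^ n) x ∈ C.comp τ) : x ∈ C.comp τ := fun a => by
  refine C.act_pow_injective hπ n ?_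
  rw [map_smul, ← h a, ← Module.End.mul_apply, ← map_mul, mul_comm, map_mul, Module.End.mul_apply]

instance (τ : Emb p L k) : Module.Finite (WOL τ) (C.comp τ) := by
  have := C.free
  have := C.finite
  obtain ⟨S, hS⟩ := (inferInstance : Module.Finite (WittVector p k) (C.comp τ)).fg_top
  refine ⟨S, eq_top_iff.2 fun x _ => ?_⟩
  have hx : x ∈ Submodule.span (WittVector p k) (S : Set (C.comp τ)) := hS ▸ Submodule.mem_top
  induction hx using Submodule.span_induction with
  | mem x h => exact Submodule.subset_span h
  | zero => exact zero_mem _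
  | add x y _ _ hx hy => exact add_mem (hx trivial) (hy trivial)
  | smul c x _ hx =>
    have h1 : c • x = WOL.ofWitt τ c • x := Subtype.ext (C.coe_ofWitt_smul τ c x).symm
    rw [h1]
    exact Submodule.smul_mem _ _ (hx trivial)

theorem ofInt_pow_smul_injective (hπ : Irreducible π) {τ : Emb p L k} (n : ℕ) {x : C.comp τ}
    (h : WOL.ofInt τ π ^ n • x = 0) : x = 0 := by
  rw [← map_pow] at h
  have h1 := congrArg Subtype.val h
  rw [coe_ofInt_smul] at h1
  exact Subtype.ext (C.act_pow_injective hπ n (h1.trans (map_zero _).symm))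

instance (τ : Emb p L k) : Module.IsTorsionFree (WOL τ) (C.comp τ) := by
  obtain ⟨π, hπ⟩ := IsDiscreteValuationRing.exists_irreducible (OL p L)
  have h1 : ∀ (r : WOL τ) (x : C.comp τ), r ≠ 0 → r • x = 0 → x = 0 := fun r x hr hx => by
    obtain ⟨n, u, hu⟩ := IsDiscreteValuationRing.eq_unit_mul_pow_irreducible hr
      (WOL.irreducible_ofInt τ hπ)
    refine C.ofInt_pow_smul_injective hπ n ?_
    rw [hu, mul_smul] at hx
    have h2 := congrArg (fun y => ((u⁻¹ : (WOL τ)ˣ) : WOL τ) • y) hx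
    simp only [smul_zero] at h2
    rwa [smul_smul, Units.inv_mul, one_smul] at h2
  exact Module.IsTorsionFree.of_smul_eq_zero fun r x h => or_iff_not_imp_left.2 fun hr => h1 r x hr h

instance (τ : Emb p L k) : Module.Free (WOL τ) (C.comp τ) := Module.free_of_finite_type_torsion_free'

end Crystal

/-! ### Matrices of semilinear maps -/

section SemiMatrix

variable {R R' R'' : Type*} [CommRing R] [CommRing R'] [CommRing R''] {s : R →+* R'}
  {s' : R' →+* R''} {s'' : R →+* R''}
  {N N' N'' : Type*} [AddCommGroup N] [Module R N] [AddCommGroup N'] [Module R' N']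
  [AddCommGroup N''] [Module R'' N''] {n n' n'' : Type*} [Fintype n] [Fintype n'] [Fintype n'']

/-- The matrix of a semilinear map. -/
def semiMatrix (b : Module.Basis n R N) (b' : Module.Basis n' R' N') (G : N →ₛₗ[s] N') :
    Matrix n' n R' :=
  Matrix.of fun i j => b'.repr (G (b j)) i

theorem apply_basis (b : Module.Basis n R N) (b' : Module.Basis n' R' N') (G : N →ₛₗ[s] N')
    (j : n) : G (b j) = ∑ i, semiMatrix b b' G i j • b' i :=
  (b'.sum_repr _).symm

theorem semiMatrix_eq (b : Module.Basis n R N) (b' : Module.Basis n' R' N') (G : N →ₛₗ[s] N')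
    {X : Matrix n' n R'} (h : ∀ j, G (b j) = ∑ i, X i j • b' i) : semiMatrix b b' G = X := by
  ext i j
  change b'.repr (G (b j)) i = X i j
  rw [h, b'.repr_sum_self]

theorem repr_apply (b : Module.Basis n R N) (b' : Module.Basis n' R' N') (G : N →ₛₗ[s] N') (x : N)
    (i : n') : b'.repr (G x) i = ∑ j, semiMatrix b b' G i j * s (b.repr x j) := by
  conv_lhs => rw [← b.sum_repr x, map_sum, map_sum, Finsupp.finsetSum_apply]
  refine Finset.sum_congr rfl fun j _ => ?_
  rw [LinearMap.map_smulₛₗ, map_smul, Finsupp.smul_apply, smul_eq_mul, mul_comm]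
  rfl

theorem semiMatrix_comp (b : Module.Basis n R N) (b' : Module.Basis n' R' N')
    (b'' : Module.Basis n'' R'' N'') (G : N →ₛₗ[s] N') (G' : N' →ₛₗ[s'] N'') (G'' : N →ₛₗ[s''] N'')
    (h : ∀ j, G'' (b j) = G' (G (b j))) :
    semiMatrix b b'' G'' = semiMatrix b' b'' G' * (semiMatrix b b' G).map s' := by
  ext i j
  change b''.repr (G'' (b j)) i = _
  rw [h, repr_apply b' b'', Matrix.mul_apply]
  rfl

theorem map_mul_semiMatrix {m m' : Type*} [Fintype m] [Fintype m'] (b : Module.Basis n R N)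
    (b' : Module.Basis n' R' N') (c : Module.Basis m R N) (c' : Module.Basis m' R' N')
    (G : N →ₛₗ[s] N') :
    semiMatrix c c' G * (c.toMatrix b).map s = c'.toMatrix b' * semiMatrix b b' G := by
  ext i j
  have h1 := repr_apply c c' G (b j) i
  rw [Matrix.mul_apply, Matrix.mul_apply]
  refine h1.symm.trans ?_
  rw [apply_basis b b' G j, map_sum, Finsupp.finsetSum_apply]
  refine Finset.sum_congr rfl fun l _ => ?_
  rw [map_smul, Finsupp.smul_apply, smul_eq_mul, mul_comm]
  rfl

theorem semiMatrix_iterate {R N : Type*} [CommRing R] [AddCommGroup N] [Module R N] {n : Type*}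
    [Fintype n] [DecidableEq n] {s : R →+* R} (b : Module.Basis n R N) (G : N →ₛₗ[s] N) (m : ℕ)
    (x : N) (i : n) :
    b.repr (G^[m] x) i = ∑ j, twist s (semiMatrix b b G) m i j * s^[m] (b.repr x j) := by
  induction m generalizing i with
  | zero => simp [twist, Matrix.one_apply]
  | succ m ih =>
    rw [Function.iterate_succ_apply', repr_apply b b G, twist]
    simp only [Matrix.mul_apply, Matrix.map_apply, ih, map_sum, map_mul, Finset.mul_sum,
      Finset.sum_mul, Function.iterate_succ_apply']
    rw [Finset.sum_comm]
    simp only [mul_assoc]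

variable (t : R ≃+* R') {G : N →ₛₗ[(t : R →+* R')] N'}

theorem eq_zero_of_mulVec_semiMatrix (hG : Function.Injective G) (b : Module.Basis n R N)
    (b' : Module.Basis n' R' N') {v : n → R'} (hv : (semiMatrix b b' G).mulVec v = 0) : v = 0 := by
  have h1 : G (∑ j, t.symm (v j) • b j) = 0 := by
    refine b'.repr.injective (Finsupp.ext fun i => ?_)
    rw [repr_apply b b' G, map_zero, Finsupp.zero_apply]
    simp only [b.repr_sum_self]
    exact (Finset.sum_congr rfl fun j _ => by
      rw [RingEquiv.coe_toRingHom, t.apply_symm_apply]).trans (congrFun hv i)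
  have h2 := hG (h1.trans (map_zero G).symm)
  funext j
  have h3 := congrArg (fun x => b.repr x j) h2
  simp only [b.repr_sum_self, map_zero, Finsupp.zero_apply] at h3
  rw [Pi.zero_apply, ← t.apply_symm_apply (v j), h3, map_zero]

theorem det_semiMatrix_ne_zero [DecidableEq n] [IsDomain R'] (hG : Function.Injective G)
    (b : Module.Basis n R N) (b' : Module.Basis n R' N') : (semiMatrix b b' G).det ≠ 0 := fun h => by
  obtain ⟨v, hv0, hv⟩ := Matrix.exists_mulVec_eq_zero_iff.2 h
  exact hv0 (eq_zero_of_mulVec_semiMatrix t hG b b' hv)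

theorem finrank_le_of_semilinear_injective [Nontrivial R] [IsDomain R'] [Module.Free R N]
    [Module.Finite R N] [Module.Free R' N'] [Module.Finite R' N'] (hG : Function.Injective G) :
    Module.finrank R N ≤ Module.finrank R' N' := by
  let b := Module.finBasis R N
  have h1 : LinearIndependent R' fun j => G (b j) := by
    rw [Fintype.linearIndependent_iff]
    intro g hg j
    have h2 : G (∑ j, t.symm (g j) • b j) = 0 := by
      rw [map_sum, ← hg]
      exact Finset.sum_congr rfl fun j _ => by
        rw [LinearMap.map_smulₛₗ, RingEquiv.coe_toRingHom, t.apply_symm_apply]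
    have h3 := congrArg (fun x => b.repr x j) (hG (h2.trans (map_zero G).symm))
    simp only [b.repr_sum_self, map_zero, Finsupp.zero_apply] at h3
    rw [← t.apply_symm_apply (g j), h3, map_zero]
  simpa using h1.fintype_card_le_finrank

end SemiMatrix

/-! ### Constancy of the rank -/

namespace Crystal

variable {p : ℕ} [Fact p.Prime] {k : Type*} [Field k] [CharP k p] [PerfectRing k p]
  {L : Type*} [Field L] [Algebra ℚ_[p] L] [Algebra ℤ_[p] L] [IsScalarTower ℤ_[p] ℚ_[p] L]
  [FiniteDimensional ℚ_[p] L] {π : OL p L}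
  {M : Type*} [AddCommGroup M] [Module (WittVector p k) M] (C : Crystal p k L M)

theorem compF_injective (τ : Emb p L k) : Function.Injective (C.compF τ) := fun _ _ h =>
  Subtype.ext (C.F_injective (congrArg Subtype.val h))

theorem rank_frobInv_le (τ : Emb p L k) : C.rank τ.frobInv ≤ C.rank τ :=
  finrank_le_of_semilinear_injective (WOL.frobEquiv τ) (C.compF_injective τ)

theorem exists_frobInv_iterate (hπ : Irreducible π) (τ τ' : Emb p L k) :
    ∃ n, Emb.frobInv^[n] τ = τ' := by
  obtain ⟨j, hj⟩ := (Emb.bijective_frobInv_iterate hπ τ).2 τ'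
  exact ⟨j, hj⟩

/-- A property of embeddings inherited by `τ` from `σ⁻¹τ` holds for all embeddings if it holds for
one. -/
theorem forall_of_frobInv (hπ : Irreducible π) {P : Emb p L k → Prop}
    (h : ∀ τ : Emb p L k, P τ.frobInv → P τ) {τ₀ : Emb p L k} (h₀ : P τ₀) (τ : Emb p L k) : P τ := by
  obtain ⟨n, rfl⟩ := exists_frobInv_iterate hπ τ τ₀
  induction n generalizing τ with
  | zero => exact h₀
  | succ n ih => exact h τ (ih τ.frobInv h₀)

/-- The injective map `F_τ` bounds the rank at `σ⁻¹τ` by the rank at `τ`; going around the cycle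
forces equality. -/
theorem rank_eq (hπ : Irreducible π) (τ τ' : Emb p L k) : C.rank τ = C.rank τ' := by
  have h : ∀ τ τ', C.rank τ ≤ C.rank τ' := fun τ τ' =>
    forall_of_frobInv hπ (P := fun τ' => C.rank τ ≤ C.rank τ')
      (fun τ' h => h.trans (C.rank_frobInv_le τ')) (τ₀ := τ) le_rfl τ'
  exact le_antisymm (h _ _) (h _ _)

end Crystal

/-! ### Independence of the Newton polygon from the embedding -/

section Transport

variable {p : ℕ} [Fact p.Prime] {k : Type*} [Field k] [CharP k p] [PerfectRing k p]
  {L : Type*} [Field L] [Algebra ℚ_[p] L] [Algebra ℤ_[p] L] [IsScalarTower ℤ_[p] ℚ_[p] L]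
  [FiniteDimensional ℚ_[p] L] {π : OL p L}

theorem Emb.frobenius_bar_frobInv (τ : Emb p L k) (a : OLnr p L) :
    WittVector.frobenius (τ.frobInv.bar a) = τ.bar a := by
  have h := frobenius_iterate_map (algebraMap k (AlgebraicClosure k)) 1 (τ.frobInv a)
  simp only [Function.iterate_one] at h
  rw [Emb.frobenius_frobInv] at h
  exact h

/-- The isomorphism `σ ⊗ 1` over the algebraic closure. -/
def WOL.frobBar (τ : Emb p L k) : WOL τ.frobInv.bar ≃+* WOL τ.bar :=
  WOL.mapEquiv WittVector.frobenius
    ((WittVector.frobeniusEquiv p (AlgebraicClosure k)).symm :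
      WittVector p (AlgebraicClosure k) →+* WittVector p (AlgebraicClosure k))
    (WittVector.frobeniusEquiv p _).apply_symm_apply
    (WittVector.frobeniusEquiv p _).symm_apply_apply (Emb.frobenius_bar_frobInv τ)

theorem WOL.frobBar_symm_ofWitt (τ : Emb p L k) (x : WittVector p (AlgebraicClosure k)) :
    (WOL.frobBar τ).symm (WOL.ofWitt τ.bar (WittVector.frobenius x)) =
      WOL.ofWitt τ.frobInv.bar x := by
  rw [RingEquiv.symm_apply_eq]
  exact (WOL.mapHom_ofWitt WittVector.frobenius (Emb.frobenius_bar_frobInv τ) x).symm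

theorem WOL.frobBar_symm_ofInt (τ : Emb p L k) (a : OL p L) :
    (WOL.frobBar τ).symm (WOL.ofInt τ.bar a) = WOL.ofInt τ.frobInv.bar a := by
  rw [RingEquiv.symm_apply_eq]
  exact (WOL.mapHom_ofInt WittVector.frobenius (Emb.frobenius_bar_frobInv τ) a).symm

theorem WOL.frobBar_symm_toBar (τ : Emb p L k) (x : WOL τ.frobInv) :
    (WOL.frobBar τ).symm (WOL.toBar (WOL.frobEquiv τ x)) = WOL.toBar x := by
  have h : ((WOL.frobBar τ).symm : WOL τ.bar →+* WOL τ.frobInv.bar).comp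
      ((WOL.toBar : WOL τ →+* WOL τ.bar).comp (WOL.frobEquiv τ : WOL τ.frobInv →+* WOL τ)) =
      WOL.toBar := by
    refine WOL.hom_ext (fun x => ?_) fun a => ?_
    · have h1 := WOL.frobBar_symm_ofWitt τ (WittVector.map (algebraMap k (AlgebraicClosure k)) x)
      have h2 := frobenius_iterate_map (algebraMap k (AlgebraicClosure k)) 1 x
      simp only [Function.iterate_one] at h2
      rw [h2, ← WOL.toBar_ofWitt, ← WOL.toBar_ofWitt, ← WOL.frobEquiv_ofWitt] at h1
      exact h1
    · have h1 := WOL.frobBar_symm_ofInt τ a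
      rw [← WOL.toBar_ofInt, ← WOL.toBar_ofInt, ← WOL.frobEquiv_ofInt] at h1
      exact h1
  exact RingHom.congr_fun h x

/-- An extension by a root of `π`, seen through the Frobenius. -/
def RootExt.ofFrobInv {τ : Emb p L k} (E : RootExt τ.frobInv π) : RootExt τ π where
  K := E.K
  incl := E.incl.comp ((WOL.frobBar τ).symm : WOL τ.bar →+* WOL τ.frobInv.bar)
  incl_injective := E.incl_injective.comp (WOL.frobBar τ).symm.injective
  m := E.m
  m_pos := E.m_pos
  root := E.root
  root_pow := E.root_pow.trans (congrArg E.incl (WOL.frobBar_symm_ofInt τ π)).symm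
  closure_eq_top := by
    have h : Set.range (E.incl.comp ((WOL.frobBar τ).symm : WOL τ.bar →+* WOL τ.frobInv.bar)) =
        Set.range E.incl := (WOL.frobBar τ).symm.surjective.range_comp E.incl
    rw [h]
    exact E.closure_eq_top
  frob := E.frob
  frob_witt x := by
    obtain ⟨y, rfl⟩ := (WittVector.frobeniusEquiv p (AlgebraicClosure k)).surjective x
    have h1 := congrArg E.incl (WOL.frobBar_symm_ofWitt τ y)
    have h2 := congrArg E.incl (WOL.frobBar_symm_ofWitt τ
      (WittVector.frobenius^[residueDegree p L π] y))
    have h3 := (Function.iterate_succ_apply' (WittVector.frobenius : WittVector p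
      (AlgebraicClosure k) →+* _) (residueDegree p L π) y).symm.trans
        (Function.iterate_succ_apply _ _ _)
    rw [h3] at h2
    exact ((congrArg E.frob h1).trans (E.frob_witt y)).trans h2.symm
  frob_int a := by
    have h1 := congrArg E.incl (WOL.frobBar_symm_ofInt τ a)
    exact ((congrArg E.frob h1).trans (E.frob_int a)).trans h1.symm
  frob_root := E.frob_root
  val := E.val
  val_nonneg x := E.val_nonneg _
  val_p := E.val_p

theorem RootExt.ofFrobInv_ofWOL {τ : Emb p L k} (E : RootExt τ.frobInv π) (x : WOL τ.frobInv) :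
    E.ofFrobInv.ofWOL (WOL.frobEquiv τ x) = E.ofWOL x :=
  congrArg E.incl (WOL.frobBar_symm_toBar τ x)

theorem Crystal.compFrob_compF {M : Type*} [AddCommGroup M] [Module (WittVector p k) M]
    (C : Crystal p k L M) (hπ : Irreducible π) (τ : Emb p L k) (x : C.comp τ.frobInv) :
    C.compFrob hπ τ (C.compF τ x) = C.compF τ (C.compFrob hπ τ.frobInv x) :=
  Subtype.ext ((Function.iterate_succ_apply C.F _ _).symm.trans
    (Function.iterate_succ_apply' C.F _ _))

/-- The slopes of the Newton polygon do not depend on the embedding. -/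
theorem Crystal.IsNewtonSlopesAt.of_frobInv {M : Type*} [AddCommGroup M] [Module (WittVector p k) M]
    {C : Crystal p k L M} (hπ : Irreducible π) {τ : Emb p L k} {h : ℕ} {s : Fin h → ℚ}
    (H : C.IsNewtonSlopesAt π τ.frobInv s) : C.IsNewtonSlopesAt π τ s := by
  obtain ⟨hs, b', X', hX', E, P, Y, hP, heq, hY, hv⟩ := H
  have hrank : Module.finrank (WOL τ) (C.comp τ) = h := by
    have h1 := C.rank_eq hπ τ τ.frobInv
    rw [rank, rank, Module.finrank_eq_card_basis b', Fintype.card_fin] at h1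
    exact h1
  let b := Module.finBasisOfFinrankEq (WOL τ) (C.comp τ) hrank
  set Q := semiMatrix b' b (C.compF τ) with hQ
  set X := semiMatrix b b (C.compFrob hπ τ) with hXd
  have hX'' : semiMatrix b' b' (C.compFrob hπ τ.frobInv) = X' :=
    semiMatrix_eq _ _ _ fun j => Subtype.ext (hX' j)
  let G : C.comp τ.frobInv →ₛₗ[((WOL.frobPow τ hπ : WOL τ →+* WOL τ).comp
      (WOL.frobEquiv τ : WOL τ.frobInv →+* WOL τ))] C.comp τ :=
    { toFun := fun x => C.compFrob hπ τ (C.compF τ x)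
      map_add' := fun x y => by rw [map_add, map_add]
      map_smul' := fun r x => by rw [LinearMap.map_smulₛₗ, LinearMap.map_smulₛₗ]; rfl }
  -- As `F_τ` commutes with `F^f`, its matrix `Q`, invertible over `K`, carries a triangularizing
  -- basis at `σ⁻¹τ` to one at `τ` with the same matrix `Y`.
  have hcomm : X * Q.map (WOL.frobPow τ hπ) = Q * X'.map (WOL.frobEquiv τ) := by
    have h1 := semiMatrix_comp b' b b (C.compF τ) (C.compFrob hπ τ) G fun _ => rfl
    have h2 := semiMatrix_comp b' b' b (C.compFrob hπ τ.frobInv) (C.compF τ) G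
      fun j => C.compFrob_compF hπ τ (b' j)
    rw [hX''] at h2
    exact h1.symm.trans h2
  let ι : WOL τ →+* E.K := E.ofFrobInv.ofWOL
  have hι : Function.Injective ι :=
    SlopeSetting.ι_injective (S := E.ofFrobInv.setting hπ) (WOL.irreducible_ofInt τ hπ)
  have hφι : ∀ r, E.frob (ι r) = ι (WOL.frobPow τ hπ r) := (E.ofFrobInv.setting hπ).φ_ι
  have hιE : ∀ r, ι (WOL.frobEquiv τ r) = E.ofWOL r := E.ofFrobInv_ofWOL
  have hdet : IsUnit (Q.map ι * P).det := by
    rw [Matrix.det_mul]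
    refine IsUnit.mul (IsUnit.mk0 _ ?_) hP
    have h1 : (Q.map ι).det = ι Q.det := (RingHom.map_det _ _).symm
    rw [h1]
    intro h2
    exact det_semiMatrix_ne_zero (WOL.frobEquiv τ) (C.compF_injective τ) b' b
      (hι (h2.trans (map_zero _).symm))
  have hfinal : X.map ι * (Q.map ι * P).map E.frob = Q.map ι * P * Y := by
    have h1 : (Q.map ι * P).map E.frob = (Q.map (WOL.frobPow τ hπ)).map ι * P.map E.frob := by
      refine Matrix.map_mul.trans (congrArg (· * _) ?_)
      ext i j
      exact hφι (Q i j)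
    have h2 : (X'.map (WOL.frobEquiv τ)).map ι = X'.map E.ofWOL := by
      ext i j
      exact hιE (X' i j)
    rw [h1, ← Matrix.mul_assoc, ← Matrix.map_mul, hcomm, Matrix.map_mul, h2, Matrix.mul_assoc, heq,
      Matrix.mul_assoc]
  exact ⟨hs, b, X, fun j => congrArg Subtype.val (apply_basis b b (C.compFrob hπ τ) j),
    E.ofFrobInv, Q.map ι * P, Y, hdet, hfinal, hY, hv⟩

end Transport

namespace Crystal

variable {p : ℕ} [Fact p.Prime] {k : Type*} [Field k] [CharP k p] [PerfectRing k p]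
  {L : Type*} [Field L] [Algebra ℚ_[p] L] [Algebra ℤ_[p] L] [IsScalarTower ℤ_[p] ℚ_[p] L]
  [FiniteDimensional ℚ_[p] L] {π : OL p L}
  {M : Type*} [AddCommGroup M] [Module (WittVector p k) M]

/-! ### Components of sub-crystals -/

namespace Sub

variable {C : Crystal p k L M} (N : C.Sub)

theorem ext_carrier {N N' : C.Sub} (h : N.carrier = N'.carrier) : N = N' := by
  cases N
  cases N'
  simp only at h
  subst h
  rfl

/-- The part of `M_τ` lying in a sub-crystal. -/
def part (τ : Emb p L k) : Submodule (WOL τ) (C.comp τ) where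
  carrier := {x | (x : M) ∈ N.carrier}
  add_mem' hx hy := N.carrier.add_mem hx hy
  zero_mem' := N.carrier.zero_mem
  smul_mem' r x hx := by
    induction r using WOL.induction_on' with
    | hmul c a =>
      change (((WOL.ofWitt τ c * WOL.ofInt τ a) • x : C.comp τ) : M) ∈ N.carrier
      rw [coe_mul_smul]
      exact N.carrier.smul_mem c (N.act_mem a _ hx)
    | hadd r s hr hs =>
      change (((r + s) • x : C.comp τ) : M) ∈ N.carrier
      rw [add_smul]
      exact N.carrier.add_mem hr hs

theorem compF_mem_part {τ : Emb p L k} {x : C.comp τ.frobInv} (hx : x ∈ N.part τ.frobInv) :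
    C.compF τ x ∈ N.part τ := N.F_mem _ hx

theorem iterate_F_mem (n : ℕ) {x : M} (hx : x ∈ N.carrier) : C.F^[n] x ∈ N.carrier := by
  induction n with
  | zero => exact hx
  | succ n ih =>
    rw [Function.iterate_succ_apply']
    exact N.F_mem _ ih

theorem mem_comp_iff {τ : Emb p L k} (x : N.carrier) :
    x ∈ N.crystal.comp τ ↔ (x : M) ∈ C.comp τ :=
  forall_congr' fun _ => Subtype.ext_iff

theorem coe_crystal_smul (τ : Emb p L k) (r : WOL τ) (x : N.crystal.comp τ) :
    (((r • x : N.crystal.comp τ) : N.carrier) : M) =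
      ((r • (⟨((x : N.carrier) : M), (N.mem_comp_iff _).1 x.2⟩ : C.comp τ) : C.comp τ) : M) := by
  induction r using WOL.induction_on' with
  | hmul c a =>
    have h1 := congrArg (Subtype.val : N.carrier → M) (N.crystal.coe_mul_smul τ c a x)
    have h2 := C.coe_mul_smul τ c a ⟨((x : N.carrier) : M), (N.mem_comp_iff _).1 x.2⟩
    exact h1.trans h2.symm
  | hadd r s hr hs =>
    rw [add_smul, add_smul]
    exact congrArg₂ (· + ·) hr hs

/-- The components of a sub-crystal. -/
def partEquiv (τ : Emb p L k) : N.crystal.comp τ ≃ₗ[WOL τ] N.part τ where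
  toFun x := ⟨⟨(x : N.carrier), (N.mem_comp_iff _).1 x.2⟩, (x : N.carrier).2⟩
  invFun x := ⟨⟨((x : C.comp τ) : M), x.2⟩, (N.mem_comp_iff _).2 (x : C.comp τ).2⟩
  left_inv _ := rfl
  right_inv _ := rfl
  map_add' _ _ := rfl
  map_smul' r x := Subtype.ext (Subtype.ext (N.coe_crystal_smul τ r x))

theorem coe_iterate_crystal_F (n : ℕ) (x : N.carrier) :
    ((N.crystal.F^[n] x : N.carrier) : M) = C.F^[n] (x : M) := by
  induction n with
  | zero => rfl
  | succ n ih =>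
    rw [Function.iterate_succ_apply', Function.iterate_succ_apply', ← ih]
    rfl

theorem rank_crystal (τ : Emb p L k) :
    N.crystal.rank τ = Module.finrank (WOL τ) (N.part τ) :=
  (N.partEquiv τ).finrank_eq

end Sub

/-! ### Sub-crystals defined by growth conditions -/

variable (C : Crystal p k L M)

theorem act_pow_mul (a b : ℕ) (x : M) :
    C.act (π ^ (a + b)) x = C.act (π ^ a) (C.act (π ^ b) x) := by
  rw [pow_add, map_mul, Module.End.mul_apply]

variable (π) in
/-- The elements `x` of `M` such that `π ^ c * F^{fm} x` is divisible by `π ^ b m` for all `m`. -/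
def slowLevel (b : ℕ → ℕ) (c : ℕ) : Submodule (WittVector p k) M where
  carrier := {x | ∀ m, ∃ y, C.act (π ^ c) (C.F^[residueDegree p L π * m] x) = C.act (π ^ b m) y}
  add_mem' {x x'} hx hx' m := by
    obtain ⟨y, hy⟩ := hx m
    obtain ⟨y', hy'⟩ := hx' m
    exact ⟨y + y', by rw [C.iterate_F_add, map_add, hy, hy', map_add]⟩
  zero_mem' m := ⟨0, by rw [iterate_map_zero, map_zero, map_zero]⟩
  smul_mem' r x hx m := by
    obtain ⟨y, hy⟩ := hx m
    exact ⟨WittVector.frobenius^[residueDegree p L π * m] r • y, by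
      rw [C.iterate_F_smul, map_smul, hy, map_smul]⟩

theorem slowLevel_mono (b : ℕ → ℕ) : Monotone (C.slowLevel π b) := fun c c' h x hx m => by
  obtain ⟨y, hy⟩ := hx m
  obtain ⟨d, rfl⟩ := Nat.exists_eq_add_of_le' h
  refine ⟨C.act (π ^ d) y, ?_⟩
  rw [act_pow_mul, hy, ← act_pow_mul, add_comm, act_pow_mul]

variable (π) in
/-- The sub-crystal on which `F^{fm}` is divisible by `π ^ b m`, up to a bounded power of `π`. -/
def slowSub (b : ℕ → ℕ) : C.Sub where
  carrier := ⨆ c, C.slowLevel π b c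
  F_mem x hx := by
    rw [Submodule.mem_iSup_of_directed _ (C.slowLevel_mono b).directed_le] at hx ⊢
    obtain ⟨c, hc⟩ := hx
    refine ⟨c, fun m => ?_⟩
    obtain ⟨y, hy⟩ := hc m
    refine ⟨C.F y, ?_⟩
    rw [← C.act_F, ← hy, C.act_F, ← Function.iterate_succ_apply' C.F,
      Function.iterate_succ_apply C.F]
  act_mem a x hx := by
    rw [Submodule.mem_iSup_of_directed _ (C.slowLevel_mono b).directed_le] at hx ⊢
    obtain ⟨c, hc⟩ := hx
    refine ⟨c, fun m => ?_⟩
    obtain ⟨y, hy⟩ := hc m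
    refine ⟨C.act a y, ?_⟩
    rw [C.iterate_F_act, ← Module.End.mul_apply, ← map_mul, mul_comm, map_mul, Module.End.mul_apply,
      hy, ← Module.End.mul_apply, ← map_mul, mul_comm, map_mul, Module.End.mul_apply]

theorem mem_slowSub {b : ℕ → ℕ} {x : M} :
    x ∈ (C.slowSub π b).carrier ↔ ∃ c, x ∈ C.slowLevel π b c :=
  Submodule.mem_iSup_of_directed _ (C.slowLevel_mono b).directed_le

/-- Noetherianity makes the bounded power of `π` uniform on the slow part; disjointness and the
growth of the slow block both depend on this uniformity. -/
theorem exists_slowLevel_eq (b : ℕ → ℕ) :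
    ∃ c, ∀ x ∈ (C.slowSub π b).carrier, x ∈ C.slowLevel π b c := by
  have := C.finite
  obtain ⟨c, hc⟩ := monotone_stabilizes_iff_noetherian.2
    (inferInstance : IsNoetherian (WittVector p k) M) ⟨C.slowLevel π b, C.slowLevel_mono b⟩
  refine ⟨c, fun x hx => ?_⟩
  obtain ⟨d, hd⟩ := C.mem_slowSub.1 hx
  have h1 : C.slowLevel π b c = C.slowLevel π b (max c d) := hc _ (le_max_left _ _)
  rw [h1]
  exact C.slowLevel_mono b (le_max_right _ _) hd

theorem mem_slowSub_of_act_pow {b : ℕ → ℕ} {n : ℕ} {x : M}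
    (h : C.act (π ^ n) x ∈ (C.slowSub π b).carrier) : x ∈ (C.slowSub π b).carrier := by
  rw [mem_slowSub] at h ⊢
  obtain ⟨c, hc⟩ := h
  refine ⟨c + n, fun m => ?_⟩
  obtain ⟨y, hy⟩ := hc m
  refine ⟨y, ?_⟩
  rwa [act_pow_mul, ← C.iterate_F_act]

/-- Conditions on the growth of `b` under which `F^{fm} x` is slow only if `x` is slow. -/
theorem mem_slowSub_of_iterate {b : ℕ → ℕ} (hb : ∀ m, ∃ B, ∀ l, b (l + m) ≤ b l + B)
    {n : ℕ} {x : M} (h : C.F^[residueDegree p L π * n] x ∈ (C.slowSub π b).carrier) :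
    x ∈ (C.slowSub π b).carrier := by
  rw [mem_slowSub] at h ⊢
  obtain ⟨c, hc⟩ := h
  obtain ⟨B, hB⟩ := hb n
  -- The sum of the `b l` disposes of the levels `m < n`; for the others, `B` bounds the effect of
  -- the shift by `n`.
  refine ⟨c + B + ∑ l ∈ Finset.range n, b l, fun m => ?_⟩
  rcases lt_or_ge m n with hmn | hmn
  · have h1 : b m ≤ ∑ l ∈ Finset.range n, b l :=
      Finset.single_le_sum (f := b) (fun _ _ => Nat.zero_le _) (Finset.mem_range.2 hmn)
    obtain ⟨d, hd⟩ := Nat.exists_eq_add_of_le (h1.trans (Nat.le_add_left _ (c + B)))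
    exact ⟨_, by rw [hd, act_pow_mul]⟩
  · obtain ⟨l, rfl⟩ := Nat.exists_eq_add_of_le' hmn
    obtain ⟨y, hy⟩ := hc l
    rw [← Function.iterate_add_apply, ← mul_add] at hy
    obtain ⟨d, hd⟩ := Nat.exists_eq_add_of_le (hB l)
    refine ⟨C.act (π ^ (d + ∑ l ∈ Finset.range n, b l)) y, ?_⟩
    rw [show c + B + ∑ l ∈ Finset.range n, b l = (B + ∑ l ∈ Finset.range n, b l) + c by ring,
      act_pow_mul, hy, ← act_pow_mul, ← act_pow_mul]
    congr 3
    omega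

variable (π) in
/-- The sub-crystal on which the inverse of `F^{fm}` is defined, up to `π ^ b m` and a bounded power
of `π`. -/
def fastSub (b : ℕ → ℕ) : C.Sub where
  carrier :=
    { carrier := {x | ∃ c, ∀ m, ∃ y, C.act (π ^ (c + b m)) x = C.F^[residueDegree p L π * m] y}
      add_mem' := by
        rintro x x' ⟨c, hc⟩ ⟨c', hc'⟩
        refine ⟨c + c', fun m => ?_⟩
        obtain ⟨y, hy⟩ := hc m
        obtain ⟨y', hy'⟩ := hc' m
        refine ⟨C.act (π ^ c') y + C.act (π ^ c) y', ?_⟩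
        rw [C.iterate_F_add, C.iterate_F_act, C.iterate_F_act, ← hy, ← hy', ← act_pow_mul,
          ← act_pow_mul, map_add]
        congr 4 <;> omega
      zero_mem' := ⟨0, fun m => ⟨0, by rw [iterate_map_zero, map_zero]⟩⟩
      smul_mem' := by
        rintro r x ⟨c, hc⟩
        refine ⟨c, fun m => ?_⟩
        obtain ⟨y, hy⟩ := hc m
        refine ⟨(WittVector.frobeniusEquiv p k).symm^[residueDegree p L π * m] r • y, ?_⟩
        rw [map_smul, hy, C.iterate_F_smul]
        congr 1
        exact (Function.LeftInverse.iterate (WittVector.frobeniusEquiv p k).apply_symm_apply _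
          r).symm }
  F_mem := by
    rintro x ⟨c, hc⟩
    refine ⟨c, fun m => ?_⟩
    obtain ⟨y, hy⟩ := hc m
    refine ⟨C.F y, ?_⟩
    rw [← C.act_F, hy, ← Function.iterate_succ_apply' C.F, Function.iterate_succ_apply C.F]
  act_mem := by
    rintro a x ⟨c, hc⟩
    refine ⟨c, fun m => ?_⟩
    obtain ⟨y, hy⟩ := hc m
    refine ⟨C.act a y, ?_⟩
    rw [C.iterate_F_act, ← hy, ← Module.End.mul_apply, ← map_mul, mul_comm, map_mul,
      Module.End.mul_apply]

theorem mem_fastSub {b : ℕ → ℕ} {x : M} : x ∈ (C.fastSub π b).carrier ↔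
    ∃ c, ∀ m, ∃ y, C.act (π ^ (c + b m)) x = C.F^[residueDegree p L π * m] y := Iff.rfl

theorem mem_fastSub_of_act_pow {b : ℕ → ℕ} {n : ℕ} {x : M}
    (h : C.act (π ^ n) x ∈ (C.fastSub π b).carrier) : x ∈ (C.fastSub π b).carrier := by
  obtain ⟨c, hc⟩ := h
  refine ⟨c + n, fun m => ?_⟩
  obtain ⟨y, hy⟩ := hc m
  refine ⟨y, ?_⟩
  rw [← hy, ← act_pow_mul]
  congr 3
  omega

theorem eq_zero_of_forall_act_pow (hπ : Irreducible π) {x : M}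
    (h : ∀ n, ∃ z, x = C.act (π ^ n) z) : x = 0 := by
  have := C.free
  let b := Module.Free.chooseBasis (WittVector p k) M
  refine b.repr.injective (Finsupp.ext fun i => ?_)
  rw [map_zero, Finsupp.zero_apply]
  refine adicComplete_witt.separated _ fun n => ?_
  obtain ⟨z, hz⟩ := h (ramIndex hπ * n)
  obtain ⟨u, hu⟩ := (associated_p_pow_ramIndex hπ).pow_pow (n := n)
  rw [← pow_mul] at hu
  have h1 : ∀ (n : ℕ) (y : M), C.act ((p : OL p L) ^ n) y = (p : WittVector p k) ^ n • y := by
    intro n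
    induction n with
    | zero => simp
    | succ n ih =>
      intro y
      rw [pow_succ, map_mul, Module.End.mul_apply, ih, act_p, smul_smul, pow_succ]
  rw [hz, ← hu, map_mul, Module.End.mul_apply, h1, map_smul, Finsupp.smul_apply, smul_eq_mul]
  exact dvd_mul_right _ _

/-- If `x` is in both, `π^(c + b₁ m) x = F^{fm} y`, and `y` is slow because its iterate is. The
uniform exponent `c'` then makes `π^(c' + c + b₁ m) x` divisible by `π^(b₂ m)`, so `x` is divisible
by every power of `π`. -/
theorem disjoint_fastSub_slowSub (hπ : Irreducible π) {b₁ b₂ : ℕ → ℕ}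
    (hb : ∀ m, ∃ B, ∀ l, b₂ (l + m) ≤ b₂ l + B) (hb' : ∀ N, ∃ m, b₁ m + N ≤ b₂ m) :
    Disjoint (C.fastSub π b₁).carrier (C.slowSub π b₂).carrier := by
  rw [Submodule.disjoint_def]
  rintro x ⟨c, hc⟩ hx₂
  obtain ⟨c', hc'⟩ := C.exists_slowLevel_eq (π := π) b₂
  refine C.eq_zero_of_forall_act_pow hπ fun N => ?_
  obtain ⟨m, hm⟩ := hb' (c + c' + N)
  obtain ⟨y, hy⟩ := hc m
  have hys : y ∈ (C.slowSub π b₂).carrier := by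
    refine C.mem_slowSub_of_iterate hb (n := m) ?_
    rw [← hy]
    exact (C.slowSub π b₂).act_mem _ _ hx₂
  obtain ⟨z, hz⟩ := hc' y hys m
  rw [← hy, ← act_pow_mul] at hz
  obtain ⟨d, hd⟩ := Nat.exists_eq_add_of_le hm
  refine ⟨C.act (π ^ d) z, C.act_pow_injective hπ (c' + (c + b₁ m)) ?_⟩
  rw [hz, ← act_pow_mul, ← act_pow_mul, hd]
  congr 3
  omega

end Crystal

/-! ### Bases adapted to saturated submodules -/

/-- Saturation makes the quotient torsion free, hence free, so a basis of `W` can be completed by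
lifts of a basis of the quotient. -/
theorem exists_adapted_basis {R N : Type*} [CommRing R] [IsDomain R] [IsDiscreteValuationRing R]
    [AddCommGroup N] [Module R N] [Module.Finite R N] [Module.Free R N] {ϖ : R}
    (hϖ : Irreducible ϖ) {W : Submodule R N} (hW : ∀ n x, ϖ ^ n • x ∈ W → x ∈ W) {r d : ℕ}
    (hd : Module.finrank R W = d) (hr : Module.finrank R N = r + d) :
    ∃ e : Module.Basis (Fin r ⊕ Fin d) R N, ∀ x, x ∈ W ↔ ∀ a, e.repr x (Sum.inl a) = 0 := by
  have htf : Module.IsTorsionFree R (N ⧸ W) := by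
    refine Module.IsTorsionFree.of_smul_eq_zero fun c x h => or_iff_not_imp_left.2 fun hc => ?_
    obtain ⟨x, rfl⟩ := W.mkQ_surjective x
    obtain ⟨n, u, rfl⟩ := IsDiscreteValuationRing.eq_unit_mul_pow_irreducible hc hϖ
    rw [← map_smul, Submodule.mkQ_apply, Submodule.Quotient.mk_eq_zero] at h
    rw [Submodule.mkQ_apply, Submodule.Quotient.mk_eq_zero]
    refine hW n x ?_
    have h1 := W.smul_mem ((u⁻¹ : Rˣ) : R) h
    rwa [smul_smul, ← mul_assoc, Units.inv_mul, one_mul] at h1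
  have hfree : Module.Free R (N ⧸ W) := Module.free_of_finite_type_torsion_free'
  have hr' : Module.finrank R (N ⧸ W) = r := by
    have := W.finrank_quotient_add_finrank
    omega
  let bW := Module.finBasisOfFinrankEq R W hd
  let bQ := Module.finBasisOfFinrankEq R (N ⧸ W) hr'
  refine ⟨(bW.sumQuot bQ).reindex (Equiv.sumComm _ _), fun x => ?_⟩
  simp only [Module.Basis.repr_reindex_apply, Equiv.sumComm_symm, Equiv.sumComm_apply, Sum.swap_inl,
    Module.Basis.sumQuot_repr_inr]
  rw [← Submodule.Quotient.mk_eq_zero, ← bQ.repr.map_eq_zero_iff, Finsupp.ext_iff]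
  rfl

namespace Crystal

variable {p : ℕ} [Fact p.Prime] {k : Type*} [Field k] [CharP k p] [PerfectRing k p]
  {L : Type*} [Field L] [Algebra ℚ_[p] L] [Algebra ℤ_[p] L] [IsScalarTower ℤ_[p] ℚ_[p] L]
  [FiniteDimensional ℚ_[p] L] {π : OL p L}
  {M : Type*} [AddCommGroup M] [Module (WittVector p k) M] {C : Crystal p k L M}

namespace Sub

variable (N : C.Sub)

/-- The sub-crystal `N` contains every `x` of which some multiple by a power of `π` is in `N`. -/
def IsSaturated (π : OL p L) : Prop := ∀ n x, C.act (π ^ n) x ∈ N.carrier → x ∈ N.carrier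

theorem mem_part_of_smul {N : C.Sub} (hπ : Irreducible π) (hN : N.IsSaturated π) {τ : Emb p L k}
    {r : WOL τ} (hr : r ≠ 0) {x : C.comp τ} (hx : r • x ∈ N.part τ) : x ∈ N.part τ := by
  obtain ⟨n, u, rfl⟩ := IsDiscreteValuationRing.eq_unit_mul_pow_irreducible hr
    (WOL.irreducible_ofInt τ hπ)
  have h1 := (N.part τ).smul_mem ((u⁻¹ : (WOL τ)ˣ) : WOL τ) hx
  rw [smul_smul, ← mul_assoc, Units.inv_mul, one_mul, ← map_pow] at h1
  refine hN n x ?_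
  rw [← C.coe_ofInt_smul τ]
  exact h1

/-- In the basis `e` of `M_τ`, the part of `M_τ` in `N` is defined by the vanishing of the first
coordinates. -/
def IsAdapted {n₁ n₂ : Type*} {τ : Emb p L k} (e : Module.Basis (n₁ ⊕ n₂) (WOL τ) (C.comp τ)) :
    Prop :=
  ∀ x, x ∈ N.part τ ↔ ∀ a, e.repr x (Sum.inl a) = 0

theorem exists_isAdapted {N : C.Sub} (hπ : Irreducible π) (hN : N.IsSaturated π) (τ : Emb p L k)
    {r d : ℕ} (hd : N.crystal.rank τ = d) (hr : C.rank τ = r + d) :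
    ∃ e : Module.Basis (Fin r ⊕ Fin d) (WOL τ) (C.comp τ), N.IsAdapted e :=
  exists_adapted_basis (WOL.irreducible_ofInt τ hπ)
    (fun n _ hx => mem_part_of_smul hπ hN
      (pow_ne_zero n (WOL.irreducible_ofInt τ hπ).ne_zero) hx)
    ((N.rank_crystal τ).symm.trans hd) hr

variable {N} {n₁ n₂ : Type*} [Fintype n₁] [Fintype n₂] [DecidableEq n₁] [DecidableEq n₂]

theorem IsAdapted.inr_mem {τ : Emb p L k} {e : Module.Basis (n₁ ⊕ n₂) (WOL τ) (C.comp τ)}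
    (he : N.IsAdapted e) (b : n₂) : e (Sum.inr b) ∈ N.part τ := by
  rw [he]
  intro a
  rw [e.repr_self, Finsupp.single_eq_of_ne (by simp)]

theorem IsAdapted.sum_sub_mem {τ : Emb p L k} {e : Module.Basis (n₁ ⊕ n₂) (WOL τ) (C.comp τ)}
    (he : N.IsAdapted e) (x : C.comp τ) :
    x - ∑ a, e.repr x (Sum.inl a) • e (Sum.inl a) ∈ N.part τ := by
  have h := e.sum_repr x
  rw [Fintype.sum_sum_type] at h
  have h1 : x - ∑ a, e.repr x (Sum.inl a) • e (Sum.inl a) =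
      ∑ b, e.repr x (Sum.inr b) • e (Sum.inr b) := by
    rw [sub_eq_iff_eq_add', h]
  rw [h1]
  exact sum_mem fun b _ => Submodule.smul_mem _ _ (he.inr_mem b)

theorem IsAdapted.toBlocks₁₂ {τ τ' : Emb p L k} {s : WOL τ →+* WOL τ'}
    {e : Module.Basis (n₁ ⊕ n₂) (WOL τ) (C.comp τ)} {e' : Module.Basis (n₁ ⊕ n₂) (WOL τ') (C.comp τ')}
    (he : N.IsAdapted e) (he' : N.IsAdapted e') {G : C.comp τ →ₛₗ[s] C.comp τ'}
    (hG : ∀ x ∈ N.part τ, G x ∈ N.part τ') : (semiMatrix e e' G).toBlocks₁₂ = 0 := by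
  ext a b
  exact (he' _).1 (hG _ (he.inr_mem b)) a

theorem IsAdapted.fromBlocks_eq {τ τ' : Emb p L k} {s : WOL τ →+* WOL τ'}
    {e : Module.Basis (n₁ ⊕ n₂) (WOL τ) (C.comp τ)} {e' : Module.Basis (n₁ ⊕ n₂) (WOL τ') (C.comp τ')}
    (he : N.IsAdapted e) (he' : N.IsAdapted e') {G : C.comp τ →ₛₗ[s] C.comp τ'}
    (hG : ∀ x ∈ N.part τ, G x ∈ N.part τ') : semiMatrix e e' G =
      Matrix.fromBlocks (semiMatrix e e' G).toBlocks₁₁ 0 (semiMatrix e e' G).toBlocks₂₁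
        (semiMatrix e e' G).toBlocks₂₂ := by
  rw [← he.toBlocks₁₂ he' hG, Matrix.fromBlocks_toBlocks]

end Sub
end Crystal

/-! ### Graphs over the first part of a basis -/

section Graph

variable {R N : Type*} [CommRing R] [AddCommGroup N] [Module R N] {n₁ n₂ : Type*} [Fintype n₁]
  [Fintype n₂] [DecidableEq n₁] [DecidableEq n₂]

theorem sum_one_smul (u : n₁ → N) (b : n₁) : ∑ a, (1 : Matrix n₁ n₁ R) a b • u a = u b := by
  rw [Finset.sum_eq_single b]
  · rw [Matrix.one_apply_eq, one_smul]
  · intro a _ ha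
    rw [Matrix.one_apply_ne ha, zero_smul]
  · simp

theorem sum_mul_smul (A B : Matrix n₁ n₁ R) (u : n₁ → N) (b : n₁) :
    ∑ a, (A * B) a b • u a = ∑ c, B c b • ∑ a, A a c • u a := by
  simp only [Matrix.mul_apply, Finset.sum_smul, Finset.smul_sum, smul_smul]
  rw [Finset.sum_comm]
  simp only [mul_comm]

/-- The vectors of the graph of `Z`. -/
def graphVec (e : Module.Basis (n₁ ⊕ n₂) R N) (Z : Matrix n₂ n₁ R) (b : n₁) : N :=
  e (Sum.inl b) + ∑ c, Z c b • e (Sum.inr c)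

theorem repr_graphVec_inl (e : Module.Basis (n₁ ⊕ n₂) R N) (Z : Matrix n₂ n₁ R) (a b : n₁) :
    e.repr (graphVec e Z b) (Sum.inl a) = (1 : Matrix n₁ n₁ R) a b := by
  simp [graphVec, Finsupp.single_apply, Matrix.one_apply, eq_comm]

theorem repr_graphVec_inr (e : Module.Basis (n₁ ⊕ n₂) R N) (Z : Matrix n₂ n₁ R) (c : n₂) (b : n₁) :
    e.repr (graphVec e Z b) (Sum.inr c) = Z c b := by
  simp [graphVec, Finsupp.single_apply]

theorem sum_smul_graphVec (e : Module.Basis (n₁ ⊕ n₂) R N) {Z : Matrix n₂ n₁ R}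
    {A : Matrix n₁ n₁ R} {B : Matrix n₂ n₁ R} (h : Z * A = B) (b : n₁) :
    ∑ a, A a b • graphVec e Z a = ∑ a, A a b • e (Sum.inl a) + ∑ c, B c b • e (Sum.inr c) := by
  simp only [graphVec, smul_add, Finset.sum_add_distrib, Finset.smul_sum, smul_smul, ← h,
    Matrix.mul_apply, Finset.sum_smul]
  congr 1
  rw [Finset.sum_comm]
  simp only [mul_comm]

variable {s : R →+* R} {G : N →ₛₗ[s] N} {e : Module.Basis (n₁ ⊕ n₂) R N}

theorem repr_apply_graphVec_inl (h : (semiMatrix e e G).toBlocks₁₂ = 0) (Z : Matrix n₂ n₁ R)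
    (a b : n₁) : e.repr (G (graphVec e Z b)) (Sum.inl a) = (semiMatrix e e G).toBlocks₁₁ a b := by
  have h1 : ∀ c, semiMatrix e e G (Sum.inl a) (Sum.inr c) = 0 := fun c => congrFun (congrFun h a) c
  rw [repr_apply e e, Fintype.sum_sum_type]
  simp only [h1, zero_mul, Finset.sum_const_zero, add_zero, repr_graphVec_inl]
  simp [Matrix.one_apply, apply_ite s, Matrix.toBlocks₁₁]

theorem repr_apply_graphVec_inr (Z : Matrix n₂ n₁ R) (c : n₂) (b : n₁) :
    e.repr (G (graphVec e Z b)) (Sum.inr c) =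
      ((semiMatrix e e G).toBlocks₂₁ + (semiMatrix e e G).toBlocks₂₂ * Z.map s) c b := by
  rw [repr_apply e e, Fintype.sum_sum_type]
  simp only [repr_graphVec_inl, repr_graphVec_inr]
  simp [Matrix.one_apply, apply_ite s, Matrix.toBlocks₂₁, Matrix.toBlocks₂₂, Matrix.mul_apply]

/-- For `Z' = Z` the equation says that the graph of `Z` is stable by `G`, which acts on it through
the upper left block. -/
theorem apply_graphVec (h : (semiMatrix e e G).toBlocks₁₂ = 0) {Z Z' : Matrix n₂ n₁ R}
    (hZ : Z' * (semiMatrix e e G).toBlocks₁₁ =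
      (semiMatrix e e G).toBlocks₂₁ + (semiMatrix e e G).toBlocks₂₂ * Z.map s) (b : n₁) :
    G (graphVec e Z b) = ∑ a, (semiMatrix e e G).toBlocks₁₁ a b • graphVec e Z' a := by
  rw [sum_smul_graphVec e hZ, ← e.sum_repr (G (graphVec e Z b)), Fintype.sum_sum_type]
  simp only [repr_apply_graphVec_inl h, repr_apply_graphVec_inr]

/-- Comparing first coordinates identifies `A` with the upper left block; the second coordinates of
the `u a` are then the matrix sought. -/
theorem exists_graph_eq (h : (semiMatrix e e G).toBlocks₁₂ = 0) {Z : Matrix n₂ n₁ R}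
    {A : Matrix n₁ n₁ R} {u : n₁ → N}
    (hu : ∀ a b, e.repr (u b) (Sum.inl a) = (1 : Matrix n₁ n₁ R) a b)
    (hA : ∀ b, G (graphVec e Z b) = ∑ a, A a b • u a) :
    ∃ Z' : Matrix n₂ n₁ R, Z' * (semiMatrix e e G).toBlocks₁₁ =
      (semiMatrix e e G).toBlocks₂₁ + (semiMatrix e e G).toBlocks₂₂ * Z.map s := by
  have h1 : ∀ j b, e.repr (G (graphVec e Z b)) j = ∑ a, A a b * e.repr (u a) j := fun j b => by
    rw [hA, map_sum, Finsupp.finsetSum_apply]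
    simp only [map_smul, Finsupp.smul_apply, smul_eq_mul]
  have hXA : (semiMatrix e e G).toBlocks₁₁ = A := by
    ext a b
    rw [← repr_apply_graphVec_inl h Z, h1]
    simp [hu, Matrix.one_apply]
  refine ⟨Matrix.of fun c a => e.repr (u a) (Sum.inr c), ?_⟩
  ext c b
  rw [← repr_apply_graphVec_inr, h1, hXA, Matrix.mul_apply]
  simp only [Matrix.of_apply, mul_comm]

end Graph

/-! ### The Frobenius modulo a sub-crystal, along the cycle of embeddings -/

namespace Crystal

variable {p : ℕ} [Fact p.Prime] {k : Type*} [Field k] [CharP k p] [PerfectRing k p]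
  {L : Type*} [Field L] [Algebra ℚ_[p] L] [Algebra ℤ_[p] L] [IsScalarTower ℤ_[p] ℚ_[p] L]
  [FiniteDimensional ℚ_[p] L] {π : OL p L}
  {M : Type*} [AddCommGroup M] [Module (WittVector p k) M] {C : Crystal p k L M}

theorem compF_mem_imageF (τ : Emb p L k) (x : C.comp τ.frobInv) : C.compF τ x ∈ C.imageF τ :=
  ⟨x, x.2, rfl⟩

theorem coe_iterate_compFrob (hπ : Irreducible π) (τ : Emb p L k) (m : ℕ) (x : C.comp τ) :
    (((C.compFrob hπ τ)^[m] x : C.comp τ) : M) = C.F^[residueDegree p L π * m] x := by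
  induction m with
  | zero => rfl
  | succ m ih =>
    rw [Function.iterate_succ_apply', coe_compFrob, ih, ← Function.iterate_add_apply]
    rw [mul_add_one, add_comm]

theorem Sub.compFrob_mem_part {N : C.Sub} (hπ : Irreducible π) {τ : Emb p L k} {x : C.comp τ}
    (hx : x ∈ N.part τ) : C.compFrob hπ τ x ∈ N.part τ := N.iterate_F_mem _ hx

section Chain

variable {N : C.Sub} {n₁ n₂ : Type*} [Fintype n₁] [Fintype n₂] [DecidableEq n₁] [DecidableEq n₂]
  (e : ∀ τ : Emb p L k, Module.Basis (n₁ ⊕ n₂) (WOL τ) (C.comp τ))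

/-- The matrix of `F_τ` modulo the second parts of the bases. -/
def diagBlock (τ : Emb p L k) : Matrix n₁ n₁ (WOL τ) :=
  (semiMatrix (e τ.frobInv) (e τ) (C.compF τ)).toBlocks₁₁

variable {e}

theorem det_diagBlock_ne_zero (he : ∀ τ, N.IsAdapted (e τ)) (τ : Emb p L k) :
    (diagBlock e τ).det ≠ 0 := fun h0 => by
  have h1 := det_semiMatrix_ne_zero (WOL.frobEquiv τ) (C.compF_injective τ) (e τ.frobInv) (e τ)
  rw [(he _).fromBlocks_eq (he τ) fun _ => N.compF_mem_part, Matrix.det_fromBlocks_zero₁₂] at h1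
  exact h1 (mul_eq_zero_of_left h0 _)

theorem compF_sub_sum_mem (he : ∀ τ, N.IsAdapted (e τ)) (τ : Emb p L k) (b : n₁) :
    C.compF τ (e τ.frobInv (Sum.inl b)) - ∑ a, diagBlock e τ a b • e τ (Sum.inl a) ∈ N.part τ :=
  (he τ).sum_sub_mem _

/-- Modulo the sub-crystal, `F^n` is the product of the twisted blocks at the successive embeddings.
The twists fix `π`, so the orders of the determinants add up. -/
theorem exists_iterate_F_sub_mem (he : ∀ τ, N.IsAdapted (e τ)) {r : Emb p L k → ℕ}
    (hr : ∀ τ, Associated (diagBlock e τ).det (WOL.ofInt τ π ^ r τ)) (n : ℕ) (τ : Emb p L k) :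
    ∃ A : Matrix n₁ n₁ (WOL τ),
      Associated A.det (WOL.ofInt τ π ^ ∑ j ∈ Finset.range n, r (Emb.frobInv^[j] τ)) ∧
      ∀ b, C.F^[n] (e (Emb.frobInv^[n] τ) (Sum.inl b)) -
        ((∑ a, A a b • e τ (Sum.inl a) : C.comp τ) : M) ∈ N.carrier := by
  induction n generalizing τ with
  | zero =>
    refine ⟨1, by simp, fun b => ?_⟩
    rw [sum_one_smul (fun a => e τ (Sum.inl a))]
    exact (sub_self (e τ (Sum.inl b) : M)).symm ▸ N.carrier.zero_mem
  | succ n ih =>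
    obtain ⟨A, hA, hA'⟩ := ih τ.frobInv
    refine ⟨diagBlock e τ * A.map (WOL.frobEquiv τ), ?_, fun b => ?_⟩
    · have h1 : (A.map (WOL.frobEquiv τ)).det = WOL.frobEquiv τ A.det :=
        (RingHom.map_det (WOL.frobEquiv τ : WOL τ.frobInv →+* WOL τ) A).symm
      have h2 := hA.map (WOL.frobEquiv τ : WOL τ.frobInv →+* WOL τ)
      rw [map_pow, RingEquiv.coe_toRingHom, WOL.frobEquiv_ofInt] at h2
      rw [Matrix.det_mul, h1, Finset.sum_range_succ', add_comm, pow_add]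
      exact (hr τ).mul_mul h2
    · have h1 : C.F^[n + 1] (e (Emb.frobInv^[n + 1] τ) (Sum.inl b)) -
          C.F ((∑ a, A a b • e τ.frobInv (Sum.inl a) : C.comp τ.frobInv) : M) ∈ N.carrier := by
        rw [Function.iterate_succ_apply' C.F, ← map_sub]
        exact N.F_mem _ (hA' b)
      have h2 : C.compF τ (∑ a, A a b • e τ.frobInv (Sum.inl a)) -
          ∑ c, (diagBlock e τ * A.map (WOL.frobEquiv τ)) c b • e τ (Sum.inl c) ∈ N.part τ := by
        have h3 : C.compF τ (∑ a, A a b • e τ.frobInv (Sum.inl a)) -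
            ∑ c, (diagBlock e τ * A.map (WOL.frobEquiv τ)) c b • e τ (Sum.inl c) =
            ∑ a, WOL.frobEquiv τ (A a b) • (C.compF τ (e τ.frobInv (Sum.inl a)) -
              ∑ c, diagBlock e τ c a • e τ (Sum.inl c)) := by
          rw [sum_mul_smul (diagBlock e τ) (A.map (WOL.frobEquiv τ)) fun c => e τ (Sum.inl c)]
          simp only [map_sum, LinearMap.map_smulₛₗ, smul_sub, Finset.sum_sub_distrib]
          rfl
        rw [h3]
        exact sum_mem fun a _ => Submodule.smul_mem _ _ (compF_sub_sum_mem he τ a)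
      have h4 := N.carrier.add_mem h1 h2
      rw [Submodule.coe_sub, coe_compF, sub_add_sub_cancel] at h4
      exact h4

/-- The determinant of the matrix of `F^f` modulo the second part of the basis. -/
theorem associated_det_compFrob (hπ : Irreducible π) (he : ∀ τ, N.IsAdapted (e τ))
    {r : Emb p L k → ℕ} (hr : ∀ τ, Associated (diagBlock e τ).det (WOL.ofInt τ π ^ r τ))
    (τ : Emb p L k) : Associated (semiMatrix (e τ) (e τ) (C.compFrob hπ τ)).toBlocks₁₁.det
      (WOL.ofInt τ π ^ ∑ j : Fin (residueDegree p L π), r (Emb.frobInv^[(j : ℕ)] τ)) := by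
  obtain ⟨A, hA, hA'⟩ := exists_iterate_F_sub_mem he hr (residueDegree p L π) τ
  rw [Finset.sum_range] at hA
  convert hA using 1
  congr 1
  ext a b
  -- The equality `σ^{-f} τ = τ` holds only propositionally, so basis vectors are compared inside
  -- `M`.
  have h1 : ∀ τ', τ' = τ → (e τ' (Sum.inl b) : M) = e τ (Sum.inl b) := by rintro _ rfl; rfl
  have h2 := hA' b
  rw [h1 _ (Emb.frobInv_iterate_residueDegree hπ τ)] at h2
  have h3 : C.compFrob hπ τ (e τ (Sum.inl b)) - ∑ a, A a b • e τ (Sum.inl a) ∈ N.part τ := h2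
  have h4 := ((he τ) _).1 h3 a
  rw [map_sub, Finsupp.sub_apply, sub_eq_zero] at h4
  refine h4.trans ?_
  simp only [map_sum, map_smul, Finsupp.finsetSum_apply, Finsupp.smul_apply, (e τ).repr_self,
    smul_eq_mul]
  rw [Finset.sum_eq_single a]
  · simp
  · intro c _ hc
    rw [Finsupp.single_eq_of_ne (by simpa using hc.symm), mul_zero]
  · simp

section Step

variable {r : Emb p L k → ℕ}

/-- By `hr` and `hmin`, the determinant of the block divides every minor of vectors in the image of
`F_τ`. Cramer's rule therefore divides the second coordinates of the `F_τ (u b)` by the block, and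
the quotient is the graph of the `u'`. -/
theorem exists_lift_compF (hr : ∀ τ, Associated (diagBlock e τ).det (WOL.ofInt τ π ^ r τ))
    (hmin : ∀ (τ : Emb p L k) (x : n₁ → C.comp τ) (ℓ : n₁ → C.comp τ →ₗ[WOL τ] WOL τ),
      (∀ b, x b ∈ C.imageF τ) → WOL.ofInt τ π ^ r τ ∣ (Matrix.of fun a b => ℓ a (x b)).det)
    (he : ∀ τ, N.IsAdapted (e τ)) (τ : Emb p L k) (u : n₁ → C.comp τ.frobInv)
    (hu : ∀ b, u b - e τ.frobInv (Sum.inl b) ∈ N.part τ.frobInv) :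
    ∃ u' : n₁ → C.comp τ, (∀ a, u' a - e τ (Sum.inl a) ∈ N.part τ) ∧
      ∀ b, C.compF τ (u b) = ∑ a, diagBlock e τ a b • u' a := by
  have h1 : ∀ a b, (e τ).repr (C.compF τ (u b)) (Sum.inl a) = diagBlock e τ a b := fun a b => by
    have h2 := ((he τ) _).1 (N.compF_mem_part (hu b)) a
    rw [map_sub, map_sub, Finsupp.sub_apply, sub_eq_zero] at h2
    exact h2
  obtain ⟨Z, hZ⟩ := exists_mul_eq_of_dvd_minors (det_diagBlock_ne_zero he τ)
    (C := Matrix.of fun c b => (e τ).repr (C.compF τ (u b)) (Sum.inr c)) fun c b => by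
      refine (hr τ).dvd.trans ?_
      -- The determinant with a replaced row is the minor for the first coordinate forms, the `b`-th
      -- one being replaced by the `c`-th second coordinate.
      convert hmin τ (fun b => C.compF τ (u b))
        (Function.update (fun a => (e τ).coord (Sum.inl a)) b ((e τ).coord (Sum.inr c)))
        (fun b => compF_mem_imageF τ (u b)) using 2
      ext a' b'
      rw [Matrix.updateRow_apply]
      change _ = Function.update (fun a => (e τ).coord (Sum.inl a)) b ((e τ).coord (Sum.inr c)) a'
        (C.compF τ (u b'))
      by_cases h : a' = b
      · subst h
        rw [if_pos rfl, Function.update_self]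
        rfl
      · rw [if_neg h, Function.update_of_ne h]
        exact (h1 a' b').symm
  refine ⟨graphVec (e τ) Z, fun a => ?_, fun b => ?_⟩
  · rw [graphVec, add_sub_cancel_left]
    exact sum_mem fun c _ => Submodule.smul_mem _ _ ((he τ).inr_mem c)
  · rw [sum_smul_graphVec (e τ) hZ, ← (e τ).sum_repr (C.compF τ (u b)), Fintype.sum_sum_type]
    simp only [h1]
    rfl

theorem exists_lift_iterate_F (hr : ∀ τ, Associated (diagBlock e τ).det (WOL.ofInt τ π ^ r τ))
    (hmin : ∀ (τ : Emb p L k) (x : n₁ → C.comp τ) (ℓ : n₁ → C.comp τ →ₗ[WOL τ] WOL τ),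
      (∀ b, x b ∈ C.imageF τ) → WOL.ofInt τ π ^ r τ ∣ (Matrix.of fun a b => ℓ a (x b)).det)
    (he : ∀ τ, N.IsAdapted (e τ)) (n : ℕ) (τ : Emb p L k) (u : n₁ → C.comp (Emb.frobInv^[n] τ))
    (hu : ∀ b, u b - e _ (Sum.inl b) ∈ N.part (Emb.frobInv^[n] τ)) :
    ∃ (u' : n₁ → C.comp τ) (A : Matrix n₁ n₁ (WOL τ)),
      (∀ a, u' a - e τ (Sum.inl a) ∈ N.part τ) ∧
      ∀ b, C.F^[n] (u b : M) = ((∑ a, A a b • u' a : C.comp τ) : M) := by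
  induction n generalizing τ with
  | zero => exact ⟨u, 1, hu, fun b => congrArg Subtype.val
      (sum_one_smul (N := C.comp τ) (R := WOL τ) u b).symm⟩
  | succ n ih =>
    obtain ⟨u₁, A, hu₁, hA⟩ := ih τ.frobInv u hu
    obtain ⟨u₂, hu₂, hu₂'⟩ := exists_lift_compF hr hmin he τ u₁ hu₁
    refine ⟨u₂, diagBlock e τ * A.map (WOL.frobEquiv τ), hu₂, fun b => ?_⟩
    rw [Function.iterate_succ_apply' C.F, hA, ← coe_compF]
    rw [sum_mul_smul (diagBlock e τ) (A.map (WOL.frobEquiv τ)) u₂]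
    simp only [map_sum, LinearMap.map_smulₛₗ, hu₂']
    rfl

/-- The graphs over the first part of the basis are permuted by `F^f`. -/
theorem exists_graph_transform (hπ : Irreducible π)
    (hr : ∀ τ, Associated (diagBlock e τ).det (WOL.ofInt τ π ^ r τ))
    (hmin : ∀ (τ : Emb p L k) (x : n₁ → C.comp τ) (ℓ : n₁ → C.comp τ →ₗ[WOL τ] WOL τ),
      (∀ b, x b ∈ C.imageF τ) → WOL.ofInt τ π ^ r τ ∣ (Matrix.of fun a b => ℓ a (x b)).det)
    (he : ∀ τ, N.IsAdapted (e τ)) (τ : Emb p L k) (Z : Matrix n₂ n₁ (WOL τ)) :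
    ∃ Z' : Matrix n₂ n₁ (WOL τ),
      Z' * (semiMatrix (e τ) (e τ) (C.compFrob hπ τ)).toBlocks₁₁ =
        (semiMatrix (e τ) (e τ) (C.compFrob hπ τ)).toBlocks₂₁ +
          (semiMatrix (e τ) (e τ) (C.compFrob hπ τ)).toBlocks₂₂ * Z.map (WOL.frobPow τ hπ) := by
  have hu : ∀ b, graphVec (e τ) Z b - e τ (Sum.inl b) ∈ N.part τ := fun b => by
    rw [graphVec, add_sub_cancel_left]
    exact sum_mem fun c _ => Submodule.smul_mem _ _ ((he τ).inr_mem c)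
  have h0 : ∀ τ', τ' = τ → ∃ u' : n₁ → C.comp τ', (∀ b, (u' b : M) = graphVec (e τ) Z b) ∧
      ∀ b, u' b - e τ' (Sum.inl b) ∈ N.part τ' := by
    rintro _ rfl
    exact ⟨_, fun _ => rfl, hu⟩
  obtain ⟨v, hv, hv'⟩ := h0 _ (Emb.frobInv_iterate_residueDegree hπ τ)
  obtain ⟨u', A, hu', hA⟩ := exists_lift_iterate_F hr hmin he _ τ v hv'
  refine exists_graph_eq (u := u') (A := A)
    ((he τ).toBlocks₁₂ (he τ) fun _ => Sub.compFrob_mem_part hπ) (fun a b => ?_) fun b =>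
    Subtype.ext (by rw [coe_compFrob, ← hv, hA])
  have h1 := ((he τ) _).1 (hu' b) a
  rw [map_sub, Finsupp.sub_apply, sub_eq_zero, (e τ).repr_self] at h1
  rw [h1, Finsupp.single_apply, Matrix.one_apply]
  simp only [Sum.inl.injEq, eq_comm]

end Step

end Chain

end Crystal

theorem card_le_finrank_of_mem {R N : Type*} [CommRing R] [Nontrivial R] [IsNoetherianRing R]
    [AddCommGroup N] [Module R N] [Module.Finite R N] {n n₂ : Type*} [Fintype n] [Fintype n₂]
    (e : Module.Basis n R N) {U : Matrix n n₂ R} (hU : ∀ z, U.mulVec z = 0 → z = 0)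
    {W : Submodule R N} (hx : ∀ j, ∑ a, U a j • e a ∈ W) :
    Fintype.card n₂ ≤ Module.finrank R W := by
  have hli : LinearIndependent R fun j => (⟨∑ a, U a j • e a, hx j⟩ : W) := by
    rw [Fintype.linearIndependent_iff]
    intro g hg
    refine fun j => congrFun (hU g ?_) j
    ext a
    have h2 := congrArg Subtype.val hg
    rw [Submodule.coe_sum] at h2
    have h4 := congrArg (fun y => e.repr y a) h2
    simp only [Submodule.coe_smul, map_sum, map_smul, Finsupp.finsetSum_apply, Finsupp.smul_apply,
      smul_eq_mul, Submodule.coe_zero, map_zero, Finsupp.zero_apply] at h4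
    rw [Matrix.mulVec, dotProduct, Pi.zero_apply, ← h4]
    refine Finset.sum_congr rfl fun j _ => ?_
    have h5 := e.repr_sum_self (fun a => U a j)
    simp only [map_sum, map_smul] at h5
    have h6 := congrFun h5 a
    rw [Finsupp.finsetSum_apply] at h6
    simp only [Finsupp.smul_apply, smul_eq_mul] at h6
    rw [h6, mul_comm]
  exact hli.fintype_card_le_finrank

namespace Crystal

variable {p : ℕ} [Fact p.Prime] {k : Type*} [Field k] [CharP k p] [PerfectRing k p]
  {L : Type*} [Field L] [Algebra ℚ_[p] L] [Algebra ℤ_[p] L] [IsScalarTower ℤ_[p] ℚ_[p] L]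
  [FiniteDimensional ℚ_[p] L] {π : OL p L}
  {M : Type*} [AddCommGroup M] [Module (WittVector p k) M] {C : Crystal p k L M}

/-! ### Elementary divisors of the Frobenius -/

/-- The adjugate shows that the nonzero determinant of `F_τ` multiplies `M_τ` into the image. -/
theorem exists_pow_smul_mem_imageF (C : Crystal p k L M) (hπ : Irreducible π) (τ : Emb p L k) :
    ∃ n, ∀ x : C.comp τ, WOL.ofInt τ π ^ n • x ∈ C.imageF τ := by
  let b : Module.Basis (Fin (C.rank τ)) (WOL τ) (C.comp τ) :=
    Module.finBasisOfFinrankEq (WOL τ) (C.comp τ) rfl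
  let b' := Module.finBasisOfFinrankEq (WOL τ.frobInv) (C.comp τ.frobInv) (C.rank_eq hπ τ.frobInv τ)
  set Q := semiMatrix b' b (C.compF τ)
  have hQ : Q.det ≠ 0 := det_semiMatrix_ne_zero (WOL.frobEquiv τ) (C.compF_injective τ) b' b
  obtain ⟨n, u, hu⟩ := IsDiscreteValuationRing.eq_unit_mul_pow_irreducible hQ
    (WOL.irreducible_ofInt τ hπ)
  have h1 : ∀ j, Q.det • b j ∈ C.imageF τ := fun j => by
    have h2 := sum_mul_smul Q Q.adjugate b j
    rw [Matrix.mul_adjugate] at h2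
    simp only [Matrix.smul_apply, smul_assoc] at h2
    rw [← Finset.smul_sum, sum_one_smul] at h2
    rw [h2]
    refine sum_mem fun c _ => Submodule.smul_mem _ _ ?_
    rw [← apply_basis b' b (C.compF τ)]
    exact compF_mem_imageF τ _
  refine ⟨n, fun x => ?_⟩
  have h3 : WOL.ofInt τ π ^ n • x = ((u⁻¹ : (WOL τ)ˣ) : WOL τ) • Q.det • x := by
    rw [hu, smul_smul, ← mul_assoc, Units.inv_mul, one_mul]
  rw [h3]
  refine Submodule.smul_mem _ _ ?_
  rw [← b.sum_repr x, Finset.smul_sum]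
  refine sum_mem fun j _ => ?_
  rw [smul_comm]
  exact Submodule.smul_mem _ _ (h1 j)

theorem val_unit_eq_zero {R : Type*} [CommRing R] (val : AddValuation R (WithTop ℚ))
    (h : ∀ x, 0 ≤ val x) (u : Rˣ) : val u = 0 := by
  have h1 : val u + val (u⁻¹ : Rˣ) = 0 := by
    rw [← AddValuation.map_mul, Units.mul_inv, AddValuation.map_one]
  refine le_antisymm ?_ (h _)
  rw [← h1]
  exact le_add_of_nonneg_right (h _)

/-- The slopes of the Hodge polygon, in terms of elementary divisors. -/
theorem IsHodgeSlopes.exists_divisors (hπ : Irreducible π) {τ : Emb p L k} {h : ℕ} {s : Fin h → ℚ}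
    (H : C.IsHodgeSlopes τ s) (hrank : C.rank τ = h) :
    ∃ (n : Fin h → ℕ) (v : Module.Basis (Fin h) (WOL τ) (C.comp τ)), Monotone n ∧
      (∀ j, s j = n j / ramIndex hπ) ∧
      ∀ x, x ∈ C.imageF τ ↔ ∀ j, WOL.ofInt τ π ^ n j ∣ v.repr x j := by
  obtain ⟨hs, val, hval, hp, a, ha, ⟨φ⟩⟩ := H
  have hϖ := WOL.irreducible_ofInt τ hπ
  have hvϖ : val (WOL.ofInt τ π) = ((1 / ramIndex hπ : ℚ) : WithTop ℚ) :=
    val_uniformizer hπ (WOL.ofInt τ) val (fun _ => hval _) hp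
  have ha0 : ∀ j, a j ≠ 0 := fun j h0 => by
    have h1 := ha j
    rw [h0, AddValuation.map_zero] at h1
    exact WithTop.coe_ne_top h1.symm
  choose n u hu using fun j => IsDiscreteValuationRing.eq_unit_mul_pow_irreducible (ha0 j) hϖ
  have he : (0 : ℚ) < ramIndex hπ := by exact_mod_cast ramIndex_pos hπ
  have hsn : ∀ j, s j = n j / ramIndex hπ := fun j => by
    have h1 := ha j
    rw [hu, AddValuation.map_mul, val_unit_eq_zero val hval, zero_add, AddValuation.map_pow, hvϖ,
      ← WithTop.coe_nsmul, nsmul_eq_mul] at h1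
    have h2 : (n j : ℚ) * (1 / ramIndex hπ) = s j := by exact_mod_cast h1
    rw [← h2, mul_one_div]
  have hn : Monotone n := fun i j hij => by
    have h1 := hs hij
    rw [hsn, hsn, div_le_div_iff_of_pos_right he] at h1
    exact_mod_cast h1
  obtain ⟨N, hN⟩ := C.exists_pow_smul_mem_imageF hπ τ
  obtain ⟨t, v, ht, hv⟩ := exists_elementary_divisors hϖ
    (Module.finBasisOfFinrankEq (WOL τ) (C.comp τ) hrank) hN
  obtain ⟨ψ⟩ := nonempty_quotient_equiv v hv
  have hspan : ∀ j, Ideal.span {a j} = Ideal.span {WOL.ofInt τ π ^ n j} := fun j => by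
    rw [hu, Ideal.span_singleton_mul_left_unit (u j).isUnit]
  -- The given quotient and the Smith form present the same module, so their sorted exponents agree.
  have htn : t = n := elementary_divisors_unique hϖ ht hn
    ((ψ.symm.trans φ).trans (LinearEquiv.piCongrRight fun j => Submodule.quotEquivOfEq _ _ (hspan j)))
  exact ⟨n, v, hn, hsn, htn ▸ hv⟩

/-- The normalized valuation of `W_{O_L,τ}(k)` does not involve the crystal, so the one provided for
`C` serves for `C'`. -/
theorem IsHodgeSlopes.of_divisors (hπ : Irreducible π) {τ : Emb p L k} {h : ℕ} {s : Fin h → ℚ}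
    (H : C.IsHodgeSlopes τ s) {M' : Type*} [AddCommGroup M'] [Module (WittVector p k) M']
    {C' : Crystal p k L M'} {h' : ℕ} {n : Fin h' → ℕ} (hn : Monotone n)
    {v : Module.Basis (Fin h') (WOL τ) (C'.comp τ)}
    (hv : ∀ x, x ∈ C'.imageF τ ↔ ∀ j, WOL.ofInt τ π ^ n j ∣ v.repr x j) :
    C'.IsHodgeSlopes τ fun j => (n j : ℚ) / ramIndex hπ := by
  obtain ⟨-, val, hval, hp, -⟩ := H
  refine ⟨fun i j hij => ?_, val, hval, hp, fun j => WOL.ofInt τ π ^ n j, fun j => ?_,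
    nonempty_quotient_equiv v hv⟩
  · exact div_le_div_of_nonneg_right (by exact_mod_cast hn hij) (Nat.cast_nonneg _)
  · rw [AddValuation.map_pow, val_uniformizer hπ (WOL.ofInt τ) val (fun _ => hval _) hp,
      ← WithTop.coe_nsmul, nsmul_eq_mul, mul_one_div]

/-! ### Membership in the sub-crystals defined by growth conditions -/

section Growth

theorem isSaturated_slowSub (C : Crystal p k L M) (b : ℕ → ℕ) : (C.slowSub π b).IsSaturated π :=
  fun _ _ h => C.mem_slowSub_of_act_pow h

theorem isSaturated_fastSub (C : Crystal p k L M) (b : ℕ → ℕ) : (C.fastSub π b).IsSaturated π :=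
  fun _ _ h => C.mem_fastSub_of_act_pow h

variable {n : Type*} [Fintype n] [DecidableEq n] {τ : Emb p L k}

/-- A quotient by a power of `π` of an element of `M_τ` is again in `M_τ`, so divisibility in `M`
can be tested on coordinates. -/
theorem mem_slowLevel_iff (hπ : Irreducible π) (e : Module.Basis n (WOL τ) (C.comp τ)) {b : ℕ → ℕ}
    {c : ℕ} {x : C.comp τ} : (x : M) ∈ C.slowLevel π b c ↔ ∀ m i,
      WOL.ofInt τ π ^ b m ∣ WOL.ofInt τ π ^ c * e.repr ((C.compFrob hπ τ)^[m] x) i := by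
  refine forall_congr' fun m => ?_
  rw [← coe_iterate_compFrob hπ, ← C.coe_ofInt_smul]
  have h0 : ∀ i, WOL.ofInt τ π ^ c * e.repr ((C.compFrob hπ τ)^[m] x) i =
      e.repr (WOL.ofInt τ (π ^ c) • (C.compFrob hπ τ)^[m] x) i := fun i => by
    rw [map_smul, Finsupp.smul_apply, smul_eq_mul, map_pow]
  simp only [h0]
  constructor
  · rintro ⟨y, hy⟩ i
    have hyc : y ∈ C.comp τ := C.mem_comp_of_act_pow_mem hπ (b m) (hy ▸ Subtype.prop _)
    have h1 : WOL.ofInt τ (π ^ c) • (C.compFrob hπ τ)^[m] x =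
        WOL.ofInt τ π ^ b m • (⟨y, hyc⟩ : C.comp τ) := Subtype.ext (by
      rw [hy, ← map_pow, C.coe_ofInt_smul])
    rw [h1, map_smul, Finsupp.smul_apply, smul_eq_mul]
    exact dvd_mul_right _ _
  · intro h1
    choose z hz using h1
    refine ⟨((∑ i, z i • e i : C.comp τ) : M), ?_⟩
    rw [← C.coe_ofInt_smul]
    congr 1
    rw [← e.sum_repr (WOL.ofInt τ (π ^ c) • (C.compFrob hπ τ)^[m] x), Finset.smul_sum]
    refine Finset.sum_congr rfl fun i _ => ?_
    rw [hz, smul_smul, map_pow]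

theorem repr_iterate_compFrob_basis (hπ : Irreducible π) (e : Module.Basis n (WOL τ) (C.comp τ))
    (m : ℕ) (i j : n) : e.repr ((C.compFrob hπ τ)^[m] (e j)) i =
      twist (WOL.frobPow τ hπ : WOL τ →+* WOL τ) (semiMatrix e e (C.compFrob hπ τ)) m i j := by
  rw [semiMatrix_iterate e, Finset.sum_eq_single j]
  · rw [e.repr_self, Finsupp.single_eq_same, iterate_map_one, mul_one]
  · intro l _ hl
    rw [e.repr_self, Finsupp.single_eq_of_ne hl, iterate_map_zero, mul_zero]
  · simp

/-- There are enough slow vectors. -/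
theorem card_le_rank_slowSub (hπ : Irreducible π) (E : RootExt τ π)
    (e : Module.Basis n (WOL τ) (C.comp τ)) {n₁ n₂ : Type*} [Fintype n₁] [DecidableEq n₁]
    [Fintype n₂] [DecidableEq n₂] {α β : ℚ}
    (T : (E.setting hπ).Split (semiMatrix e e (C.compFrob hπ τ)) α β n₁ n₂) (hαβ : α ≤ β)
    {b : ℕ → ℕ} (hb : ∀ m, (b m : ℚ) ≤ β * m) :
    Fintype.card n₂ ≤ (C.slowSub π b).crystal.rank τ := by
  obtain ⟨c, U, hU, hdvd⟩ := T.exists_slow_vectors hαβ (WOL.irreducible_ofInt τ hπ)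
    (WOL.adicComplete_ofInt τ hπ) hb
  let x : n₂ → C.comp τ := fun j => ∑ a, U a j • e a
  have hx : ∀ j, x j ∈ (C.slowSub π b).part τ := fun j => by
    refine C.mem_slowSub.2 ⟨c, (mem_slowLevel_iff hπ e).2 fun m i => ?_⟩
    rw [semiMatrix_iterate e]
    simp only [x, e.repr_sum_self]
    exact hdvd m i j
  rw [Sub.rank_crystal]
  exact card_le_finrank_of_mem e hU hx

/-- The growth of the matrix of `F^{fm}` on the slow part. -/
theorem exists_mb_twist_slowSub (hπ : Irreducible π) (E : RootExt τ π) {n₁ n₂ : Type*} [Fintype n₁]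
    [DecidableEq n₁] [Fintype n₂] [DecidableEq n₂] {b : ℕ → ℕ}
    {e : Module.Basis (n₁ ⊕ n₂) (WOL τ) (C.comp τ)} (he : (C.slowSub π b).IsAdapted e) {ρ : ℚ}
    (hb : ∀ m : ℕ, ρ * m ≤ b m + 1) :
    ∃ c : ℕ, ∀ m : ℕ, (E.setting hπ).MB (ρ * m - c) ((twist ((E.setting hπ).σ : WOL τ →+* WOL τ)
      (semiMatrix e e (C.compFrob hπ τ)).toBlocks₂₂ m).map (E.setting hπ).ι) := by
  obtain ⟨c, hc⟩ := C.exists_slowLevel_eq (π := π) b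
  -- Here `c` is the uniform exponent of the slow part and `1` is the rounding error in `hb`.
  refine ⟨c + 1, fun m i j => ?_⟩
  have h1 := (mem_slowLevel_iff hπ e).1 (hc _ (he.inr_mem j)) m (Sum.inr i)
  rw [repr_iterate_compFrob_basis, he.fromBlocks_eq he fun _ => Sub.compFrob_mem_part hπ] at h1
  obtain ⟨C'', hC''⟩ := twist_fromBlocks_zero₁₂ (WOL.frobPow τ hπ : WOL τ →+* WOL τ)
    (semiMatrix e e (C.compFrob hπ τ)).toBlocks₁₁ (semiMatrix e e (C.compFrob hπ τ)).toBlocks₂₁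
    (semiMatrix e e (C.compFrob hπ τ)).toBlocks₂₂ m
  rw [hC'', Matrix.fromBlocks_apply₂₂] at h1
  have h2 := (SlopeSetting.ge_natCast_iff (S := E.setting hπ) (WOL.irreducible_ofInt τ hπ) _ _).2 h1
  refine SlopeSetting.Ge.mono (c := (b m : ℚ) - c) ?_ (by have := hb m; push_cast; linarith)
  have h3 := (E.setting hπ).v_ϖ_pow c
  unfold SlopeSetting.Ge at h2 ⊢
  rw [map_mul, AddValuation.map_mul] at h2
  have h4 := h2.trans_eq (congrArg (· + _) h3)
  rw [Matrix.map_apply]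
  set y := (E.setting hπ).v ((E.setting hπ).ι (twist (WOL.frobPow τ hπ : WOL τ →+* WOL τ)
    (semiMatrix e e (C.compFrob hπ τ)).toBlocks₂₂ m i j))
  change _ ≤ y
  rcases eq_or_ne y ⊤ with hy | hy
  · rw [hy]; exact le_top
  · obtain ⟨q, hq⟩ := WithTop.ne_top_iff_exists.1 hy
    rw [← hq] at h4 ⊢
    have h5 : (b m : ℚ) * (E.setting hπ).w ≤ c * (E.setting hπ).w + q := by exact_mod_cast h4
    have h6 : ((b m : ℚ) - c) * (E.setting hπ).w ≤ q := by linarith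
    exact_mod_cast h6

theorem iterate_sum_smul {R N : Type*} [CommRing R] [AddCommGroup N] [Module R N] {s : R →+* R}
    {G : N →ₛₗ[s] N} {A : Matrix n n R} {u : n → N} (hu : ∀ b, G (u b) = ∑ a, A a b • u a) (m : ℕ)
    (z : n → R) : G^[m] (∑ b, z b • u b) = ∑ b, s^[m] (z b) • ∑ a, twist s A m a b • u a := by
  induction m generalizing z with
  | zero =>
    simp only [twist, Function.iterate_zero, id, sum_one_smul]
  | succ m ih =>
    rw [Function.iterate_succ_apply', ih, map_sum]
    refine Finset.sum_congr rfl fun b _ => ?_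
    rw [LinearMap.map_smulₛₗ, Function.iterate_succ_apply']
    congr 1
    rw [twist, sum_mul_smul, map_sum]
    simp only [LinearMap.map_smulₛₗ, hu, Matrix.map_apply]

/-- Vectors permuted by `F^f` through a matrix with a controlled inverse are fast. -/
theorem mem_fastSub_of_twist_inverse (hπ : Irreducible π) (E : RootExt τ π) {A : Matrix n n (WOL τ)}
    {u : n → C.comp τ} (hu : ∀ b, C.compFrob hπ τ (u b) = ∑ a, A a b • u a) {α : ℚ} {c : ℕ}
    (hA : ∀ m : ℕ, ∃ W : Matrix n n E.K, (twist ((E.setting hπ).σ : WOL τ →+* WOL τ) A m).map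
      (E.setting hπ).ι * W = 1 ∧ (E.setting hπ).MB (-α * m - c) W) {b : ℕ → ℕ}
    (hb : ∀ m : ℕ, α * m ≤ b m + 1) (j : n) : u j ∈ (C.fastSub π b).part τ := by
  refine C.mem_fastSub.2 ⟨c + 1, fun m => ?_⟩
  obtain ⟨W, hW, hWm⟩ := hA m
  obtain ⟨W', hW'⟩ := SlopeSetting.exists_integral_inverse (N := c + 1 + b m)
    (WOL.irreducible_ofInt τ hπ) hW (hWm.mono (by have := hb m; push_cast; linarith))
  -- Since `F^{fm}` is `σ^{fm}`-linear, the coefficients of the quasi-inverse `W'` are pulled back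
  -- by `σ^{-fm}`; the product with the iterate of `A` is then `π^(c + 1 + b m)`.
  refine ⟨(((∑ b, (WOL.frobPow τ hπ).symm^[m] (W' b j) • u b : C.comp τ)) : M), ?_⟩
  rw [← coe_iterate_compFrob hπ, iterate_sum_smul hu, ← C.coe_ofInt_smul]
  congr 1
  have h1 : ∀ r, (⇑(WOL.frobPow τ hπ : WOL τ →+* WOL τ))^[m] ((WOL.frobPow τ hπ).symm^[m] r) = r :=
    (E.setting hπ).iterate_σ_symm m
  simp only [h1]
  refine Eq.trans ?_ (sum_mul_smul _ W' u j)
  have h2 : twist (WOL.frobPow τ hπ : WOL τ →+* WOL τ) A m * W' =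
    WOL.ofInt τ π ^ (c + 1 + b m) • 1 := hW'
  rw [h2]
  simp only [Matrix.smul_apply, smul_assoc]
  rw [← Finset.smul_sum, sum_one_smul, map_pow]

end Growth

end Crystal

/-! ### The slow part and its complement -/

namespace Crystal

variable {p : ℕ} [Fact p.Prime] {k : Type*} [Field k] [CharP k p] [PerfectRing k p]
  {L : Type*} [Field L] [Algebra ℚ_[p] L] [Algebra ℤ_[p] L] [IsScalarTower ℤ_[p] ℚ_[p] L]
  [FiniteDimensional ℚ_[p] L] {π : OL p L}
  {M : Type*} [AddCommGroup M] [Module (WittVector p k) M] {C : Crystal p k L M}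

section Adapted

variable {τ : Emb p L k} {m n₁ n₂ m₁ m₂ : Type*} [Fintype m] [DecidableEq m] [Fintype n₁]
  [DecidableEq n₁] [Fintype n₂] [DecidableEq n₂] [Fintype m₁] [DecidableEq m₁] [Fintype m₂]
  [DecidableEq m₂] {E : RootExt τ π} {hπ : Irreducible π} {α β : ℚ}
  {b : Module.Basis m (WOL τ) (C.comp τ)}

/-- The splitting of `F^f` over `K`, in a basis adapted to a sub-crystal. -/
def adaptedSplit (T : (E.setting hπ).Split (semiMatrix b b (C.compFrob hπ τ)) α β m₁ m₂)
    {N : C.Sub} {e : Module.Basis (n₁ ⊕ n₂) (WOL τ) (C.comp τ)} (he : N.IsAdapted e) :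
    (E.setting hπ).Split (Matrix.fromBlocks (semiMatrix e e (C.compFrob hπ τ)).toBlocks₁₁ 0
      (semiMatrix e e (C.compFrob hπ τ)).toBlocks₂₁
      (semiMatrix e e (C.compFrob hπ τ)).toBlocks₂₂) α β m₁ m₂ :=
  T.changeBasis (V := e.toMatrix b) (V' := b.toMatrix e) (e.toMatrix_mul_toMatrix_flip b)
    (b.toMatrix_mul_toMatrix_flip e) (by
      rw [← he.fromBlocks_eq he fun _ => Sub.compFrob_mem_part hπ]
      exact map_mul_semiMatrix b b e e (C.compFrob hπ τ))

/-- One inequality comes from the integral slow vectors. For the other, the `i`-dimensional stable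
subspace over `K` injects into the coordinates complementary to the slow part. -/
theorem rank_slowSub_eq {h i : ℕ} (hrank : C.rank τ = h) (hi : i ≤ h)
    (T : (E.setting hπ).Split (semiMatrix b b (C.compFrob hπ τ)) α β (Fin i) (Fin (h - i)))
    (hαβ : α < β) {b' : ℕ → ℕ} (hb : ∀ m, (b' m : ℚ) ≤ β * m) (hb' : ∀ m : ℕ, β * m ≤ b' m + 1) :
    (C.slowSub π b').crystal.rank τ = h - i := by
  have h1 := card_le_rank_slowSub hπ E b T hαβ.le hb
  rw [Fintype.card_fin] at h1
  refine le_antisymm ?_ h1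
  have h2 : (C.slowSub π b').crystal.rank τ ≤ h := by
    rw [Sub.rank_crystal, ← hrank]
    exact Submodule.finrank_le _
  obtain ⟨e, he⟩ := Sub.exists_isAdapted hπ (C.isSaturated_slowSub b') τ rfl
    (r := h - (C.slowSub π b').crystal.rank τ) (by omega)
  obtain ⟨c, hc⟩ := exists_mb_twist_slowSub hπ E he hb'
  have h3 := (adaptedSplit T he).card_le hαβ hc
  rw [Fintype.card_fin, Fintype.card_fin] at h3
  omega

end Adapted

section Family

variable {n₁ n₂ m₁ m₂ : Type*} [Fintype n₁] [DecidableEq n₁] [Fintype n₂] [DecidableEq n₂]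
  {hπ : Irreducible π}

theorem isCompl_of_sup_part {N₁ N₂ : C.Sub} (hπ : Irreducible π) (τ₀ : Emb p L k)
    (hdisj : Disjoint N₁.carrier N₂.carrier) (h : ∀ τ, N₁.part τ ⊔ N₂.part τ = ⊤) :
    IsCompl N₁.carrier N₂.carrier := by
  refine ⟨hdisj, codisjoint_iff.2 (eq_top_iff.2 ?_)⟩
  rw [← C.iSup_comp_eq_top hπ τ₀]
  refine iSup_le fun τ x hx => ?_
  have h1 : (⟨x, hx⟩ : C.comp τ) ∈ N₁.part τ ⊔ N₂.part τ := h τ ▸ Submodule.mem_top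
  obtain ⟨y, hy, z, hz, hyz⟩ := Submodule.mem_sup.1 h1
  rw [← show (y : M) + z = x from congrArg Subtype.val hyz]
  exact Submodule.add_mem_sup hy hz

/-- If the Hodge and Newton polygons meet, the determinants of the Frobenius modulo the slow part
have the smallest possible orders. -/
theorem associated_det_diagBlock {τ₀ : Emb p L k} {E : RootExt τ₀ π} {m : Type*} [Fintype m]
    [DecidableEq m] {b : Module.Basis m (WOL τ₀) (C.comp τ₀)} {α β : ℚ}
    [Fintype m₂] [DecidableEq m₂]
    (T : (E.setting hπ).Split (semiMatrix b b (C.compFrob hπ τ₀)) α β n₁ m₂)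
    (hαβ : α < β) {b' : ℕ → ℕ} (hb' : ∀ m : ℕ, β * m ≤ b' m + 1)
    {e : ∀ τ : Emb p L k, Module.Basis (n₁ ⊕ n₂) (WOL τ) (C.comp τ)}
    (he : ∀ τ, (C.slowSub π b').IsAdapted (e τ)) {d : Emb p L k → ℕ}
    (hmin : ∀ (τ : Emb p L k) (x : n₁ → C.comp τ) (ℓ : n₁ → C.comp τ →ₗ[WOL τ] WOL τ),
      (∀ b, x b ∈ C.imageF τ) → WOL.ofInt τ π ^ d τ ∣ (Matrix.of fun a b => ℓ a (x b)).det)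
    (hdet : (E.setting hπ).v T.A.det = ((((∑ j : Fin (residueDegree p L π),
      d (Emb.frobInv^[(j : ℕ)] τ₀) : ℕ) : ℚ) * (E.setting hπ).w : ℚ) : WithTop ℚ))
    (τ : Emb p L k) : Associated (diagBlock e τ).det (WOL.ofInt τ π ^ d τ) := by
  have hr : ∀ τ, ∃ r : ℕ, Associated (diagBlock e τ).det (WOL.ofInt τ π ^ r) := fun τ =>
    IsDiscreteValuationRing.associated_pow_irreducible (det_diagBlock_ne_zero he τ)
      (WOL.irreducible_ofInt τ hπ)
  choose r hr using hr
  -- The determinant of the block is one of the minors bounded by `hmin`.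
  have hle : ∀ τ, d τ ≤ r τ := fun τ => by
    have h1 := hmin τ (fun b => C.compF τ (e τ.frobInv (Sum.inl b)))
      (fun a => (e τ).coord (Sum.inl a)) fun b => compF_mem_imageF τ _
    have h2 : WOL.ofInt τ π ^ d τ ∣ WOL.ofInt τ π ^ r τ :=
      Dvd.dvd.trans h1 (hr τ).dvd
    exact (pow_dvd_pow_iff (WOL.irreducible_ofInt τ hπ).ne_zero
      (WOL.irreducible_ofInt τ hπ).not_isUnit).1 h2
  obtain ⟨c, hc⟩ := exists_mb_twist_slowSub hπ E (he τ₀) hb'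
  -- The determinant of `F^f` modulo the slow part has the valuation of `T.A.det`, which `hdet`
  -- makes equal to the sum of the lower bounds.
  have h1 := (adaptedSplit T (he τ₀)).v_det ((adaptedSplit T (he τ₀)).det_toRows₁_ne_zero hαβ hc)
  obtain ⟨u, hu⟩ := (associated_det_compFrob hπ he hr τ₀).symm
  have h2 : (E.setting hπ).v ((E.setting hπ).ι
      (semiMatrix (e τ₀) (e τ₀) (C.compFrob hπ τ₀)).toBlocks₁₁.det) = ((((∑ j : Fin
        (residueDegree p L π), r (Emb.frobInv^[(j : ℕ)] τ₀) : ℕ) : ℚ) *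
          (E.setting hπ).w : ℚ) : WithTop ℚ) := by
    rw [← hu, map_mul, AddValuation.map_mul, SlopeSetting.v_unit, add_zero]
    exact SlopeSetting.v_ϖ_pow _
  have h3 : (((∑ j : Fin (residueDegree p L π), r (Emb.frobInv^[(j : ℕ)] τ₀) : ℕ) : ℚ) *
      (E.setting hπ).w) = ((∑ j : Fin (residueDegree p L π), d (Emb.frobInv^[(j : ℕ)] τ₀) : ℕ) : ℚ) *
      (E.setting hπ).w := by
    exact_mod_cast (h2.symm.trans h1).trans hdet
  have h4 := mul_right_cancel₀ (E.setting hπ).w_pos.ne' h3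
  have h5 : ∑ j : Fin (residueDegree p L π), d (Emb.frobInv^[(j : ℕ)] τ₀) =
      ∑ j : Fin (residueDegree p L π), r (Emb.frobInv^[(j : ℕ)] τ₀) := by exact_mod_cast h4.symm
  -- Inequalities at each embedding with equal sums over the cycle are equalities.
  have h6 := (Finset.sum_eq_sum_iff_of_le fun j _ => hle _).1 h5
  obtain ⟨j, hj⟩ := (Emb.bijective_frobInv_iterate hπ τ₀).2 τ
  have h7 : d τ = r τ := hj ▸ h6 j (Finset.mem_univ j)
  rw [h7]
  exact hr τ

/-- The fast and slow parts span the crystal. -/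
theorem fastSub_sup_slowSub {τ₀ : Emb p L k} {E : RootExt τ₀ π} {m : Type*} [Fintype m]
    [DecidableEq m] {b : Module.Basis m (WOL τ₀) (C.comp τ₀)} {α β : ℚ}
    [Fintype m₂] [DecidableEq m₂]
    (T : (E.setting hπ).Split (semiMatrix b b (C.compFrob hπ τ₀)) α β n₁ m₂)
    (hαβ : α < β) {b₁ b₂ : ℕ → ℕ} (hb₁ : ∀ m : ℕ, α * m ≤ b₁ m + 1)
    (hb₂ : ∀ m : ℕ, β * m ≤ b₂ m + 1)
    {e : ∀ τ : Emb p L k, Module.Basis (n₁ ⊕ n₂) (WOL τ) (C.comp τ)}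
    (he : ∀ τ, (C.slowSub π b₂).IsAdapted (e τ)) {d : Emb p L k → ℕ}
    (hmin : ∀ (τ : Emb p L k) (x : n₁ → C.comp τ) (ℓ : n₁ → C.comp τ →ₗ[WOL τ] WOL τ),
      (∀ b, x b ∈ C.imageF τ) → WOL.ofInt τ π ^ d τ ∣ (Matrix.of fun a b => ℓ a (x b)).det)
    (hr : ∀ τ, Associated (diagBlock e τ).det (WOL.ofInt τ π ^ d τ)) (τ : Emb p L k) :
    (C.fastSub π b₁).part τ ⊔ (C.slowSub π b₂).part τ = ⊤ := by
  have hmem : ∀ τ (u : n₁ → C.comp τ), (∀ b, u b ∈ (C.fastSub π b₁).part τ) →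
      (∀ b, u b - e τ (Sum.inl b) ∈ (C.slowSub π b₂).part τ) →
      (C.fastSub π b₁).part τ ⊔ (C.slowSub π b₂).part τ = ⊤ := fun τ u hu hu' => by
    rw [eq_top_iff, ← (e τ).span_eq, Submodule.span_le]
    rintro _ ⟨a | a, rfl⟩
    · have h1 : e τ (Sum.inl a) = u a - (u a - e τ (Sum.inl a)) := by rw [sub_sub_cancel]
      rw [h1]
      exact sub_mem (Submodule.mem_sup_left (hu a)) (Submodule.mem_sup_right (hu' a))
    · exact Submodule.mem_sup_right ((he τ).inr_mem a)
  refine forall_of_frobInv hπ (P := fun τ => (C.fastSub π b₁).part τ ⊔ (C.slowSub π b₂).part τ = ⊤)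
    (fun τ hτ => ?_) (τ₀ := τ₀) ?_ τ
  · have h1 : ∀ b, ∃ u ∈ (C.fastSub π b₁).part τ.frobInv,
        u - e τ.frobInv (Sum.inl b) ∈ (C.slowSub π b₂).part τ.frobInv := fun b => by
      have h2 : e τ.frobInv (Sum.inl b) ∈
        (C.fastSub π b₁).part τ.frobInv ⊔ (C.slowSub π b₂).part τ.frobInv := hτ ▸ Submodule.mem_top
      obtain ⟨y, hy, z, hz, hyz⟩ := Submodule.mem_sup.1 h2
      refine ⟨y, hy, ?_⟩
      rw [← hyz, sub_add_cancel_left]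
      exact neg_mem hz
    choose u hu hu' using h1
    obtain ⟨u', hu₁, hu₂⟩ := exists_lift_compF hr hmin he τ u hu'
    refine hmem τ u' (fun a => ?_) hu₁
    -- By the adjugate, the determinant of the block times `u'` is a combination of the fast vectors
    -- `F_τ u`; saturation removes the determinant.
    refine Sub.mem_part_of_smul hπ (C.isSaturated_fastSub b₁) (det_diagBlock_ne_zero he τ) ?_
    have h2 := sum_mul_smul (diagBlock e τ) (diagBlock e τ).adjugate u' a
    rw [Matrix.mul_adjugate] at h2
    simp only [Matrix.smul_apply, smul_assoc] at h2
    rw [← Finset.smul_sum, sum_one_smul] at h2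
    rw [h2]
    refine sum_mem fun c _ => Submodule.smul_mem _ _ ?_
    rw [← hu₂]
    exact Sub.compF_mem_part _ (hu c)
  -- At `τ₀` the graph transform is a contraction, and the graph of its fixed point is made of fast
  -- vectors.
  · obtain ⟨c, hc⟩ := exists_mb_twist_slowSub hπ E (he τ₀) hb₂
    obtain ⟨c', hc'⟩ := (adaptedSplit T (he τ₀)).exists_twist_inverse
      ((adaptedSplit T (he τ₀)).det_toRows₁_ne_zero hαβ hc)
    obtain ⟨Z, hZ⟩ := SlopeSetting.exists_fixed_matrix (S := E.setting hπ)
      (WOL.irreducible_ofInt τ₀ hπ) (WOL.adicComplete_ofInt τ₀ hπ)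
      (exists_graph_transform hπ hr hmin he τ₀) hαβ hc hc'
    have hX := (he τ₀).toBlocks₁₂ (he τ₀) (G := C.compFrob hπ τ₀) fun _ => Sub.compFrob_mem_part hπ
    refine hmem τ₀ (graphVec (e τ₀) Z)
      (mem_fastSub_of_twist_inverse hπ E (apply_graphVec hX hZ) hc' hb₁) fun b => ?_
    rw [graphVec, add_sub_cancel_left]
    exact sum_mem fun c _ => Submodule.smul_mem _ _ ((he τ₀).inr_mem c)

end Family

end Crystal

namespace Crystal

variable {p : ℕ} [Fact p.Prime] {k : Type*} [Field k] [CharP k p] [PerfectRing k p]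
  {L : Type*} [Field L] [Algebra ℚ_[p] L] [Algebra ℤ_[p] L] [IsScalarTower ℤ_[p] ℚ_[p] L]
  [FiniteDimensional ℚ_[p] L] {π : OL p L}
  {M : Type*} [AddCommGroup M] [Module (WittVector p k) M] {C : Crystal p k L M}

/-! ### Decompositions into two sub-crystals -/

namespace Sub

variable {N₁ N₂ : C.Sub} {τ : Emb p L k} {n₁ n₂ : Type*} [Fintype n₁] [DecidableEq n₁] [Fintype n₂]
  [DecidableEq n₂]

/-- The inclusion of a component of a sub-crystal. -/
def inclComp (N : C.Sub) (τ : Emb p L k) : N.crystal.comp τ →ₗ[WOL τ] C.comp τ :=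
  (N.part τ).subtype.comp (N.partEquiv τ).toLinearMap

theorem inclComp_mem_part (N : C.Sub) (x : N.crystal.comp τ) : N.inclComp τ x ∈ N.part τ :=
  (x : N.carrier).2

theorem inclComp_injective (N : C.Sub) : Function.Injective (N.inclComp τ) := fun x y h => by
  have h1 : ((x : N.carrier) : M) = ((y : N.carrier) : M) :=
    congrArg (fun z : C.comp τ => (z : M)) h
  exact Subtype.ext (Subtype.ext h1)

theorem exists_inclComp_eq {N : C.Sub} {x : C.comp τ} (hx : x ∈ N.part τ) :
    ∃ y, N.inclComp τ y = x :=
  ⟨(N.partEquiv τ).symm ⟨x, hx⟩, congrArg Subtype.val ((N.partEquiv τ).apply_symm_apply ⟨x, hx⟩)⟩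

theorem compF_inclComp (N : C.Sub) (x : N.crystal.comp τ.frobInv) :
    C.compF τ (N.inclComp τ.frobInv x) = N.inclComp τ (N.crystal.compF τ x) := rfl

theorem compFrob_inclComp (N : C.Sub) (hπ : Irreducible π) (x : N.crystal.comp τ) :
    C.compFrob hπ τ (N.inclComp τ x) = N.inclComp τ (N.crystal.compFrob hπ τ x) :=
  Subtype.ext (N.coe_iterate_crystal_F _ _).symm

theorem exists_add_eq (h : IsCompl (N₁.part τ) (N₂.part τ)) (x : C.comp τ) :
    ∃ x₁ x₂, x = N₁.inclComp τ x₁ + N₂.inclComp τ x₂ := by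
  have h1 : x ∈ N₁.part τ ⊔ N₂.part τ := h.sup_eq_top ▸ Submodule.mem_top
  obtain ⟨y, hy, z, hz, hyz⟩ := Submodule.mem_sup.1 h1
  obtain ⟨x₁, rfl⟩ := exists_inclComp_eq hy
  obtain ⟨x₂, rfl⟩ := exists_inclComp_eq hz
  exact ⟨x₁, x₂, hyz.symm⟩

theorem eq_of_add_eq (h : IsCompl (N₁.part τ) (N₂.part τ)) {x₁ y₁ : N₁.crystal.comp τ}
    {x₂ y₂ : N₂.crystal.comp τ}
    (hxy : N₁.inclComp τ x₁ + N₂.inclComp τ x₂ = N₁.inclComp τ y₁ + N₂.inclComp τ y₂) :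
    x₁ = y₁ ∧ x₂ = y₂ := by
  have h1 : N₁.inclComp τ (x₁ - y₁) = N₂.inclComp τ (y₂ - x₂) := by
    rw [map_sub, map_sub, sub_eq_sub_iff_add_eq_add, hxy, add_comm]
  have h2 : N₁.inclComp τ (x₁ - y₁) = 0 := (Submodule.disjoint_def.1 h.disjoint) _
    (N₁.inclComp_mem_part _) (h1 ▸ N₂.inclComp_mem_part _)
  have h3 : x₁ - y₁ = 0 := N₁.inclComp_injective (h2.trans (map_zero _).symm)
  have h4 : y₂ - x₂ = 0 := N₂.inclComp_injective ((h1.symm.trans h2).trans (map_zero _).symm)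
  exact ⟨sub_eq_zero.1 h3, (sub_eq_zero.1 h4).symm⟩

/-- The basis of `M_τ` obtained from bases of the components of two complementary sub-crystals. -/
def sumBasis (h : IsCompl (N₁.part τ) (N₂.part τ)) (b₁ : Module.Basis n₁ (WOL τ) (N₁.crystal.comp τ))
    (b₂ : Module.Basis n₂ (WOL τ) (N₂.crystal.comp τ)) :
    Module.Basis (n₁ ⊕ n₂) (WOL τ) (C.comp τ) :=
  ((b₁.map (N₁.partEquiv τ)).prod (b₂.map (N₂.partEquiv τ))).map
    (Submodule.prodEquivOfIsCompl _ _ h)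

variable (h : IsCompl (N₁.part τ) (N₂.part τ)) (b₁ : Module.Basis n₁ (WOL τ) (N₁.crystal.comp τ))
  (b₂ : Module.Basis n₂ (WOL τ) (N₂.crystal.comp τ))

theorem sumBasis_inl (a : n₁) : sumBasis h b₁ b₂ (Sum.inl a) = N₁.inclComp τ (b₁ a) := by
  rw [sumBasis, Module.Basis.map_apply, Module.Basis.prod_apply]
  simp
  rfl

theorem sumBasis_inr (a : n₂) : sumBasis h b₁ b₂ (Sum.inr a) = N₂.inclComp τ (b₂ a) := by
  rw [sumBasis, Module.Basis.map_apply, Module.Basis.prod_apply]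
  simp
  rfl

theorem sumBasis_repr (x₁ : N₁.crystal.comp τ) (x₂ : N₂.crystal.comp τ) (j : n₁ ⊕ n₂) :
    (sumBasis h b₁ b₂).repr (N₁.inclComp τ x₁ + N₂.inclComp τ x₂) j =
      Sum.elim (b₁.repr x₁) (b₂.repr x₂) j := by
  have h1 : N₁.inclComp τ x₁ + N₂.inclComp τ x₂ =
      ∑ j, Sum.elim (b₁.repr x₁) (b₂.repr x₂) j • sumBasis h b₁ b₂ j := by
    rw [Fintype.sum_sum_type]
    simp only [Sum.elim_inl, Sum.elim_inr, sumBasis_inl, sumBasis_inr, ← map_smul, ← map_sum,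
      Module.Basis.sum_repr]
  rw [h1, Module.Basis.repr_sum_self]

theorem sumBasis_repr_left (x₁ : N₁.crystal.comp τ) (j : n₁ ⊕ n₂) :
    (sumBasis h b₁ b₂).repr (N₁.inclComp τ x₁) j = Sum.elim (b₁.repr x₁) (fun _ => 0) j := by
  have h1 := sumBasis_repr h b₁ b₂ x₁ 0 j
  rw [map_zero, add_zero] at h1
  rw [h1, map_zero]
  rfl

theorem sumBasis_repr_right (x₂ : N₂.crystal.comp τ) (j : n₁ ⊕ n₂) :
    (sumBasis h b₁ b₂).repr (N₂.inclComp τ x₂) j = Sum.elim (fun _ => 0) (b₂.repr x₂) j := by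
  have h1 := sumBasis_repr h b₁ b₂ 0 x₂ j
  rw [map_zero, zero_add] at h1
  rw [h1, map_zero]
  rfl

theorem isAdapted_sumBasis : N₂.IsAdapted (sumBasis h b₁ b₂) := fun x => by
  constructor
  · intro hx a
    obtain ⟨y, rfl⟩ := exists_inclComp_eq hx
    rw [sumBasis_repr_right]
    rfl
  · intro hx
    obtain ⟨x₁, x₂, rfl⟩ := exists_add_eq h x
    have h1 : x₁ = 0 := b₁.repr.injective (Finsupp.ext fun a => by
      rw [map_zero, Finsupp.zero_apply, ← hx a, sumBasis_repr, Sum.elim_inl])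
    rw [h1, map_zero, zero_add]
    exact N₂.inclComp_mem_part _

set_option maxHeartbeats 1000000 in
theorem semiMatrix_sumBasis (hπ : Irreducible π) :
    semiMatrix (sumBasis h b₁ b₂) (sumBasis h b₁ b₂) (C.compFrob hπ τ) =
      Matrix.fromBlocks (semiMatrix b₁ b₁ (N₁.crystal.compFrob hπ τ)) 0 0
        (semiMatrix b₂ b₂ (N₂.crystal.compFrob hπ τ)) := by
  have h1 : ∀ i j, semiMatrix (sumBasis h b₁ b₂) (sumBasis h b₁ b₂) (C.compFrob hπ τ) i j =
    (sumBasis h b₁ b₂).repr (C.compFrob hπ τ (sumBasis h b₁ b₂ j)) i := fun _ _ => rfl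
  have h2 : ∀ i b, semiMatrix (sumBasis h b₁ b₂) (sumBasis h b₁ b₂) (C.compFrob hπ τ) i (Sum.inl b) =
      Sum.elim (b₁.repr (N₁.crystal.compFrob hπ τ (b₁ b))) (fun _ => 0) i := fun i b => by
    rw [h1, sumBasis_inl, compFrob_inclComp, sumBasis_repr_left]
  have h3 : ∀ i b, semiMatrix (sumBasis h b₁ b₂) (sumBasis h b₁ b₂) (C.compFrob hπ τ) i (Sum.inr b) =
      Sum.elim (fun _ => 0) (b₂.repr (N₂.crystal.compFrob hπ τ (b₂ b))) i := fun i b => by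
    rw [h1, sumBasis_inr, compFrob_inclComp, sumBasis_repr_right]
  refine Matrix.ext fun i j => ?_
  rcases i with a | a <;> rcases j with b | b
  · exact h2 (Sum.inl a) b
  · exact h3 (Sum.inl a) b
  · exact h2 (Sum.inr a) b
  · exact h3 (Sum.inr a) b

theorem rank_add_rank (h : IsCompl (N₁.part τ) (N₂.part τ)) :
    N₁.crystal.rank τ + N₂.crystal.rank τ = C.rank τ := by
  have h1 := Module.finrank_eq_card_basis (sumBasis h
    (Module.finBasis (WOL τ) (N₁.crystal.comp τ)) (Module.finBasis (WOL τ) (N₂.crystal.comp τ)))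
  rw [Fintype.card_sum, Fintype.card_fin, Fintype.card_fin] at h1
  exact h1.symm

theorem add_mem_imageF_iff (h : ∀ τ : Emb p L k, IsCompl (N₁.part τ) (N₂.part τ)) (τ : Emb p L k)
    (x₁ : N₁.crystal.comp τ) (x₂ : N₂.crystal.comp τ) :
    N₁.inclComp τ x₁ + N₂.inclComp τ x₂ ∈ C.imageF τ ↔
      x₁ ∈ N₁.crystal.imageF τ ∧ x₂ ∈ N₂.crystal.imageF τ := by
  constructor
  · rintro ⟨y, hy, hxy⟩
    obtain ⟨y₁, y₂, hy'⟩ := exists_add_eq (h τ.frobInv) ⟨y, hy⟩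
    have h1 : N₁.inclComp τ (N₁.crystal.compF τ y₁) + N₂.inclComp τ (N₂.crystal.compF τ y₂) =
        N₁.inclComp τ x₁ + N₂.inclComp τ x₂ := by
      rw [← compF_inclComp, ← compF_inclComp, ← map_add, ← hy']
      exact Subtype.ext hxy
    obtain ⟨rfl, rfl⟩ := eq_of_add_eq (h τ) h1
    exact ⟨compF_mem_imageF τ y₁, compF_mem_imageF τ y₂⟩
  · rintro ⟨⟨y₁, hy₁, h1⟩, ⟨y₂, hy₂, h2⟩⟩
    have h1' : N₁.crystal.compF τ ⟨y₁, hy₁⟩ = x₁ := Subtype.ext h1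
    have h2' : N₂.crystal.compF τ ⟨y₂, hy₂⟩ = x₂ := Subtype.ext h2
    rw [← h1', ← h2', ← compF_inclComp, ← compF_inclComp, ← map_add]
    exact compF_mem_imageF τ _

end Sub

/-- The elementary divisors of the Frobenius on a direct sum. -/
theorem exists_equiv_divisors (hπ : Irreducible π) {N₁ N₂ : C.Sub}
    (hN : ∀ τ : Emb p L k, IsCompl (N₁.part τ) (N₂.part τ)) {τ : Emb p L k} {h i : ℕ} (hi : i ≤ h)
    {n : Fin h → ℕ} {v : Module.Basis (Fin h) (WOL τ) (C.comp τ)} (hn : Monotone n)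
    (hv : ∀ x, x ∈ C.imageF τ ↔ ∀ j, WOL.ofInt τ π ^ n j ∣ v.repr x j) {s₁ : Fin i → ℕ}
    {v₁ : Module.Basis (Fin i) (WOL τ) (N₁.crystal.comp τ)}
    (hv₁ : ∀ x, x ∈ N₁.crystal.imageF τ ↔ ∀ j, WOL.ofInt τ π ^ s₁ j ∣ v₁.repr x j)
    {s₂ : Fin (h - i) → ℕ} {v₂ : Module.Basis (Fin (h - i)) (WOL τ) (N₂.crystal.comp τ)}
    (hv₂ : ∀ x, x ∈ N₂.crystal.imageF τ ↔ ∀ j, WOL.ofInt τ π ^ s₂ j ∣ v₂.repr x j) :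
    ∃ g : Fin i ⊕ Fin (h - i) ≃ Fin h, ∀ j, n (g j) = Sum.elim s₁ s₂ j := by
  -- The concatenated exponents are sorted, so that uniqueness applies to two monotone sequences.
  let t : Fin h → ℕ := Sum.elim s₁ s₂ ∘ (SlopeSetting.splitEquiv hi).symm
  let g : Fin i ⊕ Fin (h - i) ≃ Fin h := (SlopeSetting.splitEquiv hi).trans (Tuple.sort t).symm
  have hg : ∀ l, (t ∘ Tuple.sort t) l = Sum.elim s₁ s₂ (g.symm l) := fun _ => rfl
  let w := (Sub.sumBasis (hN τ) v₁ v₂).reindex g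
  have hw : ∀ x, x ∈ C.imageF τ ↔ ∀ l, WOL.ofInt τ π ^ (t ∘ Tuple.sort t) l ∣ w.repr x l := by
    intro x
    obtain ⟨x₁, x₂, rfl⟩ := Sub.exists_add_eq (hN τ) x
    rw [Sub.add_mem_imageF_iff hN, hv₁, hv₂]
    simp only [hg, w, Module.Basis.repr_reindex_apply, Sub.sumBasis_repr]
    constructor
    · rintro ⟨h1, h2⟩ l
      rcases g.symm l with j | j
      · exact h1 j
      · exact h2 j
    · intro h1
      exact ⟨fun j => by simpa using h1 (g (Sum.inl j)), fun j => by simpa using h1 (g (Sum.inr j))⟩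
  obtain ⟨ψ⟩ := nonempty_quotient_equiv w hw
  obtain ⟨ψ'⟩ := nonempty_quotient_equiv v hv
  have h1 := elementary_divisors_unique (WOL.irreducible_ofInt τ hπ) hn (Tuple.monotone_sort t)
    (ψ'.symm.trans ψ)
  refine ⟨g, fun j => ?_⟩
  rw [h1, hg, g.symm_apply_apply]

/-- The Hodge polygons of the summands of a crystal. -/
theorem isHodgeSlopes_of_det (hπ : Irreducible π) {N₁ N₂ : C.Sub}
    (hN : ∀ τ : Emb p L k, IsCompl (N₁.part τ) (N₂.part τ)) {τ : Emb p L k} {h i : ℕ} (hi : i ≤ h)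
    (b₁ : ∀ τ : Emb p L k, Module.Basis (Fin i) (WOL τ) (N₁.crystal.comp τ))
    (b₂ : ∀ τ : Emb p L k, Module.Basis (Fin (h - i)) (WOL τ) (N₂.crystal.comp τ))
    {n : Fin h → ℕ} {v : Module.Basis (Fin h) (WOL τ) (C.comp τ)} (hn : Monotone n)
    (hv : ∀ x, x ∈ C.imageF τ ↔ ∀ j, WOL.ofInt τ π ^ n j ∣ v.repr x j)
    (hdet : Associated (diagBlock (fun τ => Sub.sumBasis (hN τ) (b₁ τ) (b₂ τ)) τ).det
      (WOL.ofInt τ π ^ ∑ j, n (Fin.castLE hi j)))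
    {a : Fin h → ℚ} (ha : C.IsHodgeSlopes τ a) (han : ∀ j, a j = n j / ramIndex hπ) :
    N₁.crystal.IsHodgeSlopes τ (firstSlopes a hi) ∧ N₂.crystal.IsHodgeSlopes τ (lastSlopes a hi) := by
  have hϖ := WOL.irreducible_ofInt τ hπ
  obtain ⟨c₁, hc₁⟩ := N₁.crystal.exists_pow_smul_mem_imageF hπ τ
  obtain ⟨c₂, hc₂⟩ := N₂.crystal.exists_pow_smul_mem_imageF hπ τ
  obtain ⟨s₁, v₁, hs₁, hv₁⟩ := exists_elementary_divisors hϖ (b₁ τ) hc₁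
  obtain ⟨s₂, v₂, hs₂, hv₂⟩ := exists_elementary_divisors hϖ (b₂ τ) hc₂
  obtain ⟨g, hg⟩ := exists_equiv_divisors hπ hN hi hn hv hv₁ hv₂
  -- The block is the matrix of `F_τ` on `N₁`, so the order of its determinant is at least the sum
  -- of `s₁`; conversely `s₁` is a subfamily of `n` with `i` entries, whose sum is at least that of
  -- the `i` smallest.
  have hsum : ∑ j, s₁ j = ∑ j, n (Fin.castLE hi j) := by
    refine le_antisymm ?_ ?_
    · have h1 := pow_sum_dvd_det le_rfl hs₁ hv₁
        (x := fun b => N₁.crystal.compF τ (b₁ τ.frobInv b)) (fun b => compF_mem_imageF τ _)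
        fun a => (b₁ τ).coord a
      have h2 : (Matrix.of fun a b => (b₁ τ).coord a (N₁.crystal.compF τ (b₁ τ.frobInv b))) =
          diagBlock (fun τ => Sub.sumBasis (hN τ) (b₁ τ) (b₂ τ)) τ := by
        ext a b
        change _ = (Sub.sumBasis (hN τ) (b₁ τ) (b₂ τ)).repr (C.compF τ
          (Sub.sumBasis (hN τ.frobInv) (b₁ τ.frobInv) (b₂ τ.frobInv) (Sum.inl b))) (Sum.inl a)
        rw [Sub.sumBasis_inl, Sub.compF_inclComp, Sub.sumBasis_repr_left]
        rfl
      rw [h2] at h1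
      exact (pow_dvd_pow_iff hϖ.ne_zero hϖ.not_isUnit).1 (h1.trans hdet.dvd)
    · refine (sum_castLE_le hi hn (g := fun j => g (Sum.inl j))
        (g.injective.comp Sum.inl_injective)).trans_eq ?_
      exact Finset.sum_congr rfl fun j _ => hg (Sum.inl j)
  obtain ⟨h1, h2⟩ := eq_first_last hi hn hs₁ hs₂ g hg hsum
  constructor
  · convert IsHodgeSlopes.of_divisors hπ ha hs₁ hv₁ using 1
    funext j
    rw [firstSlopes, han, h1]
  · convert IsHodgeSlopes.of_divisors hπ ha hs₂ hv₂ using 1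
    funext j
    rw [lastSlopes, han, h2]

/-- The Newton polygons of the fast and slow parts of a crystal. -/
theorem isNewtonSlopesAt_of_split {hπ : Irreducible π} {τ : Emb p L k} {E : RootExt τ π} {h i : ℕ}
    (hi : i ≤ h) {b : Module.Basis (Fin h) (WOL τ) (C.comp τ)} {α β : ℚ}
    (T : (E.setting hπ).Split (semiMatrix b b (C.compFrob hπ τ)) α β (Fin i) (Fin (h - i)))
    (hαβ : α < β) {lam : Fin h → ℚ} (hlam : Monotone lam)
    (hA : ∀ a b, b < a → T.A a b = 0) (hA' : ∀ a, (E.setting hπ).v (T.A a a) =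
      (((residueDegree p L π : ℚ) * lam (Fin.castLE hi a) : ℚ) : WithTop ℚ))
    (hD : ∀ a b, b < a → T.D a b = 0) (hD' : ∀ a, (E.setting hπ).v (T.D a a) =
      (((residueDegree p L π : ℚ) * lam ⟨i + a, by omega⟩ : ℚ) : WithTop ℚ))
    {b' : ℕ → ℕ} (hb' : ∀ m : ℕ, β * m ≤ b' m + 1) {N : C.Sub}
    (hN : IsCompl (N.part τ) ((C.slowSub π b').part τ))
    (b₁ : Module.Basis (Fin i) (WOL τ) (N.crystal.comp τ))
    (b₂ : Module.Basis (Fin (h - i)) (WOL τ) ((C.slowSub π b').crystal.comp τ)) :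
    N.crystal.IsNewtonSlopesAt π τ (firstSlopes lam hi) ∧
      (C.slowSub π b').crystal.IsNewtonSlopesAt π τ (lastSlopes lam hi) := by
  set e := Sub.sumBasis hN b₁ b₂ with he
  have hX := Sub.semiMatrix_sumBasis hN b₁ b₂ hπ
  let T' : (E.setting hπ).Split (Matrix.fromBlocks (semiMatrix b₁ b₁ (N.crystal.compFrob hπ τ)) 0 0
      (semiMatrix b₂ b₂ ((C.slowSub π b').crystal.compFrob hπ τ))) α β (Fin i) (Fin (h - i)) :=
    T.changeBasis (V := e.toMatrix b) (V' := b.toMatrix e) (e.toMatrix_mul_toMatrix_flip b)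
      (b.toMatrix_mul_toMatrix_flip e) (by
        rw [← hX]
        exact map_mul_semiMatrix b b e e (C.compFrob hπ τ))
  obtain ⟨c, hc⟩ := exists_mb_twist_slowSub hπ E (Sub.isAdapted_sumBasis hN b₁ b₂) hb'
  rw [hX, Matrix.toBlocks_fromBlocks₂₂] at hc
  -- Over `K` the stable subspace lies in the complement `N`. So the diagonal blocks of the change
  -- of basis carry the two blocks of `F^f` to `T.A` and `T.D`, which are already triangular.
  have h0 : T'.P₁.toRows₂ = 0 := T'.toRows₂_eq_zero hαβ hc
  refine ⟨⟨fun j l hjl => hlam (by exact hjl), b₁, _, fun j => congrArg Subtype.val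
      (apply_basis b₁ b₁ (N.crystal.compFrob hπ τ) j), E, T'.P₁.toRows₁, T.A,
      T'.isUnit_det_toRows₁ h0, T'.toRows₁_eq, hA, hA'⟩,
    ⟨fun j l hjl => hlam (by exact Nat.add_le_add_left hjl i), b₂, _, fun j => congrArg Subtype.val
      (apply_basis b₂ b₂ ((C.slowSub π b').crystal.compFrob hπ τ) j), E, T'.P₂.toRows₂, T.D,
      T'.isUnit_det_toRows₂ h0, T'.toRows₂_eq h0, hD, hD'⟩⟩

end Crystal

/-! ### Polygons and the uniqueness of the decomposition -/

theorem polygon_eq_sum {h i : ℕ} (hi : i ≤ h) (s : Fin h → ℚ) :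
    polygon s i = ∑ j, s (Fin.castLE hi j) := by
  rw [polygon, ← (SlopeSetting.splitEquiv hi).sum_comp, Fintype.sum_sum_type]
  simp [SlopeSetting.splitEquiv_inl, SlopeSetting.splitEquiv_inr]

theorem map_det_of_upper {K : Type*} [Field K] (v : AddValuation K (WithTop ℚ)) {i : ℕ}
    {A : Matrix (Fin i) (Fin i) K} (hA : ∀ a b, b < a → A a b = 0) {t : Fin i → ℚ}
    (ht : ∀ a, v (A a a) = (t a : WithTop ℚ)) : v A.det = ((∑ a, t a : ℚ) : WithTop ℚ) := by
  have h1 : A.BlockTriangular id := fun a b hab => hA a b hab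
  rw [Matrix.det_of_isUpperTriangular h1]
  have h2 : ∀ s : Finset (Fin i), v (∏ a ∈ s, A a a) = ((∑ a ∈ s, t a : ℚ) : WithTop ℚ) := by
    intro s
    induction s using Finset.induction_on with
    | empty => simp
    | insert a s has ih =>
      rw [Finset.prod_insert has, Finset.sum_insert has, AddValuation.map_mul, ih, ht,
        WithTop.coe_add]
  exact h2 Finset.univ

namespace Crystal

variable {p : ℕ} [Fact p.Prime] {k : Type*} [Field k] [CharP k p] [PerfectRing k p]
  {L : Type*} [Field L] [Algebra ℚ_[p] L] [Algebra ℤ_[p] L] [IsScalarTower ℤ_[p] ℚ_[p] L]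
  [FiniteDimensional ℚ_[p] L] {π : OL p L}
  {M : Type*} [AddCommGroup M] [Module (WittVector p k) M] {C : Crystal p k L M}

/-- The splitting over `K` given by the Newton polygon. -/
theorem IsNewtonSlopesAt.exists_split (hπ : Irreducible π) {τ : Emb p L k} {h i : ℕ}
    {s : Fin h → ℚ} (H : C.IsNewtonSlopesAt π τ s) (hi : i ≤ h) {α β : ℚ}
    (hα : ∀ l : Fin i, (ramIndex hπ * residueDegree p L π : ℚ) * s (Fin.castLE hi l) ≤ α)
    (hβ : ∀ l : Fin (h - i), β ≤ (ramIndex hπ * residueDegree p L π : ℚ) * s ⟨i + l, by omega⟩) :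
    ∃ (b : Module.Basis (Fin h) (WOL τ) (C.comp τ)) (E : RootExt τ π)
      (T : (E.setting hπ).Split (semiMatrix b b (C.compFrob hπ τ)) α β (Fin i) (Fin (h - i))),
      (∀ a b, b < a → T.A a b = 0) ∧ (∀ a, (E.setting hπ).v (T.A a a) =
        (((residueDegree p L π : ℚ) * s (Fin.castLE hi a) : ℚ) : WithTop ℚ)) ∧
      (∀ a b, b < a → T.D a b = 0) ∧ ∀ a, (E.setting hπ).v (T.D a a) =
        (((residueDegree p L π : ℚ) * s ⟨i + a, by omega⟩ : ℚ) : WithTop ℚ) := by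
  obtain ⟨-, b, X, hX, E, P, Y, hP, heq, hY, hv⟩ := H
  have hX' : semiMatrix b b (C.compFrob hπ τ) = X := semiMatrix_eq _ _ _ fun j => Subtype.ext (hX j)
  subst hX'
  have he : (ramIndex hπ : ℚ) ≠ 0 := by exact_mod_cast (ramIndex_pos hπ).ne'
  -- As `v(π) = 1 / e`, the valuation `f s` is `e f s` in units of `v(π)`.
  have hw : ∀ q : ℚ, (ramIndex hπ * residueDegree p L π : ℚ) * q * (E.setting hπ).w =
      residueDegree p L π * q := fun q => by
    change (ramIndex hπ * residueDegree p L π : ℚ) * q * (1 / ramIndex hπ) = _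
    field_simp
  obtain ⟨T, h1, h2, h3, h4⟩ := SlopeSetting.exists_split (S := E.setting hπ) hi hP heq hY
    (s := fun l => (ramIndex hπ * residueDegree p L π : ℚ) * s l)
    (fun l => (hv l).trans (by rw [hw])) hα hβ
  exact ⟨b, E, T, h1, fun a => (h2 a).trans (by rw [hw]), h3, fun a => (h4 a).trans (by rw [hw])⟩

theorem carrier_eq_top_of_part (hπ : Irreducible π) (τ₀ : Emb p L k) {N : C.Sub}
    (h : ∀ (τ : Emb p L k) (x : C.comp τ), x ∈ N.part τ) : N.carrier = ⊤ := by
  rw [eq_top_iff, ← C.iSup_comp_eq_top hπ τ₀]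
  exact iSup_le fun τ x hx => h τ ⟨x, hx⟩

/-- The splitting with `i = 0` has only a quotient part, so the slow part has full rank; being
saturated, it is everything. -/
theorem IsNewtonSlopes.slowSub_eq_top (hπ : Irreducible π) (τ₀ : Emb p L k) {h : ℕ} {s : Fin h → ℚ}
    (H : C.IsNewtonSlopes π s) {β : ℚ}
    (hβ : ∀ l, β ≤ (ramIndex hπ * residueDegree p L π : ℚ) * s l) {b : ℕ → ℕ}
    (hb : ∀ m, (b m : ℚ) ≤ β * m) : (C.slowSub π b).carrier = ⊤ := by
  refine carrier_eq_top_of_part hπ τ₀ fun τ x => ?_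
  obtain ⟨v, E, T, -⟩ := (H τ).exists_split hπ (Nat.zero_le h) (α := β) (β := β)
    (fun l => l.elim0) fun l => hβ _
  have h1 := card_le_rank_slowSub hπ E v T le_rfl hb
  have hrank : C.rank τ = h := by rw [rank, Module.finrank_eq_card_basis v, Fintype.card_fin]
  have h2 : (C.slowSub π b).crystal.rank τ ≤ h := by
    rw [Sub.rank_crystal, ← hrank]
    exact Submodule.finrank_le _
  rw [Fintype.card_fin] at h1
  obtain ⟨e, he⟩ := Sub.exists_isAdapted hπ (C.isSaturated_slowSub b) τ (r := 0) (d := h)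
    (by omega) (by omega)
  exact (he x).2 fun a => a.elim0

/-- The splitting with `i = h` has only a stable part, so the whole matrix of `F^f` has iterates
with inverses controlled by `α`. -/
theorem IsNewtonSlopes.fastSub_eq_top (hπ : Irreducible π) (τ₀ : Emb p L k) {h : ℕ} {s : Fin h → ℚ}
    (H : C.IsNewtonSlopes π s) {α : ℚ}
    (hα : ∀ l, (ramIndex hπ * residueDegree p L π : ℚ) * s l ≤ α) {b : ℕ → ℕ}
    (hb : ∀ m : ℕ, α * m ≤ b m + 1) : (C.fastSub π b).carrier = ⊤ := by
  refine carrier_eq_top_of_part hπ τ₀ fun τ x => ?_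
  have hempty : IsEmpty (Fin (h - h)) := by rw [Nat.sub_self]; infer_instance
  obtain ⟨v, E, T, -⟩ := (H τ).exists_split hπ le_rfl (α := α) (β := α)
    (fun l => hα _) fun l => hempty.elim l
  have h0 : T.P₂ * T.Q₂ = 0 := by
    ext a b
    rw [Matrix.mul_apply, Finset.univ_eq_empty, Finset.sum_empty, Matrix.zero_apply]
  have h1 := T.PQ
  rw [h0, add_zero] at h1
  obtain ⟨c, hc⟩ := SlopeSetting.exists_twist_inverse_of_eq
    (Matrix.isUnit_det_of_right_inverse h1) T.eq₁ T.ZA T.mbZ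
  have h2 := mem_fastSub_of_twist_inverse hπ E (apply_basis v v (C.compFrob hπ τ)) hc hb
  rw [← v.sum_repr x]
  exact sum_mem fun j _ => Submodule.smul_mem _ _ (h2 j)

theorem Sub.le_slowSub {N : C.Sub} {b : ℕ → ℕ} (h : (N.crystal.slowSub π b).carrier = ⊤) :
    N.carrier ≤ (C.slowSub π b).carrier := fun x hx => by
  have h1 : (⟨x, hx⟩ : N.carrier) ∈ (N.crystal.slowSub π b).carrier := h ▸ Submodule.mem_top
  obtain ⟨c, hc⟩ := N.crystal.mem_slowSub.1 h1
  refine C.mem_slowSub.2 ⟨c, fun m => ?_⟩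
  obtain ⟨y, hy⟩ := hc m
  have h2 := congrArg (Subtype.val : N.carrier → M) hy
  have h3 := N.coe_iterate_crystal_F (residueDegree p L π * m) ⟨x, hx⟩
  exact ⟨y, (congrArg (C.act (π ^ c)) h3.symm).trans h2⟩

theorem Sub.le_fastSub {N : C.Sub} {b : ℕ → ℕ} (h : (N.crystal.fastSub π b).carrier = ⊤) :
    N.carrier ≤ (C.fastSub π b).carrier := fun x hx => by
  have h1 : (⟨x, hx⟩ : N.carrier) ∈ (N.crystal.fastSub π b).carrier := h ▸ Submodule.mem_top
  obtain ⟨c, hc⟩ := N.crystal.mem_fastSub.1 h1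
  refine C.mem_fastSub.2 ⟨c, fun m => ?_⟩
  obtain ⟨y, hy⟩ := hc m
  have h2 := congrArg (Subtype.val : N.carrier → M) hy
  exact ⟨y, h2.trans (N.coe_iterate_crystal_F (residueDegree p L π * m) y)⟩

/-- For `x` in `A`, the component of `x` in `B'` lies in both `A` and `B`, hence vanishes;
symmetrically for `B`. -/
theorem eq_of_le_of_isCompl {R N : Type*} [CommRing R] [AddCommGroup N] [Module R N]
    {A B A' B' : Submodule R N} (h : Disjoint A B) (h' : IsCompl A' B') (hA : A' ≤ A) (hB : B' ≤ B) :
    A' = A ∧ B' = B := by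
  have key : ∀ x, ∃ y ∈ A', ∃ z ∈ B', y + z = x := fun x =>
    Submodule.mem_sup.1 (h'.sup_eq_top ▸ Submodule.mem_top)
  constructor
  · refine le_antisymm hA fun x hx => ?_
    obtain ⟨y, hy, z, hz, rfl⟩ := key x
    have h1 : z ∈ A := (Submodule.add_mem_iff_right A (hA hy)).1 hx
    rw [(Submodule.disjoint_def.1 h) z h1 (hB hz), add_zero]
    exact hy
  · refine le_antisymm hB fun x hx => ?_
    obtain ⟨y, hy, z, hz, rfl⟩ := key x
    have h1 : y ∈ B := (Submodule.add_mem_iff_left B (hB hz)).1 hx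
    rw [(Submodule.disjoint_def.1 h) y (hA hy) h1, zero_add]
    exact hz

end Crystal

/-! ### Integer parts of linear growth rates -/

theorem natFloor_mul_le {β : ℚ} (hβ : 0 ≤ β) (m : ℕ) : ((⌊β * m⌋₊ : ℕ) : ℚ) ≤ β * m :=
  Nat.floor_le (mul_nonneg hβ (Nat.cast_nonneg m))

theorem mul_le_natFloor_add_one (β : ℚ) (m : ℕ) : β * m ≤ (⌊β * m⌋₊ : ℕ) + 1 :=
  (Nat.lt_floor_add_one _).le

theorem exists_natFloor_add_le {β : ℚ} (hβ : 0 ≤ β) (m : ℕ) :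
    ∃ B, ∀ l : ℕ, ⌊β * (l + m : ℕ)⌋₊ ≤ ⌊β * l⌋₊ + B := by
  obtain ⟨B, hB⟩ := exists_nat_ge (β * m + 1)
  refine ⟨B, fun l => ?_⟩
  have h1 := natFloor_mul_le hβ (l + m)
  have h2 := mul_le_natFloor_add_one β l
  push_cast at h1
  have h3 : ((⌊β * (l + m : ℕ)⌋₊ : ℕ) : ℚ) ≤ ((⌊β * l⌋₊ + B : ℕ) : ℚ) := by
    push_cast
    linarith
  exact_mod_cast h3

theorem exists_natFloor_add_le_natFloor {α β : ℚ} (hα : 0 ≤ α) (hαβ : α < β) (N : ℕ) :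
    ∃ m : ℕ, ⌊α * m⌋₊ + N ≤ ⌊β * m⌋₊ := by
  obtain ⟨m, hm⟩ := exists_nat_ge ((N + 1 : ℚ) / (β - α))
  rw [div_le_iff₀ (by linarith)] at hm
  refine ⟨m, ?_⟩
  have h1 := natFloor_mul_le hα m
  have h2 := mul_le_natFloor_add_one β m
  have h3 : ((⌊α * m⌋₊ + N : ℕ) : ℚ) ≤ ((⌊β * m⌋₊ : ℕ) : ℚ) := by
    push_cast
    linarith
  exact_mod_cast h3

end HodgeNewton

end

/-! ### The Hodge–Newton decomposition -/

open HodgeNewton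
/-- `k` is a perfect field of characteristic `p` containing the residue field of `L`, and `π` is a
uniformizer of `L`. The Newton polygon is computed at one embedding `τ₀` in the hypothesis, and at
all of them in the conclusion. A decomposition of `(M, F)` as a direct sum of `F`-crystals with
action of `O_L` is a pair of complementary sub-crystals with action. -/
theorem mainTheorem2 {p : ℕ} [Fact p.Prime] {k : Type*} [Field k] [CharP k p] [PerfectRing k p]
    {L : Type*} [Field L] [Algebra ℚ_[p] L] [Algebra ℤ_[p] L] [IsScalarTower ℤ_[p] ℚ_[p] L]
    [FiniteDimensional ℚ_[p] L] (π : OL p L) (hπ : Irreducible π)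
    (hk : Nonempty (ResidueFieldOL p L π →+* k))
    {M : Type*} [AddCommGroup M] [Module (WittVector p k) M] (C : Crystal p k L M)
    (h : ℕ) (τ₀ : Emb p L k) (hrank : C.rank τ₀ = h)
    (a : Emb p L k → Fin h → ℚ) (ha : ∀ τ, C.IsHodgeSlopes τ (a τ))
    (lam : Fin h → ℚ) (hlam : C.IsNewtonSlopesAt π τ₀ lam)
    (i : ℕ) (y : ℚ) (hbreak : IsBreakPoint lam i y) (hHodge : hodgePolygon π a i = y) :
    ∃! D : C.Sub × C.Sub,
      IsCompl D.1.carrier D.2.carrier ∧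
      ((∀ τ, D.1.crystal.rank τ = i) ∧
        D.1.crystal.IsNewtonSlopes π (firstSlopes lam hbreak.le) ∧
        ∀ τ, D.1.crystal.IsHodgeSlopes τ (firstSlopes (a τ) hbreak.le)) ∧
      ((∀ τ, D.2.crystal.rank τ = h - i) ∧
        D.2.crystal.IsNewtonSlopes π (lastSlopes lam hbreak.le) ∧
        ∀ τ, D.2.crystal.IsHodgeSlopes τ (lastSlopes (a τ) hbreak.le)) := by
  have hi := hbreak.le
  obtain ⟨hy, hi0, hih, hlt⟩ := hbreak
  have hmono : Monotone lam := hlam.1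
  have he : (0 : ℚ) < ramIndex hπ := by exact_mod_cast ramIndex_pos hπ
  have hf : (0 : ℚ) < residueDegree p L π := by exact_mod_cast residueDegree_pos hπ
  have hef : (0 : ℚ) < ramIndex hπ * residueDegree p L π := mul_pos he hf
  -- These are the slopes of `F^f` on both sides of the break, in units of `v(π)`.
  set α : ℚ := (ramIndex hπ * residueDegree p L π : ℚ) * lam ⟨i - 1, by omega⟩ with hα
  set β : ℚ := (ramIndex hπ * residueDegree p L π : ℚ) * lam ⟨i, hih⟩ with hβ
  have hαβ : α < β := mul_lt_mul_of_pos_left hlt hef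
  have hlα : ∀ l : Fin i,
      (ramIndex hπ * residueDegree p L π : ℚ) * lam (Fin.castLE hi l) ≤ α := fun l =>
    mul_le_mul_of_nonneg_left (hmono (Fin.mk_le_mk.2 (by omega))) hef.le
  have hlβ : ∀ l : Fin (h - i),
      β ≤ (ramIndex hπ * residueDegree p L π : ℚ) * lam ⟨i + l, by omega⟩ := fun l =>
    mul_le_mul_of_nonneg_left (hmono (Fin.mk_le_mk.2 (by omega))) hef.le
  obtain ⟨b, E, T, hA, hA', hD, hD'⟩ := hlam.exists_split hπ hi hlα hlβ
  have hne : Nonempty (Fin i) := ⟨⟨0, hi0⟩⟩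
  -- Nonnegativity comes from the integrality of `F`; without it the natural integer parts below
  -- would not approximate `α m`.
  have hα0 : 0 ≤ α := T.nonneg_of_nonempty
  have hβ0 : 0 ≤ β := hα0.trans hαβ.le
  let b₁ : ℕ → ℕ := fun m => ⌊α * m⌋₊
  let b₂ : ℕ → ℕ := fun m => ⌊β * m⌋₊
  have hb₁ : ∀ m : ℕ, α * m ≤ b₁ m + 1 := mul_le_natFloor_add_one α
  have hb₂ : ∀ m : ℕ, β * m ≤ b₂ m + 1 := mul_le_natFloor_add_one β
  have hb₂' : ∀ m : ℕ, (b₂ m : ℚ) ≤ β * m := natFloor_mul_le hβ0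
  set fast := C.fastSub π b₁
  set slow := C.slowSub π b₂
  have hdisj : Disjoint fast.carrier slow.carrier := C.disjoint_fastSub_slowSub hπ
    (exists_natFloor_add_le hβ0) (exists_natFloor_add_le_natFloor hα0 hαβ)
  have hCrank : ∀ τ, C.rank τ = h := fun τ => (C.rank_eq hπ τ τ₀).trans hrank
  have hslow : ∀ τ, slow.crystal.rank τ = h - i := fun τ =>
    (slow.crystal.rank_eq hπ τ τ₀).trans (Crystal.rank_slowSub_eq hrank hi T hαβ hb₂' hb₂)
  choose n v hn han hv using fun τ => (ha τ).exists_divisors hπ (hCrank τ)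
  have hmin : ∀ (τ : Emb p L k) (x : Fin i → C.comp τ) (ℓ : Fin i → C.comp τ →ₗ[WOL τ] WOL τ),
      (∀ b, x b ∈ C.imageF τ) →
      WOL.ofInt τ π ^ (∑ j, n τ (Fin.castLE hi j)) ∣ (Matrix.of fun a b => ℓ a (x b)).det :=
    fun τ x ℓ hx => pow_sum_dvd_det hi (hn τ) (hv τ) hx ℓ
  -- The contact of the polygons enters here, and only here: `f (λ_1 + ⋯ + λ_i)` equals the sum over
  -- the cycle of embeddings of the Hodge ordinates at `i`, which are the sums of the smallest
  -- exponents divided by `e`.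
  have hdet : (E.setting hπ).v T.A.det = ((((∑ j : Fin (residueDegree p L π),
      ∑ l, n (Emb.frobInv^[(j : ℕ)] τ₀) (Fin.castLE hi l) : ℕ) : ℚ) *
        (E.setting hπ).w : ℚ) : WithTop ℚ) := by
    rw [map_det_of_upper _ hA hA']
    congr 1
    rw [← Finset.mul_sum, ← polygon_eq_sum hi, hy, ← hHodge, hodgePolygon,
      mul_div_cancel₀ _ hf.ne', ← finsum_eq_of_bijective _ (Emb.bijective_frobInv_iterate hπ τ₀)
        (fun j => rfl), finsum_eq_sum_of_fintype]
    change _ = _ * (1 / (ramIndex hπ : ℚ))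
    push_cast
    rw [Finset.sum_mul]
    refine Finset.sum_congr rfl fun j _ => ?_
    rw [polygon_eq_sum hi, Finset.sum_mul]
    refine Finset.sum_congr rfl fun l _ => ?_
    rw [han, mul_one_div]
  have hsup : ∀ τ, fast.part τ ⊔ slow.part τ = ⊤ := by
    choose e he using fun τ => Crystal.Sub.exists_isAdapted hπ (C.isSaturated_slowSub b₂) τ
      (hslow τ) (r := i) ((hCrank τ).trans (by omega))
    exact Crystal.fastSub_sup_slowSub T hαβ hb₁ hb₂ he hmin
      (Crystal.associated_det_diagBlock T hαβ hb₂ he hmin hdet)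
  have hcompl : ∀ τ, IsCompl (fast.part τ) (slow.part τ) := fun τ =>
    ⟨Submodule.disjoint_def.2 fun x hx hx' =>
      Subtype.ext (Submodule.disjoint_def.1 hdisj x hx hx'), codisjoint_iff.2 (hsup τ)⟩
  have hfast : ∀ τ, fast.crystal.rank τ = i := fun τ => by
    have h1 := Crystal.Sub.rank_add_rank (hcompl τ)
    rw [hslow, hCrank] at h1
    omega
  let c₁ := fun τ => Module.finBasisOfFinrankEq (WOL τ) (fast.crystal.comp τ) (hfast τ)
  let c₂ := fun τ => Module.finBasisOfFinrankEq (WOL τ) (slow.crystal.comp τ) (hslow τ)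
  have hNewton := Crystal.isNewtonSlopesAt_of_split hi T hαβ hmono hA hA' hD hD' hb₂ (hcompl τ₀)
    (c₁ τ₀) (c₂ τ₀)
  have hHdg := fun τ => Crystal.isHodgeSlopes_of_det hπ hcompl hi c₁ c₂ (hn τ) (hv τ)
    (Crystal.associated_det_diagBlock T hαβ hb₂
      (fun τ => Crystal.Sub.isAdapted_sumBasis (hcompl τ) (c₁ τ) (c₂ τ)) hmin hdet τ)
    (ha τ) (han τ)
  refine ⟨(fast, slow), ⟨Crystal.isCompl_of_sup_part hπ τ₀ hdisj hsup,
    ⟨hfast, Crystal.forall_of_frobInv hπ (fun _ => Crystal.IsNewtonSlopesAt.of_frobInv hπ) hNewton.1,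
      fun τ => (hHdg τ).1⟩,
    ⟨hslow, Crystal.forall_of_frobInv hπ (fun _ => Crystal.IsNewtonSlopesAt.of_frobInv hπ) hNewton.2,
      fun τ => (hHdg τ).2⟩⟩, ?_⟩
  -- Uniqueness uses only the Newton slopes: they place `N₁` in the fast part and `N₂` in the slow
  -- part.
  rintro ⟨N₁, N₂⟩ ⟨hN, ⟨-, hN₁, -⟩, ⟨-, hN₂, -⟩⟩
  obtain ⟨h1, h2⟩ := Crystal.eq_of_le_of_isCompl hdisj hN
    (Crystal.Sub.le_fastSub (hN₁.fastSub_eq_top hπ τ₀ hlα hb₁))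
    (Crystal.Sub.le_slowSub (hN₂.slowSub_eq_top hπ τ₀ hlβ hb₂'))
  exact Prod.ext (Crystal.Sub.ext_carrier h1) (Crystal.Sub.ext_carrier h2)
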